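/- **Setting.** Let $F$ be a number field with adele ring $\mathbb A=\mathbb A_\infty\times\mathbb A_f$, let $G$ be a linear algebraic group over $F$ (not necessarily reductive or connected) with centre $Z$, and let $K_\infty$ be a maximal compact subgroup of $G(\mathbb A_\infty)$. An *automorphic form* is a function $\Phi:G(\mathbb A)\to\mathbb C$ such that: $\Phi$ is right invariant under some open compact subgroup of $G(\mathbb A_f)$, and $G(\mathbb A_\infty)\ni g\mapsto\Phi(gh)$ is $C^\infty$ for every $h\in G(\mathbb A)$; the right translates of $\Phi$ by $K_\infty$ span a finite-dimensional space; $\Phi(\gamma g)=\Phi(g)$ for $\gamma\in G(F)$; and $\Phi(zg)=\chi(z)\Phi(g)$ for $z\in Z(\mathbb A)$, for some unitary character $\chi$ of $Z(\mathbb A)$. It is *square-integrable* if $\int_{G(F)Z(\mathbb A)\backslash G(\mathbb A)}|\Phi(g)|^2\,dg<\infty$ for the invariant measure. Write $R$ for right translation, and $(R(X)\Phi)(g)=\frac{d}{dt}\big|_{0}\Phi(g\exp(tX))$ for $X$ in the Lie algebra $\mathfrak g$ of $G(\mathbb A_\infty)$, extended complex linearly to $\mathfrak g_{\mathbb C}$.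 An *automorphic representation* is a space of automorphic forms invariant under $G(\mathbb A_f)$, $K_\infty$ and $\mathfrak g$; the one *generated by* $\Phi$ is the smallest that contains $\Phi$; it is *irreducible* if it is nonzero and its only invariant subspaces are $0$ and itself. Assume that $G(\mathbb A_\infty)=Z'G'$ with a subgroup $Z'\subset Z(\mathbb A_\infty)$ and a closed subgroup $G'$ whose identity component $G'_0$ has finite index in $G'$; that $K'$ is a maximal compact subgroup of $G'$, with identity component $K'_0$ of finite index in $K'$, and $K_\infty=(Z'\cap K_\infty)K'$; and that, with $\mathfrak g'$ and $\mathfrak k$ the Lie algebras of $G'$ and $K'$, there is a direct sum decomposition $\mathfrak g'_{\mathbb C}=\mathfrak p^+_{\mathbb C}\oplus\mathfrak k_{\mathbb C}\oplus\mathfrak p^-_{\mathbb C}$ with Lie subalgebras $\mathfrak p^\pm_{\mathbb C}$ such that $[\mathfrak k_{\mathbb C},\mathfrak p^\pm_{\mathbb C}]\subset\mathfrak p^\pm_{\mathbb C}$. A *$K'_0$-type* is (the class of) an irreducible finite-dimensional representation of $K'_0$. For a $K'_0$-type $\tau$, regarded as a module for $\mathfrak k_{\mathbb C}+\mathfrak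 p^-_{\mathbb C}$ on which $\mathfrak p^-_{\mathbb C}$ acts by zero, put $L_\tau=\mathcal U(\mathfrak g'_{\mathbb C})\otimes_{\mathcal U(\mathfrak k_{\mathbb C}+\mathfrak p^-_{\mathbb C})}\tau$. For $\sigma\in K'$, let $(L_\tau)^\sigma$ be the same space with $X\in\mathfrak g'_{\mathbb C}$ acting as $\mathrm{Ad}(\sigma)X$. As $K'_0$ is connected, $K'_0$-types in $\mathfrak g'_{\mathbb C}$-modules are understood through the action of $\mathfrak k_{\mathbb C}$. **Statement.** For each finite place $v$ let $K_v$ be an open compact subgroup of $G(F_v)$; assume that almost all, but not necessarily all, $K_v$ are maximal compact in $G(F_v)$. Let $\Phi$ be a square-integrable automorphic form on $G(\mathbb A)$ such that: 1. the span of the functions $R(k)\Phi$, $k\in K'_0$, is an irreducible representation $\tau$ of $K'_0$; 2. the $K'_0$-type $\tau$ occurs in $L_\tau$ exactly once; 3. for $\sigma\in K'$, $\sigma\notin K'_0$, the $\mathfrak g'_{\mathbb C}$-modules $L_\tau$ and $(L_\tau)^\sigma$ have no $K'_0$-type in common; 4. $R(\mathfrak p^-_{\mathbb C})\Phi=0$;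 5. for each finite place $v$, $\Phi$ is right invariant under $K_v$ and is an eigenvector of the local Hecke algebra $\mathcal H(G(F_v),K_v)$ of locally constant, compactly supported, $K_v$-bi-invariant functions $f:G(F_v)\to\mathbb C$, which act by $R(f)\Phi=\int_{G(F_v)}f(g)R(g)\Phi\,dg$. Then the automorphic representation of $G(\mathbb A)$ generated by $\Phi$ is irreducible. -/

import Mathlib

open NumberField IsDedekindDomain MeasureTheory Filter Topology
open scoped TensorProduct ContDiff

universe u

noncomputable section

attribute [local instance 100] LieRing.ofAssociativeRing LieAlgebra.ofAssociativeAlgebra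

/-! ### Linear algebraic groups and their points -/

/-- `g ∈ GL_n(R)` is a common zero of the polynomials in `eqs` (in the matrix entries). -/
def SatisfiesEquations {F : Type u} [Field F] {n : ℕ} (eqs : Set (MvPolynomial (Fin n × Fin n) F))
    {R : Type u} [CommRing R] [Algebra F R] (g : GL (Fin n) R) : Prop :=
  ∀ p ∈ eqs, MvPolynomial.aeval (fun ij : Fin n × Fin n => (g : Matrix (Fin n) (Fin n) R) ij.1 ij.2) p = 0

/-- A linear algebraic group over `F`, presented as a closed subgroup scheme of `GL_n`: a set of
polynomial equations whose solutions in `GL_n(R)` form a subgroup, for every commutative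
`F`-algebra `R`. No connectedness or reductivity is assumed. -/
structure LinearAlgebraicGroup (F : Type u) [Field F] (n : ℕ) where
  equations : Set (MvPolynomial (Fin n × Fin n) F)
  one_sat : ∀ (R : Type u) [CommRing R] [Algebra F R],
    SatisfiesEquations equations (1 : GL (Fin n) R)
  mul_sat : ∀ (R : Type u) [CommRing R] [Algebra F R] (g h : GL (Fin n) R),
    SatisfiesEquations equations g → SatisfiesEquations equations h →
      SatisfiesEquations equations (g * h)
  inv_sat : ∀ (R : Type u) [CommRing R] [Algebra F R] (g : GL (Fin n) R),
    SatisfiesEquations equations g → SatisfiesEquations equations g⁻¹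

namespace LinearAlgebraicGroup

variable {F : Type u} [Field F] {n : ℕ}

/-- The group `G(R)`, as a subgroup of `GL_n(R)`. For a topological ring `R` it carries the
subspace topology of `GL_n(R) = (M_n(R))ˣ`. -/
def points (G : LinearAlgebraicGroup F n) (R : Type u) [CommRing R] [Algebra F R] :
    Subgroup (GL (Fin n) R) where
  carrier := {g | SatisfiesEquations G.equations g}
  one_mem' := G.one_sat R
  mul_mem' := fun {g h} hg hh => G.mul_sat R g h hg hh
  inv_mem' := fun {g} hg => G.inv_sat R g hg

/-- Functoriality: `G(R) → G(S)` for a homomorphism `R → S` of `F`-algebras. -/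
def map (G : LinearAlgebraicGroup F n) {R S : Type u} [CommRing R] [Algebra F R] [CommRing S]
    [Algebra F S] (f : R →ₐ[F] S) : G.points R →* G.points S :=
  ((Matrix.GeneralLinearGroup.map (n := Fin n) f.toRingHom).comp (G.points R).subtype).codRestrict
    (G.points S) (fun g p hp => by
      have h := congrArg f (g.2 p hp)
      rw [map_zero, MvPolynomial.comp_aeval_apply] at h
      exact h)

/-- `Z(R)`, where `Z` is the (scheme-theoretic) centre of `G`: those `g ∈ G(R)` whose image in
`G(S)` is central for every `R`-algebra `S`. -/
def center (G : LinearAlgebraicGroup F n) (R : Type u) [CommRing R] [Algebra F R] :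
    Subgroup (G.points R) where
  carrier := {g | ∀ (S : Type u) [CommRing S] [Algebra F S] (f : R →ₐ[F] S) (h : G.points S),
    G.map f g * h = h * G.map f g}
  one_mem' := by intro S _ _ f h; simp
  mul_mem' := by
    intro a b ha hb S _ _ f h
    rw [map_mul, mul_assoc, hb S f h, ← mul_assoc, ha S f h, mul_assoc]
  inv_mem' := by
    intro a ha S _ _ f h
    rw [map_inv, inv_mul_eq_iff_eq_mul, ← mul_assoc, ha S f h, mul_assoc, mul_inv_cancel, mul_one]

end LinearAlgebraicGroup

/-! ### Adeles -/

/-- The ring of archimedean adeles `𝔸_∞ = F ⊗_ℚ ℝ = ∏_{v ∣ ∞} F_v = ℝ^{r₁} × ℂ^{r₂}`. -/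
abbrev ArchAdele (F : Type u) [Field F] [NumberField F] : Type u := mixedEmbedding.mixedSpace F

/-- The ring of finite adeles. -/
abbrev FinAdele (F : Type u) [Field F] [NumberField F] : Type u := FiniteAdeleRing (𝓞 F) F

/-- Finite places of `F`. -/
abbrev FinPlace (F : Type u) [Field F] [NumberField F] : Type u := HeightOneSpectrum (𝓞 F)

instance archAdeleAlgebra (F : Type u) [Field F] [NumberField F] : Algebra F (ArchAdele F) :=
  (mixedEmbedding F).toAlgebra

namespace LinearAlgebraicGroup

variable {F : Type u} [Field F] [NumberField F] {n : ℕ}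

/-- `G(𝔸_∞)`. -/
abbrev ArchPts (G : LinearAlgebraicGroup F n) : Type u := G.points (ArchAdele F)

/-- `G(𝔸_f)`. -/
abbrev FinPts (G : LinearAlgebraicGroup F n) : Type u := G.points (FinAdele F)

/-- `G(F_v)` for a finite place `v`. -/
abbrev LocPts (G : LinearAlgebraicGroup F n) (v : FinPlace F) : Type u :=
  G.points (v.adicCompletion F)

/-- `G(𝔸) = G(𝔸_∞) × G(𝔸_f)`. -/
abbrev Adelic (G : LinearAlgebraicGroup F n) : Type u := G.ArchPts × G.FinPts

/-- The diagonal embedding `G(F) → G(𝔸)`. -/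
def diag (G : LinearAlgebraicGroup F n) : G.points F →* G.Adelic :=
  (G.map (Algebra.ofId F (ArchAdele F))).prod (G.map (Algebra.ofId F (FinAdele F)))

/-- `Z(𝔸) = Z(𝔸_∞) × Z(𝔸_f)`. -/
def adelicCenter (G : LinearAlgebraicGroup F n) : Subgroup G.Adelic :=
  (G.center (ArchAdele F)).prod (G.center (FinAdele F))

end LinearAlgebraicGroup

/-! ### The embedding `G(F_v) → G(𝔸_f)` -/

section LocalEmbedding

variable {F : Type u} [Field F] [NumberField F] {n : ℕ}

open scoped Classical in
/-- The matrix over `𝔸_f` whose component at `v` is `g` and whose other components are `1`. -/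
def localMatrix (v : FinPlace F) (g : Matrix (Fin n) (Fin n) (v.adicCompletion F)) :
    Matrix (Fin n) (Fin n) (FinAdele F) := fun i j =>
  ⟨Function.update (fun w : FinPlace F =>
      (1 : Matrix (Fin n) (Fin n) (w.adicCompletion F)) i j) v (g i j), by
    have hfin : ({v} : Set (FinPlace F))ᶜ ∈ (cofinite : Filter (FinPlace F)) :=
      (Set.finite_singleton v).compl_mem_cofinite
    filter_upwards [hfin] with w hw
    have hw' : w ≠ v := hw
    rw [Function.update_of_ne hw']
    by_cases hij : i = j
    · subst hij; rw [Matrix.one_apply_eq]; exact one_mem _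
    · rw [Matrix.one_apply_ne hij]; exact zero_mem _⟩

open scoped Classical in
theorem localMatrix_apply (v : FinPlace F) (g : Matrix (Fin n) (Fin n) (v.adicCompletion F))
    (i j : Fin n) (w : FinPlace F) :
    (localMatrix v g i j) w = Function.update (fun w : FinPlace F =>
      (1 : Matrix (Fin n) (Fin n) (w.adicCompletion F)) i j) v (g i j) w := rfl

/-- The component `𝔸_f → F_w`. -/
def finAdeleEval (w : FinPlace F) : FinAdele F →ₐ[F] w.adicCompletion F where
  toFun a := a w
  map_one' := rfl
  map_mul' _ _ := rfl
  map_zero' := rfl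
  map_add' _ _ := rfl
  commutes' _ := rfl

theorem finAdele_matrix_ext {A B : Matrix (Fin n) (Fin n) (FinAdele F)}
    (h : ∀ w, A.map (finAdeleEval w) = B.map (finAdeleEval w)) : A = B := by
  funext i j
  exact FiniteAdeleRing.ext F fun w => congrFun (congrFun (h w) i) j

theorem localMatrix_map_same (v : FinPlace F)
    (g : Matrix (Fin n) (Fin n) (v.adicCompletion F)) :
    (localMatrix v g).map (finAdeleEval v) = g := by
  funext i j
  classical exact (localMatrix_apply v g i j v).trans (Function.update_self v (g i j) _)

theorem localMatrix_map_ne {v w : FinPlace F} (h : w ≠ v)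
    (g : Matrix (Fin n) (Fin n) (v.adicCompletion F)) :
    (localMatrix v g).map (finAdeleEval w) = 1 := by
  funext i j
  classical exact (localMatrix_apply v g i j w).trans (Function.update_of_ne h (g i j) _)

theorem localMatrix_one (v : FinPlace F) :
    localMatrix v (1 : Matrix (Fin n) (Fin n) (v.adicCompletion F)) = 1 := by
  refine finAdele_matrix_ext fun w => ?_
  rw [Matrix.map_one _ (map_zero _) (map_one _)]
  by_cases h : w = v
  · subst h; exact localMatrix_map_same _ _
  · exact localMatrix_map_ne h _

theorem localMatrix_mul (v : FinPlace F) (g h : Matrix (Fin n) (Fin n) (v.adicCompletion F)) :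
    localMatrix v (g * h) = localMatrix v g * localMatrix v h := by
  refine finAdele_matrix_ext fun w => ?_
  rw [Matrix.map_mul]
  by_cases hw : w = v
  · subst hw; simp only [localMatrix_map_same]
  · simp only [localMatrix_map_ne hw, mul_one]

/-- `GL_n(F_v) → GL_n(𝔸_f)`, with trivial components away from `v`. -/
def localGL (v : FinPlace F) : GL (Fin n) (v.adicCompletion F) →* GL (Fin n) (FinAdele F) where
  toFun g := ⟨localMatrix v g.1, localMatrix v g⁻¹.1,
    by rw [← localMatrix_mul, ← Units.val_mul, mul_inv_cancel, Units.val_one, localMatrix_one],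
    by rw [← localMatrix_mul, ← Units.val_mul, inv_mul_cancel, Units.val_one, localMatrix_one]⟩
  map_one' := Units.ext (localMatrix_one v)
  map_mul' g h := Units.ext (localMatrix_mul v g.1 h.1)

/-- `G(F_v) → G(𝔸_f)`, with trivial components away from `v`. -/
def LinearAlgebraicGroup.localEmb (G : LinearAlgebraicGroup F n) (v : FinPlace F) :
    G.LocPts v →* G.FinPts :=
  ((localGL v).comp (G.points (v.adicCompletion F)).subtype).codRestrict (G.points (FinAdele F))
    (fun g p hp => by
      apply FiniteAdeleRing.ext
      intro w
      change finAdeleEval w _ = 0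
      rw [MvPolynomial.comp_aeval_apply]
      by_cases hw : w = v
      · subst hw
        have h := g.2 p hp
        rw [← localMatrix_map_same w (g : GL (Fin n) (w.adicCompletion F)).1] at h
        exact h
      · have h := G.one_sat (w.adicCompletion F) p hp
        rw [Units.val_one, ← localMatrix_map_ne hw (g : GL (Fin n) (v.adicCompletion F)).1] at h
        exact h)

end LocalEmbedding

/-! ### Lie algebras of closed subgroups of `G(𝔸_∞)` -/

section LieAlgebras


theorem norm_pow_sub_pow_le {B : Type*} [NormedRing B] [NormOneClass B] {R : ℝ} (hR : 1 ≤ R)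
    {x y : B} (hx : ‖x‖ ≤ R) (hy : ‖y‖ ≤ R) (k : ℕ) :
    ‖x ^ k - y ^ k‖ ≤ k * R ^ k * ‖x - y‖ := by
  have hR0 : 0 ≤ R := zero_le_one.trans hR
  induction k with
  | zero => simp
  | succ k ih =>
    have e : x ^ (k + 1) - y ^ (k + 1) = x ^ k * (x - y) + (x ^ k - y ^ k) * y := by
      rw [pow_succ, pow_succ]; noncomm_ring
    have h1 : ‖x ^ k * (x - y)‖ ≤ R ^ k * ‖x - y‖ :=
      (norm_mul_le _ _).trans (mul_le_mul_of_nonneg_right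
        ((norm_pow_le x k).trans (pow_le_pow_left₀ (norm_nonneg _) hx k)) (norm_nonneg _))
    have h2 : ‖(x ^ k - y ^ k) * y‖ ≤ k * R ^ k * ‖x - y‖ * R :=
      (norm_mul_le _ _).trans (mul_le_mul ih hy (norm_nonneg _) (by positivity))
    have h3 : R ^ k * ‖x - y‖ ≤ R ^ (k + 1) * ‖x - y‖ :=
      mul_le_mul_of_nonneg_right (pow_le_pow_right₀ hR (Nat.le_succ k)) (norm_nonneg _)
    rw [e]
    refine (norm_add_le _ _).trans ((add_le_add (h1.trans h3) h2).trans (le_of_eq ?_))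
    push_cast; ring

/-- If `c` is a curve through `1` with velocity `Z` at `0`, then `c (1/m) ^ m → exp Z`. -/
theorem tendsto_curve_pow {B : Type*} [NormedRing B] [NormedAlgebra ℝ B] [NormOneClass B]
    [CompleteSpace B] {c : ℝ → B} {Z : B} (h0 : c 0 = 1) (hc : HasDerivAt c Z 0) :
    Tendsto (fun m : ℕ => c (1 / ((m : ℝ) + 1)) ^ (m + 1)) atTop (𝓝 (NormedSpace.exp Z)) := by
  have hs : Tendsto (fun m : ℕ => 1 / ((m : ℝ) + 1)) atTop (𝓝 0) :=
    tendsto_one_div_add_atTop_nhds_zero_nat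
  have he : HasDerivAt (fun t : ℝ => NormedSpace.exp (t • Z)) Z 0 := by
    simpa using hasDerivAt_exp_smul_const Z (0 : ℝ)
  have hd : HasDerivAt (fun t : ℝ => c t - NormedSpace.exp (t • Z)) 0 0 := by
    have h := hc.sub he
    rw [sub_self] at h
    exact h
  have hO : ∀ {f : ℝ → B} {D : B}, f 0 = 1 → HasDerivAt f D 0 →
      ∀ᶠ m : ℕ in atTop, ‖f (1 / ((m : ℝ) + 1))‖ ≤ 1 + (‖D‖ + 1) * (1 / ((m : ℝ) + 1)) := by
    intro f D hf0 hf
    have h1 := (hasDerivAt_iff_isLittleO.mp hf).def (zero_lt_one)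
    filter_upwards [hs.eventually h1] with m hm
    set s : ℝ := 1 / ((m : ℝ) + 1) with hsdef
    have hspos : 0 ≤ s := by positivity
    simp only [sub_zero, hf0, one_mul, Real.norm_eq_abs, abs_of_nonneg hspos] at hm
    have e : f s = 1 + (s • D + (f s - 1 - s • D)) := by abel
    rw [e]
    refine (norm_add_le _ _).trans ?_
    rw [norm_one]
    have := norm_add_le (s • D) (f s - 1 - s • D)
    rw [norm_smul, Real.norm_eq_abs, abs_of_nonneg hspos] at this
    nlinarith
  have hlim : Tendsto (fun m : ℕ => NormedSpace.exp ((1 / ((m : ℝ) + 1)) • Z) ^ (m + 1)) atTop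
      (𝓝 (NormedSpace.exp Z)) := by
    refine tendsto_const_nhds.congr fun m => ?_
    let _ : NormedAlgebra ℚ B := NormedAlgebra.restrictScalars ℚ ℝ B
    rw [← NormedSpace.exp_nsmul, ← Nat.cast_smul_eq_nsmul ℝ, smul_smul]
    congr 1
    have : ((m : ℝ) + 1) ≠ 0 := by positivity
    push_cast
    rw [mul_one_div_cancel this, one_smul]
  have hdiff : Tendsto (fun m : ℕ => c (1 / ((m : ℝ) + 1)) ^ (m + 1) -
      NormedSpace.exp ((1 / ((m : ℝ) + 1)) • Z) ^ (m + 1)) atTop (𝓝 0) := by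
    have hexp0 : (fun t : ℝ => NormedSpace.exp (t • Z)) 0 = 1 := by simp
    rw [Metric.tendsto_nhds]
    intro ε hε
    set E : ℝ := Real.exp (‖Z‖ + 1) with hE
    have hEpos : 0 < E := Real.exp_pos _
    have hq : 0 < ε / (2 * E) := by positivity
    have h1 := (hasDerivAt_iff_isLittleO.mp hd).def hq
    filter_upwards [hs.eventually h1, hO h0 hc, hO hexp0 he] with m hm ha hb
    set s : ℝ := 1 / ((m : ℝ) + 1) with hsdef
    have hmpos : 0 < (m : ℝ) + 1 := by positivity
    have hspos : 0 ≤ s := by positivity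
    have hsm : ((m : ℝ) + 1) * s = 1 := mul_one_div_cancel hmpos.ne'
    simp only [sub_zero, h0, zero_smul, NormedSpace.exp_zero, sub_self, smul_zero,
      Real.norm_eq_abs, abs_of_nonneg hspos] at hm
    set R : ℝ := 1 + (‖Z‖ + 1) * s with hR
    have hR1 : 1 ≤ R := by
      have : 0 ≤ (‖Z‖ + 1) * s := by positivity
      linarith
    have hRE : R ^ (m + 1) ≤ E := by
      have h2 : R ≤ Real.exp ((‖Z‖ + 1) * s) := by
        have := Real.add_one_le_exp ((‖Z‖ + 1) * s); linarith
      refine (pow_le_pow_left₀ (zero_le_one.trans hR1) h2 _).trans (le_of_eq ?_)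
      rw [← Real.exp_nat_mul]
      congr 1
      push_cast
      linear_combination (‖Z‖ + 1) * hsm
    have h3 := norm_pow_sub_pow_le hR1 ha hb (m + 1)
    rw [dist_zero_right]
    refine h3.trans_lt ?_
    push_cast
    calc ((m : ℝ) + 1) * R ^ (m + 1) * ‖c s - NormedSpace.exp (s • Z)‖
        ≤ ((m : ℝ) + 1) * E * (ε / (2 * E) * s) := by gcongr
      _ = (((m : ℝ) + 1) * s) * (ε / 2) := by field_simp
      _ < ε := by rw [hsm]; linarith
  simpa using hdiff.add hlim

theorem hasDerivAt_exp_smul_zero {B : Type*} [NormedRing B] [NormedAlgebra ℝ B]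
    [CompleteSpace B] (X : B) : HasDerivAt (fun t : ℝ => NormedSpace.exp (t • X)) X 0 := by
  simpa using hasDerivAt_exp_smul_const X (0 : ℝ)

theorem exp_smul_mul_exp_smul_neg {B : Type*} [NormedRing B] [NormedAlgebra ℝ B]
    [CompleteSpace B] (X : B) (t : ℝ) :
    NormedSpace.exp (t • X) * NormedSpace.exp (t • -X) = 1 := by
  let _ : NormedAlgebra ℚ B := NormedAlgebra.restrictScalars ℚ ℝ B
  rw [smul_neg, ← NormedSpace.exp_add_of_commute (Commute.refl (t • X)).neg_right,
    add_neg_cancel, NormedSpace.exp_zero]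

variable {F : Type u} [Field F] [NumberField F] {n : ℕ} {G : LinearAlgebraicGroup F n}

/-- The matrix of an element of `G(𝔸_∞)`. -/
def archMatrix (g : G.ArchPts) : Matrix (Fin n) (Fin n) (ArchAdele F) := (g : GL (Fin n) (ArchAdele F))

theorem archMatrix_mul (g h : G.ArchPts) : archMatrix (g * h) = archMatrix g * archMatrix h := rfl

theorem archMatrix_one : archMatrix (1 : G.ArchPts) = 1 := rfl

theorem archMatrix_pow (g : G.ArchPts) (k : ℕ) : archMatrix (g ^ k) = archMatrix g ^ k := rfl

theorem archMatrix_injective : Function.Injective (archMatrix (G := G)) :=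
  fun _ _ h => Subtype.ext (Units.ext h)

/-- `X` belongs to the Lie algebra of `H`: the one-parameter group `exp (tX)` lies in `H`. -/
def IsTangent (H : ClosedSubgroup G.ArchPts) (X : Matrix (Fin n) (Fin n) (ArchAdele F)) : Prop :=
  ∀ t : ℝ, ∃ h ∈ H, archMatrix h = NormedSpace.exp (t • X)

theorem isClosed_points (G : LinearAlgebraicGroup F n) :
    IsClosed ((G.points (ArchAdele F) : Subgroup (GL (Fin n) (ArchAdele F))) :
      Set (GL (Fin n) (ArchAdele F))) := by
  have : ((G.points (ArchAdele F) : Subgroup (GL (Fin n) (ArchAdele F))) :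
      Set (GL (Fin n) (ArchAdele F))) = ⋂ p ∈ G.equations, {g : GL (Fin n) (ArchAdele F) |
        MvPolynomial.aeval (fun ij : Fin n × Fin n =>
          (g : Matrix (Fin n) (Fin n) (ArchAdele F)) ij.1 ij.2) p = 0} := by
    ext g
    simp only [Set.mem_iInter]
    rfl
  rw [this]
  refine isClosed_biInter fun p _ => isClosed_eq ?_ continuous_const
  have hcont : Continuous fun g : GL (Fin n) (ArchAdele F) => fun ij : Fin n × Fin n =>
      (g : Matrix (Fin n) (Fin n) (ArchAdele F)) ij.1 ij.2 :=
    continuous_pi fun ij => (Units.continuous_val.matrix_elem ij.1 ij.2)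
  simp only [MvPolynomial.aeval_def, MvPolynomial.eval₂_eq_eval_map]
  exact (MvPolynomial.continuous_eval _).comp hcont

open scoped Classical in
attribute [local instance] Matrix.linftyOpNormedRing Matrix.linftyOpNormedAlgebra in
/-- A differentiable curve in `H` through `1` has its velocity in the Lie algebra of `H`. -/
theorem isTangent_of_curve (H : ClosedSubgroup G.ArchPts) {Z : Matrix (Fin n) (Fin n) (ArchAdele F)}
    (γ : ℝ → G.ArchPts) (hγ : ∀ t, γ t ∈ H) (h0 : γ 0 = 1)
    (hd : HasDerivAt (fun t => archMatrix (γ t)) Z 0) : IsTangent H Z := by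
  intro t
  rcases isEmpty_or_nonempty (Fin n) with hn | hn
  · exact ⟨1, one_mem H, Subsingleton.elim _ _⟩
  let _ : NormedAlgebra ℚ (Matrix (Fin n) (Fin n) (ArchAdele F)) :=
    NormedAlgebra.restrictScalars ℚ ℝ _
  have hd' : HasDerivAt (fun s : ℝ => archMatrix (γ (t * s))) (t • Z) 0 := by
    have h1 : HasDerivAt (fun s : ℝ => t * s) t 0 := by
      simpa using (hasDerivAt_id (0 : ℝ)).const_mul t
    have h2 : HasDerivAt (fun t => archMatrix (γ t)) Z ((fun s : ℝ => t * s) 0) := by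
      simpa using hd
    exact h2.scomp (0 : ℝ) h1
  have hlim := tendsto_curve_pow (c := fun s : ℝ => archMatrix (γ (t * s)))
    (by simp [h0, archMatrix_one]) hd'
  obtain ⟨u, hu⟩ := NormedSpace.isUnit_exp (t • Z)
  let x : ℕ → G.ArchPts := fun m => γ (t * (1 / ((m : ℝ) + 1))) ^ (m + 1)
  have hx : ∀ m, x m ∈ H := fun m => pow_mem (hγ _) _
  have hlim' : Tendsto (fun m => ((x m : G.ArchPts) : GL (Fin n) (ArchAdele F))) atTop (𝓝 u) := by
    refine Units.isOpenEmbedding_val.isEmbedding.tendsto_nhds_iff.mpr ?_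
    rw [hu]
    exact hlim
  have hu' : u ∈ G.points (ArchAdele F) :=
    (isClosed_points G).mem_of_tendsto hlim' (Eventually.of_forall fun m => (x m).2)
  have hlim'' : Tendsto x atTop (𝓝 (⟨u, hu'⟩ : G.ArchPts)) :=
    tendsto_subtype_rng.mpr hlim'
  exact ⟨⟨u, hu'⟩, H.isClosed'.mem_of_tendsto hlim'' (Eventually.of_forall hx), hu⟩

theorem IsTangent.smul {H : ClosedSubgroup G.ArchPts} {X : Matrix (Fin n) (Fin n) (ArchAdele F)}
    (hX : IsTangent H X) (r : ℝ) : IsTangent H (r • X) := fun t => by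
  rw [smul_smul]; exact hX (t * r)

open scoped Classical in
attribute [local instance] Matrix.linftyOpNormedRing Matrix.linftyOpNormedAlgebra in
theorem IsTangent.add {H : ClosedSubgroup G.ArchPts} {X Y : Matrix (Fin n) (Fin n) (ArchAdele F)}
    (hX : IsTangent H X) (hY : IsTangent H Y) : IsTangent H (X + Y) := by
  choose a ha ha' using hX
  choose b hb hb' using hY
  have h1 : HasDerivAt (fun t : ℝ => NormedSpace.exp (t • X)) X 0 := 
    hasDerivAt_exp_smul_zero X
  have h2 : HasDerivAt (fun t : ℝ => NormedSpace.exp (t • Y)) Y 0 := 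
    hasDerivAt_exp_smul_zero Y
  refine isTangent_of_curve H (fun t => a t * b t) (fun t => mul_mem (ha t) (hb t)) ?_ ?_
  · apply archMatrix_injective
    rw [archMatrix_mul, ha', hb', archMatrix_one, zero_smul, zero_smul, NormedSpace.exp_zero,
      mul_one]
  · simp only [archMatrix_mul, ha', hb']
    have h := h1.mul h2
    simp only [zero_smul, NormedSpace.exp_zero, mul_one, one_mul] at h
    exact h

open scoped Classical in
attribute [local instance] Matrix.linftyOpNormedRing Matrix.linftyOpNormedAlgebra in
/-- `Ad(σ)` preserves the Lie algebra of `H` for `σ ∈ H`. -/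
theorem IsTangent.conj {H : ClosedSubgroup G.ArchPts} {X : Matrix (Fin n) (Fin n) (ArchAdele F)}
    (hX : IsTangent H X) {σ : G.ArchPts} (hσ : σ ∈ H) :
    IsTangent H (archMatrix σ * X * archMatrix σ⁻¹) := fun t => by
  obtain ⟨h, hh, he⟩ := hX t
  refine ⟨σ * h * σ⁻¹, mul_mem (mul_mem hσ hh) (inv_mem hσ), ?_⟩
  let _ : NormedAlgebra ℚ (Matrix (Fin n) (Fin n) (ArchAdele F)) :=
    NormedAlgebra.restrictScalars ℚ ℝ _
  have e := NormedSpace.exp_units_conj (σ : GL (Fin n) (ArchAdele F)) (t • X)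
  rw [archMatrix_mul, archMatrix_mul, he]
  have e2 : t • (archMatrix σ * X * archMatrix σ⁻¹) =
      archMatrix σ * (t • X) * archMatrix σ⁻¹ := by
    rw [mul_smul_comm, smul_mul_assoc]
  rw [e2]
  exact e.symm

/-- The Lie algebra `{X | exp (tX) ∈ H for all t ∈ ℝ}` as a real vector space. -/
def lieSubmodule (H : ClosedSubgroup G.ArchPts) :
    Submodule ℝ (Matrix (Fin n) (Fin n) (ArchAdele F)) where
  carrier := {X | IsTangent H X}
  add_mem' := fun {_ _} hX hY => IsTangent.add hX hY
  zero_mem' := fun t => ⟨1, one_mem H, by rw [smul_zero, NormedSpace.exp_zero, archMatrix_one]⟩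
  smul_mem' := fun r _ hX => IsTangent.smul hX r

open scoped Classical in
attribute [local instance] Matrix.linftyOpNormedRing Matrix.linftyOpNormedAlgebra in
theorem IsTangent.lie {H : ClosedSubgroup G.ArchPts} {X Y : Matrix (Fin n) (Fin n) (ArchAdele F)}
    (hX : IsTangent H X) (hY : IsTangent H Y) : IsTangent H ⁅X, Y⁆ := by
  have h1 : HasDerivAt (fun t : ℝ => NormedSpace.exp (t • X)) X 0 := 
    hasDerivAt_exp_smul_zero X
  have h2 : HasDerivAt (fun t : ℝ => NormedSpace.exp (t • -X)) (-X) 0 := 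
    hasDerivAt_exp_smul_zero (-X)
  have h := (h1.mul_const Y).mul h2
  simp only [zero_smul, NormedSpace.exp_zero, mul_one, one_mul] at h
  have e : X * Y + Y * -X = ⁅X, Y⁆ := by rw [Ring.lie_def, mul_neg, sub_eq_add_neg]
  rw [e, hasDerivAt_iff_tendsto_slope] at h
  have hmem : ∀ t : ℝ, NormedSpace.exp (t • X) * Y * NormedSpace.exp (t • -X) ∈
      lieSubmodule H := by
    intro t
    obtain ⟨a, ha, hea⟩ := hX t
    have hinv : archMatrix a⁻¹ = NormedSpace.exp (t • -X) := by
      have h3 : archMatrix a * NormedSpace.exp (t • -X) = 1 := by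
        rw [hea]; exact exp_smul_mul_exp_smul_neg X t
      have h4 : archMatrix a⁻¹ * archMatrix a = 1 := by
        rw [← archMatrix_mul, inv_mul_cancel, archMatrix_one]
      exact left_inv_eq_right_inv h4 h3
    rw [← hea, ← hinv]
    exact IsTangent.conj hY ha
  have hclosed : IsClosed ((lieSubmodule H : Submodule ℝ _) :
      Set (Matrix (Fin n) (Fin n) (ArchAdele F))) := Submodule.closed_of_finiteDimensional _
  refine hclosed.mem_of_tendsto h (Eventually.of_forall fun t => ?_)
  rw [slope_def_module]
  exact Submodule.smul_mem _ _ (Submodule.sub_mem _ (hmem t) (hmem 0))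

/-- The Lie algebra `{X | exp (tX) ∈ H for all t ∈ ℝ}` of a closed subgroup `H` of `G(𝔸_∞)`. -/
def lieAlg (H : ClosedSubgroup G.ArchPts) :
    LieSubalgebra ℝ (Matrix (Fin n) (Fin n) (ArchAdele F)) where
  __ := lieSubmodule H
  lie_mem' := fun {_ _} hX hY => IsTangent.lie hX hY

/-- `oneParam X t` is the element `exp (tX)` of `G(𝔸_∞)`. -/
def oneParam {H : ClosedSubgroup G.ArchPts} (X : lieAlg H) (t : ℝ) : G.ArchPts :=
  (show IsTangent H X from X.2) t |>.choose

theorem oneParam_mem {H : ClosedSubgroup G.ArchPts} (X : lieAlg H) (t : ℝ) : oneParam X t ∈ H :=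
  ((show IsTangent H X from X.2) t).choose_spec.1

theorem archMatrix_oneParam {H : ClosedSubgroup G.ArchPts} (X : lieAlg H) (t : ℝ) :
    archMatrix (oneParam X t) =
      NormedSpace.exp (t • (X : Matrix (Fin n) (Fin n) (ArchAdele F))) :=
  ((show IsTangent H X from X.2) t).choose_spec.2

/-- The adjoint action `Ad(σ) X = σ X σ⁻¹` of `σ ∈ H` on the Lie algebra of `H`. -/
def Ad {H : ClosedSubgroup G.ArchPts} (σ : H) : lieAlg H →ₗ⁅ℝ⁆ lieAlg H where
  toFun X := ⟨archMatrix (σ : G.ArchPts) * X * archMatrix (σ : G.ArchPts)⁻¹,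
    IsTangent.conj X.2 σ.2⟩
  map_add' X Y := Subtype.ext (by simp [mul_add, add_mul])
  map_smul' r X := Subtype.ext (by simp)
  map_lie' := by
    intro X Y
    apply Subtype.ext
    have h : archMatrix (σ : G.ArchPts)⁻¹ * archMatrix (σ : G.ArchPts) = 1 := by
      rw [← archMatrix_mul, inv_mul_cancel, archMatrix_one]
    simp only [LieSubalgebra.coe_bracket, Ring.lie_def, mul_sub, sub_mul]
    congr 1
    · rw [mul_assoc (_ * _) _ (_ * _ * _), ← mul_assoc (archMatrix (σ : G.ArchPts)⁻¹),
        ← mul_assoc (archMatrix (σ : G.ArchPts)⁻¹), h]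
      simp only [one_mul, mul_assoc]
    · rw [mul_assoc (_ * _) _ (_ * _ * _), ← mul_assoc (archMatrix (σ : G.ArchPts)⁻¹),
        ← mul_assoc (archMatrix (σ : G.ArchPts)⁻¹), h]
      simp only [one_mul, mul_assoc]

/-- The complex linear extension of `Ad(σ)`. -/
def AdC {H : ClosedSubgroup G.ArchPts} (σ : H) : (ℂ ⊗[ℝ] lieAlg H) →ₗ⁅ℂ⁆ (ℂ ⊗[ℝ] lieAlg H) where
  __ := (Ad σ).toLinearMap.baseChange ℂ
  map_lie' := by
    intro X Y
    change (Ad σ).toLinearMap.baseChange ℂ ⁅X, Y⁆ =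
      ⁅(Ad σ).toLinearMap.baseChange ℂ X, (Ad σ).toLinearMap.baseChange ℂ Y⁆
    induction X with
    | zero => simp
    | add a b ha hb => simp only [add_lie, map_add, ha, hb]
    | tmul a x =>
      induction Y with
      | zero =>
        have h : ⁅a ⊗ₜ[ℝ] x, (0 : ℂ ⊗[ℝ] lieAlg H)⁆ = 0 := by
          have h2 := LieRing.lie_add (a ⊗ₜ[ℝ] x) (0 : ℂ ⊗[ℝ] lieAlg H) 0
          rwa [add_zero, left_eq_add] at h2
        rw [map_zero, lie_zero]
        exact (congrArg _ h).trans (map_zero _)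
      | add c d hc hd => rw [map_add, LieRing.lie_add, LieRing.lie_add, map_add, hc, hd]
      | tmul b y => simp

end LieAlgebras

/-! ### Automorphic forms and automorphic representations -/

section Automorphic

variable {F : Type u} [Field F] [NumberField F] {n : ℕ} {G : LinearAlgebraicGroup F n}

/-- Right translation `(R(x) f)(g) = f(gx)` on functions on `G(𝔸)`. -/
def rightTranslation (G : LinearAlgebraicGroup F n) :
    Representation ℂ G.Adelic (G.Adelic → ℂ) where
  toFun x :=
    { toFun := fun f g => f (g * x)
      map_add' := fun _ _ => rfl
      map_smul' := fun _ _ => rfl }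
  map_one' := by ext f g; simp
  map_mul' x y := by ext f g; simp [mul_assoc]

/-- `G(𝔸_∞)` as a closed subgroup of itself. -/
def fullArch (G : LinearAlgebraicGroup F n) : ClosedSubgroup G.ArchPts where
  __ := (⊤ : Subgroup G.ArchPts)
  isClosed' := isClosed_univ

/-- `(R(X) f)(g) = d/dt|₀ f(g exp(tX))` for `X` in the (real) Lie algebra of a closed subgroup of
`G(𝔸_∞)`. -/
def lieDeriv {H : ClosedSubgroup G.ArchPts} (X : lieAlg H) (f : G.Adelic → ℂ) : G.Adelic → ℂ :=
  fun g => deriv (fun t : ℝ => f (g * (oneParam X t, 1))) 0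

open scoped Classical in
/-- Smooth (`C^∞`) functions on the Lie group `G(𝔸_∞)`: locally restrictions of `C^∞` functions
on the real vector space `M_n(𝔸_∞)`, of which `G(𝔸_∞)` is an embedded submanifold. -/
def IsSmoothArch (φ : G.ArchPts → ℂ) : Prop :=
  ∀ g₀ : G.ArchPts, ∃ ψ : (Fin n → Fin n → ArchAdele F) → ℂ, ContDiff ℝ ∞ ψ ∧
    ∀ᶠ g in 𝓝 g₀, φ g = ψ (fun i j => archMatrix g i j)

/-- Automorphic forms on `G(𝔸)`, with respect to the maximal compact subgroup `Kinf` of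
`G(𝔸_∞)`. -/
structure IsAutomorphicForm (Kinf : Subgroup G.ArchPts) (f : G.Adelic → ℂ) : Prop where
  right_invariant : ∃ Kf : Subgroup G.FinPts, IsOpen (Kf : Set G.FinPts) ∧
    IsCompact (Kf : Set G.FinPts) ∧ ∀ k ∈ Kf, rightTranslation G (1, k) f = f
  smooth : ∀ h : G.Adelic, IsSmoothArch (fun g : G.ArchPts => f ((g, 1) * h))
  finite : FiniteDimensional ℂ
    (Submodule.span ℂ {f' | ∃ k ∈ Kinf, f' = rightTranslation G (k, 1) f})
  left_invariant : ∀ (γ : G.points F) (g : G.Adelic), f (G.diag γ * g) = f g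
  central : ∃ χ : G.adelicCenter →* Circle, Continuous χ ∧
    ∀ (z : G.adelicCenter) (g : G.Adelic), f ((z : G.Adelic) * g) = (χ z : ℂ) * f g

/-- Stability of a space of functions on `G(𝔸)` under `G(𝔸_f)`, `Kinf` and the Lie algebra
of `G(𝔸_∞)`. -/
structure IsInvariantSpace (Kinf : Subgroup G.ArchPts) (W : Submodule ℂ (G.Adelic → ℂ)) :
    Prop where
  fin : ∀ (h : G.FinPts), ∀ f ∈ W, rightTranslation G (1, h) f ∈ W
  cpt : ∀ k ∈ Kinf, ∀ f ∈ W, rightTranslation G (k, 1) f ∈ W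
  lie : ∀ X : lieAlg (fullArch G), ∀ f ∈ W, lieDeriv X f ∈ W

/-- An automorphic representation: an invariant space of automorphic forms (irreducible or not). -/
structure IsAutomorphicRep (Kinf : Subgroup G.ArchPts) (W : Submodule ℂ (G.Adelic → ℂ)) :
    Prop where
  automorphic : ∀ f ∈ W, IsAutomorphicForm Kinf f
  invariant : IsInvariantSpace Kinf W

/-- An irreducible automorphic representation: it is nonzero and its only invariant subspaces
are `0` and itself. -/
structure IsIrreducibleAutomorphicRep (Kinf : Subgroup G.ArchPts)
    (V : Submodule ℂ (G.Adelic → ℂ)) : Prop where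
  rep : IsAutomorphicRep Kinf V
  nontrivial : V ≠ ⊥
  eq_bot_or_eq : ∀ W ≤ V, IsInvariantSpace Kinf W → W = ⊥ ∨ W = V

/-- The space generated by `Φ` under the right action of `G(𝔸_f)`, `Kinf` and the Lie algebra of
`G(𝔸_∞)`: the smallest invariant space that contains `Φ`. -/
def generatedRep (Kinf : Subgroup G.ArchPts) (Φ : G.Adelic → ℂ) : Submodule ℂ (G.Adelic → ℂ) :=
  sInf {W | Φ ∈ W ∧ IsInvariantSpace Kinf W}

/-! ### Square-integrability -/

/-- The subgroup `G(F)Z(𝔸)` of `G(𝔸)`. -/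
def rationalCentral (G : LinearAlgebraicGroup F n) : Subgroup G.Adelic :=
  G.diag.range ⊔ G.adelicCenter

/-- The space `G(F)Z(𝔸) \ G(𝔸)` of cosets `G(F)Z(𝔸)g`, with the quotient topology and its Borel
`σ`-algebra. -/
def AutomorphicQuotient (G : LinearAlgebraicGroup F n) : Type u :=
  Quotient (QuotientGroup.rightRel (rationalCentral G))

instance (G : LinearAlgebraicGroup F n) : TopologicalSpace (AutomorphicQuotient G) :=
  inferInstanceAs (TopologicalSpace (Quotient (QuotientGroup.rightRel (rationalCentral G))))

instance (G : LinearAlgebraicGroup F n) : MeasurableSpace (AutomorphicQuotient G) := borel _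

instance (G : LinearAlgebraicGroup F n) : BorelSpace (AutomorphicQuotient G) := ⟨rfl⟩

/-- Right translation by `x` on `G(F)Z(𝔸) \ G(𝔸)`. -/
def AutomorphicQuotient.rightMul (x : G.Adelic) :
    AutomorphicQuotient G → AutomorphicQuotient G :=
  Quotient.map (· * x) (fun a b h => by
    rw [← Quotient.eq_iff_equiv, Quotient.eq, QuotientGroup.rightRel_apply] at h ⊢
    simpa [mul_assoc] using h)

/-- `μ` is the measure on `G(F)Z(𝔸) \ G(𝔸)` obtained from a Haar measure on `G(𝔸)`, that is,
a nonzero right `G(𝔸)`-invariant Radon measure (it is unique up to a positive constant). -/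
structure IsQuotientHaar (μ : Measure (AutomorphicQuotient G)) : Prop where
  regular : μ.Regular
  ne_zero : μ ≠ 0
  invariant : ∀ x : G.Adelic, μ.map (AutomorphicQuotient.rightMul x) = μ

/-- `∫_{G(F)Z(𝔸)\G(𝔸)} |Φ(g)|² dg < ∞`. For an automorphic form `Φ` the function `|Φ|²` is left
`G(F)Z(𝔸)`-invariant, so the choice of coset representatives does not matter. -/
def IsSquareIntegrable (μ : Measure (AutomorphicQuotient G)) (Φ : G.Adelic → ℂ) : Prop :=
  ∫⁻ q : AutomorphicQuotient G, ‖Φ (Quotient.out q)‖ₑ ^ 2 ∂μ < ⊤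

/-! ### Local Hecke algebras -/

instance (G : LinearAlgebraicGroup F n) (v : FinPlace F) : MeasurableSpace (G.LocPts v) := borel _

instance (G : LinearAlgebraicGroup F n) (v : FinPlace F) : BorelSpace (G.LocPts v) := ⟨rfl⟩

/-- Elements of the Hecke algebra `ℋ(G(F_v), K_v)`. -/
structure IsHeckeFunction {v : FinPlace F} (Kv : Subgroup (G.LocPts v)) (φ : G.LocPts v → ℂ) :
    Prop where
  locallyConstant : IsLocallyConstant φ
  compactSupport : HasCompactSupport φ
  left_invariant : ∀ k ∈ Kv, ∀ g, φ (k * g) = φ g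
  right_invariant : ∀ k ∈ Kv, ∀ g, φ (g * k) = φ g

/-- `R(φ)Φ = ∫_{G(F_v)} φ(g) R(g)Φ dg`. -/
def heckeAction {v : FinPlace F} (ν : Measure (G.LocPts v)) (φ : G.LocPts v → ℂ)
    (Φ : G.Adelic → ℂ) : G.Adelic → ℂ :=
  fun x => ∫ g, φ g * rightTranslation G (1, G.localEmb v g) Φ x ∂ν

/-- `Φ` is right `K_v`-invariant and an eigenvector of the Hecke algebra `ℋ(G(F_v), K_v)`. -/
structure IsHeckeEigenvector {v : FinPlace F} (ν : Measure (G.LocPts v))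
    (Kv : Subgroup (G.LocPts v)) (Φ : G.Adelic → ℂ) : Prop where
  right_invariant : ∀ k ∈ Kv, rightTranslation G (1, G.localEmb v k) Φ = Φ
  eigen : ∀ φ : G.LocPts v → ℂ, IsHeckeFunction Kv φ → ∃ c : ℂ, heckeAction ν φ Φ = c • Φ

end Automorphic

/-! ### The archimedean data -/

section Archimedean

variable {F : Type u} [Field F] [NumberField F] {n : ℕ}

/-- The real Lie algebra of `K`, as a subspace of the Lie algebra of `H` (for `K ≤ H`). -/
def lieSubspace {G : LinearAlgebraicGroup F n} (H K : ClosedSubgroup G.ArchPts) :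
    Submodule ℝ (lieAlg H) :=
  (lieAlg K).toSubmodule.comap (lieAlg H).toSubmodule.subtype

/-- The archimedean data: a maximal compact subgroup `K_∞` of `G(𝔸_∞)`; a decomposition
`G(𝔸_∞) = Z'G'` with `Z'` central and `G'` a closed subgroup (hence a Lie group) with finitely many
connected components; a maximal compact subgroup `K'` of `G'` with `K_∞ = (Z' ∩ K_∞)K'`;
and a decomposition `𝔤'_ℂ = 𝔭⁺ ⊕ 𝔨_ℂ ⊕ 𝔭⁻` with Lie subalgebras `𝔭^±` normalized
by `𝔨_ℂ`, where `𝔨` is the Lie algebra of `K'`. -/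
structure ArchimedeanData (G : LinearAlgebraicGroup F n) where
  Kinf : Subgroup G.ArchPts
  Kinf_maximal : Maximal (fun C : Subgroup G.ArchPts => IsCompact (C : Set G.ArchPts)) Kinf
  Z' : Subgroup G.ArchPts
  Z'_central : Z' ≤ G.center (ArchAdele F)
  G' : ClosedSubgroup G.ArchPts
  Z'_sup_G' : Z' ⊔ G'.toSubgroup = ⊤
  G'_finiteIndex : (Subgroup.connectedComponentOfOne G'.toSubgroup).FiniteIndex
  K' : ClosedSubgroup G.ArchPts
  K'_maximal : Maximal (fun C : Subgroup G.ArchPts => C ≤ G'.toSubgroup ∧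
    IsCompact (C : Set G.ArchPts)) K'.toSubgroup
  K'_finiteIndex : (Subgroup.connectedComponentOfOne K'.toSubgroup).FiniteIndex
  Kinf_eq : Kinf = (Z' ⊓ Kinf) ⊔ K'.toSubgroup
  pPlus : LieSubalgebra ℂ (ℂ ⊗[ℝ] lieAlg G')
  pMinus : LieSubalgebra ℂ (ℂ ⊗[ℝ] lieAlg G')
  decomposition : DirectSum.IsInternal
    ![pPlus.toSubmodule, (lieSubspace G' K').baseChange ℂ, pMinus.toSubmodule]
  bracket_pPlus : ∀ Y ∈ (lieSubspace G' K').baseChange ℂ, ∀ X ∈ pPlus, ⁅Y, X⁆ ∈ pPlus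
  bracket_pMinus : ∀ Y ∈ (lieSubspace G' K').baseChange ℂ, ∀ X ∈ pMinus, ⁅Y, X⁆ ∈ pMinus

namespace ArchimedeanData


variable {G : LinearAlgebraicGroup F n} (D : ArchimedeanData G)

/-- The connected component `K'₀` of `K'`. -/
def K'₀ : Subgroup G.ArchPts :=
  (Subgroup.connectedComponentOfOne D.K'.toSubgroup).map D.K'.toSubgroup.subtype

/-- The real Lie algebra `𝔤'` of `G'`. -/
abbrev g' : Type u := lieAlg D.G'

/-- `𝔤'_ℂ`. -/
abbrev g'C : Type u := ℂ ⊗[ℝ] D.g'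

/-- The real Lie algebra `𝔨` of `K'`, as a subspace of `𝔤'`. -/
abbrev k : Submodule ℝ D.g' := lieSubspace D.G' D.K'

/-- `w = dρ(Y)v = d/dt|₀ ρ(exp(tY))v` for a (finite-dimensional) representation `ρ` of `K'₀`. -/
def IsDerived {E : Type*} [AddCommGroup E] [Module ℂ E] (ρ : Representation ℂ D.K'₀ E)
    (Y : D.g') (v w : E) : Prop :=
  ∃ γ : ℝ → D.K'₀, (∀ t, (γ t : G.ArchPts) = oneParam Y t) ∧
    ∀ l : Module.Dual ℂ E, HasDerivAt (fun t => l (ρ (γ t) v)) (l w) 0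

/-- The intertwining maps `Hom(ρ, M)` from a representation `ρ` of the connected group `K'₀` to a
`𝔤'_ℂ`-module `M`: since `K'₀` is connected, these are the linear maps that commute with the
actions of `𝔨`. -/
def typeHom {E M : Type*} [AddCommGroup E] [Module ℂ E] [AddCommGroup M] [Module ℂ M]
    (ρ : Representation ℂ D.K'₀ E) (a : D.g'C →ₗ⁅ℂ⁆ Module.End ℂ M) :
    Submodule ℂ (E →ₗ[ℂ] M) where
  carrier := {T | ∀ Y ∈ D.k, ∀ v w : E, D.IsDerived ρ Y v w → T w = a (1 ⊗ₜ Y) (T v)}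
  add_mem' := by
    intro S T hS hT Y hY v w h
    simp [hS Y hY v w h, hT Y hY v w h]
  zero_mem' := by intro Y hY v w h; simp
  smul_mem' := by
    intro c T hT Y hY v w h
    simp [hT Y hY v w h]

/-- The multiplicity of a `K'₀`-type `ρ` in a `𝔤'_ℂ`-module is one. -/
def OccursOnce {E M : Type*} [AddCommGroup E] [Module ℂ E] [AddCommGroup M] [Module ℂ M]
    (ρ : Representation ℂ D.K'₀ E) (a : D.g'C →ₗ⁅ℂ⁆ Module.End ℂ M) : Prop :=
  Module.finrank ℂ (D.typeHom ρ a) = 1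

/-- Two `𝔤'_ℂ`-modules have a `K'₀`-type (an irreducible continuous finite-dimensional
representation of `K'₀`) in common. -/
def HaveCommonType {M M' : Type*} [AddCommGroup M] [Module ℂ M] [AddCommGroup M'] [Module ℂ M']
    (a : D.g'C →ₗ⁅ℂ⁆ Module.End ℂ M) (a' : D.g'C →ₗ⁅ℂ⁆ Module.End ℂ M') : Prop :=
  ∃ (d : ℕ) (ρ : Representation ℂ D.K'₀ (Fin d → ℂ)), (∀ v, Continuous fun k => ρ k v) ∧
    ρ.IsIrreducible ∧ D.typeHom ρ a ≠ ⊥ ∧ D.typeHom ρ a' ≠ ⊥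

/-- The twist `π^σ(X) = π(Ad(σ)X)` of a `𝔤'_ℂ`-module, for `σ ∈ G'`. -/
def twist {M : Type*} [AddCommGroup M] [Module ℂ M] (a : D.g'C →ₗ⁅ℂ⁆ Module.End ℂ M)
    (σ : D.G') : D.g'C →ₗ⁅ℂ⁆ Module.End ℂ M :=
  a.comp (AdC σ)

/-- `𝒰(𝔤'_ℂ)`. -/
abbrev U : Type u := UniversalEnvelopingAlgebra ℂ D.g'C

/-- The relations `XY ⊗ v = X ⊗ Yv` that define `𝒰(𝔤'_ℂ) ⊗_{𝒰(𝔨_ℂ + 𝔭⁻)} ρ` as a quotient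
of `𝒰(𝔤'_ℂ) ⊗_ℂ ρ`; here `Y` runs through the generators of `𝒰(𝔨_ℂ + 𝔭⁻)` in `𝔨` and in `𝔭⁻`,
and the latter act on `ρ` by zero. -/
def inducedRelations {E : Type*} [AddCommGroup E] [Module ℂ E] (ρ : Representation ℂ D.K'₀ E) :
    Submodule D.U (D.U ⊗[ℂ] E) :=
  Submodule.span D.U
    ({x | ∃ Y ∈ D.k, ∃ v w : E, D.IsDerived ρ Y v w ∧
        x = UniversalEnvelopingAlgebra.ι ℂ (1 ⊗ₜ Y : D.g'C) ⊗ₜ v - 1 ⊗ₜ w} ∪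
     {x | ∃ Y ∈ D.pMinus, ∃ v : E, x = UniversalEnvelopingAlgebra.ι ℂ (Y : D.g'C) ⊗ₜ v})

/-- The induced module `L_ρ = 𝒰(𝔤'_ℂ) ⊗_{𝒰(𝔨_ℂ + 𝔭⁻)} ρ`. -/
abbrev L {E : Type*} [AddCommGroup E] [Module ℂ E] (ρ : Representation ℂ D.K'₀ E) : Type _ :=
  (D.U ⊗[ℂ] E) ⧸ D.inducedRelations ρ

/-- The action of `𝔤'_ℂ` on `L_ρ`, by multiplication on the left. -/
def lAction {E : Type*} [AddCommGroup E] [Module ℂ E] (ρ : Representation ℂ D.K'₀ E) :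
    D.g'C →ₗ⁅ℂ⁆ Module.End ℂ (D.L ρ) :=
  ((Algebra.lsmul ℂ ℂ (D.L ρ)).toLieHom).comp (UniversalEnvelopingAlgebra.ι ℂ)

/-- Right translation by `K'₀` on functions on `G(𝔸)`. -/
def restrictedTranslation : Representation ℂ D.K'₀ (G.Adelic → ℂ) :=
  (rightTranslation G).comp ((MonoidHom.inl G.ArchPts G.FinPts).comp D.K'₀.subtype)

/-- The span of the functions `R(k)Φ`, `k ∈ K'₀`, as a representation space of `K'₀`. -/
def tauSpace (Φ : G.Adelic → ℂ) : Subrepresentation D.restrictedTranslation where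
  toSubmodule := Submodule.span ℂ (Set.range fun k : D.K'₀ => D.restrictedTranslation k Φ)
  apply_mem_toSubmodule := by
    intro g v hv
    induction hv using Submodule.span_induction with
    | mem x hx =>
      obtain ⟨k, rfl⟩ := hx
      refine Submodule.subset_span ⟨g * k, ?_⟩
      simp [map_mul]
    | zero => rw [map_zero]; exact zero_mem _
    | add x y _ _ hx hy => rw [map_add]; exact add_mem hx hy
    | smul c x _ hx => rw [map_smul]; exact Submodule.smul_mem _ _ hx

/-- The representation `τ` of `K'₀` on the span of the functions `R(k)Φ`, `k ∈ K'₀`. -/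
def tau (Φ : G.Adelic → ℂ) : Representation ℂ D.K'₀ (D.tauSpace Φ).toSubmodule :=
  (D.tauSpace Φ).toRepresentation

/-- `R(𝔭⁻)Φ = 0`; every element of `𝔤'_ℂ` has the form `X + iY` with `X, Y ∈ 𝔤'`. -/
def AnnihilatedByPMinus (Φ : G.Adelic → ℂ) : Prop :=
  ∀ X Y : D.g', (1 ⊗ₜ X + Complex.I ⊗ₜ Y : D.g'C) ∈ D.pMinus →
    lieDeriv X Φ + Complex.I • lieDeriv Y Φ = 0

theorem K'_le_G' {σ : G.ArchPts} (hσ : σ ∈ D.K') : σ ∈ D.G' := D.K'_maximal.prop.1 hσ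

end ArchimedeanData

end Archimedean

end

/-! Let `M = R(𝒰(𝔤'_ℂ))τ`, where `τ` is spanned by the translates `R(k)Φ`, `k ∈ K'₀`. `Ad(K'₀)`
preserves `𝔭⁻`, so `𝔭⁻` kills all of `τ` and `M` is a quotient of `L_τ`. The sum of the
`K'`-translates of `M` (`archPart`), and then of the `G(𝔸_f)`-translates of that (`adelicPart`), is
an invariant space containing `Φ`; the remaining central directions act by scalars.

The argument is unitary, so every form in this space has to be square-integrable, although this is
assumed for `Φ` alone. A `K'₀`-invariant inner product on `𝔤'` with orthonormal basis `Xᵢ` gives `Δ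
= ∑ Xᵢ²` commuting with `𝔨`. Then `v ↦ Δ ⊗ v` lies in `Hom(τ, L_τ)`, which is one-dimensional, so
`Δ` is a scalar on `τ`. Commuting `Δ` past the `Xᵢ` shows that each iterated derivative `f`
satisfies `Δf = g + ∑ Xᵢhᵢ` with `g`, `hᵢ` of no higher order than `f`, and a Caccioppoli inequality
on the noncompact quotient makes the `Xᵢf` square-integrable (`integrable_sq_deriv_of_sum_eq`,
`iterateSpan_le`, `liePart_le_l2Forms`). On such forms translations are unitary and Lie derivatives
skew-adjoint, so orthogonal complements of invariant spaces are invariant.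

Let `W` be an invariant subspace of the generated representation. If `Φ ∈ W`, then `W` is
everything. If `W` is orthogonal to `Φ`, it is orthogonal to all that `Φ` generates, hence zero. It
remains to exclude other cases (`petersson_eq_zero_of_not_mem`). A given `w ∈ W` involves only
finitely many finite places. Averaging it over `K_v` at those places keeps it in `W`, changes `⟨Φ,
w⟩` by a nonzero factor, and moves it into `archPart`, because the Hecke eigenvector property makes
the average of `R(g)f` over `K_v` a multiple of `f` (`exists_mem_inf_of_placeSpan`).

Inside `archPart` the only copy of `τ` is `τ` itself: a `K'₀`-homomorphism from `τ` to `M` lifts to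
`𝒰(𝔤'_ℂ) ⊗ τ` by averaging over the compact group `K'₀`, hence defines an element of `Hom(τ, L_τ)`
and is a scalar. For a translate by `σ ∉ K'₀` the lift lands in a twist of `L_τ` that shares no type
with `L_τ`, so it vanishes (`exists_lift`, `hom_eq_smul`, `twisted_hom_eq_zero`). Orthogonal
projections onto finite-dimensional orbit spans then show that a `K'₀`-stable subspace of `archPart`
contains `τ` or is orthogonal to it (`Representation.le_or_inner_eq_zero`). -/

noncomputable section

attribute [local instance 100] LieRing.ofAssociativeRing LieAlgebra.ofAssociativeAlgebra

/-! ### Lie derivatives of functions smooth in the archimedean variable. -/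

section SmoothFunctions

open scoped Classical

variable {F : Type u} [Field F] [NumberField F] {n : ℕ} {G : LinearAlgebraicGroup F n}

attribute [local instance] Matrix.linftyOpNormedRing Matrix.linftyOpNormedAlgebra in
theorem isEmbedding_archMatrix : IsEmbedding (archMatrix (G := G)) := by
  have h1 : IsEmbedding (fun g : GL (Fin n) (ArchAdele F) =>
      (g : Matrix (Fin n) (Fin n) (ArchAdele F))) := Units.isOpenEmbedding_val.isEmbedding
  exact h1.comp IsEmbedding.subtypeVal

theorem continuous_archMatrix : Continuous (archMatrix (G := G)) :=
  isEmbedding_archMatrix.continuous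

attribute [local instance] Matrix.linftyOpNormedRing Matrix.linftyOpNormedAlgebra in
theorem hasDerivAt_matrix_exp (X : Matrix (Fin n) (Fin n) (ArchAdele F)) (t : ℝ) :
    HasDerivAt (fun t : ℝ => NormedSpace.exp (t • X)) (NormedSpace.exp (t • X) * X) t :=
  hasDerivAt_exp_smul_const X t

attribute [local instance] Matrix.linftyOpNormedRing Matrix.linftyOpNormedAlgebra in
theorem matrix_exp_add (X : Matrix (Fin n) (Fin n) (ArchAdele F)) (s t : ℝ) :
    NormedSpace.exp ((s + t) • X) = NormedSpace.exp (s • X) * NormedSpace.exp (t • X) := by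
  let _ : NormedAlgebra ℚ (Matrix (Fin n) (Fin n) (ArchAdele F)) :=
    NormedAlgebra.restrictScalars ℚ ℝ _
  rw [add_smul]
  exact NormedSpace.exp_add_of_commute (((Commute.refl X).smul_left s).smul_right t)

variable {H H₁ H₂ : ClosedSubgroup G.ArchPts}

theorem oneParam_eq {X : lieAlg H₁} {Y : lieAlg H₂}
    (h : (X : Matrix (Fin n) (Fin n) (ArchAdele F)) = Y) (t : ℝ) :
    oneParam X t = oneParam Y t :=
  archMatrix_injective (by rw [archMatrix_oneParam, archMatrix_oneParam, h])

theorem oneParam_zero (X : lieAlg H) : oneParam X 0 = 1 :=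
  archMatrix_injective (by
    rw [archMatrix_oneParam, zero_smul, NormedSpace.exp_zero, archMatrix_one])

theorem oneParam_add (X : lieAlg H) (s t : ℝ) :
    oneParam X (s + t) = oneParam X s * oneParam X t :=
  archMatrix_injective (by
    rw [archMatrix_mul, archMatrix_oneParam, archMatrix_oneParam, archMatrix_oneParam,
      matrix_exp_add])

theorem oneParam_neg (X : lieAlg H) (t : ℝ) : oneParam X (-t) = (oneParam X t)⁻¹ :=
  eq_inv_of_mul_eq_one_left (by rw [← oneParam_add, neg_add_cancel, oneParam_zero])

theorem hasDerivAt_archMatrix_oneParam (X : lieAlg H) (t : ℝ) :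
    HasDerivAt (fun t => archMatrix (oneParam X t))
      (archMatrix (oneParam X t) * (X : Matrix (Fin n) (Fin n) (ArchAdele F))) t := by
  simp only [archMatrix_oneParam]
  exact hasDerivAt_matrix_exp _ t

attribute [local instance] Matrix.linftyOpNormedRing Matrix.linftyOpNormedAlgebra in
theorem continuous_oneParam (X : lieAlg H) : Continuous (oneParam X) := by
  rw [isEmbedding_archMatrix.continuous_iff]
  exact continuous_iff_continuousAt.mpr fun t =>
    (hasDerivAt_archMatrix_oneParam X t).continuousAt

attribute [local instance] Matrix.linftyOpNormedRing Matrix.linftyOpNormedAlgebra in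
theorem hasDerivAt_entries_mul_oneParam (g : G.ArchPts) (X : lieAlg H) (t : ℝ) :
    HasDerivAt (fun t => (fun i j => archMatrix (g * oneParam X t) i j :
        Fin n → Fin n → ArchAdele F))
      (fun i j => (archMatrix (g * oneParam X t) *
        (X : Matrix (Fin n) (Fin n) (ArchAdele F))) i j) t := by
  have h := (hasDerivAt_archMatrix_oneParam X t).const_mul (archMatrix g)
  rw [← mul_assoc, ← archMatrix_mul] at h
  simp only [← archMatrix_mul] at h
  exact h

/-- The derivative of `ψ` along the left-invariant vector field `M ↦ M X`. -/
def matrixLieDeriv (X : Matrix (Fin n) (Fin n) (ArchAdele F))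
    (ψ : (Fin n → Fin n → ArchAdele F) → ℂ) : (Fin n → Fin n → ArchAdele F) → ℂ :=
  fun M => fderiv ℝ ψ M (fun i j => ∑ k, M i k * X k j)

/-- Right multiplication by `X` as a continuous linear map. -/
def mulRightCLM (X : Matrix (Fin n) (Fin n) (ArchAdele F)) :
    (Fin n → Fin n → ArchAdele F) →L[ℝ] (Fin n → Fin n → ArchAdele F) :=
  LinearMap.toContinuousLinearMap
    { toFun := fun M i j => ∑ k, M i k * X k j
      map_add' := by intro M N; ext1 i; ext1 j; simp [add_mul, Finset.sum_add_distrib]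
      map_smul' := by intro c M; ext1 i; ext1 j; simp [Finset.smul_sum] }

theorem mulRightCLM_apply (X : Matrix (Fin n) (Fin n) (ArchAdele F))
    (M : Fin n → Fin n → ArchAdele F) :
    mulRightCLM X M = fun i j => ∑ k, M i k * X k j := rfl

theorem contDiff_matrixLieDeriv (X : Matrix (Fin n) (Fin n) (ArchAdele F))
    {ψ : (Fin n → Fin n → ArchAdele F) → ℂ} (hψ : ContDiff ℝ ∞ ψ) :
    ContDiff ℝ ∞ (matrixLieDeriv X ψ) := by
  have h1 : ContDiff ℝ ∞ (fderiv ℝ ψ) := hψ.fderiv_right (by simp)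
  exact h1.clm_apply (mulRightCLM X).contDiff

/-- Functions on `G(𝔸)` that are `C^∞` in the archimedean variable. -/
def smoothFunctions (G : LinearAlgebraicGroup F n) : Submodule ℂ (G.Adelic → ℂ) where
  carrier := {f | ∀ h : G.Adelic, IsSmoothArch (fun g : G.ArchPts => f ((g, 1) * h))}
  add_mem' := by
    intro f₁ f₂ h₁ h₂ h g₀
    obtain ⟨ψ₁, hψ₁, e₁⟩ := h₁ h g₀
    obtain ⟨ψ₂, hψ₂, e₂⟩ := h₂ h g₀
    refine ⟨ψ₁ + ψ₂, hψ₁.add hψ₂, ?_⟩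
    filter_upwards [e₁, e₂] with g a b
    simp only [Pi.add_apply, a, b]
  zero_mem' := fun h g₀ => ⟨0, contDiff_const, by simp⟩
  smul_mem' := by
    intro c f hf h g₀
    obtain ⟨ψ, hψ, e⟩ := hf h g₀
    refine ⟨c • ψ, hψ.const_smul c, ?_⟩
    filter_upwards [e] with g a
    simp only [Pi.smul_apply, a]

/-- The local form of a smooth function. -/
theorem smoothFunctions.exists_local {f : G.Adelic → ℂ} (hf : f ∈ smoothFunctions G)
    (x : G.Adelic) : ∃ ψ : (Fin n → Fin n → ArchAdele F) → ℂ, ContDiff ℝ ∞ ψ ∧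
      ∀ᶠ g in 𝓝 x.1, f (g, x.2) = ψ (fun i j => archMatrix g i j) := by
  obtain ⟨ψ, hψ, e⟩ := hf (1, x.2) x.1
  refine ⟨ψ, hψ, ?_⟩
  filter_upwards [e] with g hg
  simpa using hg

/-- Right multiplication by `h.1` is the restriction of a linear map of matrices, so only
translations in the finite variable need to be tested, and the local model can be chosen around the
point itself. -/
theorem mem_smoothFunctions_iff {f : G.Adelic → ℂ} : f ∈ smoothFunctions G ↔
    ∀ x : G.Adelic, ∃ ψ : (Fin n → Fin n → ArchAdele F) → ℂ, ContDiff ℝ ∞ ψ ∧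
      ∀ᶠ g in 𝓝 x.1, f (g, x.2) = ψ (fun i j => archMatrix g i j) := by
  refine ⟨fun hf x => smoothFunctions.exists_local hf x, fun H h g₀ => ?_⟩
  obtain ⟨ψ, hψ, e⟩ := H (g₀ * h.1, h.2)
  refine ⟨fun M => ψ (mulRightCLM (archMatrix h.1) M), hψ.comp (mulRightCLM (archMatrix h.1)).contDiff, ?_⟩
  have hc : Tendsto (fun g : G.ArchPts => g * h.1) (𝓝 g₀) (𝓝 (g₀ * h.1)) :=
    (continuous_mul_const h.1).tendsto g₀
  filter_upwards [hc.eventually e] with g hg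
  have : ((g, 1) * h : G.Adelic) = (g * h.1, h.2) := by ext1 <;> simp
  rw [this, hg]
  rfl

theorem tendsto_mul_oneParam (g : G.ArchPts) (X : lieAlg H) (t : ℝ) :
    Tendsto (fun t => g * oneParam X t) (𝓝 t) (𝓝 (g * oneParam X t)) :=
  ((continuous_oneParam X).const_mul g).tendsto t

theorem hasDerivAt_of_local {φ : G.ArchPts → ℂ} {ψ : (Fin n → Fin n → ArchAdele F) → ℂ}
    (hψ : ContDiff ℝ ∞ ψ) (g : G.ArchPts) (X : lieAlg H) (t : ℝ)
    (h : ∀ᶠ g' in 𝓝 (g * oneParam X t), φ g' = ψ (fun i j => archMatrix g' i j)) :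
    HasDerivAt (fun t => φ (g * oneParam X t))
      (matrixLieDeriv X ψ (fun i j => archMatrix (g * oneParam X t) i j)) t := by
  have h1 : HasFDerivAt ψ (fderiv ℝ ψ (fun i j => archMatrix (g * oneParam X t) i j))
      (fun i j => archMatrix (g * oneParam X t) i j) :=
    (hψ.differentiable (by simp)).differentiableAt.hasFDerivAt
  have h2 := h1.comp_hasDerivAt t (hasDerivAt_entries_mul_oneParam g X t)
  exact h2.congr_of_eventuallyEq ((tendsto_mul_oneParam g X t).eventually h)

theorem smoothFunctions.lieDeriv_eq {f : G.Adelic → ℂ} (X : lieAlg H) (x : G.Adelic)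
    {ψ : (Fin n → Fin n → ArchAdele F) → ℂ} (hψ : ContDiff ℝ ∞ ψ)
    (h : ∀ᶠ g in 𝓝 x.1, f (g, x.2) = ψ (fun i j => archMatrix g i j)) :
    ∀ᶠ g in 𝓝 x.1, lieDeriv X f (g, x.2) = matrixLieDeriv X ψ (fun i j => archMatrix g i j) := by
  filter_upwards [h.eventually_nhds] with g hg
  have := hasDerivAt_of_local (φ := fun g => f (g, x.2)) hψ g X 0
    (by rw [oneParam_zero, mul_one]; exact hg)
  rw [oneParam_zero, mul_one] at this
  rw [← this.deriv]
  simp only [lieDeriv, Prod.mk_mul_mk, mul_one]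

theorem smoothFunctions.lieDeriv_mem {f : G.Adelic → ℂ} (hf : f ∈ smoothFunctions G)
    (X : lieAlg H) : lieDeriv X f ∈ smoothFunctions G := by
  rw [mem_smoothFunctions_iff]
  intro x
  obtain ⟨ψ, hψ, e⟩ := smoothFunctions.exists_local hf x
  exact ⟨_, contDiff_matrixLieDeriv X hψ, smoothFunctions.lieDeriv_eq X x hψ e⟩

theorem smoothFunctions.hasDerivAt {f : G.Adelic → ℂ} (hf : f ∈ smoothFunctions G)
    (X : lieAlg H) (x : G.Adelic) (t : ℝ) :
    HasDerivAt (fun t => f (x * (oneParam X t, 1))) (lieDeriv X f (x * (oneParam X t, 1))) t := by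
  obtain ⟨ψ, hψ, e⟩ := smoothFunctions.exists_local hf (x * (oneParam X t, 1))
  have h1 := (smoothFunctions.lieDeriv_eq X _ hψ e).self_of_nhds
  have h2 := hasDerivAt_of_local (φ := fun g => f (g, x.2)) hψ x.1 X t
    (by simpa using e)
  have e1 : ∀ t, x * (oneParam X t, (1 : G.FinPts)) = (x.1 * oneParam X t, x.2) := fun t => by
    ext1 <;> simp
  simp only [e1] at h1 ⊢
  rw [h1]
  exact h2

theorem smoothFunctions.hasDerivAt_zero {f : G.Adelic → ℂ} (hf : f ∈ smoothFunctions G)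
    (X : lieAlg H) (x : G.Adelic) :
    HasDerivAt (fun t => f (x * (oneParam X t, 1))) (lieDeriv X f x) 0 := by
  have h := smoothFunctions.hasDerivAt hf X x 0
  have e : x * ((oneParam X 0, 1) : G.Adelic) = x := by rw [oneParam_zero]; exact mul_one x
  rwa [e] at h

theorem lieDeriv_congr {X : lieAlg H₁} {Y : lieAlg H₂}
    (h : (X : Matrix (Fin n) (Fin n) (ArchAdele F)) = Y) (f : G.Adelic → ℂ) :
    lieDeriv X f = lieDeriv Y f := by
  funext x
  simp only [lieDeriv, oneParam_eq h]

theorem smoothFunctions.lieDeriv_add {f₁ f₂ : G.Adelic → ℂ} (h₁ : f₁ ∈ smoothFunctions G)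
    (h₂ : f₂ ∈ smoothFunctions G) (X : lieAlg H) :
    lieDeriv X (f₁ + f₂) = lieDeriv X f₁ + lieDeriv X f₂ := by
  funext x
  exact ((smoothFunctions.hasDerivAt_zero h₁ X x).add (smoothFunctions.hasDerivAt_zero h₂ X x)).deriv

theorem lieDeriv_smul (c : ℂ) (f : G.Adelic → ℂ) (X : lieAlg H) :
    lieDeriv X (c • f) = c • lieDeriv X f := by
  funext x
  simp [lieDeriv]

theorem smoothFunctions.add_lieDeriv {f : G.Adelic → ℂ} (hf : f ∈ smoothFunctions G)
    (X Y : lieAlg H) : lieDeriv (X + Y) f = lieDeriv X f + lieDeriv Y f := by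
  funext x
  obtain ⟨ψ, hψ, e⟩ := smoothFunctions.exists_local hf x
  have h := fun X : lieAlg H => (smoothFunctions.lieDeriv_eq X _ hψ e).self_of_nhds
  change lieDeriv (X + Y) f (x.1, x.2) = lieDeriv X f (x.1, x.2) + lieDeriv Y f (x.1, x.2)
  rw [h, h, h]
  simp only [matrixLieDeriv]
  rw [← map_add]
  congr 1
  ext1 i; ext1 j
  simp [mul_add, Finset.sum_add_distrib]

theorem smoothFunctions.smul_lieDeriv {f : G.Adelic → ℂ} (hf : f ∈ smoothFunctions G)
    (c : ℝ) (X : lieAlg H) : lieDeriv (c • X) f = (c : ℂ) • lieDeriv X f := by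
  funext x
  obtain ⟨ψ, hψ, e⟩ := smoothFunctions.exists_local hf x
  have h := fun X : lieAlg H => (smoothFunctions.lieDeriv_eq X _ hψ e).self_of_nhds
  change lieDeriv (c • X) f (x.1, x.2) = (c : ℂ) • lieDeriv X f (x.1, x.2)
  rw [h, h]
  simp only [matrixLieDeriv]
  rw [Complex.coe_smul, ← map_smul]
  congr 1
  ext1 i; ext1 j
  simp [Finset.smul_sum]

/-- The second-order terms cancel by symmetry of the second derivative; what remains is the
derivative of `ψ` along the commutator of the linear vector fields `M ↦ MX` and `M ↦ MY`. -/
theorem matrixLieDeriv_bracket (X Y : Matrix (Fin n) (Fin n) (ArchAdele F))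
    {ψ : (Fin n → Fin n → ArchAdele F) → ℂ} (hψ : ContDiff ℝ ∞ ψ)
    (M : Fin n → Fin n → ArchAdele F) :
    matrixLieDeriv (X * Y - Y * X) ψ M =
      matrixLieDeriv X (matrixLieDeriv Y ψ) M - matrixLieDeriv Y (matrixLieDeriv X ψ) M := by
  have h1 : ContDiff ℝ ∞ (fderiv ℝ ψ) := hψ.fderiv_right (by simp)
  have key : ∀ X Y : Matrix (Fin n) (Fin n) (ArchAdele F),
      matrixLieDeriv X (matrixLieDeriv Y ψ) M =
        fderiv ℝ (fderiv ℝ ψ) M (mulRightCLM X M) (mulRightCLM Y M) +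
          fderiv ℝ ψ M (mulRightCLM Y (mulRightCLM X M)) := by
    intro X Y
    have h2 : HasFDerivAt (fderiv ℝ ψ) (fderiv ℝ (fderiv ℝ ψ) M) M :=
      (h1.differentiable (by simp)).differentiableAt.hasFDerivAt
    have h3 : HasFDerivAt (matrixLieDeriv Y ψ) _ M := h2.clm_apply (mulRightCLM Y).hasFDerivAt
    change fderiv ℝ (matrixLieDeriv Y ψ) M (mulRightCLM X M) = _
    rw [h3.fderiv]
    simp only [mulRightCLM_apply, add_apply, ContinuousLinearMap.comp_apply,
      ContinuousLinearMap.flip_apply, add_comm]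
  have hsymm : IsSymmSndFDerivAt ℝ ψ M :=
    hψ.contDiffAt.isSymmSndFDerivAt (by simpa using WithTop.coe_le_coe.mpr (le_top : (2 : ℕ∞) ≤ ⊤))
  rw [key, key, hsymm.eq (mulRightCLM X M) (mulRightCLM Y M)]
  rw [add_sub_add_left_eq_sub, ← map_sub]
  change fderiv ℝ ψ M (mulRightCLM _ M) = _
  congr 1
  have e : ∀ X Y : Matrix (Fin n) (Fin n) (ArchAdele F),
      mulRightCLM Y (mulRightCLM X M) = ((Matrix.of M) * (X * Y) : Matrix _ _ _) := by
    intro X Y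
    rw [← Matrix.mul_assoc]
    rfl
  rw [e, e]
  change ((Matrix.of M) * (X * Y - Y * X) : Matrix _ _ _) = _
  rw [mul_sub]
  rfl

theorem smoothFunctions.lieDeriv_bracket {f : G.Adelic → ℂ} (hf : f ∈ smoothFunctions G)
    (X Y : lieAlg H) :
    lieDeriv ⁅X, Y⁆ f = lieDeriv X (lieDeriv Y f) - lieDeriv Y (lieDeriv X f) := by
  funext x
  obtain ⟨ψ, hψ, e⟩ := smoothFunctions.exists_local hf x
  have h := fun X : lieAlg H => (smoothFunctions.lieDeriv_eq X _ hψ e)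
  have h' := fun X Y : lieAlg H => (smoothFunctions.lieDeriv_eq Y _
    (contDiff_matrixLieDeriv X hψ) (h X)).self_of_nhds
  change lieDeriv ⁅X, Y⁆ f (x.1, x.2) = lieDeriv X (lieDeriv Y f) (x.1, x.2) -
    lieDeriv Y (lieDeriv X f) (x.1, x.2)
  rw [h', h', (h _).self_of_nhds, LieSubalgebra.coe_bracket, Ring.lie_def,
    matrixLieDeriv_bracket _ _ hψ]

theorem rightTranslation_apply (x : G.Adelic) (f : G.Adelic → ℂ) (g : G.Adelic) :
    rightTranslation G x f g = f (g * x) := rfl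

theorem smoothFunctions.rightTranslation_mem {f : G.Adelic → ℂ} (hf : f ∈ smoothFunctions G)
    (x : G.Adelic) : rightTranslation G x f ∈ smoothFunctions G := by
  intro h
  simp only [rightTranslation_apply, mul_assoc]
  exact hf (h * x)

theorem lieDeriv_rightTranslation_fin (X : lieAlg H) (h : G.FinPts) (f : G.Adelic → ℂ) :
    lieDeriv X (rightTranslation G (1, h) f) = rightTranslation G (1, h) (lieDeriv X f) := by
  funext x
  simp only [lieDeriv, rightTranslation_apply]
  congr 1
  funext t
  congr 1
  rw [mul_assoc, mul_assoc]
  congr 1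
  ext1 <;> simp

attribute [local instance] Matrix.linftyOpNormedRing Matrix.linftyOpNormedAlgebra in
theorem oneParam_conj {X : lieAlg H₁} {Y : lieAlg H₂} (σ : G.ArchPts)
    (h : (Y : Matrix (Fin n) (Fin n) (ArchAdele F)) = archMatrix σ * X * archMatrix σ⁻¹) (t : ℝ) :
    oneParam Y t = σ * oneParam X t * σ⁻¹ := by
  apply archMatrix_injective
  rw [archMatrix_mul, archMatrix_mul, archMatrix_oneParam, archMatrix_oneParam, h]
  let _ : NormedAlgebra ℚ (Matrix (Fin n) (Fin n) (ArchAdele F)) :=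
    NormedAlgebra.restrictScalars ℚ ℝ _
  have e := NormedSpace.exp_units_conj (σ : GL (Fin n) (ArchAdele F))
    (t • (X : Matrix (Fin n) (Fin n) (ArchAdele F)))
  have e2 : t • (archMatrix σ * X * archMatrix σ⁻¹) =
      archMatrix σ * (t • (X : Matrix (Fin n) (Fin n) (ArchAdele F))) * archMatrix σ⁻¹ := by
    rw [mul_smul_comm, smul_mul_assoc]
  rw [e2]
  exact e

/-- This is what makes the translate by `σ` of a space stable under `𝔤'` stable under `𝔤'` again,
for `σ ∈ K'`. -/
theorem rightTranslation_lieDeriv {X : lieAlg H₁} {Y : lieAlg H₂} (σ : G.ArchPts)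
    (h : (Y : Matrix (Fin n) (Fin n) (ArchAdele F)) = archMatrix σ * X * archMatrix σ⁻¹)
    (f : G.Adelic → ℂ) :
    rightTranslation G (σ, 1) (lieDeriv X f) = lieDeriv Y (rightTranslation G (σ, 1) f) := by
  funext x
  simp only [lieDeriv, rightTranslation_apply, oneParam_conj σ h]
  congr 1
  funext t
  congr 1
  rw [mul_assoc, mul_assoc]
  congr 1
  ext1 <;> simp [mul_assoc]

/-- The action of the real Lie algebra of `H` on smooth functions. -/
def smoothLieHom (H : ClosedSubgroup G.ArchPts) :
    lieAlg H →ₗ⁅ℝ⁆ Module.End ℂ (smoothFunctions G) where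
  toFun X :=
    { toFun := fun f => ⟨lieDeriv X f, smoothFunctions.lieDeriv_mem f.2 X⟩
      map_add' := fun f₁ f₂ => Subtype.ext (smoothFunctions.lieDeriv_add f₁.2 f₂.2 X)
      map_smul' := fun c f => Subtype.ext (lieDeriv_smul c f X) }
  map_add' X Y := by
    ext1 f
    exact Subtype.ext (smoothFunctions.add_lieDeriv f.2 X Y)
  map_smul' c X := by
    ext1 f
    exact Subtype.ext (smoothFunctions.smul_lieDeriv f.2 c X)
  map_lie' := by
    intro X Y
    ext1 f
    exact Subtype.ext (smoothFunctions.lieDeriv_bracket f.2 X Y)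

theorem smoothLieHom_apply (X : lieAlg H) (f : smoothFunctions G) :
    (smoothLieHom H X f : G.Adelic → ℂ) = lieDeriv X f := rfl

end SmoothFunctions

/-! ### Automorphic forms with a fixed central character form an invariant space. -/

section AutomorphicForms

open scoped Classical

/-- A translate `R(h)f` is fixed by `hKh⁻¹` when `f` is fixed by `K`. -/
theorem exists_isOpen_isCompact_conj {A : Type*} [Group A] [TopologicalSpace A]
    [IsTopologicalGroup A] {K : Subgroup A} (ho : IsOpen (K : Set A)) (hc : IsCompact (K : Set A))
    (h : A) : ∃ K' : Subgroup A, IsOpen (K' : Set A) ∧ IsCompact (K' : Set A) ∧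
      ∀ k ∈ K', ∃ k₁ ∈ K, k * h = h * k₁ := by
  refine ⟨K.comap (MulAut.conj h⁻¹).toMonoidHom, ?_, ?_, fun k hk => ?_⟩
  · exact ho.preimage (by
      change Continuous fun k => h⁻¹ * k * h⁻¹⁻¹
      fun_prop)
  · have e : ((K.comap (MulAut.conj h⁻¹).toMonoidHom : Subgroup A) : Set A) =
        (fun k => h * k * h⁻¹) '' K := by
      ext k
      constructor
      · intro hk
        exact ⟨h⁻¹ * k * h⁻¹⁻¹, hk, by group⟩
      · rintro ⟨k', hk', rfl⟩
        change h⁻¹ * (h * k' * h⁻¹) * h⁻¹⁻¹ ∈ K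
        have : h⁻¹ * (h * k' * h⁻¹) * h⁻¹⁻¹ = k' := by group
        rwa [this]
    rw [e]
    exact hc.image (by fun_prop)
  · exact ⟨h⁻¹ * k * h⁻¹⁻¹, hk, by group⟩

variable {F : Type u} [Field F] [NumberField F] {n : ℕ} {G : LinearAlgebraicGroup F n}
  {H : ClosedSubgroup G.ArchPts}

theorem rightTranslation_mul_apply (x y : G.Adelic) (f : G.Adelic → ℂ) :
    rightTranslation G (x * y) f = rightTranslation G x (rightTranslation G y f) := by
  rw [map_mul]; rfl

theorem rightTranslation_arch_fin_comm (k : G.ArchPts) (h : G.FinPts) (f : G.Adelic → ℂ) :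
    rightTranslation G (k, 1) (rightTranslation G (1, h) f) =
      rightTranslation G (1, h) (rightTranslation G (k, 1) f) := by
  rw [← rightTranslation_mul_apply, ← rightTranslation_mul_apply]
  simp

/-- The span of the right translates of `f` by elements of `C`. -/
def archSpan (C : Subgroup G.ArchPts) (f : G.Adelic → ℂ) : Submodule ℂ (G.Adelic → ℂ) :=
  Submodule.span ℂ {f' | ∃ k ∈ C, f' = rightTranslation G (k, 1) f}

theorem rightTranslation_mem_archSpan {C : Subgroup G.ArchPts} (f : G.Adelic → ℂ)
    {k : G.ArchPts} (hk : k ∈ C) : rightTranslation G (k, 1) f ∈ archSpan C f :=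
  Submodule.subset_span ⟨k, hk, rfl⟩

theorem archSpan_le_iff {C : Subgroup G.ArchPts} {f : G.Adelic → ℂ}
    {E : Submodule ℂ (G.Adelic → ℂ)} :
    archSpan C f ≤ E ↔ ∀ k ∈ C, rightTranslation G (k, 1) f ∈ E := by
  rw [archSpan, Submodule.span_le]
  constructor
  · exact fun h k hk => h ⟨k, hk, rfl⟩
  · rintro h _ ⟨k, hk, rfl⟩; exact h k hk

theorem rightTranslation_mem_of_mem_archSpan {C : Subgroup G.ArchPts} {f f' : G.Adelic → ℂ}
    {k : G.ArchPts} (hk : k ∈ C) (hf' : f' ∈ archSpan C f) :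
    rightTranslation G (k, 1) f' ∈ archSpan C f := by
  induction hf' using Submodule.span_induction with
  | mem x hx =>
    obtain ⟨k', hk', rfl⟩ := hx
    refine Submodule.subset_span ⟨k * k', mul_mem hk hk', ?_⟩
    rw [← rightTranslation_mul_apply]
    simp
  | zero => rw [map_zero]; exact zero_mem _
  | add x y _ _ hx hy => rw [map_add]; exact add_mem hx hy
  | smul c x _ hx => rw [map_smul]; exact Submodule.smul_mem _ _ hx

theorem archSpan_le_smoothFunctions {C : Subgroup G.ArchPts} {f : G.Adelic → ℂ}
    (hf : f ∈ smoothFunctions G) : archSpan C f ≤ smoothFunctions G :=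
  archSpan_le_iff.mpr fun _ _ => smoothFunctions.rightTranslation_mem hf _

instance (H : ClosedSubgroup G.ArchPts) : FiniteDimensional ℝ (lieAlg H) :=
  inferInstanceAs (FiniteDimensional ℝ (lieAlg H).toSubmodule)

/-- A space of smooth functions spanned by finitely many Lie derivatives of a finite-dimensional
space is finite-dimensional. -/
theorem finiteDimensional_lieDeriv_span (H : ClosedSubgroup G.ArchPts)
    {E : Submodule ℂ (G.Adelic → ℂ)} [FiniteDimensional ℂ E] (hE : E ≤ smoothFunctions G) :
    ∃ E' : Submodule ℂ (G.Adelic → ℂ), FiniteDimensional ℂ E' ∧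
      ∀ X : lieAlg H, ∀ f ∈ E, lieDeriv X f ∈ E' := by
  let b := Module.finBasis ℝ (lieAlg H)
  let L := fun i => ((smoothFunctions G).subtype ∘ₗ (smoothLieHom H (b i))) ∘ₗ
    (Submodule.inclusion hE)
  refine ⟨⨆ i, LinearMap.range (L i), inferInstance, fun X f hf => ?_⟩
  have hX : smoothLieHom H X ⟨f, hE hf⟩ =
      ∑ i, (b.repr X i) • smoothLieHom H (b i) ⟨f, hE hf⟩ := by
    conv_lhs => rw [← b.sum_repr X]
    rw [map_sum]
    simp only [LinearMap.sum_apply, map_smul, LinearMap.smul_apply]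
  rw [← smoothLieHom_apply X ⟨f, hE hf⟩, hX, ← Submodule.subtype_apply, map_sum]
  refine Submodule.sum_mem _ fun i _ => ?_
  refine (Submodule.mem_iSup_of_mem i ?_)
  refine ⟨((b.repr X i : ℝ) : ℂ) • ⟨f, hf⟩, ?_⟩
  rw [map_smul]
  rfl

/-- Automorphic forms with central character `χ`. -/
structure IsAutomorphicFormWith (Kinf : Subgroup G.ArchPts) (χ : G.adelicCenter →* Circle)
    (f : G.Adelic → ℂ) : Prop where
  right_invariant : ∃ Kf : Subgroup G.FinPts, IsOpen (Kf : Set G.FinPts) ∧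
    IsCompact (Kf : Set G.FinPts) ∧ ∀ k ∈ Kf, rightTranslation G (1, k) f = f
  smooth : f ∈ smoothFunctions G
  finite : FiniteDimensional ℂ (archSpan Kinf f)
  left_invariant : ∀ (γ : G.points F) (g : G.Adelic), f (G.diag γ * g) = f g
  central : ∀ (z : G.adelicCenter) (g : G.Adelic), f ((z : G.Adelic) * g) = (χ z : ℂ) * f g

theorem IsAutomorphicForm.exists_with {Kinf : Subgroup G.ArchPts} {f : G.Adelic → ℂ}
    (hf : IsAutomorphicForm Kinf f) : ∃ χ : G.adelicCenter →* Circle, Continuous χ ∧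
      IsAutomorphicFormWith Kinf χ f := by
  obtain ⟨χ, hχ, h⟩ := hf.central
  exact ⟨χ, hχ, hf.right_invariant, hf.smooth, hf.finite, hf.left_invariant, h⟩

theorem IsAutomorphicFormWith.isAutomorphicForm {Kinf : Subgroup G.ArchPts}
    {χ : G.adelicCenter →* Circle} (hχ : Continuous χ) {f : G.Adelic → ℂ}
    (hf : IsAutomorphicFormWith Kinf χ f) : IsAutomorphicForm Kinf f :=
  ⟨hf.right_invariant, hf.smooth, hf.finite, hf.left_invariant, χ, hχ, hf.central⟩

/-- The space of automorphic forms with central character `χ`, for a compact subgroup. -/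
def automorphicForms (Kinf : Subgroup G.ArchPts) (χ : G.adelicCenter →* Circle)
    (hne : ∃ Kf : Subgroup G.FinPts, IsOpen (Kf : Set G.FinPts) ∧ IsCompact (Kf : Set G.FinPts)) :
    Submodule ℂ (G.Adelic → ℂ) where
  carrier := {f | IsAutomorphicFormWith Kinf χ f}
  add_mem' := by
    intro f₁ f₂ h₁ h₂
    obtain ⟨K₁, o₁, c₁, i₁⟩ := h₁.right_invariant
    obtain ⟨K₂, o₂, c₂, i₂⟩ := h₂.right_invariant
    refine ⟨⟨K₁ ⊓ K₂, o₁.inter o₂, c₁.inter_right (K₂.isClosed_of_isOpen o₂), fun k hk => ?_⟩,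
      add_mem h₁.smooth h₂.smooth, ?_, fun γ g => ?_, fun z g => ?_⟩
    · rw [map_add, i₁ k hk.1, i₂ k hk.2]
    · have := h₁.finite
      have := h₂.finite
      have hle : archSpan Kinf (f₁ + f₂) ≤ archSpan Kinf f₁ ⊔ archSpan Kinf f₂ :=
        archSpan_le_iff.mpr fun k hk => by
          rw [map_add]
          exact Submodule.add_mem_sup (rightTranslation_mem_archSpan _ hk)
            (rightTranslation_mem_archSpan _ hk)
      exact Submodule.finiteDimensional_of_le hle
    · simp only [Pi.add_apply, h₁.left_invariant, h₂.left_invariant]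
    · simp only [Pi.add_apply, h₁.central, h₂.central, mul_add]
  -- Even the zero function must be fixed by an open compact subgroup, and `hne` supplies one.
  zero_mem' := by
    obtain ⟨Kf, o, c⟩ := hne
    refine ⟨⟨Kf, o, c, fun k _ => map_zero _⟩, zero_mem _, ?_, fun γ g => rfl, fun z g => by simp⟩
    have hle : archSpan Kinf (0 : G.Adelic → ℂ) ≤ ⊥ :=
      archSpan_le_iff.mpr fun k _ => by rw [map_zero]; exact zero_mem _
    exact Submodule.finiteDimensional_of_le hle
  smul_mem' := by
    intro c f hf
    obtain ⟨K₁, o₁, c₁, i₁⟩ := hf.right_invariant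
    refine ⟨⟨K₁, o₁, c₁, fun k hk => ?_⟩,
      Submodule.smul_mem _ _ hf.smooth, ?_, fun γ g => ?_, fun z g => ?_⟩
    · rw [map_smul, i₁ k hk]
    · have := hf.finite
      have hle : archSpan Kinf (c • f) ≤ archSpan Kinf f :=
        archSpan_le_iff.mpr fun k hk => by
          rw [map_smul]
          exact Submodule.smul_mem _ _ (rightTranslation_mem_archSpan _ hk)
      exact Submodule.finiteDimensional_of_le hle
    · simp only [Pi.smul_apply, hf.left_invariant]
    · simp only [Pi.smul_apply, hf.central, smul_eq_mul]; ring

theorem mem_automorphicForms {Kinf : Subgroup G.ArchPts} {χ : G.adelicCenter →* Circle}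
    {hne : ∃ Kf : Subgroup G.FinPts, IsOpen (Kf : Set G.FinPts) ∧ IsCompact (Kf : Set G.FinPts)}
    {f : G.Adelic → ℂ} : f ∈ automorphicForms Kinf χ hne ↔ IsAutomorphicFormWith Kinf χ f :=
  Iff.rfl

/-- An element of the Lie algebra of `H`, in the Lie algebra of `G(𝔸_∞)`. -/
def toFullArch (X : lieAlg H) : lieAlg (fullArch G) :=
  ⟨X, fun t => ⟨oneParam X t, trivial, archMatrix_oneParam X t⟩⟩

theorem lieDeriv_toFullArch (X : lieAlg H) (f : G.Adelic → ℂ) :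
    lieDeriv (toFullArch X) f = lieDeriv X f := 
  lieDeriv_congr (X := toFullArch X) (Y := X) rfl f

namespace IsAutomorphicFormWith

variable {Kinf : Subgroup G.ArchPts} {χ : G.adelicCenter →* Circle} {f : G.Adelic → ℂ}

theorem rightTranslation_fin (hf : IsAutomorphicFormWith Kinf χ f) (h : G.FinPts) :
    IsAutomorphicFormWith Kinf χ (rightTranslation G (1, h) f) := by
  obtain ⟨K₁, o₁, c₁, i₁⟩ := hf.right_invariant
  obtain ⟨K₂, o₂, c₂, i₂⟩ := exists_isOpen_isCompact_conj o₁ c₁ h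
  refine ⟨⟨K₂, o₂, c₂, fun k hk => ?_⟩,
    smoothFunctions.rightTranslation_mem hf.smooth _, ?_, fun γ g => ?_, fun z g => ?_⟩
  · obtain ⟨k₁, hk₁, e⟩ := i₂ k hk
    have e' : ((1, k) * (1, h) : G.Adelic) = (1, h) * (1, k₁) := by
      rw [Prod.mk_mul_mk, Prod.mk_mul_mk, e]
    rw [← rightTranslation_mul_apply, e', rightTranslation_mul_apply, i₁ _ hk₁]
  · have := hf.finite
    have hle : archSpan Kinf (rightTranslation G (1, h) f) ≤
        (archSpan Kinf f).map (rightTranslation G (1, h)) :=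
      archSpan_le_iff.mpr fun k hk => by
        rw [rightTranslation_arch_fin_comm]
        exact Submodule.mem_map_of_mem (rightTranslation_mem_archSpan _ hk)
    exact Submodule.finiteDimensional_of_le hle
  · simp only [rightTranslation_apply, mul_assoc, hf.left_invariant]
  · simp only [rightTranslation_apply, mul_assoc, hf.central]

theorem rightTranslation_arch (hf : IsAutomorphicFormWith Kinf χ f) {k : G.ArchPts}
    (hk : k ∈ Kinf) : IsAutomorphicFormWith Kinf χ (rightTranslation G (k, 1) f) := by
  obtain ⟨K₁, o₁, c₁, i₁⟩ := hf.right_invariant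
  refine ⟨⟨K₁, o₁, c₁, fun h hh => ?_⟩,
    smoothFunctions.rightTranslation_mem hf.smooth _, ?_, fun γ g => ?_, fun z g => ?_⟩
  · rw [← rightTranslation_arch_fin_comm, i₁ h hh]
  · have := hf.finite
    have hle : archSpan Kinf (rightTranslation G (k, 1) f) ≤ archSpan Kinf f :=
      archSpan_le_iff.mpr fun k' hk' =>
        rightTranslation_mem_of_mem_archSpan hk' (rightTranslation_mem_archSpan _ hk)
    exact Submodule.finiteDimensional_of_le hle
  · simp only [rightTranslation_apply, mul_assoc, hf.left_invariant]
  · simp only [rightTranslation_apply, mul_assoc, hf.central]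

/-- `K_∞`-finiteness is the point: `R(k)Xf` is the derivative of `R(k)f` in the direction `Ad(k)X`,
and all derivatives of the finite-dimensional space `archSpan Kinf f` lie in one finite-dimensional
space. -/
theorem lieDeriv (hf : IsAutomorphicFormWith Kinf χ f) (X : lieAlg H) :
    IsAutomorphicFormWith Kinf χ (lieDeriv X f) := by
  obtain ⟨K₁, o₁, c₁, i₁⟩ := hf.right_invariant
  refine ⟨⟨K₁, o₁, c₁, fun h hh => ?_⟩,
    smoothFunctions.lieDeriv_mem hf.smooth _, ?_, fun γ g => ?_, fun z g => ?_⟩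
  · rw [← lieDeriv_rightTranslation_fin, i₁ h hh]
  · have := hf.finite
    obtain ⟨E', hE', h⟩ := finiteDimensional_lieDeriv_span (fullArch G)
      (archSpan_le_smoothFunctions (C := Kinf) hf.smooth)
    have hle : archSpan Kinf (_root_.lieDeriv X f) ≤ E' :=
      archSpan_le_iff.mpr fun k hk => by
        let σ : fullArch G := ⟨k, trivial⟩
        have e := rightTranslation_lieDeriv (X := toFullArch X) (Y := Ad σ (toFullArch X)) k rfl f
        rw [lieDeriv_toFullArch] at e
        rw [e]
        exact h _ _ (rightTranslation_mem_archSpan _ hk)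
    exact Submodule.finiteDimensional_of_le hle
  · simp only [_root_.lieDeriv, mul_assoc, hf.left_invariant]
  · simp only [_root_.lieDeriv, mul_assoc, hf.central, deriv_const_mul_field]

/-- Smoothness controls only the archimedean variable; right invariance under an open subgroup of
`G(𝔸_f)` makes the local model at `(g₀, h₀)` valid for all `h` near `h₀` too. -/
theorem continuous (hf : IsAutomorphicFormWith Kinf χ f) : Continuous f := by
  obtain ⟨K₁, o₁, -, i₁⟩ := hf.right_invariant
  rw [continuous_iff_continuousAt]
  rintro ⟨g₀, h₀⟩
  obtain ⟨ψ, hψ, e⟩ := smoothFunctions.exists_local hf.smooth (g₀, h₀)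
  have hU : {h : G.FinPts | h₀⁻¹ * h ∈ K₁} ∈ 𝓝 h₀ := by
    refine (o₁.preimage (continuous_const_mul h₀⁻¹)).mem_nhds ?_
    simp [one_mem]
  have hev : ∀ᶠ x in 𝓝 ((g₀, h₀) : G.Adelic), ψ (fun i j => archMatrix x.1 i j) = f x := by
    rw [nhds_prod_eq]
    filter_upwards [prod_mem_prod e hU] with x hx
    have h2 : h₀⁻¹ * x.2 ∈ K₁ := hx.2
    have h1 : f (x.1, h₀) = ψ (fun i j => archMatrix x.1 i j) := hx.1
    have h3 := congrFun (i₁ _ h2) (x.1, h₀)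
    rw [rightTranslation_apply] at h3
    rw [← h1, ← h3]
    congr 1
    ext1 <;> simp
  refine ContinuousAt.congr ?_ hev
  have hc : Continuous fun x : G.Adelic => ψ (fun i j => archMatrix x.1 i j) :=
    hψ.continuous.comp (continuous_archMatrix.comp continuous_fst)
  exact hc.continuousAt

end IsAutomorphicFormWith

theorem automorphicForms_isInvariantSpace (Kinf : Subgroup G.ArchPts)
    (χ : G.adelicCenter →* Circle)
    (hne : ∃ Kf : Subgroup G.FinPts, IsOpen (Kf : Set G.FinPts) ∧ IsCompact (Kf : Set G.FinPts)) :
    IsInvariantSpace Kinf (automorphicForms Kinf χ hne) :=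
  ⟨fun h _ hf => IsAutomorphicFormWith.rightTranslation_fin hf h,
    fun _ hk _ hf => IsAutomorphicFormWith.rightTranslation_arch hf hk,
    fun X _ hf => IsAutomorphicFormWith.lieDeriv hf X⟩

theorem isInvariantSpace_generatedRep (Kinf : Subgroup G.ArchPts) (Φ : G.Adelic → ℂ) :
    IsInvariantSpace Kinf (generatedRep Kinf Φ) := by
  constructor
  · intro h f hf
    simp only [generatedRep, Submodule.mem_sInf] at hf ⊢
    exact fun W hW => hW.2.fin h f (hf W hW)
  · intro k hk f hf
    simp only [generatedRep, Submodule.mem_sInf] at hf ⊢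
    exact fun W hW => hW.2.cpt k hk f (hf W hW)
  · intro X f hf
    simp only [generatedRep, Submodule.mem_sInf] at hf ⊢
    exact fun W hW => hW.2.lie X f (hf W hW)

theorem mem_generatedRep_self (Kinf : Subgroup G.ArchPts) (Φ : G.Adelic → ℂ) :
    Φ ∈ generatedRep Kinf Φ := by
  simp only [generatedRep, Submodule.mem_sInf]
  exact fun W hW => hW.1

theorem generatedRep_le {Kinf : Subgroup G.ArchPts} {Φ : G.Adelic → ℂ}
    {W : Submodule ℂ (G.Adelic → ℂ)} (h : Φ ∈ W) (hW : IsInvariantSpace Kinf W) :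
    generatedRep Kinf Φ ≤ W := sInf_le ⟨h, hW⟩

/-- Forms with different central characters cannot be added; here all of them inherit the character
of `Φ`. -/
theorem isAutomorphicRep_generatedRep {Kinf : Subgroup G.ArchPts} {Φ : G.Adelic → ℂ}
    (hΦ : IsAutomorphicForm Kinf Φ) : IsAutomorphicRep Kinf (generatedRep Kinf Φ) := by
  obtain ⟨χ, hχ, h⟩ := hΦ.exists_with
  obtain ⟨Kf, o, c, -⟩ := h.right_invariant
  refine ⟨fun f hf => ?_, isInvariantSpace_generatedRep Kinf Φ⟩
  have hle := generatedRep_le (W := automorphicForms Kinf χ ⟨Kf, o, c⟩) h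
    (automorphicForms_isInvariantSpace Kinf χ _)
  exact (mem_automorphicForms.mp (hle hf)).isAutomorphicForm hχ

end AutomorphicForms

/-! ### Integration by parts along measure-preserving flows. -/

section FlowCutoffs

variable {Q ι : Type*} [TopologicalSpace Q]

/-- A continuous flow. -/
structure IsFlow (φ : ℝ → Q → Q) : Prop where
  zero : ∀ q, φ 0 q = q
  add : ∀ s t q, φ (s + t) q = φ s (φ t q)
  continuous : Continuous fun p : ℝ × Q => φ p.1 p.2

theorem IsFlow.neg_apply {φ : ℝ → Q → Q} (h : IsFlow φ) (t : ℝ) (q : Q) : φ (-t) (φ t q) = q := by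
  rw [← h.add, neg_add_cancel, h.zero]

theorem IsFlow.apply_neg {φ : ℝ → Q → Q} (h : IsFlow φ) (t : ℝ) (q : Q) : φ t (φ (-t) q) = q := by
  rw [← h.add, add_neg_cancel, h.zero]

theorem IsFlow.continuous_apply {φ : ℝ → Q → Q} (h : IsFlow φ) (t : ℝ) : Continuous (φ t) :=
  h.continuous.comp (Continuous.prodMk_right t)

/-- The time-`t` map of a flow as a homeomorphism. -/
def IsFlow.homeomorph {φ : ℝ → Q → Q} (h : IsFlow φ) (t : ℝ) : Q ≃ₜ Q where
  toFun := φ t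
  invFun := φ (-t)
  left_inv := h.neg_apply t
  right_inv := h.apply_neg t
  continuous_toFun := h.continuous_apply t
  continuous_invFun := h.continuous_apply (-t)

/-- Compactly supported cutoff functions which are `ε`-Lipschitz along the flows `φ i`. -/
structure IsCutoff (φ : ι → ℝ → Q → Q) (ε : ℝ) (η : Q → ℝ) : Prop where
  lsc : LowerSemicontinuous η
  nonneg : ∀ q, 0 ≤ η q
  le_one : ∀ q, η q ≤ 1
  support : ∃ S : Set Q, IsCompact S ∧ ∀ q, 0 < η q → q ∈ S
  lipschitz : ∀ i t q, |η (φ i t q) - η q| ≤ ε * |t|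

/-- `F'` is the derivative of `F` along the flow `φ`, and both are continuous. -/
structure IsFlowDeriv (φ : ℝ → Q → Q) (F F' : Q → ℂ) : Prop where
  continuous : Continuous F
  continuous_deriv : Continuous F'
  hasDerivAt : ∀ q t, HasDerivAt (fun t => F (φ t q)) (F' (φ t q)) t

variable [MeasurableSpace Q] [BorelSpace Q] {μ : Measure Q} [IsFiniteMeasureOnCompacts μ]
  {φ : ι → ℝ → Q → Q} {ε : ℝ} {η : Q → ℝ}

theorem integrable_of_bound_of_support {O S : Set Q} (hS : IsCompact S) (hO : O ⊆ S)
    (hOm : MeasurableSet O) {g : Q → ℂ} (hg : Measurable g) {B : ℝ} (hB : ∀ q ∈ O, ‖g q‖ ≤ B)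
    (h0 : ∀ q ∉ O, g q = 0) : Integrable g μ := by
  have hfin : μ O < ⊤ := (measure_mono hO).trans_lt hS.measure_lt_top
  have h1 : IntegrableOn g O μ :=
    Measure.integrableOn_of_bounded hfin.ne hg.aestronglyMeasurable
      ((ae_restrict_iff' hOm).mpr (Eventually.of_forall hB))
  exact h1.integrable_of_forall_notMem_eq_zero h0

theorem IsCutoff.measurable (h : IsCutoff φ ε η) : Measurable η := h.lsc.measurable

/-- A cutoff times a continuous function is integrable. -/
theorem IsCutoff.integrable_mul (h : IsCutoff φ ε η) {F : Q → ℂ} (hF : Continuous F) :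
    Integrable (fun q => (η q : ℂ) * F q) μ := by
  obtain ⟨S, hS, hηS⟩ := h.support
  obtain ⟨B, hB⟩ := hS.exists_bound_of_continuousOn hF.continuousOn
  have hO : IsOpen {q | 0 < η q} := h.lsc.isOpen_preimage 0
  refine integrable_of_bound_of_support (O := {q | 0 < η q}) hS hηS hO.measurableSet
    (B := max B 0) ?_ ?_ ?_
  · exact (Complex.measurable_ofReal.comp h.measurable).mul hF.measurable
  · intro q hq
    rw [norm_mul, Complex.norm_real, Real.norm_eq_abs, abs_of_nonneg (h.nonneg q)]
    calc η q * ‖F q‖ ≤ 1 * ‖F q‖ := by gcongr; exact h.le_one q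
      _ ≤ max B 0 := by rw [one_mul]; exact (hB q (hηS q hq)).trans (le_max_left _ _)
  · intro q hq
    have : η q = 0 := le_antisymm (not_lt.mp hq) (h.nonneg q)
    simp [this]

/-- Integration by parts against the square of a cutoff. -/
theorem IsCutoff.norm_integral_sq_mul_le (h : IsCutoff φ ε η) {i : ι} (hφ : IsFlow (φ i))
    (hμ : ∀ t, MeasurePreserving (φ i t) μ μ) {F F' : Q → ℂ} (hF : IsFlowDeriv (φ i) F F')
    (hε : 0 ≤ ε) :
    ‖∫ q, ((η q ^ 2 : ℝ) : ℂ) * F' q ∂μ‖ ≤ 2 * ε * ∫ q, η q * ‖F q‖ ∂μ := by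
  obtain ⟨S, hS, hηS⟩ := h.support
  have hIcc : IsCompact (Set.Icc (-1 : ℝ) 1) := isCompact_Icc
  let S' : Set Q := (fun p : ℝ × Q => φ i p.1 p.2) '' (Set.Icc (-1 : ℝ) 1 ×ˢ S)
  have hS' : IsCompact S' := (hIcc.prod hS).image hφ.continuous
  -- All integrands below vanish off `O`. It is open by lower semicontinuity, hence measurable,
  -- whereas the compact set `S'` containing it need not be, as no separation is assumed.
  let O : Set Q := ⋃ t : ℝ, ⋃ _ : t ∈ Set.Icc (-1 : ℝ) 1, {q | 0 < η (φ i t q)}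
  have hO : IsOpen O := isOpen_iUnion fun t => isOpen_iUnion fun _ =>
    (h.lsc.isOpen_preimage 0).preimage (hφ.continuous_apply t)
  have hOS : O ⊆ S' := by
    intro q hq
    simp only [O, Set.mem_iUnion] at hq
    obtain ⟨t, ht, hq⟩ := hq
    refine ⟨(-t, φ i t q), ⟨⟨by linarith [ht.2], by linarith [ht.1]⟩, hηS _ hq⟩,
      hφ.neg_apply t q⟩
  have hO0 : ∀ t ∈ Set.Icc (-1 : ℝ) 1, ∀ q ∉ O, η (φ i t q) = 0 := by
    intro t ht q hq
    refine le_antisymm (not_lt.mp fun hlt => hq ?_) (h.nonneg _)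
    exact Set.mem_iUnion₂.mpr ⟨t, ht, hlt⟩
  have h0mem : (0 : ℝ) ∈ Set.Icc (-1 : ℝ) 1 := by constructor <;> norm_num
  have hO00 : ∀ q ∉ O, η q = 0 := fun q hq => by
    have := hO0 0 h0mem q hq
    rwa [hφ.zero] at this
  obtain ⟨BF, hBF⟩ := hS'.exists_bound_of_continuousOn hF.continuous.continuousOn
  obtain ⟨B', hB'⟩ := hS'.exists_bound_of_continuousOn hF.continuous_deriv.continuousOn
  have hInt : ∀ t ∈ Set.Icc (-1 : ℝ) 1,
      Integrable (fun q => ((η (φ i t q) ^ 2 : ℝ) : ℂ) * F q) μ := by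
    intro t ht
    refine integrable_of_bound_of_support hS' hOS hO.measurableSet (B := max BF 0) ?_ ?_ ?_
    · exact (Complex.measurable_ofReal.comp
        ((h.measurable.comp (hφ.continuous_apply t).measurable).pow_const 2)).mul
          hF.continuous.measurable
    · intro q hq
      rw [norm_mul, Complex.norm_real, Real.norm_eq_abs, abs_of_nonneg (sq_nonneg _)]
      calc η (φ i t q) ^ 2 * ‖F q‖ ≤ 1 * ‖F q‖ := by
            gcongr; exact pow_le_one₀ (h.nonneg _) (h.le_one _)
        _ ≤ max BF 0 := by rw [one_mul]; exact (hBF q (hOS hq)).trans (le_max_left _ _)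
    · intro q hq
      simp [hO0 t ht q hq]
  have hFO : Integrable (O.indicator fun q => (‖F q‖ : ℝ)) μ := by
    have hc : Integrable (O.indicator fun q => ((‖F q‖ : ℝ) : ℂ)) μ := by
      refine integrable_of_bound_of_support hS' hOS hO.measurableSet (B := BF) ?_ ?_ ?_
      · exact (Complex.measurable_ofReal.comp hF.continuous.norm.measurable).indicator
          hO.measurableSet
      · intro q hq
        simpa [Set.indicator_of_mem hq] using hBF q (hOS hq)
      · intro q hq
        exact Set.indicator_of_notMem hq _
    have := hc.re
    refine this.congr (Eventually.of_forall fun q => ?_)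
    by_cases hq : q ∈ O <;> simp [hq]
  have hηF : Integrable (fun q => η q * ‖F q‖) μ := by
    have := (h.integrable_mul (μ := μ) (F := fun q => ((‖F q‖ : ℝ) : ℂ))
      (Complex.continuous_ofReal.comp hF.continuous.norm)).re
    refine this.congr (Eventually.of_forall fun q => ?_)
    simp [← Complex.ofReal_mul]
  let s : ℕ → ℝ := fun m => 1 / ((m : ℝ) + 1)
  have hs : Tendsto s atTop (𝓝 0) := tendsto_one_div_add_atTop_nhds_zero_nat
  have hs0 : ∀ m, 0 < s m := fun m => by positivity
  have hs1 : ∀ m, s m ≤ 1 := fun m => by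
    have : (0 : ℝ) ≤ m := Nat.cast_nonneg m
    exact (div_le_one (by positivity)).mpr (by linarith)
  -- Difference quotients of `F` with steps `s m → 0`. Invariance of the measure moves the flow from
  -- `F` onto `η²`.
  let D : ℕ → Q → ℂ := fun m q =>
    ((η q ^ 2 : ℝ) : ℂ) * ((s m : ℂ)⁻¹ * (F (φ i (s m) q) - F q))
  have hDint : ∀ m, ∫ q, D m q ∂μ =
      ∫ q, (s m : ℂ)⁻¹ * (((η (φ i (-s m) q) ^ 2 - η q ^ 2 : ℝ) : ℂ) * F q) ∂μ := by
    intro m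
    have hm : -s m ∈ Set.Icc (-1 : ℝ) 1 := ⟨by linarith [hs1 m], by linarith [hs0 m]⟩
    have hm0 : (0 : ℝ) ∈ Set.Icc (-1 : ℝ) 1 := h0mem
    have i1 := hInt _ hm
    have i2 := hInt _ hm0
    simp only [hφ.zero] at i2
    have e1 : ∫ q, ((η q ^ 2 : ℝ) : ℂ) * F (φ i (s m) q) ∂μ =
        ∫ q, ((η (φ i (-s m) q) ^ 2 : ℝ) : ℂ) * F q ∂μ := by
      have e := (hμ (s m)).integral_comp (hφ.homeomorph (s m)).measurableEmbedding
        (fun q => ((η (φ i (-s m) q) ^ 2 : ℝ) : ℂ) * F q)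
      simp only [hφ.neg_apply] at e
      exact e
    have i3 : Integrable (fun q => ((η q ^ 2 : ℝ) : ℂ) * F (φ i (s m) q)) μ := by
      have := (hμ (s m)).integrable_comp_of_integrable i1
      refine this.congr (Eventually.of_forall fun q => ?_)
      change ((η (φ i (-s m) (φ i (s m) q)) ^ 2 : ℝ) : ℂ) * F (φ i (s m) q) = _
      rw [hφ.neg_apply]
    calc ∫ q, D m q ∂μ = ∫ q, (s m : ℂ)⁻¹ * (((η q ^ 2 : ℝ) : ℂ) * F (φ i (s m) q) -
          ((η q ^ 2 : ℝ) : ℂ) * F q) ∂μ := by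
          congr 1; funext q; simp only [D]; ring
      _ = (s m : ℂ)⁻¹ * (∫ q, ((η (φ i (-s m) q) ^ 2 : ℝ) : ℂ) * F q ∂μ -
          ∫ q, ((η q ^ 2 : ℝ) : ℂ) * F q ∂μ) := by
          rw [integral_const_mul, integral_sub i3 i2, e1]
      _ = _ := by
          rw [integral_const_mul, ← integral_sub i1 i2]
          congr 2; funext q; push_cast; ring
  have hbound : ∀ m, ‖∫ q, D m q ∂μ‖ ≤
      2 * ε * (∫ q, η q * ‖F q‖ ∂μ) + s m * (ε ^ 2 * ∫ q, O.indicator (fun q => ‖F q‖) q ∂μ) := by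
    intro m
    rw [hDint m]
    have hm : -s m ∈ Set.Icc (-1 : ℝ) 1 := ⟨by linarith [hs1 m], by linarith [hs0 m]⟩
    calc ‖∫ q, (s m : ℂ)⁻¹ * (((η (φ i (-s m) q) ^ 2 - η q ^ 2 : ℝ) : ℂ) * F q) ∂μ‖
        ≤ ∫ q, (2 * ε * (η q * ‖F q‖) + (s m * ε ^ 2) * O.indicator (fun q => ‖F q‖) q) ∂μ := by
          refine norm_integral_le_of_norm_le ((hηF.const_mul _).add (hFO.const_mul _))
            (Eventually.of_forall fun q => ?_)
          by_cases hq : q ∈ O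
          · rw [Set.indicator_of_mem hq, norm_mul, norm_mul, norm_inv, Complex.norm_real,
              Complex.norm_real, Real.norm_eq_abs, Real.norm_eq_abs, abs_of_pos (hs0 m)]
            have hl := h.lipschitz i (-s m) q
            rw [abs_neg, abs_of_pos (hs0 m)] at hl
            -- From `a² - b² = (a - b)(2b + (a - b))`: after division by `s m`, the main term is
            -- linear in `η` and the error is `O(s m)` on `O`.
            have h2 : |η (φ i (-s m) q) ^ 2 - η q ^ 2| ≤ ε * s m * (2 * η q + ε * s m) := by
              have e : η (φ i (-s m) q) ^ 2 - η q ^ 2 =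
                (η (φ i (-s m) q) - η q) * (2 * η q + (η (φ i (-s m) q) - η q)) := by ring
              rw [e, abs_mul]
              have := h.nonneg q
              gcongr
              refine (abs_add_le _ _).trans ?_
              rw [abs_of_nonneg (by positivity)]
              exact add_le_add le_rfl hl
            calc (s m)⁻¹ * (|η (φ i (-s m) q) ^ 2 - η q ^ 2| * ‖F q‖)
                ≤ (s m)⁻¹ * ((ε * s m * (2 * η q + ε * s m)) * ‖F q‖) := by
                  have := (hs0 m).le
                  gcongr
              _ = _ := by
                  have := (hs0 m).ne'
                  field_simp
          · have := hO0 _ hm q hq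
            have h3 := hO00 q hq
            simp [this, h3, hq]
      _ = _ := by
          rw [integral_add (hηF.const_mul _) (hFO.const_mul _), integral_const_mul,
            integral_const_mul]
          ring
  have hlim : Tendsto (fun m => ∫ q, D m q ∂μ) atTop
      (𝓝 (∫ q, ((η q ^ 2 : ℝ) : ℂ) * F' q ∂μ)) := by
    have hbd : Integrable (O.indicator fun _ => (max B' 0 : ℝ)) μ :=
      (integrable_indicator_iff hO.measurableSet).mpr
        (integrableOn_const ((measure_mono hOS).trans_lt hS'.measure_lt_top).ne)
    refine tendsto_integral_of_dominated_convergence _ (fun m => ?_) hbd (fun m => ?_) ?_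
    · refine Measurable.aestronglyMeasurable ?_
      exact (Complex.measurable_ofReal.comp (h.measurable.pow_const 2)).mul
        (((hF.continuous.comp (hφ.continuous_apply _)).sub hF.continuous).measurable.const_mul _)
    · refine Eventually.of_forall fun q => ?_
      by_cases hq : 0 < η q
      · have hqO : q ∈ O := Set.mem_iUnion₂.mpr ⟨0, h0mem, by simpa [hφ.zero] using hq⟩
        rw [Set.indicator_of_mem hqO, norm_mul, norm_mul, norm_inv, Complex.norm_real,
          Complex.norm_real, Real.norm_eq_abs, Real.norm_eq_abs, abs_of_pos (hs0 m),
          abs_of_nonneg (sq_nonneg _)]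
        -- The mean value inequality along the flow, which stays in `S'`, dominates the difference
        -- quotients uniformly.
        have hmv : ‖F (φ i (s m) q) - F (φ i 0 q)‖ ≤ B' * (s m - 0) := by
          refine norm_image_sub_le_of_norm_deriv_le_segment' (f := fun t => F (φ i t q))
            (fun t _ => (hF.hasDerivAt q t).hasDerivWithinAt) (fun t ht => ?_) (s m)
            ⟨(hs0 m).le, le_rfl⟩
          exact hB' _ ⟨(t, q), ⟨⟨by linarith [ht.1], by linarith [ht.2, hs1 m]⟩, hηS q hq⟩, rfl⟩
        rw [hφ.zero, sub_zero] at hmv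
        have h1 : η q ^ 2 ≤ 1 := pow_le_one₀ (h.nonneg _) (h.le_one _)
        have h2 : (s m)⁻¹ * ‖F (φ i (s m) q) - F q‖ ≤ max B' 0 := by
          rw [inv_mul_le_iff₀ (hs0 m)]
          refine hmv.trans ?_
          rw [mul_comm]
          exact mul_le_mul_of_nonneg_left (le_max_left _ _) (hs0 m).le
        calc η q ^ 2 * ((s m)⁻¹ * ‖F (φ i (s m) q) - F q‖) ≤ 1 * max B' 0 := by
              have := (hs0 m).le
              gcongr
          _ = _ := one_mul _
      · have : η q = 0 := le_antisymm (not_lt.mp hq) (h.nonneg q)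
        simp only [D, this]
        simp only [ne_eq, OfNat.ofNat_ne_zero, not_false_eq_true, zero_pow, Complex.ofReal_zero,
          zero_mul, norm_zero]
        exact Set.indicator_nonneg (fun _ _ => le_max_right _ _) _
    · refine Eventually.of_forall fun q => Tendsto.const_mul _ ?_
      have hd := hF.hasDerivAt q 0
      rw [hφ.zero, hasDerivAt_iff_tendsto_slope] at hd
      have hs' : Tendsto s atTop (𝓝[≠] 0) :=
        tendsto_nhdsWithin_iff.mpr ⟨hs, Eventually.of_forall fun m => (hs0 m).ne'⟩
      refine (hd.comp hs').congr fun m => ?_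
      simp only [Function.comp, slope_def_module, hφ.zero, sub_zero]
      rw [Complex.real_smul, Complex.ofReal_inv]
  have hlim2 : Tendsto (fun m => 2 * ε * (∫ q, η q * ‖F q‖ ∂μ) +
      s m * (ε ^ 2 * ∫ q, O.indicator (fun q => ‖F q‖) q ∂μ)) atTop
      (𝓝 (2 * ε * (∫ q, η q * ‖F q‖ ∂μ))) := by
    simpa using (hs.mul_const (ε ^ 2 * ∫ q, O.indicator (fun q => ‖F q‖) q ∂μ)).const_add
      (2 * ε * (∫ q, η q * ‖F q‖ ∂μ))
  exact le_of_tendsto_of_tendsto' hlim.norm hlim2 hbound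

end FlowCutoffs

/-! ### Vanishing integrals of derivatives and the Caccioppoli inequality. -/

section FlowIntegration

variable {Q ι : Type*} [TopologicalSpace Q] [MeasurableSpace Q] [BorelSpace Q] {μ : Measure Q}
  {φ : ι → ℝ → Q → Q}

/-- Every compact set admits cutoffs with arbitrarily small Lipschitz constants. -/
def HasCutoffs (φ : ι → ℝ → Q → Q) : Prop :=
  ∀ S : Set Q, IsCompact S → ∀ ε : ℝ, 0 < ε → ∃ η, IsCutoff φ ε η ∧ ∀ q ∈ S, η q = 1

/-- No `σ`-compactness is assumed, so only the set where `ψ` is positive is exhausted: its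
superlevel sets have finite measure, and regularity fills them by compact sets up to null sets. -/
theorem HasCutoffs.exists_seq [μ.Regular] (hc : HasCutoffs φ) {ψ : Q → ℝ} (hψ : Continuous ψ)
    (hfin : ∀ a : ℝ, 0 < a → μ {q | a < ψ q} < ⊤) :
    ∃ η : ℕ → Q → ℝ, (∀ j : ℕ, IsCutoff φ (1 / ((j : ℝ) + 1)) (η j)) ∧
      ∀ᵐ q ∂μ, 0 < ψ q → ∀ᶠ j in atTop, η j q = 1 := by
  let U : ℕ → Set Q := fun m => {q | 1 / ((m : ℝ) + 1) < ψ q}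
  have hU : ∀ m, IsOpen (U m) := fun m => isOpen_lt continuous_const hψ
  have hUfin : ∀ m, μ (U m) < ⊤ := fun m => hfin _ (by positivity)
  have hK : ∀ m l : ℕ, ∃ K ⊆ U m, IsCompact K ∧ μ (U m) ≤ μ K + 1 / ((l : ENNReal) + 1) := by
    intro m l
    by_cases h0 : μ (U m) = 0
    · exact ⟨∅, Set.empty_subset _, isCompact_empty, by simp [h0]⟩
    · have hlt : μ (U m) - 1 / ((l : ENNReal) + 1) < μ (U m) :=
        ENNReal.sub_lt_self (hUfin m).ne h0 (by simp)
      obtain ⟨K, hKU, hKc, hK⟩ := (hU m).exists_lt_isCompact hlt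
      exact ⟨K, hKU, hKc, tsub_le_iff_right.mp hK.le⟩
  choose K hKU hKc hKm using hK
  let S : ℕ → Set Q := fun j => ⋃ m ∈ Finset.range j, ⋃ l ∈ Finset.range j, K m l
  have hS : ∀ j, IsCompact (S j) := fun j =>
    (Finset.range j).isCompact_biUnion fun m _ => (Finset.range j).isCompact_biUnion
      fun l _ => hKc m l
  choose η hη hη1 using fun j : ℕ => hc (S j) (hS j) (1 / ((j : ℝ) + 1)) (by positivity)
  refine ⟨η, hη, ?_⟩
  let E : Set Q := {q | ∀ᶠ j in atTop, η j q = 1}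
  have hE : MeasurableSet E := by
    have e : E = ⋃ N : ℕ, ⋂ j : ℕ, ⋂ _ : N ≤ j, η j ⁻¹' {1} := by
      ext q
      simp [E, eventually_atTop]
    rw [e]
    exact MeasurableSet.iUnion fun N => MeasurableSet.iInter fun j => MeasurableSet.iInter
      fun _ => (hη j).measurable (measurableSet_singleton 1)
  have hKE : ∀ m l, K m l ⊆ E := by
    intro m l q hq
    filter_upwards [eventually_gt_atTop m, eventually_gt_atTop l] with j hm hl
    exact hη1 j q (Set.mem_iUnion₂.mpr ⟨m, Finset.mem_range.mpr hm,
      Set.mem_iUnion₂.mpr ⟨l, Finset.mem_range.mpr hl, hq⟩⟩)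
  have hnull : ∀ m, μ (U m \ E) = 0 := by
    intro m
    have h1 : ∀ l : ℕ, μ (U m \ E) ≤ 1 / ((l : ENNReal) + 1) := by
      intro l
      have h2 : μ (U m ∩ E) + μ (U m \ E) = μ (U m) := measure_inter_add_sdiff _ hE
      have h3 : μ (K m l) ≤ μ (U m ∩ E) :=
        measure_mono (Set.subset_inter (hKU m l) (hKE m l))
      have h4 : μ (U m ∩ E) ≠ ⊤ := ((measure_mono Set.inter_subset_left).trans_lt (hUfin m)).ne
      have h5 : μ (U m ∩ E) + μ (U m \ E) ≤ μ (U m ∩ E) + 1 / ((l : ENNReal) + 1) := by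
        rw [h2]
        exact (hKm m l).trans (add_le_add h3 le_rfl)
      exact (ENNReal.add_le_add_iff_left h4).mp h5
    refine le_antisymm (ge_of_tendsto' (x := atTop) (f := fun l : ℕ => 1 / ((l : ENNReal) + 1))
      ?_ h1) zero_le
    have := ENNReal.tendsto_inv_nat_nhds_zero.comp (tendsto_add_atTop_nat 1)
    refine this.congr fun l => ?_
    simp
  have hall : μ (⋃ m, U m \ E) = 0 := measure_iUnion_null hnull
  rw [ae_iff]
  refine measure_mono_null (fun q hq => ?_) hall
  simp only [Set.mem_ofPred_eq, Classical.not_imp] at hq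
  obtain ⟨m, hm⟩ := exists_nat_one_div_lt hq.1
  exact Set.mem_iUnion.mpr ⟨m, hm, hq.2⟩

theorem measure_lt_top_of_integrable {ψ : Q → ℝ} (hψ : Integrable ψ μ) (a : ℝ) (ha : 0 < a) :
    μ {q | a < ψ q} < ⊤ :=
  (measure_mono fun q (hq : a < ψ q) => hq.le).trans_lt (hψ.measure_ge_lt_top ha)

/-- The integral of a derivative along a measure-preserving flow vanishes. -/
theorem integral_flowDeriv_eq_zero [μ.Regular] (hc : HasCutoffs φ) {i : ι} (hφ : IsFlow (φ i))
    (hμ : ∀ t, MeasurePreserving (φ i t) μ μ) {F F' : Q → ℂ} (hF : IsFlowDeriv (φ i) F F')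
    (hFi : Integrable F μ) (hFi' : Integrable F' μ) : ∫ q, F' q ∂μ = 0 := by
  obtain ⟨η, hη, hη1⟩ := hc.exists_seq hF.continuous_deriv.norm
    (measure_lt_top_of_integrable hFi'.norm)
  have hlim : Tendsto (fun j => ∫ q, ((η j q ^ 2 : ℝ) : ℂ) * F' q ∂μ) atTop
      (𝓝 (∫ q, F' q ∂μ)) := by
    refine tendsto_integral_of_dominated_convergence (fun q => ‖F' q‖) (fun j => ?_) hFi'.norm
      (fun j => Eventually.of_forall fun q => ?_) ?_
    · exact ((Complex.measurable_ofReal.comp ((hη j).measurable.pow_const 2)).mul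
        hF.continuous_deriv.measurable).aestronglyMeasurable
    · rw [norm_mul, Complex.norm_real, Real.norm_eq_abs, abs_of_nonneg (sq_nonneg _)]
      exact mul_le_of_le_one_left (norm_nonneg _)
        (pow_le_one₀ ((hη j).nonneg _) ((hη j).le_one _))
    · filter_upwards [hη1] with q hq
      by_cases h0 : F' q = 0
      · simp [h0]
      · refine tendsto_const_nhds.congr' ?_
        filter_upwards [hq (norm_pos_iff.mpr h0)] with j hj
        simp [hj]
  -- The Lipschitz constant `1 / (j + 1)` leaves a boundary term of at most `2 / (j + 1)` times the
  -- `L¹`-norm of `F`.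
  have hz : Tendsto (fun j : ℕ => 2 * (1 / ((j : ℝ) + 1)) * ∫ q, ‖F q‖ ∂μ) atTop (𝓝 0) := by
    have := (tendsto_one_div_add_atTop_nhds_zero_nat (𝕜 := ℝ)).const_mul 2 |>.mul_const
      (∫ q, ‖F q‖ ∂μ)
    simpa using this
  refine tendsto_nhds_unique hlim (squeeze_zero_norm (fun j => ?_) hz)
  refine ((hη j).norm_integral_sq_mul_le hφ hμ hF (by positivity)).trans ?_
  have : ∫ q, η j q * ‖F q‖ ∂μ ≤ ∫ q, ‖F q‖ ∂μ := by
    refine integral_mono_of_nonneg (Eventually.of_forall fun q =>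
      mul_nonneg ((hη j).nonneg q) (norm_nonneg _)) hFi.norm (Eventually.of_forall fun q => ?_)
    exact mul_le_of_le_one_left (norm_nonneg _) ((hη j).le_one q)
  gcongr

/-- A nonnegative continuous function whose truncations have bounded integrals is integrable. -/
theorem integrable_of_cutoff_bound [μ.Regular] (hc : HasCutoffs φ) {ψ : Q → ℝ}
    (hψ : Continuous ψ) (hψ0 : ∀ q, 0 ≤ ψ q) {B : ENNReal} (hB : B < ⊤)
    (h : ∀ η, IsCutoff φ 1 η → ∫⁻ q, ENNReal.ofReal (η q ^ 2 * ψ q) ∂μ ≤ B) :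
    Integrable ψ μ := by
  have hm : ∀ η : Q → ℝ, IsCutoff φ 1 η →
      Measurable fun q => ENNReal.ofReal (η q ^ 2 * ψ q) := fun η hη =>
    ((hη.measurable.pow_const 2).mul hψ.measurable).ennreal_ofReal
  have hfin : ∀ a : ℝ, 0 < a → μ {q | a < ψ q} < ⊤ := by
    intro a ha
    -- Markov's inequality on compact subsets, with a cutoff equal to `1` there, bounds the
    -- superlevel sets before integrability of `ψ` is known. Afterwards Fatou's lemma applies along
    -- a sequence of cutoffs.
    have hle : μ {q | a < ψ q} ≤ B / ENNReal.ofReal a := by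
      have hU : IsOpen {q | a < ψ q} := isOpen_lt continuous_const hψ
      rw [hU.measure_eq_iSup_isCompact]
      refine iSup₂_le fun K hKU => iSup_le fun hK => ?_
      obtain ⟨η, hη, hη1⟩ := hc K hK 1 one_pos
      rw [ENNReal.le_div_iff_mul_le (Or.inl (by simpa using ha)) (Or.inl ENNReal.ofReal_ne_top),
        mul_comm]
      refine le_trans ?_ ((mul_meas_ge_le_lintegral (hm η hη) (ENNReal.ofReal a)).trans (h η hη))
      gcongr
      intro q hq
      rw [Set.mem_ofPred_eq, hη1 q hq, one_pow, one_mul]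
      exact ENNReal.ofReal_le_ofReal (hKU hq).le
    exact hle.trans_lt (ENNReal.div_lt_top hB.ne (by simpa using ha))
  obtain ⟨η, hη, hη1⟩ := hc.exists_seq hψ hfin
  have hη' : ∀ j, IsCutoff φ 1 (η j) := fun j =>
    { hη j with
      lipschitz := fun i t q => ((hη j).lipschitz i t q).trans (by
        gcongr
        rw [div_le_one (by positivity)]
        linarith [(Nat.cast_nonneg j : (0 : ℝ) ≤ j)]) }
  refine ⟨hψ.measurable.aestronglyMeasurable, ?_⟩
  rw [hasFiniteIntegral_iff_ofReal (Eventually.of_forall hψ0)]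
  refine lt_of_le_of_lt ?_ hB
  calc ∫⁻ q, ENNReal.ofReal (ψ q) ∂μ
      ≤ ∫⁻ q, liminf (fun j => ENNReal.ofReal (η j q ^ 2 * ψ q)) atTop ∂μ := by
        refine lintegral_mono_ae ?_
        filter_upwards [hη1] with q hq
        rcases (hψ0 q).eq_or_lt with h0 | h0
        · simp [← h0]
        · refine le_of_eq (Eq.symm ?_)
          refine Tendsto.liminf_eq (tendsto_const_nhds.congr' ?_)
          filter_upwards [hq h0] with j hj
          simp [hj]
    _ ≤ liminf (fun j => ∫⁻ q, ENNReal.ofReal (η j q ^ 2 * ψ q) ∂μ) atTop :=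
        lintegral_liminf_le fun j => hm _ (hη' j)
    _ ≤ B := by
        refine liminf_le_of_frequently_le' (Frequently.of_forall fun j => h _ (hη' j))

theorem IsCutoff.integrable_sq_mul [IsFiniteMeasureOnCompacts μ] {ε : ℝ} {η : Q → ℝ}
    (h : IsCutoff φ ε η) {F : Q → ℂ} (hF : Continuous F) :
    Integrable (fun q => ((η q ^ 2 : ℝ) : ℂ) * F q) μ := by
  refine (h.integrable_mul hF).mono ?_ (Eventually.of_forall fun q => ?_)
  · exact ((Complex.measurable_ofReal.comp (h.measurable.pow_const 2)).mul
      hF.measurable).aestronglyMeasurable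
  · rw [norm_mul, norm_mul, Complex.norm_real, Complex.norm_real, Real.norm_eq_abs,
      Real.norm_eq_abs, abs_of_nonneg (sq_nonneg _), abs_of_nonneg (h.nonneg q)]
    have h1 := h.nonneg q
    have h2 := h.le_one q
    gcongr
    nlinarith

theorem IsCutoff.integrable_sq_mul_real [IsFiniteMeasureOnCompacts μ] {ε : ℝ} {η : Q → ℝ}
    (h : IsCutoff φ ε η) {F : Q → ℝ} (hF : Continuous F) :
    Integrable (fun q => η q ^ 2 * F q) μ := by
  have := (h.integrable_sq_mul (μ := μ) (Complex.continuous_ofReal.comp hF)).re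
  refine this.congr (Eventually.of_forall fun q => ?_)
  simp [← Complex.ofReal_mul, ← Complex.ofReal_pow]

open scoped ComplexConjugate in
/-- The Caccioppoli inequality: if `∑ XᵢXᵢ f = g + ∑ Xᵢ hᵢ` with `f`, `g`, `hᵢ` square-integrable,
then the `Xᵢ f` are square-integrable. -/
theorem integrable_sq_deriv_of_sum_eq [Fintype ι] [μ.Regular] (hc : HasCutoffs φ)
    (hφ : ∀ i, IsFlow (φ i)) (hμ : ∀ i t, MeasurePreserving (φ i t) μ μ)
    {f g : Q → ℂ} {X XX h Xh : ι → Q → ℂ}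
    (hfX : ∀ i, IsFlowDeriv (φ i) (fun q => conj (f q) * X i q)
      (fun q => conj (X i q) * X i q + conj (f q) * XX i q))
    (hfh : ∀ i, IsFlowDeriv (φ i) (fun q => conj (f q) * h i q)
      (fun q => conj (X i q) * h i q + conj (f q) * Xh i q))
    (heq : ∀ q, ∑ i, XX i q = g q + ∑ i, Xh i q)
    (hX : ∀ i, Continuous fun q => ‖X i q‖)
    (hf2 : Integrable (fun q => ‖f q‖ ^ 2) μ) (hg2 : Integrable (fun q => ‖g q‖ ^ 2) μ)
    (hh2 : ∀ i, Integrable (fun q => ‖h i q‖ ^ 2) μ) (i₀ : ι) :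
    Integrable (fun q => ‖X i₀ q‖ ^ 2) μ := by
  -- Chosen so that absorption leaves `E / 2 ≤ C`: one quarter of `E` is spent on the products of
  -- `Xᵢf` with `hᵢ`, another on the boundary terms.
  let C : ℝ := (∑ i, (5 * (∫ q, ‖f q‖ ^ 2 ∂μ) + 2 * ∫ q, ‖h i q‖ ^ 2 ∂μ)) +
    (∫ q, ‖f q‖ ^ 2 ∂μ) + ∫ q, ‖g q‖ ^ 2 ∂μ
  refine integrable_of_cutoff_bound hc ((hX i₀).pow 2) (fun q => sq_nonneg _)
    (B := ENNReal.ofReal (2 * C)) ENNReal.ofReal_lt_top fun η hη => ?_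
  have iXX : ∀ i, Integrable (fun q => η q ^ 2 * ‖X i q‖ ^ 2) μ := fun i =>
    hη.integrable_sq_mul_real ((hX i).pow 2)
  rw [← ofReal_integral_eq_lintegral_ofReal (iXX i₀)
    (Eventually.of_forall fun q => by positivity)]
  refine ENNReal.ofReal_le_ofReal ?_
  have hle : ∫ q, η q ^ 2 * ‖X i₀ q‖ ^ 2 ∂μ ≤ ∑ i, ∫ q, η q ^ 2 * ‖X i q‖ ^ 2 ∂μ :=
    Finset.single_le_sum (f := fun i => ∫ q, η q ^ 2 * ‖X i q‖ ^ 2 ∂μ)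
      (fun i _ => integral_nonneg fun q => by positivity) (Finset.mem_univ i₀)
  refine hle.trans ?_
  set E := ∑ i, ∫ q, η q ^ 2 * ‖X i q‖ ^ 2 ∂μ with hE
  -- integration by parts
  have hI := fun i => hη.norm_integral_sq_mul_le (hφ i) (hμ i) (hfX i) zero_le_one
  have hJ := fun i => hη.norm_integral_sq_mul_le (hφ i) (hμ i) (hfh i) zero_le_one
  set I : ι → ℂ := fun i => ∫ q, ((η q ^ 2 : ℝ) : ℂ) *
    (conj (X i q) * X i q + conj (f q) * XX i q) ∂μ with hIdef
  set J : ι → ℂ := fun i => ∫ q, ((η q ^ 2 : ℝ) : ℂ) *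
    (conj (X i q) * h i q + conj (f q) * Xh i q) ∂μ with hJdef
  have iI := fun i => hη.integrable_sq_mul (μ := μ) (hfX i).continuous_deriv
  have iJ := fun i => hη.integrable_sq_mul (μ := μ) (hfh i).continuous_deriv
  have iS : Integrable (fun q => ∑ i, η q ^ 2 * ‖X i q‖ ^ 2) μ :=
    integrable_finsetSum _ fun i _ => iXX i
  let D : Q → ℂ := fun q => (∑ i, ((η q ^ 2 : ℝ) : ℂ) *
      (conj (X i q) * X i q + conj (f q) * XX i q)) -
    (∑ i, ((η q ^ 2 : ℝ) : ℂ) * (conj (X i q) * h i q + conj (f q) * Xh i q))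
  have iD : Integrable D μ := (integrable_finsetSum _ fun i _ => iI i).sub
    (integrable_finsetSum _ fun i _ => iJ i)
  have hD : ∫ q, D q ∂μ = ∑ i, I i - ∑ i, J i := by
    rw [integral_sub (integrable_finsetSum _ fun i _ => iI i)
      (integrable_finsetSum _ fun i _ => iJ i), integral_finsetSum _ fun i _ => iI i,
      integral_finsetSum _ fun i _ => iJ i]
  -- The equation eliminates the second derivatives of `f` together with the derivatives of the
  -- `hᵢ`; only first derivatives of `f` survive.
  have hDeq : ∀ q, D q = ((∑ i, η q ^ 2 * ‖X i q‖ ^ 2 : ℝ) : ℂ) +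
      (((η q ^ 2 : ℝ) : ℂ) * (conj (f q) * g q) -
        ∑ i, ((η q ^ 2 : ℝ) : ℂ) * (conj (X i q) * h i q)) := by
    intro q
    have h1 : ∀ i, conj (X i q) * X i q = ((‖X i q‖ ^ 2 : ℝ) : ℂ) := fun i => by
      rw [Complex.conj_mul', Complex.ofReal_pow]
    simp only [D, ← Finset.mul_sum, Finset.sum_add_distrib]
    rw [heq]
    simp only [h1]
    push_cast
    ring
  let R : Q → ℝ := fun q => (∑ i, (1 / 4 * (η q ^ 2 * ‖X i q‖ ^ 2) + ‖h i q‖ ^ 2)) +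
    (‖f q‖ ^ 2 + ‖g q‖ ^ 2)
  have iT : ∀ i, Integrable (fun q => 1 / 4 * (η q ^ 2 * ‖X i q‖ ^ 2) + ‖h i q‖ ^ 2) μ := fun i =>
    ((iXX i).const_mul (1 / 4)).add (hh2 i)
  have iT' : Integrable (fun q => ∑ i, (1 / 4 * (η q ^ 2 * ‖X i q‖ ^ 2) + ‖h i q‖ ^ 2)) μ :=
    integrable_finsetSum _ fun i _ => iT i
  have ifg : Integrable (fun q => ‖f q‖ ^ 2 + ‖g q‖ ^ 2) μ := hf2.add hg2
  have iR : Integrable R μ := iT'.add ifg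
  have hRint : ∫ q, R q ∂μ = 1 / 4 * E + (∑ i, ∫ q, ‖h i q‖ ^ 2 ∂μ) +
      (∫ q, ‖f q‖ ^ 2 ∂μ) + ∫ q, ‖g q‖ ^ 2 ∂μ := by
    simp only [R]
    rw [integral_add iT' ifg, integral_add hf2 hg2, integral_finsetSum _ fun i _ => iT i]
    simp only [integral_add ((iXX _).const_mul (1 / 4)) (hh2 _), integral_const_mul]
    rw [Finset.sum_add_distrib, ← Finset.mul_sum]
    ring
  have hDR : ∀ q, ∑ i, η q ^ 2 * ‖X i q‖ ^ 2 - R q ≤ (D q).re := by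
    intro q
    rw [hDeq q, Complex.add_re, Complex.ofReal_re]
    have h1 : ‖((η q ^ 2 : ℝ) : ℂ) * (conj (f q) * g q) -
        ∑ i, ((η q ^ 2 : ℝ) : ℂ) * (conj (X i q) * h i q)‖ ≤ R q := by
      have hη0 := hη.nonneg q
      have hη1 := hη.le_one q
      refine (norm_sub_le _ _).trans ?_
      rw [add_comm]
      refine add_le_add ((norm_sum_le _ _).trans (Finset.sum_le_sum fun i _ => ?_)) ?_
      · rw [norm_mul, norm_mul, Complex.norm_real, Real.norm_eq_abs, abs_of_nonneg (sq_nonneg _),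
          RCLike.norm_conj]
        have hx := norm_nonneg (X i q)
        have hy := norm_nonneg (h i q)
        have : η q ^ 2 * (‖X i q‖ * ‖h i q‖) ≤ (η q * ‖X i q‖) * ‖h i q‖ := by
          have : η q ^ 2 ≤ η q := by nlinarith
          nlinarith [mul_nonneg hx hy]
        nlinarith [sq_nonneg (1 / 2 * (η q * ‖X i q‖) - ‖h i q‖)]
      · rw [norm_mul, norm_mul, Complex.norm_real, Real.norm_eq_abs, abs_of_nonneg (sq_nonneg _),
          RCLike.norm_conj]
        have hx := norm_nonneg (f q)
        have hy := norm_nonneg (g q)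
        have : η q ^ 2 * (‖f q‖ * ‖g q‖) ≤ ‖f q‖ * ‖g q‖ :=
          mul_le_of_le_one_left (mul_nonneg hx hy) (pow_le_one₀ hη0 hη1)
        nlinarith [sq_nonneg (‖f q‖ - ‖g q‖)]
    have h2 := (abs_le.mp ((Complex.abs_re_le_norm _).trans h1)).1
    linarith
  -- `2ab ≤ a² / 4 + 4b²` with `a = η‖Xᵢf‖` and `b = ‖f‖`.
  have hIb : ∀ i, ‖I i‖ ≤ 1 / 4 * (∫ q, η q ^ 2 * ‖X i q‖ ^ 2 ∂μ) + 4 * ∫ q, ‖f q‖ ^ 2 ∂μ := by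
    intro i
    refine (hI i).trans ?_
    rw [mul_one, ← integral_const_mul, ← integral_const_mul, ← integral_const_mul,
      ← integral_add ((iXX i).const_mul _) (hf2.const_mul _)]
    refine integral_mono_of_nonneg (Eventually.of_forall fun q => ?_)
      (((iXX i).const_mul _).add (hf2.const_mul _)) (Eventually.of_forall fun q => ?_)
    · have := hη.nonneg q
      positivity
    · simp only [norm_mul, RCLike.norm_conj]
      nlinarith [sq_nonneg (1 / 2 * (η q * ‖X i q‖) - 2 * ‖f q‖)]
  have hJb : ∀ i, ‖J i‖ ≤ (∫ q, ‖f q‖ ^ 2 ∂μ) + ∫ q, ‖h i q‖ ^ 2 ∂μ := by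
    intro i
    refine (hJ i).trans ?_
    rw [mul_one, ← integral_const_mul, ← integral_add hf2 (hh2 i)]
    refine integral_mono_of_nonneg (Eventually.of_forall fun q => ?_)
      (hf2.add (hh2 i)) (Eventually.of_forall fun q => ?_)
    · have := hη.nonneg q
      positivity
    · simp only [norm_mul, RCLike.norm_conj]
      have hx := norm_nonneg (f q)
      have hy := norm_nonneg (h i q)
      have : η q * (‖f q‖ * ‖h i q‖) ≤ ‖f q‖ * ‖h i q‖ :=
        mul_le_of_le_one_left (mul_nonneg hx hy) (hη.le_one q)
      nlinarith [sq_nonneg (‖f q‖ - ‖h i q‖)]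
  have hmain : E - ∫ q, R q ∂μ ≤ ∑ i, ‖I i‖ + ∑ i, ‖J i‖ := by
    calc E - ∫ q, R q ∂μ = ∫ q, (∑ i, η q ^ 2 * ‖X i q‖ ^ 2 - R q) ∂μ := by
          rw [integral_sub iS iR, integral_finsetSum _ fun i _ => iXX i]
      _ ≤ ∫ q, (D q).re ∂μ := integral_mono (iS.sub iR) iD.re hDR
      _ = (∫ q, D q ∂μ).re := integral_re iD
      _ ≤ ‖∫ q, D q ∂μ‖ := (le_abs_self _).trans (Complex.abs_re_le_norm _)
      _ ≤ ‖∑ i, I i‖ + ‖∑ i, J i‖ := by rw [hD]; exact norm_sub_le _ _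
      _ ≤ _ := add_le_add (norm_sum_le _ _) (norm_sum_le _ _)
  have hs1 : ∑ i, ‖I i‖ ≤ 1 / 4 * E + ∑ _i : ι, 4 * ∫ q, ‖f q‖ ^ 2 ∂μ := by
    refine (Finset.sum_le_sum fun i _ => hIb i).trans_eq ?_
    rw [Finset.sum_add_distrib, ← Finset.mul_sum]
  have hs2 : ∑ i, ‖J i‖ ≤ ∑ i, ((∫ q, ‖f q‖ ^ 2 ∂μ) + ∫ q, ‖h i q‖ ^ 2 ∂μ) :=
    Finset.sum_le_sum fun i _ => hJb i
  have hC : C = (∑ _i : ι, 4 * ∫ q, ‖f q‖ ^ 2 ∂μ) +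
      (∑ i, ((∫ q, ‖f q‖ ^ 2 ∂μ) + ∫ q, ‖h i q‖ ^ 2 ∂μ)) + (∑ i, ∫ q, ‖h i q‖ ^ 2 ∂μ) +
      (∫ q, ‖f q‖ ^ 2 ∂μ) + ∫ q, ‖g q‖ ^ 2 ∂μ := by
    simp only [C, ← Finset.sum_add_distrib]
    congr 2
    refine Finset.sum_congr rfl fun i _ => ?_
    ring
  rw [hRint] at hmain
  linarith

end FlowIntegration

/-! ### Cutoffs from a proper length function on the acting group. -/

section ActionCutoffs

variable {Q B ι : Type*} [TopologicalSpace Q] [Group B] [TopologicalSpace B] [IsTopologicalGroup B]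

/-- Cutoffs along the flows given by one-parameter subgroups `e i` of a group `B` acting from the
right on `Q`, constructed from a proper length function `ℓ` on `B`. -/
theorem hasCutoffs_of_length [WeaklyLocallyCompactSpace Q] (act : Q → B → Q)
    (act_one : ∀ q, act q 1 = q) (act_mul : ∀ q a b, act q (a * b) = act (act q a) b)
    (hact : Continuous fun p : Q × B => act p.1 p.2) {e : ι → ℝ → B}
    (he : ∀ i t, e i (-t) = (e i t)⁻¹) {ℓ : B → ℝ} (hℓ0 : ∀ b, 0 ≤ ℓ b) (hℓ1 : ℓ 1 = 0)
    (hℓc : ∀ r, IsCompact {b | ℓ b ≤ r}) {c : ℝ} (hc : 0 ≤ c)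
    (hℓ : ∀ i t b, ℓ (e i t * b) ≤ ℓ b + c * |t|) :
    HasCutoffs (fun i t q => act q (e i t)) := by
  classical
  intro S hS ε hε
  obtain ⟨C', hC', hSC⟩ := exists_compact_superset hS
  let C : Set Q := interior C'
  have hC : IsOpen C := isOpen_interior
  -- Division by `c + 1` because `c` may be zero.
  let δ : ℝ := ε / (c + 1)
  have hδ : 0 < δ := by positivity
  have hδc : δ * c ≤ ε := by
    rw [div_mul_eq_mul_div, div_le_iff₀ (by positivity)]
    nlinarith
  let θ : B → ℝ := fun b => max 0 (1 - δ * ℓ b)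
  have hθ0 : ∀ b, 0 ≤ θ b := fun b => le_max_left _ _
  have hθ1 : ∀ b, θ b ≤ 1 := fun b => max_le zero_le_one (by nlinarith [hℓ0 b])
  have hθe : ∀ i t b, θ b ≤ θ (e i t * b) + ε * |t| := by
    intro i t b
    have h1 := hℓ i t b
    have h2 : δ * (c * |t|) ≤ ε * |t| := by
      rw [← mul_assoc]; gcongr
    refine max_le (by have := hθ0 (e i t * b); positivity) ?_
    have h3 : 1 - δ * ℓ (e i t * b) ≤ θ (e i t * b) := le_max_right _ _
    nlinarith
  -- The cutoff `⨆ b, w q b` is large when a short group element carries `q` into `C`. As `C` is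
  -- open, each `w · b` is lower semicontinuous, hence so is the supremum.
  let w : Q → B → ℝ := fun q b => if act q b ∈ C then θ b else 0
  have hw1 : ∀ q b, w q b ≤ 1 := fun q b => by
    simp only [w]; split_ifs
    exacts [hθ1 b, zero_le_one]
  have hw0 : ∀ q b, 0 ≤ w q b := fun q b => by
    simp only [w]; split_ifs
    exacts [hθ0 b, le_rfl]
  have hbdd : ∀ q, BddAbove (Set.range (w q)) := fun q => ⟨1, by rintro _ ⟨b, rfl⟩; exact hw1 q b⟩
  let η : Q → ℝ := fun q => ⨆ b, w q b
  have hle : ∀ q b, w q b ≤ η q := fun q b => le_ciSup (hbdd q) b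
  have hη0 : ∀ q, 0 ≤ η q := fun q => (hw0 q 1).trans (hle q 1)
  have hη1 : ∀ q, η q ≤ 1 := fun q => ciSup_le (hw1 q)
  have hηl : ∀ i t q, η (act q (e i t)) ≤ η q + ε * |t| := by
    intro i t q
    refine ciSup_le fun b => ?_
    by_cases hb : act (act q (e i t)) b ∈ C
    · have e1 : w (act q (e i t)) b = θ b := if_pos hb
      have e2 : w q (e i t * b) = θ (e i t * b) := if_pos (by rwa [act_mul])
      rw [e1]
      refine (hθe i t b).trans ?_
      rw [← e2]
      gcongr
      exact hle _ _
    · have e1 : w (act q (e i t)) b = 0 := if_neg hb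
      rw [e1]
      have := hη0 q
      positivity
  refine ⟨η, ⟨?_, hη0, hη1, ?_, ?_⟩, ?_⟩
  · intro q y hy
    obtain ⟨b, hb⟩ := exists_lt_of_lt_ciSup hy
    by_cases hq : act q b ∈ C
    · have e1 : w q b = θ b := if_pos hq
      rw [e1] at hb
      have hcont : Continuous fun q => act q b := hact.comp (Continuous.prodMk_left b)
      filter_upwards [(hC.preimage hcont).mem_nhds hq] with q' hq'
      refine hb.trans_le ?_
      have e2 : w q' b = θ b := if_pos hq'
      rw [← e2]
      exact hle _ _
    · have e1 : w q b = 0 := if_neg hq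
      rw [e1] at hb
      exact Eventually.of_forall fun q' => hb.trans_le (hη0 q')
  · refine ⟨(fun p : Q × B => act p.1 p.2) '' (C' ×ˢ ((fun b => b⁻¹) '' {b | ℓ b ≤ 1 / δ})),
      (hC'.prod ((hℓc _).image continuous_inv)).image hact, fun q hq => ?_⟩
    obtain ⟨b, hb⟩ := exists_lt_of_lt_ciSup hq
    by_cases hqb : act q b ∈ C
    · have e1 : w q b = θ b := if_pos hqb
      rw [e1] at hb
      refine ⟨(act q b, b⁻¹), ⟨interior_subset hqb, b, ?_, rfl⟩, ?_⟩
      · rw [Set.mem_ofPred_eq, le_div_iff₀ hδ]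
        have := (lt_max_iff.mp hb).resolve_left (lt_irrefl _)
        linarith
      · change act (act q b) b⁻¹ = q
        rw [← act_mul, mul_inv_cancel, act_one]
    · have e1 : w q b = 0 := if_neg hqb
      exact absurd hb (by rw [e1]; exact lt_irrefl _)
  · intro i t q
    rw [abs_le]
    have h1 := hηl i t q
    -- The reverse inequality is the same bound for the flow run backwards.
    have h2 := hηl i (-t) (act q (e i t))
    rw [← act_mul, he, mul_inv_cancel, act_one, abs_neg] at h2
    constructor <;> linarith
  · intro q hq
    refine le_antisymm (hη1 q) ?_
    refine le_trans (le_of_eq ?_) (hle q 1)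
    have e1 : w q 1 = θ 1 := if_pos (by rw [act_one]; exact hSC hq)
    rw [e1]
    simp [θ, hℓ1]

theorem isFlow_of_action (act : Q → B → Q)
    (act_one : ∀ q, act q 1 = q) (act_mul : ∀ q a b, act q (a * b) = act (act q a) b)
    (hact : Continuous fun p : Q × B => act p.1 p.2) {e : ℝ → B} (hc : Continuous e)
    (h0 : e 0 = 1) (hadd : ∀ s t, e (s + t) = e s * e t) : IsFlow fun t q => act q (e t) where
  zero q := by rw [h0, act_one]
  add s t q := by rw [add_comm, hadd, act_mul]
  continuous := hact.comp (continuous_snd.prodMk (hc.comp continuous_fst))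

end ActionCutoffs

/-! ### Functions and actions on a coset space. -/

section CosetSpaces

variable {A : Type*} [Group A] [TopologicalSpace A] [IsTopologicalGroup A] (Γ : Subgroup A)

theorem isOpenQuotientMap_rightRel :
    IsOpenQuotientMap (Quotient.mk (QuotientGroup.rightRel Γ)) :=
  MulAction.isOpenQuotientMap_quotientMk

theorem weaklyLocallyCompactSpace_rightRel [WeaklyLocallyCompactSpace A] :
    WeaklyLocallyCompactSpace (Quotient (QuotientGroup.rightRel Γ)) where
  exists_compact_mem_nhds q := by
    obtain ⟨a, rfl⟩ := Quotient.exists_rep q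
    obtain ⟨s, hs, hsa⟩ := WeaklyLocallyCompactSpace.exists_compact_mem_nhds a
    exact ⟨_, hs.image (isOpenQuotientMap_rightRel Γ).continuous,
      (isOpenQuotientMap_rightRel Γ).isOpenMap.image_mem_nhds hsa⟩

/-- The projection is open, so its product with the identity of `A` is still a quotient map, and
continuity may be tested upstairs. -/
theorem continuous_action_rightRel
    {act : Quotient (QuotientGroup.rightRel Γ) → A → Quotient (QuotientGroup.rightRel Γ)}
    (h : ∀ a b, act (Quotient.mk _ a) b = Quotient.mk _ (a * b)) :
    Continuous fun p : Quotient (QuotientGroup.rightRel Γ) × A => act p.1 p.2 := by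
  have hq : IsOpenQuotientMap (Prod.map (Quotient.mk (QuotientGroup.rightRel Γ)) (id : A → A)) :=
    (isOpenQuotientMap_rightRel Γ).prodMap IsOpenQuotientMap.id
  rw [hq.isQuotientMap.continuous_iff]
  have e : (fun p : Quotient (QuotientGroup.rightRel Γ) × A => act p.1 p.2) ∘
      Prod.map (Quotient.mk (QuotientGroup.rightRel Γ)) (id : A → A) =
      fun p => Quotient.mk _ (p.1 * p.2) := by
    funext p
    exact h p.1 p.2
  rw [e]
  exact (isOpenQuotientMap_rightRel Γ).continuous.comp continuous_mul

/-- `Quotient.out` need not be continuous, but an invariant function does not see the choice of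
representative. -/
theorem continuous_out_rightRel {Y : Type*} [TopologicalSpace Y] {F : A → Y} (hF : Continuous F)
    (h : ∀ γ ∈ Γ, ∀ a, F (γ * a) = F a) :
    (∀ a, F (Quotient.out (Quotient.mk (QuotientGroup.rightRel Γ) a)) = F a) ∧
      Continuous fun q : Quotient (QuotientGroup.rightRel Γ) => F (Quotient.out q) := by
  have h1 : ∀ a, F (Quotient.out (Quotient.mk (QuotientGroup.rightRel Γ) a)) = F a := by
    intro a
    have := Quotient.mk_out (s := QuotientGroup.rightRel Γ) a
    have h2 : a * (Quotient.out (Quotient.mk (QuotientGroup.rightRel Γ) a))⁻¹ ∈ Γ :=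
      QuotientGroup.rightRel_apply.mp this
    rw [← h _ h2, inv_mul_cancel_right]
  refine ⟨h1, ?_⟩
  rw [(isOpenQuotientMap_rightRel Γ).isQuotientMap.continuous_iff]
  exact hF.congr fun a => (h1 a).symm

end CosetSpaces

/-! ### A logarithmic length function on `G(𝔸_∞)`. -/

section NormExp

theorem norm_exp_le_exp_norm {B : Type*} [NormedRing B] [NormedAlgebra ℝ B] [NormOneClass B]
    [CompleteSpace B] (x : B) : ‖NormedSpace.exp x‖ ≤ Real.exp ‖x‖ := by
  rw [NormedSpace.exp_eq_tsum ℝ, Real.exp_eq_exp_ℝ, NormedSpace.exp_eq_tsum ℝ]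
  refine (norm_tsum_le_tsum_norm (NormedSpace.norm_expSeries_summable' (𝕂 := ℝ) x)).trans ?_
  refine Summable.tsum_le_tsum (fun n => ?_) (NormedSpace.norm_expSeries_summable' (𝕂 := ℝ) x)
    (NormedSpace.expSeries_summable' (𝕂 := ℝ) ‖x‖)
  rw [norm_smul, smul_eq_mul, Real.norm_eq_abs, abs_of_nonneg (by positivity)]
  gcongr
  exact norm_pow_le x n

end NormExp

section ArchLength

open scoped Classical

variable {F : Type u} [Field F] [NumberField F] {n : ℕ} {G : LinearAlgebraicGroup F n}
  {H : ClosedSubgroup G.ArchPts}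

attribute [local instance] Matrix.linftyOpNormedRing Matrix.linftyOpNormedAlgebra

/-- The length function `log max (1, ‖g‖, ‖g⁻¹‖)` on `G(𝔸_∞)`. -/
def archLength (g : G.ArchPts) : ℝ := Real.log (max 1 (max ‖archMatrix g‖ ‖archMatrix g⁻¹‖))

theorem archLength_nonneg (g : G.ArchPts) : 0 ≤ archLength g := Real.log_nonneg (le_max_left _ _)

theorem norm_matrix_one_le : ‖(1 : Matrix (Fin n) (Fin n) (ArchAdele F))‖ ≤ 1 := by
  rcases isEmpty_or_nonempty (Fin n) with hn | hn
  · rw [Subsingleton.elim (1 : Matrix (Fin n) (Fin n) (ArchAdele F)) 0, norm_zero]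
    exact zero_le_one
  · rw [norm_one]

theorem archLength_one : archLength (1 : G.ArchPts) = 0 := by
  have h : max (1 : ℝ) (max ‖archMatrix (1 : G.ArchPts)‖ ‖archMatrix (1 : G.ArchPts)⁻¹‖) = 1 := by
    rw [inv_one, max_self, archMatrix_one]
    exact max_eq_left norm_matrix_one_le
  rw [archLength, h, Real.log_one]

theorem continuous_archLength : Continuous (archLength (G := G)) := by
  refine Continuous.log ?_ fun g => (zero_lt_one.trans_le (le_max_left _ _)).ne'
  exact continuous_const.max (continuous_archMatrix.norm.max
    (continuous_archMatrix.comp continuous_inv).norm)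

theorem norm_archMatrix_oneParam_le (X : lieAlg H) (t : ℝ) :
    ‖archMatrix (oneParam X t)‖ ≤
      Real.exp (‖(X : Matrix (Fin n) (Fin n) (ArchAdele F))‖ * |t|) := by
  rw [archMatrix_oneParam]
  rcases isEmpty_or_nonempty (Fin n) with hn | hn
  · rw [Subsingleton.elim (NormedSpace.exp _) (0 : Matrix (Fin n) (Fin n) (ArchAdele F)), norm_zero]
    positivity
  · refine (norm_exp_le_exp_norm _).trans ?_
    rw [norm_smul, Real.norm_eq_abs, mul_comm]

/-- Norms are submultiplicative and `‖exp(tX)‖` is at most `exp(|t|‖X‖)`; the logarithm turns this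
exponential growth into the linear growth that `hasCutoffs_of_length` requires. -/
theorem archLength_oneParam_mul_le (X : lieAlg H) (t : ℝ) (g : G.ArchPts) :
    archLength (oneParam X t * g) ≤
      archLength g + ‖(X : Matrix (Fin n) (Fin n) (ArchAdele F))‖ * |t| := by
  set c := ‖(X : Matrix (Fin n) (Fin n) (ArchAdele F))‖ * |t|
  have hc : 0 ≤ c := by positivity
  have h1 : ‖archMatrix (oneParam X t)‖ ≤ Real.exp c := norm_archMatrix_oneParam_le X t
  have h2 : ‖archMatrix (oneParam X t)⁻¹‖ ≤ Real.exp c := by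
    rw [← oneParam_neg]
    have := norm_archMatrix_oneParam_le X (-t)
    rwa [abs_neg] at this
  have hpos : ∀ a : ℝ, 0 < max 1 a := fun a => zero_lt_one.trans_le (le_max_left _ _)
  rw [archLength, archLength, ← Real.log_exp c, ← Real.log_mul (hpos _).ne' (Real.exp_pos c).ne']
  refine Real.log_le_log (hpos _) ?_
  set m := max 1 (max ‖archMatrix g‖ ‖archMatrix g⁻¹‖)
  have hm1 : 1 ≤ m := le_max_left _ _
  have hm2 : ‖archMatrix g‖ ≤ m := (le_max_left _ _).trans (le_max_right _ _)
  have hm3 : ‖archMatrix g⁻¹‖ ≤ m := (le_max_right _ _).trans (le_max_right _ _)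
  have he : 1 ≤ Real.exp c := Real.one_le_exp hc
  refine max_le ?_ (max_le ?_ ?_)
  · nlinarith
  · rw [archMatrix_mul, mul_comm m]
    exact (norm_mul_le _ _).trans (mul_le_mul h1 hm2 (norm_nonneg _) (Real.exp_pos c).le)
  · rw [mul_inv_rev, archMatrix_mul]
    exact (norm_mul_le _ _).trans (mul_le_mul hm3 h2 (norm_nonneg _) (by linarith))

/-- The pair `(g, g⁻¹)` embeds the group as a closed set, and both components are bounded. A bound
on `g` alone would allow degeneration to singular matrices. -/
theorem isCompact_archLength_le (r : ℝ) : IsCompact {g : G.ArchPts | archLength g ≤ r} := by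
  have h1 : IsClosedEmbedding (fun g : G.ArchPts => Units.embedProduct _
      (g : GL (Fin n) (ArchAdele F))) :=
    (Units.isClosedEmbedding_embedProduct).comp (isClosed_points G).isClosedEmbedding_subtypeVal
  let C : Set (Matrix (Fin n) (Fin n) (ArchAdele F) × (Matrix (Fin n) (Fin n) (ArchAdele F))ᵐᵒᵖ) :=
    Metric.closedBall 0 (Real.exp r) ×ˢ (MulOpposite.op '' Metric.closedBall 0 (Real.exp r))
  have : ProperSpace (Matrix (Fin n) (Fin n) (ArchAdele F)) := FiniteDimensional.proper ℝ _
  have hC : IsCompact C := (isCompact_closedBall _ _).prod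
    ((isCompact_closedBall _ _).image MulOpposite.continuous_op)
  have h2 := h1.isCompact_preimage hC
  refine h2.of_isClosed_subset (isClosed_le continuous_archLength continuous_const) ?_
  intro g hg
  have hpos : (0 : ℝ) < max 1 (max ‖archMatrix g‖ ‖archMatrix g⁻¹‖) :=
    zero_lt_one.trans_le (le_max_left _ _)
  have h3 : max 1 (max ‖archMatrix g‖ ‖archMatrix g⁻¹‖) ≤ Real.exp r :=
    (Real.log_le_iff_le_exp hpos).mp hg
  refine ⟨?_, archMatrix g⁻¹, ?_, rfl⟩
  · rw [mem_closedBall_zero_iff]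
    exact ((le_max_left _ _).trans (le_max_right _ _)).trans h3
  · rw [mem_closedBall_zero_iff]
    exact ((le_max_right _ _).trans (le_max_right _ _)).trans h3

instance : WeaklyLocallyCompactSpace G.ArchPts where
  exists_compact_mem_nhds g := ⟨_, isCompact_archLength_le (archLength g + 1),
    mem_of_superset ((isOpen_lt continuous_archLength continuous_const).mem_nhds
      (show archLength g < archLength g + 1 from lt_add_one (archLength g)))
      fun x hx => show archLength x ≤ _ from le_of_lt (show archLength x < _ from hx)⟩

end ArchLength

/-- Applied to the open compact subgroup that fixes an automorphic form, this yields local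
compactness of `G(𝔸_f)`. -/
theorem weaklyLocallyCompactSpace_of_subgroup {A : Type*} [Group A] [TopologicalSpace A]
    [IsTopologicalGroup A] {K : Subgroup A} (ho : IsOpen (K : Set A)) (hc : IsCompact (K : Set A)) :
    WeaklyLocallyCompactSpace A where
  exists_compact_mem_nhds a := ⟨(fun k => a * k) '' K, hc.image (continuous_const_mul a),
    ((Homeomorph.mulLeft a).isOpenMap _ ho).mem_nhds ⟨1, one_mem K, mul_one a⟩⟩

/-! ### Square-integrable forms on the automorphic quotient. -/

section Petersson

variable {F : Type u} [Field F] [NumberField F] {n : ℕ} {G : LinearAlgebraicGroup F n}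
  {H : ClosedSubgroup G.ArchPts}

instance : IsTopologicalGroup G.FinPts := inferInstance

/-- The coset of `g`. -/
def AutomorphicQuotient.mk (g : G.Adelic) : AutomorphicQuotient G := Quotient.mk _ g

theorem AutomorphicQuotient.exists_rep (q : AutomorphicQuotient G) : ∃ g, mk g = q :=
  Quotient.exists_rep q

theorem AutomorphicQuotient.rightMul_mk (x g : G.Adelic) :
    rightMul x (mk g) = mk (g * x) := rfl

theorem AutomorphicQuotient.rightMul_one (q : AutomorphicQuotient G) : rightMul 1 q = q := by
  obtain ⟨g, rfl⟩ := exists_rep q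
  rw [rightMul_mk, mul_one]

theorem AutomorphicQuotient.rightMul_mul (q : AutomorphicQuotient G) (x y : G.Adelic) :
    rightMul (x * y) q = rightMul y (rightMul x q) := by
  obtain ⟨g, rfl⟩ := exists_rep q
  rw [rightMul_mk, rightMul_mk, rightMul_mk, mul_assoc]

theorem AutomorphicQuotient.continuous_rightMul :
    Continuous fun p : AutomorphicQuotient G × G.Adelic => rightMul p.2 p.1 :=
  continuous_action_rightRel (rationalCentral G) (act := fun q x => rightMul x q)
    fun _ _ => rfl

/-- The flow on the automorphic quotient given by `exp (tX)`. -/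
def expFlow (X : lieAlg H) (t : ℝ) (q : AutomorphicQuotient G) : AutomorphicQuotient G :=
  AutomorphicQuotient.rightMul (oneParam X t, 1) q

theorem continuous_archAction : Continuous fun p : AutomorphicQuotient G × G.ArchPts =>
    AutomorphicQuotient.rightMul ((p.2, 1) : G.Adelic) p.1 :=
  AutomorphicQuotient.continuous_rightMul.comp
    (continuous_fst.prodMk (continuous_snd.prodMk continuous_const))

theorem archAction_mul (q : AutomorphicQuotient G) (a b : G.ArchPts) :
    AutomorphicQuotient.rightMul ((a * b, 1) : G.Adelic) q =
      AutomorphicQuotient.rightMul (b, 1) (AutomorphicQuotient.rightMul (a, 1) q) := by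
  rw [← AutomorphicQuotient.rightMul_mul, Prod.mk_mul_mk, mul_one]

theorem isFlow_expFlow (X : lieAlg H) : IsFlow (expFlow X) :=
  isFlow_of_action (fun q (b : G.ArchPts) => AutomorphicQuotient.rightMul ((b, 1) : G.Adelic) q)
    AutomorphicQuotient.rightMul_one archAction_mul continuous_archAction (continuous_oneParam X)
    (oneParam_zero X) (oneParam_add X)

theorem hasCutoffs_expFlow [WeaklyLocallyCompactSpace G.FinPts] {ι : Type*} [Finite ι]
    (X : ι → lieAlg H) : HasCutoffs (fun i => expFlow (X i)) := by
  classical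
  have hQ : WeaklyLocallyCompactSpace (AutomorphicQuotient G) :=
    weaklyLocallyCompactSpace_rightRel (rationalCentral G)
  let _ := Fintype.ofFinite ι
  let _ : NormedRing (Matrix (Fin n) (Fin n) (ArchAdele F)) := Matrix.linftyOpNormedRing
  have hle : ∀ i, ‖(X i : Matrix (Fin n) (Fin n) (ArchAdele F))‖ ≤
      ∑ i, ‖(X i : Matrix (Fin n) (Fin n) (ArchAdele F))‖ := fun i =>
    Finset.single_le_sum (f := fun i => ‖(X i : Matrix (Fin n) (Fin n) (ArchAdele F))‖)
      (fun i _ => norm_nonneg _) (Finset.mem_univ i)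
  exact hasCutoffs_of_length
    (fun q (b : G.ArchPts) => AutomorphicQuotient.rightMul ((b, 1) : G.Adelic) q)
    AutomorphicQuotient.rightMul_one archAction_mul continuous_archAction
    (e := fun i => oneParam (X i)) (fun i => oneParam_neg (X i)) archLength_nonneg
    archLength_one isCompact_archLength_le (Finset.sum_nonneg fun i _ => norm_nonneg _)
    fun i t b => (archLength_oneParam_mul_le (X i) t b).trans (by gcongr; exact hle i)

theorem IsQuotientHaar.measurePreserving {μ : Measure (AutomorphicQuotient G)}
    (hμ : IsQuotientHaar μ) (x : G.Adelic) :
    MeasurePreserving (AutomorphicQuotient.rightMul x) μ μ :=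
  ⟨(AutomorphicQuotient.continuous_rightMul.comp (Continuous.prodMk_left x)).measurable,
    hμ.invariant x⟩

/-- Right translation as a homeomorphism. -/
def rightMulHomeomorph (x : G.Adelic) : AutomorphicQuotient G ≃ₜ AutomorphicQuotient G where
  toFun := AutomorphicQuotient.rightMul x
  invFun := AutomorphicQuotient.rightMul x⁻¹
  left_inv q := by rw [← AutomorphicQuotient.rightMul_mul, mul_inv_cancel,
    AutomorphicQuotient.rightMul_one]
  right_inv q := by rw [← AutomorphicQuotient.rightMul_mul, inv_mul_cancel,
    AutomorphicQuotient.rightMul_one]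
  continuous_toFun := AutomorphicQuotient.continuous_rightMul.comp (Continuous.prodMk_left x)
  continuous_invFun := AutomorphicQuotient.continuous_rightMul.comp (Continuous.prodMk_left x⁻¹)

/-- Nonempty open sets have positive measure. -/
theorem IsQuotientHaar.isOpenPosMeasure {μ : Measure (AutomorphicQuotient G)}
    (hμ : IsQuotientHaar μ) : μ.IsOpenPosMeasure := by
  refine ⟨fun U hU hne h0 => hμ.ne_zero ?_⟩
  have := hμ.regular
  obtain ⟨q₀, hq₀⟩ := hne
  obtain ⟨g₀, rfl⟩ := AutomorphicQuotient.exists_rep q₀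
  rw [← Measure.measure_univ_eq_zero, isOpen_univ.measure_eq_iSup_isCompact]
  simp only [ENNReal.iSup_eq_zero]
  intro K _ hK
  -- `G(𝔸)` acts transitively, so translates of the null open set `U` give every point a null
  -- neighbourhood. Compact sets are then null, and regularity forces `μ = 0`.
  refine hK.measure_zero_of_nhdsWithin fun q _ => ?_
  obtain ⟨g, rfl⟩ := AutomorphicQuotient.exists_rep q
  let x : G.Adelic := g⁻¹ * g₀
  refine ⟨AutomorphicQuotient.rightMul x ⁻¹' U, mem_nhdsWithin_of_mem_nhds
    ((hU.preimage (rightMulHomeomorph x).continuous).mem_nhds ?_), ?_⟩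
  · have e : rightMulHomeomorph x (AutomorphicQuotient.mk g) = AutomorphicQuotient.mk g₀ :=
      congrArg AutomorphicQuotient.mk (mul_inv_cancel_left g g₀)
    rw [Set.mem_preimage, e]
    exact hq₀
  · rw [(hμ.measurePreserving x).measure_preimage hU.measurableSet.nullMeasurableSet, h0]

theorem invariant_of_mem_sup {A Y : Type*} [Group A] {F : A → Y} {Γ₁ Γ₂ : Subgroup A}
    (h₁ : ∀ γ ∈ Γ₁, ∀ a, F (γ * a) = F a) (h₂ : ∀ γ ∈ Γ₂, ∀ a, F (γ * a) = F a) :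
    ∀ γ ∈ Γ₁ ⊔ Γ₂, ∀ a, F (γ * a) = F a := by
  let S : Subgroup A :=
    { carrier := {γ | ∀ a, F (γ * a) = F a}
      one_mem' := fun a => by rw [one_mul]
      mul_mem' := fun {x y} hx hy a => by rw [mul_assoc, hx, hy]
      inv_mem' := fun {x} hx a => by rw [← hx (x⁻¹ * a), mul_inv_cancel_left] }
  have h : Γ₁ ⊔ Γ₂ ≤ S := sup_le h₁ h₂
  exact fun γ hγ => h hγ

variable {Kinf : Subgroup G.ArchPts} {χ : G.adelicCenter →* Circle} {f g : G.Adelic → ℂ}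

open scoped ComplexConjugate

/-- The function `conj f * g` descends to the automorphic quotient. -/
theorem IsAutomorphicFormWith.conj_mul_invariant (hf : IsAutomorphicFormWith Kinf χ f)
    (hg : IsAutomorphicFormWith Kinf χ g) : ∀ γ ∈ rationalCentral G, ∀ a,
      conj (f (γ * a)) * g (γ * a) = conj (f a) * g a := by
  refine invariant_of_mem_sup (F := fun a => conj (f a) * g a) ?_ ?_
  · rintro _ ⟨γ, rfl⟩ a
    simp only [hf.left_invariant, hg.left_invariant]
  · intro z hz a
    have h1 := hf.central ⟨z, hz⟩ a
    have h2 := hg.central ⟨z, hz⟩ a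
    simp only at h1 h2
    -- Unitarity of `χ`.
    have h3 : conj (χ ⟨z, hz⟩ : ℂ) * (χ ⟨z, hz⟩ : ℂ) = 1 := by
      rw [← Complex.normSq_eq_conj_mul_self, Circle.normSq_coe, Complex.ofReal_one]
    simp only [h1, h2, map_mul]
    linear_combination (conj (f a) * g a) * h3

theorem IsAutomorphicFormWith.out_mk (hf : IsAutomorphicFormWith Kinf χ f)
    (hg : IsAutomorphicFormWith Kinf χ g) (a : G.Adelic) :
    conj (f (Quotient.out (AutomorphicQuotient.mk a))) *
      g (Quotient.out (AutomorphicQuotient.mk a)) = conj (f a) * g a :=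
  (continuous_out_rightRel (rationalCentral G)
    ((Complex.continuous_conj.comp hf.continuous).mul hg.continuous)
    (hf.conj_mul_invariant hg)).1 a

theorem IsAutomorphicFormWith.continuous_out (hf : IsAutomorphicFormWith Kinf χ f)
    (hg : IsAutomorphicFormWith Kinf χ g) : Continuous fun q : AutomorphicQuotient G =>
    conj (f (Quotient.out q)) * g (Quotient.out q) :=
  (continuous_out_rightRel (rationalCentral G)
    ((Complex.continuous_conj.comp hf.continuous).mul hg.continuous)
    (hf.conj_mul_invariant hg)).2

theorem IsAutomorphicFormWith.continuous_norm_out (hf : IsAutomorphicFormWith Kinf χ f) :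
    Continuous fun q : AutomorphicQuotient G => ‖f (Quotient.out q)‖ := by
  have h := (hf.continuous_out hf).norm.sqrt
  refine h.congr fun q => ?_
  rw [norm_mul, RCLike.norm_conj, Real.sqrt_mul_self (norm_nonneg _)]

theorem IsAutomorphicFormWith.out_rightMul (hf : IsAutomorphicFormWith Kinf χ f)
    (hg : IsAutomorphicFormWith Kinf χ g) (x : G.Adelic) (q : AutomorphicQuotient G) :
    conj (f (Quotient.out (AutomorphicQuotient.rightMul x q))) *
      g (Quotient.out (AutomorphicQuotient.rightMul x q)) =
    conj (f (Quotient.out q * x)) * g (Quotient.out q * x) := by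
  have h : AutomorphicQuotient.mk (Quotient.out q) = q := Quotient.out_eq q
  conv_lhs => rw [← h, AutomorphicQuotient.rightMul_mk]
  exact hf.out_mk hg _

/-- A form with nontrivial central character does not descend to the quotient; products `f̄g` do, so
flow derivatives are taken of those. -/
theorem IsAutomorphicFormWith.isFlowDeriv (hf : IsAutomorphicFormWith Kinf χ f)
    (hg : IsAutomorphicFormWith Kinf χ g) (X : lieAlg H) :
    IsFlowDeriv (expFlow X)
      (fun q : AutomorphicQuotient G => conj (f (Quotient.out q)) * g (Quotient.out q))
      (fun q => conj (_root_.lieDeriv X f (Quotient.out q)) * g (Quotient.out q) +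
        conj (f (Quotient.out q)) * _root_.lieDeriv X g (Quotient.out q)) where
  continuous := hf.continuous_out hg
  continuous_deriv := ((hf.lieDeriv X).continuous_out hg).add (hf.continuous_out (hg.lieDeriv X))
  hasDerivAt q t := by
    simp only [expFlow]
    have e1 : (fun t : ℝ => conj (f (Quotient.out (AutomorphicQuotient.rightMul
        ((oneParam X t, 1) : G.Adelic) q))) * g (Quotient.out (AutomorphicQuotient.rightMul
        ((oneParam X t, 1) : G.Adelic) q))) = fun t => conj (f (Quotient.out q *
          (oneParam X t, 1))) * g (Quotient.out q * (oneParam X t, 1)) :=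
      funext fun t => hf.out_rightMul hg _ q
    rw [e1, (hf.lieDeriv X).out_rightMul hg, hf.out_rightMul (hg.lieDeriv X)]
    have h1 := smoothFunctions.hasDerivAt hf.smooth X (Quotient.out q) t
    have h2 := smoothFunctions.hasDerivAt hg.smooth X (Quotient.out q) t
    exact h1.star.mul h2

/-- Square-integrable automorphic forms with central character `χ`. -/
structure IsL2Form (μ : Measure (AutomorphicQuotient G)) (Kinf : Subgroup G.ArchPts)
    (χ : G.adelicCenter →* Circle) (f : G.Adelic → ℂ) : Prop where
  form : IsAutomorphicFormWith Kinf χ f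
  integrable : Integrable (fun q : AutomorphicQuotient G => ‖f (Quotient.out q)‖ ^ 2) μ

variable {μ : Measure (AutomorphicQuotient G)}

theorem IsAutomorphicFormWith.isL2Form (hf : IsAutomorphicFormWith Kinf χ f)
    (h : IsSquareIntegrable μ f) : IsL2Form μ Kinf χ f := by
  refine ⟨hf, (hf.continuous_norm_out.pow 2).aestronglyMeasurable, ?_⟩
  rw [HasFiniteIntegral]
  refine lt_of_le_of_lt (lintegral_mono fun q => ?_) h
  rw [enorm_pow, enorm_norm]

theorem IsL2Form.rightTranslation_of_form (hμ : IsQuotientHaar μ) (hf : IsL2Form μ Kinf χ f)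
    {x : G.Adelic} (h : IsAutomorphicFormWith Kinf χ (rightTranslation G x f)) :
    IsL2Form μ Kinf χ (rightTranslation G x f) := by
  refine ⟨h, ?_⟩
  refine ((hμ.measurePreserving x).integrable_comp_of_integrable hf.integrable).congr ?_
  refine Eventually.of_forall fun q => ?_
  have e := congrArg norm (hf.form.out_rightMul hf.form x q)
  rw [norm_mul, RCLike.norm_conj, norm_mul, RCLike.norm_conj] at e
  simp only [Function.comp, rightTranslation_apply, pow_two]
  exact e

theorem IsL2Form.integrable_mul (hf : IsL2Form μ Kinf χ f) (hg : IsL2Form μ Kinf χ g) :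
    Integrable (fun q : AutomorphicQuotient G =>
      conj (f (Quotient.out q)) * g (Quotient.out q)) μ := by
  refine (hf.integrable.add hg.integrable).mono'
    (hf.form.continuous_out hg.form).aestronglyMeasurable (Eventually.of_forall fun q => ?_)
  rw [norm_mul, RCLike.norm_conj, Pi.add_apply]
  nlinarith [sq_nonneg (‖f (Quotient.out q)‖ - ‖g (Quotient.out q)‖),
    sq_nonneg (‖f (Quotient.out q)‖ + ‖g (Quotient.out q)‖)]

end Petersson

/-! ### The Petersson product, skew-adjointness and elliptic regularity. -/

section PeterssonProduct

open scoped ComplexConjugate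

variable {F : Type u} [Field F] [NumberField F] {n : ℕ} {G : LinearAlgebraicGroup F n}
  {H : ClosedSubgroup G.ArchPts}
  {Kinf : Subgroup G.ArchPts} {χ : G.adelicCenter →* Circle} {f g : G.Adelic → ℂ}
  {μ : Measure (AutomorphicQuotient G)}

/-- The space of square-integrable automorphic forms with central character `χ`. -/
def l2Forms (μ : Measure (AutomorphicQuotient G)) (Kinf : Subgroup G.ArchPts)
    (χ : G.adelicCenter →* Circle)
    (hne : ∃ Kf : Subgroup G.FinPts, IsOpen (Kf : Set G.FinPts) ∧ IsCompact (Kf : Set G.FinPts)) :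
    Submodule ℂ (G.Adelic → ℂ) where
  carrier := {f | IsL2Form μ Kinf χ f}
  add_mem' := by
    intro f g hf hg
    have h : IsAutomorphicFormWith Kinf χ (f + g) :=
      (automorphicForms Kinf χ hne).add_mem hf.form hg.form
    refine ⟨h, ((hf.integrable.add hg.integrable).const_mul 2).mono'
      (h.continuous_norm_out.pow 2).aestronglyMeasurable (Eventually.of_forall fun q => ?_)⟩
    rw [Real.norm_of_nonneg (by positivity)]
    simp only [Pi.add_apply]
    have := norm_add_le (f (Quotient.out q)) (g (Quotient.out q))
    nlinarith [sq_nonneg (‖f (Quotient.out q)‖ - ‖g (Quotient.out q)‖),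
      norm_nonneg (f (Quotient.out q) + g (Quotient.out q))]
  zero_mem' := by
    refine ⟨(automorphicForms Kinf χ hne).zero_mem, ?_⟩
    simp
  smul_mem' := by
    intro c f hf
    refine ⟨(automorphicForms Kinf χ hne).smul_mem c hf.form, ?_⟩
    simp only [Pi.smul_apply, norm_smul, mul_pow]
    exact hf.integrable.const_mul _

theorem mem_l2Forms {hne : ∃ Kf : Subgroup G.FinPts, IsOpen (Kf : Set G.FinPts) ∧
    IsCompact (Kf : Set G.FinPts)} : f ∈ l2Forms μ Kinf χ hne ↔ IsL2Form μ Kinf χ f := Iff.rfl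

/-- The Petersson product. -/
def petersson (μ : Measure (AutomorphicQuotient G)) (f g : G.Adelic → ℂ) : ℂ :=
  ∫ q : AutomorphicQuotient G, conj (f (Quotient.out q)) * g (Quotient.out q) ∂μ

theorem conj_petersson (f g : G.Adelic → ℂ) :
    conj (petersson μ g f) = petersson μ f g := by
  rw [petersson, petersson, ← integral_conj]
  simp only [map_mul, Complex.conj_conj, mul_comm]

theorem petersson_smul_left (c : ℂ) (f g : G.Adelic → ℂ) :
    petersson μ (c • f) g = conj c * petersson μ f g := by
  rw [petersson, petersson, ← integral_const_mul]
  simp only [Pi.smul_apply, smul_eq_mul, map_mul, mul_assoc]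

theorem petersson_add_left {f₁ f₂ : G.Adelic → ℂ} (h₁ : IsL2Form μ Kinf χ f₁)
    (h₂ : IsL2Form μ Kinf χ f₂) (hg : IsL2Form μ Kinf χ g) :
    petersson μ (f₁ + f₂) g = petersson μ f₁ g + petersson μ f₂ g := by
  rw [petersson, petersson, petersson,
    ← integral_add (h₁.integrable_mul hg) (h₂.integrable_mul hg)]
  simp only [Pi.add_apply, map_add, add_mul]

theorem petersson_self (f : G.Adelic → ℂ) : petersson μ f f =
    ((∫ q : AutomorphicQuotient G, ‖f (Quotient.out q)‖ ^ 2 ∂μ : ℝ) : ℂ) := by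
  rw [petersson, ← integral_complex_ofReal]
  congr 1
  funext q
  rw [mul_comm, Complex.mul_conj, Complex.normSq_eq_norm_sq]

/-- `‖f‖²` is continuous on the quotient and vanishes almost everywhere, hence everywhere, since
nonempty open sets have positive measure. -/
theorem eq_zero_of_petersson_self (hμ : IsQuotientHaar μ) (hf : IsL2Form μ Kinf χ f)
    (h : petersson μ f f = 0) : f = 0 := by
  have := hμ.isOpenPosMeasure
  rw [petersson_self, Complex.ofReal_eq_zero,
    integral_eq_zero_iff_of_nonneg (fun q => by positivity) hf.integrable] at h
  have h2 := (hf.form.continuous_norm_out.pow 2).ae_eq_iff_eq μ continuous_const |>.mp h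
  funext a
  have h3 := hf.form.out_mk hf.form a
  have h4 : ‖f (Quotient.out (AutomorphicQuotient.mk a))‖ ^ 2 = 0 := congrFun h2 _
  have h5 : f (Quotient.out (AutomorphicQuotient.mk a)) = 0 := by simpa using h4
  rw [h5, mul_zero] at h3
  simpa using h3.symm

theorem petersson_rightTranslation (hμ : IsQuotientHaar μ) (hf : IsL2Form μ Kinf χ f)
    (hg : IsL2Form μ Kinf χ g) (x : G.Adelic) :
    petersson μ (rightTranslation G x f) (rightTranslation G x g) = petersson μ f g := by
  have h := (hμ.measurePreserving x).integral_comp (rightMulHomeomorph x).measurableEmbedding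
    (fun q : AutomorphicQuotient G => conj (f (Quotient.out q)) * g (Quotient.out q))
  rw [petersson, petersson, ← h]
  congr 1
  funext q
  exact (hf.form.out_rightMul hg.form x q).symm

variable [WeaklyLocallyCompactSpace G.FinPts]

/-- The Lie algebra acts by skew-adjoint operators. -/
theorem petersson_lieDeriv (hμ : IsQuotientHaar μ) (hf : IsL2Form μ Kinf χ f)
    (hg : IsL2Form μ Kinf χ g) (X : lieAlg H) (hXf : IsL2Form μ Kinf χ (lieDeriv X f))
    (hXg : IsL2Form μ Kinf χ (lieDeriv X g)) :
    petersson μ (lieDeriv X f) g = - petersson μ f (lieDeriv X g) := by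
  have := hμ.regular
  have h := integral_flowDeriv_eq_zero (μ := μ) (hasCutoffs_expFlow (fun _ : Unit => X)) (i := ())
    (isFlow_expFlow X) (fun t => hμ.measurePreserving _) (hf.form.isFlowDeriv hg.form X)
    (hf.integrable_mul hg) ((hXf.integrable_mul hg).add (hf.integrable_mul hXg))
  rw [integral_add (hXf.integrable_mul hg) (hf.integrable_mul hXg)] at h
  exact eq_neg_of_add_eq_zero_left h

/-- Square-integrability of first derivatives from an elliptic equation. -/
theorem isL2Form_lieDeriv_of_sum_eq {ι : Type*} [Fintype ι] (hμ : IsQuotientHaar μ)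
    (X : ι → lieAlg H) {h : ι → G.Adelic → ℂ} (hf : IsL2Form μ Kinf χ f)
    (hg : IsL2Form μ Kinf χ g) (hh : ∀ i, IsL2Form μ Kinf χ (h i))
    (heq : ∑ i, lieDeriv (X i) (lieDeriv (X i) f) = g + ∑ i, lieDeriv (X i) (h i)) (i : ι) :
    IsL2Form μ Kinf χ (lieDeriv (X i) f) := by
  have := hμ.regular
  refine ⟨hf.form.lieDeriv _, ?_⟩
  refine integrable_sq_deriv_of_sum_eq (μ := μ) (hasCutoffs_expFlow X)
    (fun i => isFlow_expFlow (X i)) (fun i t => hμ.measurePreserving _)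
    (f := fun q => f (Quotient.out q)) (g := fun q => g (Quotient.out q))
    (X := fun i q => lieDeriv (X i) f (Quotient.out q))
    (XX := fun i q => lieDeriv (X i) (lieDeriv (X i) f) (Quotient.out q))
    (h := fun i q => h i (Quotient.out q)) (Xh := fun i q => lieDeriv (X i) (h i) (Quotient.out q))
    (fun i => hf.form.isFlowDeriv (hf.form.lieDeriv _) _)
    (fun i => hf.form.isFlowDeriv (hh i).form _) (fun q => ?_)
    (fun i => (hf.form.lieDeriv _).continuous_norm_out) hf.integrable hg.integrable
    (fun i => (hh i).integrable) i
  have := congrFun heq (Quotient.out q)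
  simpa only [Finset.sum_apply, Pi.add_apply] using this

end PeterssonProduct

/-! ### Closed subgroups near the identity. -/

section Cartan

variable {B : Type*} [NormedRing B] [NormedAlgebra ℝ B] [FiniteDimensional ℝ B]

/-- Strict differentiability with derivative `1` bounds `exp x - exp y - (x - y)` by half of `‖x -
y‖` near zero. -/
theorem exp_injOn_nhds_zero [CompleteSpace B] : ∃ ε > 0, ∀ x y : B, ‖x‖ < ε → ‖y‖ < ε →
    NormedSpace.exp x = NormedSpace.exp y → x = y := by
  have h : HasStrictFDerivAt NormedSpace.exp (1 : B →L[ℝ] B) 0 := hasStrictFDerivAt_exp_zero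
  have h2 := h.isLittleO.def (show (0 : ℝ) < 1 / 2 by norm_num)
  rw [Metric.eventually_nhds_iff] at h2
  obtain ⟨ε, hε, h3⟩ := h2
  refine ⟨ε, hε, fun x y hx hy hxy => ?_⟩
  have h4 := h3 (y := (x, y)) (by
    rw [Prod.dist_eq]; exact max_lt (by simpa using hx) (by simpa using hy))
  simp only [hxy, sub_self, zero_sub, norm_neg, one_apply_eq_self] at h4
  have h5 : ‖x - y‖ = 0 := by linarith [norm_nonneg (x - y)]
  exact sub_eq_zero.mp (norm_eq_zero.mp h5)

/-- A sequence of small elements with exponentials in `S` produces a one-parameter subgroup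
of `S`. -/
theorem exp_mem_of_tendsto_direction [CompleteSpace B] {S : Set B}
    (hmul : ∀ x y : B, NormedSpace.exp x ∈ S → NormedSpace.exp y ∈ S →
      NormedSpace.exp x * NormedSpace.exp y ∈ S)
    (hone : (1 : B) ∈ S) (hneg : ∀ x : B, NormedSpace.exp x ∈ S → NormedSpace.exp (-x) ∈ S)
    (hcl : ∀ x : B, NormedSpace.exp x ∈ closure S → NormedSpace.exp x ∈ S)
    {y : ℕ → B} {z : B} (hy0 : ∀ m, y m ≠ 0) (hy : Tendsto y atTop (𝓝 0))
    (hyS : ∀ m, NormedSpace.exp (y m) ∈ S)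
    (hz : Tendsto (fun m => ‖y m‖⁻¹ • y m) atTop (𝓝 z)) (t : ℝ) :
    NormedSpace.exp (t • z) ∈ S := by
  let _ : NormedAlgebra ℚ B := NormedAlgebra.restrictScalars ℚ ℝ B
  have hnat : ∀ x : B, NormedSpace.exp x ∈ S → ∀ k : ℕ, NormedSpace.exp ((k : ℝ) • x) ∈ S := by
    intro x hx k
    induction k with
    | zero => simpa using hone
    | succ k ih =>
      have e : ((k + 1 : ℕ) : ℝ) • x = (k : ℝ) • x + x := by push_cast; rw [add_smul, one_smul]
      have hcomm : Commute ((k : ℝ) • x) x := (Commute.refl x).smul_left _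
      rw [e, NormedSpace.exp_add_of_commute hcomm]
      exact hmul _ _ ih hx
  have hint : ∀ x : B, NormedSpace.exp x ∈ S → ∀ k : ℤ, NormedSpace.exp ((k : ℝ) • x) ∈ S := by
    intro x hx k
    obtain ⟨m, rfl | rfl⟩ := k.eq_nat_or_neg
    · simpa using hnat x hx m
    · have := hneg _ (hnat x hx m)
      simpa using this
  -- Integer multiples of `y m` approximate `t • z`: replacing `t / ‖y m‖` by its integer part costs
  -- at most `‖y m‖`, which tends to zero.
  have hlim : Tendsto (fun m => ((⌊t / ‖y m‖⌋ : ℤ) : ℝ) • y m) atTop (𝓝 (t • z)) := by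
    have h1 : Tendsto (fun m => t • (‖y m‖⁻¹ • y m)) atTop (𝓝 (t • z)) := hz.const_smul t
    have h2 : Tendsto (fun m => Int.fract (t / ‖y m‖) • y m) atTop (𝓝 0) := by
      refine squeeze_zero_norm (fun m => ?_) (tendsto_norm_zero.comp hy)
      rw [norm_smul, Real.norm_of_nonneg (Int.fract_nonneg _)]
      exact mul_le_of_le_one_left (norm_nonneg _) (Int.fract_lt_one _).le
    have h3 := h1.sub h2
    rw [sub_zero] at h3
    refine h3.congr fun m => ?_
    rw [smul_smul, ← sub_smul, ← div_eq_mul_inv, Int.self_sub_fract]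
  refine hcl _ (mem_closure_of_tendsto
    ((NormedSpace.exp_continuous.tendsto _).comp hlim) (Eventually.of_forall fun m => ?_))
  exact hint _ (hyS m) _

/-- Near the identity, a closed subgroup consists of exponentials of small elements of its
Lie algebra. -/
theorem exists_exp_eq_of_closed [CompleteSpace B] {S : Set B} {h : Submodule ℝ B}
    (hh : ∀ x, (∀ t : ℝ, NormedSpace.exp (t • x) ∈ S) ↔ x ∈ h)
    (hmul : ∀ x ∈ S, ∀ y ∈ S, x * y ∈ S)
    (hone : (1 : B) ∈ S) (hneg : ∀ x : B, NormedSpace.exp x ∈ S → NormedSpace.exp (-x) ∈ S)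
    (hcl : ∀ x : B, NormedSpace.exp x ∈ closure S → NormedSpace.exp x ∈ S) {ε : ℝ} (hε : 0 < ε) :
    ∀ᶠ s in 𝓝 (1 : B), s ∈ S → ∃ x ∈ h, ‖x‖ < ε ∧ s = NormedSpace.exp x := by
  let _ : NormedAlgebra ℚ B := NormedAlgebra.restrictScalars ℚ ℝ B
  obtain ⟨m, hm⟩ := Submodule.exists_isCompl h
  -- Otherwise the directions of ever smaller counterexamples in `m` accumulate at a unit vector. It
  -- lies in `m`, and it generates a one-parameter group in `S`, so it lies in `h` as well, which is
  -- absurd.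
  have key : ∃ δ > 0, ∀ y ∈ m, ‖y‖ < δ → NormedSpace.exp y ∈ S → y = 0 := by
    by_contra! hcon
    choose y hym hyn hyS hy0 using fun k : ℕ => hcon (1 / ((k : ℝ) + 1)) (by positivity)
    have hy : Tendsto y atTop (𝓝 0) := squeeze_zero_norm (fun k => (hyn k).le)
      tendsto_one_div_add_atTop_nhds_zero_nat
    have : ProperSpace B := FiniteDimensional.proper ℝ B
    obtain ⟨z, hz, φ, hφ, hlim⟩ := (isCompact_sphere (0 : B) 1).tendsto_subseq
      (x := fun k => ‖y k‖⁻¹ • y k) (fun k => by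
        rw [mem_sphere_zero_iff_norm, norm_smul, norm_inv, norm_norm,
          inv_mul_cancel₀ (norm_ne_zero_iff.mpr (hy0 k))])
    have hzm : z ∈ m := (Submodule.closed_of_finiteDimensional m).mem_of_tendsto hlim
      (Eventually.of_forall fun k => m.smul_mem _ (hym _))
    have hzh : z ∈ h := (hh z).mp fun t => exp_mem_of_tendsto_direction
      (fun x y hx hy => hmul _ hx _ hy) hone hneg hcl
      (y := y ∘ φ) (fun k => hy0 _) (hy.comp hφ.tendsto_atTop) (fun k => hyS _) hlim t
    have hz0 : z = 0 := (Submodule.disjoint_def.mp hm.disjoint) z hzh hzm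
    rw [mem_sphere_zero_iff_norm, hz0, norm_zero] at hz
    exact zero_ne_one hz
  obtain ⟨δ, hδ, hkey⟩ := key
  let e := (Submodule.prodEquivOfIsCompl h m hm).toContinuousLinearEquiv
  have hexp : HasStrictFDerivAt NormedSpace.exp (1 : B →L[ℝ] B) 0 := hasStrictFDerivAt_exp_zero
  have h1 : HasStrictFDerivAt (fun p : h × m => NormedSpace.exp (p.1 : B))
      (h.subtypeL.comp (ContinuousLinearMap.fst ℝ h m)) 0 := by
    have h0 : HasStrictFDerivAt (fun p : h × m => (p.1 : B))
      (h.subtypeL.comp (ContinuousLinearMap.fst ℝ h m)) 0 :=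
      (h.subtypeL.comp (ContinuousLinearMap.fst ℝ h m)).hasStrictFDerivAt
    exact HasStrictFDerivAt.comp (0 : h × m) (g := NormedSpace.exp) (by simpa using hexp) h0
  have h2 : HasStrictFDerivAt (fun p : h × m => NormedSpace.exp (p.2 : B))
      (m.subtypeL.comp (ContinuousLinearMap.snd ℝ h m)) 0 := by
    have h0 : HasStrictFDerivAt (fun p : h × m => (p.2 : B))
      (m.subtypeL.comp (ContinuousLinearMap.snd ℝ h m)) 0 :=
      (m.subtypeL.comp (ContinuousLinearMap.snd ℝ h m)).hasStrictFDerivAt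
    exact HasStrictFDerivAt.comp (0 : h × m) (g := NormedSpace.exp) (by simpa using hexp) h0
  -- The map `(x, y) ↦ exp x · exp y` on `h × m` has an invertible derivative at zero, so its values
  -- fill a neighbourhood of `1`.
  have h3 : HasStrictFDerivAt (fun p : h × m => NormedSpace.exp (p.1 : B) *
      NormedSpace.exp (p.2 : B)) (e : h × m →L[ℝ] B) 0 := by
    refine (h1.mul' h2).congr_fderiv ?_
    ext p <;> simp [e]
  have hmap := h3.map_nhds_eq_of_equiv
  simp only [Prod.fst_zero, Prod.snd_zero, ZeroMemClass.coe_zero, NormedSpace.exp_zero,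
    mul_one] at hmap
  rw [← hmap, eventually_map]
  have hball : ∀ᶠ p : h × m in 𝓝 0, ‖p.1‖ < ε ∧ ‖p.2‖ < δ := by
    have hc1 : Continuous fun p : h × m => ‖p.1‖ := continuous_fst.norm
    have hc2 : Continuous fun p : h × m => ‖p.2‖ := continuous_snd.norm
    refine (hc1.continuousAt.eventually_lt continuousAt_const ?_).and
      (hc2.continuousAt.eventually_lt continuousAt_const ?_)
    · simpa using hε
    · simpa using hδ
  filter_upwards [hball] with p hp hpS
  have hxS : NormedSpace.exp (p.1 : B) ∈ S := by
    have := (hh p.1).mpr p.1.2 1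
    rwa [one_smul] at this
  have hyS : NormedSpace.exp (p.2 : B) ∈ S := by
    have h4 := hmul _ (hneg _ hxS) _ hpS
    rwa [← mul_assoc, ← NormedSpace.exp_add_of_commute (Commute.refl (p.1 : B)).neg_left,
      neg_add_cancel, NormedSpace.exp_zero, one_mul] at h4
  have hy0 : (p.2 : B) = 0 := hkey _ p.2.2 hp.2 hyS
  exact ⟨p.1, p.1.2, hp.1, by rw [hy0, NormedSpace.exp_zero, mul_one]⟩

end Cartan

/-- An uncountable family in a second countable space accumulates at one of its members. -/
theorem exists_forall_nhds_exists_ne {ι Y : Type*} [Uncountable ι] [TopologicalSpace Y]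
    [SecondCountableTopology Y] (y : ι → Y) :
    ∃ t₀, ∀ U ∈ 𝓝 (y t₀), ∃ t, t ≠ t₀ ∧ y t ∈ U := by
  by_contra! h
  choose U hU hne using h
  have hb := TopologicalSpace.isBasis_countableBasis Y
  choose V hV hyV hVU using fun t => hb.mem_nhds_iff.mp (hU t)
  have hinj : Function.Injective fun t => (⟨V t, hV t⟩ : TopologicalSpace.countableBasis Y) := by
    intro s t hst
    by_contra hs
    have e : V s = V t := congrArg Subtype.val hst
    exact hne t s hs (hVU t (e ▸ hyV s))
  have := (TopologicalSpace.countable_countableBasis Y).to_subtype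
  exact not_countable hinj.countable

theorem mul_mul_inv_of_commute {A : Type*} [Group A] {z g z₀ g₀ : A}
    (h : ∀ x, z₀⁻¹ * x = x * z₀⁻¹) : z * g * (z₀ * g₀)⁻¹ = z * z₀⁻¹ * (g * g₀⁻¹) := by
  rw [mul_assoc z z₀⁻¹, h, mul_inv_rev]
  simp only [mul_assoc]

/-! ### Exponential generation, and the Lie algebra of a product `ZG'`. -/

section ClosedSubgroups

open scoped Classical

variable {F : Type u} [Field F] [NumberField F] {n : ℕ} {G : LinearAlgebraicGroup F n}
  {H : ClosedSubgroup G.ArchPts}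

attribute [local instance] Matrix.linftyOpNormedRing Matrix.linftyOpNormedAlgebra

/-- `H` is closed in `G(𝔸_∞)`, not in the space of matrices; a limit of the form `exp x` is
invertible, so the convergence takes place inside the group. -/
theorem exp_mem_of_mem_closure (H : ClosedSubgroup G.ArchPts)
    (x : Matrix (Fin n) (Fin n) (ArchAdele F))
    (hx : NormedSpace.exp x ∈ closure (archMatrix '' (H : Set G.ArchPts))) :
    NormedSpace.exp x ∈ archMatrix '' (H : Set G.ArchPts) := by
  let _ : NormedAlgebra ℚ (Matrix (Fin n) (Fin n) (ArchAdele F)) :=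
    NormedAlgebra.restrictScalars ℚ ℝ _
  have : FrechetUrysohnSpace (Matrix (Fin n) (Fin n) (ArchAdele F)) :=
    inferInstanceAs (FrechetUrysohnSpace (Fin n → Fin n → ArchAdele F))
  rw [mem_closure_iff_seq_limit] at hx
  obtain ⟨s, hs, hlim⟩ := hx
  choose h hh hhs using hs
  rcases isEmpty_or_nonempty (Fin n) with hn | hn
  · exact ⟨1, one_mem H, Subsingleton.elim _ _⟩
  obtain ⟨u, hu⟩ := NormedSpace.isUnit_exp x
  have hlim' : Tendsto (fun m => ((h m : G.ArchPts) : GL (Fin n) (ArchAdele F))) atTop (𝓝 u) := by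
    refine Units.isOpenEmbedding_val.isEmbedding.tendsto_nhds_iff.mpr ?_
    rw [hu]
    exact hlim.congr fun m => (hhs m).symm
  have hu' : u ∈ G.points (ArchAdele F) :=
    (isClosed_points G).mem_of_tendsto hlim' (Eventually.of_forall fun m => (h m).2)
  have hlim'' : Tendsto h atTop (𝓝 (⟨u, hu'⟩ : G.ArchPts)) :=
    tendsto_subtype_rng.mpr hlim'
  exact ⟨⟨u, hu'⟩, H.isClosed'.mem_of_tendsto hlim'' (Eventually.of_forall hh), hu⟩

/-- Near the identity, a closed subgroup consists of exponentials of small elements of its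
Lie algebra. -/
theorem exists_oneParam_eq (H : ClosedSubgroup G.ArchPts) {ε : ℝ} (hε : 0 < ε) :
    ∀ᶠ g in 𝓝 (1 : G.ArchPts), g ∈ H → ∃ X : lieAlg H,
      ‖(X : Matrix (Fin n) (Fin n) (ArchAdele F))‖ < ε ∧ g = oneParam X 1 := by
  have h := exists_exp_eq_of_closed (S := archMatrix '' (H : Set G.ArchPts))
    (h := lieSubmodule H) (fun x => Iff.rfl) ?_ ⟨1, one_mem H, archMatrix_one⟩ ?_
    (exp_mem_of_mem_closure H) hε
  · have hc : Tendsto (archMatrix (G := G)) (𝓝 1) (𝓝 1) :=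
      continuous_archMatrix.tendsto' 1 1 archMatrix_one
    filter_upwards [hc.eventually h] with g hg hgH
    obtain ⟨x, hx, hxε, e⟩ := hg ⟨g, hgH, rfl⟩
    refine ⟨⟨x, hx⟩, hxε, archMatrix_injective ?_⟩
    rw [e, archMatrix_oneParam, one_smul]
    rfl
  · rintro _ ⟨a, ha, rfl⟩ _ ⟨b, hb, rfl⟩
    exact ⟨a * b, mul_mem ha hb, archMatrix_mul a b⟩
  · rintro x ⟨a, ha, e⟩
    refine ⟨a⁻¹, inv_mem ha, ?_⟩
    have h3 : archMatrix a * NormedSpace.exp (-x) = 1 := by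
      have := exp_smul_mul_exp_smul_neg x 1
      rw [e]
      rwa [one_smul, one_smul] at this
    have h4 : archMatrix a⁻¹ * archMatrix a = 1 := by
      rw [← archMatrix_mul, inv_mul_cancel, archMatrix_one]
    exact left_inv_eq_right_inv h4 h3

theorem oneParam_mem_identityComponent (X : lieAlg H) (t : ℝ) : oneParam X t ∈
    (Subgroup.connectedComponentOfOne H.toSubgroup).map H.toSubgroup.subtype := by
  let γ : ℝ → H.toSubgroup := fun t => ⟨oneParam X t, oneParam_mem X t⟩
  have hγ : Continuous γ := (continuous_oneParam X).subtype_mk _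
  refine ⟨γ t, ?_, rfl⟩
  have h0 : γ 0 = 1 := Subtype.ext (oneParam_zero X)
  have hc : IsPreconnected (Set.range γ) := isPreconnected_range hγ
  exact hc.subset_connectedComponent ⟨0, h0⟩ ⟨t, rfl⟩

/-- The identity component of a closed subgroup is generated by exponentials. -/
theorem identityComponent_le_closure (H : ClosedSubgroup G.ArchPts) :
    (Subgroup.connectedComponentOfOne H.toSubgroup).map H.toSubgroup.subtype ≤
      Subgroup.closure (Set.range fun X : lieAlg H => oneParam X 1) := by
  let C := (Subgroup.closure (Set.range fun X : lieAlg H => oneParam X 1)).comap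
    H.toSubgroup.subtype
  have hopen : IsOpen (C : Set H.toSubgroup) := by
    refine Subgroup.isOpen_of_mem_nhds C (g := 1) ?_
    have hc : Tendsto (fun g : H.toSubgroup => (g : G.ArchPts)) (𝓝 1) (𝓝 1) :=
      continuous_subtype_val.tendsto' 1 1 rfl
    have h1 := exists_oneParam_eq H (one_pos (α := ℝ))
    filter_upwards [hc.eventually h1] with g hg
    obtain ⟨X, -, e⟩ := hg g.2
    have h2 : (g : G.ArchPts) ∈ Subgroup.closure (Set.range fun X : lieAlg H => oneParam X 1) := by
      rw [e]
      exact Subgroup.subset_closure ⟨X, rfl⟩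
    exact h2
  have hclopen : IsClopen (C : Set H.toSubgroup) := ⟨C.isClosed_of_isOpen hopen, hopen⟩
  rintro _ ⟨g, hg, rfl⟩
  exact hclopen.connectedComponent_subset (one_mem C) hg

instance : SecondCountableTopology G.ArchPts := by
  have : SecondCountableTopology (Matrix (Fin n) (Fin n) (ArchAdele F)) :=
    inferInstanceAs (SecondCountableTopology (Fin n → Fin n → ArchAdele F))
  exact isEmbedding_archMatrix.secondCountableTopology

/-- Differentiation at zero in `s`, and afterwards in `t`. -/
theorem commute_of_commute_oneParam {H₁ H₂ : ClosedSubgroup G.ArchPts} (a : lieAlg H₁)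
    (b : lieAlg H₂) (h : ∀ s t, oneParam a s * oneParam b t = oneParam b t * oneParam a s) :
    Commute (a : Matrix (Fin n) (Fin n) (ArchAdele F)) b := by
  have h1 : ∀ t, (a : Matrix (Fin n) (Fin n) (ArchAdele F)) * archMatrix (oneParam b t) =
      archMatrix (oneParam b t) * a := by
    intro t
    have e1 := (hasDerivAt_archMatrix_oneParam a 0).mul_const (archMatrix (oneParam b t))
    have e2 := (hasDerivAt_archMatrix_oneParam a 0).const_mul (archMatrix (oneParam b t))
    simp only [← archMatrix_mul, h] at e1
    have e3 := e1.unique e2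
    rwa [oneParam_zero, archMatrix_one, one_mul] at e3
  have e1 := (hasDerivAt_archMatrix_oneParam b 0).const_mul
    (a : Matrix (Fin n) (Fin n) (ArchAdele F))
  have e2 := (hasDerivAt_archMatrix_oneParam b 0).mul_const
    (a : Matrix (Fin n) (Fin n) (ArchAdele F))
  simp only [h1] at e1
  have e3 := e1.unique e2
  rwa [oneParam_zero, archMatrix_one, one_mul] at e3

/-- If `G(𝔸_∞) = ZG'` with a central subgroup `Z`, then the Lie algebra of `G(𝔸_∞)` is the sum of
those of the closure of `Z` and of `G'`. -/
theorem exists_lieAlg_add (Z : Subgroup G.ArchPts) (hZ : ∀ z ∈ Z, ∀ g, z * g = g * z)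
    (Zc : ClosedSubgroup G.ArchPts) (hZc : Z ≤ Zc.toSubgroup)
    (hZcc : ∀ z ∈ Zc, ∀ g, z * g = g * z)
    (G' : ClosedSubgroup G.ArchPts) (hsup : Z ⊔ G'.toSubgroup = ⊤) (X : lieAlg H) :
    ∃ (a : lieAlg Zc) (b : lieAlg G'),
      (X : Matrix (Fin n) (Fin n) (ArchAdele F)) = a + b := by
  let _ : NormedAlgebra ℚ (Matrix (Fin n) (Fin n) (ArchAdele F)) :=
    NormedAlgebra.restrictScalars ℚ ℝ _
  have hnormal : Z.Normal := ⟨fun z hz g => by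
    rw [← hZ z hz g, mul_assoc, mul_inv_cancel, mul_one]; exact hz⟩
  have hdec : ∀ x : G.ArchPts, ∃ z ∈ Z, ∃ g ∈ G'.toSubgroup, z * g = x := fun x => by
    have hx : x ∈ Z ⊔ G'.toSubgroup := by rw [hsup]; trivial
    exact Subgroup.mem_sup_of_normal_left.mp hx
  choose z hz g hg hzg using fun t : ℝ => hdec (oneParam X t)
  -- The factors of `exp(tX)` need not depend continuously on `t`. Uncountability of `ℝ` and second
  -- countability replace continuity: there are `t ≠ t₀` for which `t`, `z t` and `g t` are all
  -- close to their values at `t₀`.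
  obtain ⟨t₀, ht₀⟩ := exists_forall_nhds_exists_ne
    (fun t : ℝ => ((t, z t, g t) : ℝ × G.ArchPts × G.ArchPts))
  obtain ⟨ε, hε, hinj⟩ := exp_injOn_nhds_zero (B := Matrix (Fin n) (Fin n) (ArchAdele F))
  have hε2 : 0 < ε / 2 := by positivity
  let x : ℝ → Matrix (Fin n) (Fin n) (ArchAdele F) := fun s => (s - t₀) • X.1
  have hxc : Continuous x := by fun_prop
  have h1 : ∀ᶠ s in 𝓝 t₀, ‖x s‖ < ε := by
    refine hxc.norm.continuousAt.eventually_lt continuousAt_const ?_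
    simpa [x] using hε
  have h2 : ∀ᶠ w in 𝓝 (z t₀), w * (z t₀)⁻¹ ∈ Zc → ∃ a : lieAlg Zc,
      ‖(a : Matrix (Fin n) (Fin n) (ArchAdele F))‖ < ε / 2 ∧ w * (z t₀)⁻¹ = oneParam a 1 :=
    ((continuous_mul_const (z t₀)⁻¹).tendsto' (z t₀) 1 (mul_inv_cancel _)).eventually
      (exists_oneParam_eq Zc hε2)
  have h3 : ∀ᶠ w in 𝓝 (g t₀), w * (g t₀)⁻¹ ∈ G' → ∃ a : lieAlg G',
      ‖(a : Matrix (Fin n) (Fin n) (ArchAdele F))‖ < ε / 2 ∧ w * (g t₀)⁻¹ = oneParam a 1 :=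
    ((continuous_mul_const (g t₀)⁻¹).tendsto' (g t₀) 1 (mul_inv_cancel _)).eventually
      (exists_oneParam_eq G' hε2)
  obtain ⟨t, htne, ht1, ht2, ht3⟩ := ht₀ _ (prod_mem_nhds h1 (prod_mem_nhds h2 h3))
  obtain ⟨a, ha, hae⟩ := ht2 (mul_mem (hZc (hz t)) (inv_mem (hZc (hz t₀))))
  obtain ⟨b, hb, hbe⟩ := ht3 (mul_mem (hg t) (inv_mem (hg t₀)))
  have hcomm : Commute (a : Matrix (Fin n) (Fin n) (ArchAdele F)) b :=
    commute_of_commute_oneParam a b fun s t => hZcc _ (oneParam_mem a s) _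
  have hprod : oneParam X (t - t₀) = oneParam a 1 * oneParam b 1 := by
    rw [sub_eq_add_neg, oneParam_add, oneParam_neg, ← hzg t, ← hzg t₀, ← hae, ← hbe]
    exact mul_mul_inv_of_commute (hZ _ (inv_mem (hz t₀)))
  have hexp : NormedSpace.exp (x t) =
      NormedSpace.exp ((a : Matrix (Fin n) (Fin n) (ArchAdele F)) + b) := by
    have e := congrArg archMatrix hprod
    rw [archMatrix_mul, archMatrix_oneParam, archMatrix_oneParam, archMatrix_oneParam, one_smul,
      one_smul] at e
    exact e.trans (NormedSpace.exp_add_of_commute hcomm).symm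
  -- Both exponents are small, so equality of exponentials gives `(t - t₀)X = a + b`.
  have hx := hinj _ _ ht1 ((norm_add_le _ _).trans_lt (by linarith)) hexp
  have hne : t - t₀ ≠ 0 := sub_ne_zero.mpr htne
  refine ⟨(t - t₀)⁻¹ • a, (t - t₀)⁻¹ • b, ?_⟩
  have e : (t - t₀)⁻¹ • x t = X.1 := by
    simp only [x]
    rw [smul_smul, inv_mul_cancel₀ hne, one_smul]
  rw [← e, hx, smul_add]
  rfl

end ClosedSubgroups

/-! ### Central directions act by scalars. -/

section CentralDirections

variable {F : Type u} [Field F] [NumberField F] {n : ℕ} {G : LinearAlgebraicGroup F n}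

theorem mul_comm_of_mem_center {z : G.ArchPts} (hz : z ∈ G.center (ArchAdele F)) (g : G.ArchPts) :
    z * g = g * z := by
  have h := hz (ArchAdele F) (AlgHom.id F _) g
  have e : ∀ x : G.ArchPts, G.map (AlgHom.id F (ArchAdele F)) x = x := by
    intro x
    apply archMatrix_injective
    ext i j <;> rfl
  rwa [e] at h

/-- The closure of a subgroup. -/
def closedClosure (Z : Subgroup G.ArchPts) : ClosedSubgroup G.ArchPts where
  __ := Z.topologicalClosure
  isClosed' := Z.isClosed_topologicalClosure

theorem mul_comm_of_mem_closedClosure {Z : Subgroup G.ArchPts}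
    (hZ : ∀ z ∈ Z, ∀ g, z * g = g * z) : ∀ z ∈ closedClosure Z, ∀ g, z * g = g * z := by
  intro z hz g
  have hcl : IsClosed {z : G.ArchPts | z * g = g * z} :=
    isClosed_eq (continuous_mul_const g) (continuous_const_mul g)
  exact closure_minimal (fun z hz => hZ z hz g) hcl hz

/-- Central directions act on automorphic forms by scalars. -/
theorem IsAutomorphicFormWith.lieDeriv_central {Kinf : Subgroup G.ArchPts}
    {χ : G.adelicCenter →* Circle} {f : G.Adelic → ℂ} (hf : IsAutomorphicFormWith Kinf χ f)
    {Z : Subgroup G.ArchPts} (hZ : Z ≤ G.center (ArchAdele F)) (a : lieAlg (closedClosure Z)) :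
    ∃ c : ℂ, _root_.lieDeriv a f = c • f := by
  -- Cross-multiplied form of "`z` acts by a scalar": it avoids `χ`, and it is a closed condition on
  -- `z`, so it extends from `Z` to the closure.
  have hscal : ∀ z ∈ closedClosure Z, ∀ g g₀ : G.Adelic,
      f (((z, 1) : G.Adelic) * g) * f g₀ = f (((z, 1) : G.Adelic) * g₀) * f g := by
    intro z hz g g₀
    have hc : ∀ g : G.Adelic, Continuous fun z : G.ArchPts => f (((z, 1) : G.Adelic) * g) :=
      fun g => hf.continuous.comp
        ((continuous_id.prodMk continuous_const).mul continuous_const)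
    have hcl : IsClosed {z : G.ArchPts | f (((z, 1) : G.Adelic) * g) * f g₀ =
        f (((z, 1) : G.Adelic) * g₀) * f g} :=
      isClosed_eq ((hc g).mul continuous_const) ((hc g₀).mul continuous_const)
    refine closure_minimal (fun z hz => ?_) hcl hz
    have h1 := fun g => hf.central ⟨(z, 1), hZ hz, one_mem _⟩ g
    simp only at h1
    simp only [Set.mem_ofPred_eq, h1]
    ring
  have hcomm : ∀ (g : G.Adelic) (t : ℝ), g * (oneParam a t, 1) = (oneParam a t, 1) * g := by
    intro g t
    have h := mul_comm_of_mem_closedClosure (fun z hz => mul_comm_of_mem_center (hZ hz))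
      _ (oneParam_mem a t) g.1
    refine Prod.ext h.symm ?_
    exact (mul_one g.2).trans (one_mul g.2).symm
  by_cases h0 : f = 0
  · refine ⟨0, ?_⟩
    rw [h0, zero_smul]
    have := lieDeriv_smul 0 (0 : G.Adelic → ℂ) a
    simpa using this
  obtain ⟨g₀, hg₀⟩ := Function.ne_iff.mp h0
  simp only [Pi.zero_apply] at hg₀
  refine ⟨_root_.lieDeriv a f g₀ / f g₀, funext fun g => ?_⟩
  have h1 : _root_.lieDeriv a f g * f g₀ = _root_.lieDeriv a f g₀ * f g := by
    simp only [_root_.lieDeriv]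
    rw [← deriv_mul_const_field, ← deriv_mul_const_field]
    simp only [hcomm, hscal _ (oneParam_mem a _) g g₀]
  rw [Pi.smul_apply, smul_eq_mul, div_mul_eq_mul_div, eq_div_iff hg₀, h1]

end CentralDirections

/-! ### Averaging and differentiating in vector spaces without topology. -/

section Expansions

variable {𝕜 : Type*} [RCLike 𝕜] {X Y Z : Type*} [AddCommGroup X] [Module 𝕜 X]
  [AddCommGroup Y] [Module 𝕜 Y] [AddCommGroup Z] [Module 𝕜 Z]

/-- Maps `k ↦ ∑ f_j(k) e_j` into a vector space with continuous coefficients `f_j`. -/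
def continuousExpansions (𝕜 : Type*) [RCLike 𝕜] (K X : Type*) [TopologicalSpace K]
    [AddCommGroup X] [Module 𝕜 X] : Submodule 𝕜 (K → X) :=
  Submodule.span 𝕜 {c | ∃ (f : K → 𝕜) (e : X), Continuous f ∧ c = fun k => f k • e}

/-- Pairs of a curve `t ↦ ∑ f_j(t) e_j` with coefficients `f_j` differentiable at `0` and its
derivative at `0`. -/
def derivExpansions (𝕜 : Type*) [RCLike 𝕜] (X : Type*) [AddCommGroup X] [Module 𝕜 X] :
    Submodule 𝕜 ((ℝ → X) × X) :=
  Submodule.span 𝕜 {c | ∃ (f : ℝ → 𝕜) (f' : 𝕜) (e : X), HasDerivAt f f' 0 ∧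
    c = (fun t => f t • e, f' • e)}

section Continuous

variable {K K' : Type*} [TopologicalSpace K] [TopologicalSpace K']

theorem smul_mem_continuousExpansions {f : K → 𝕜} (hf : Continuous f) (e : X) :
    (fun k => f k • e) ∈ continuousExpansions 𝕜 K X :=
  Submodule.subset_span ⟨f, e, hf, rfl⟩

theorem const_mem_continuousExpansions (e : X) :
    (fun _ => e) ∈ continuousExpansions 𝕜 K X := by
  simpa using smul_mem_continuousExpansions (𝕜 := 𝕜) (K := K) (f := fun _ => 1) continuous_const e

theorem map_mem_continuousExpansions (A : X →ₗ[𝕜] Y) {c : K → X}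
    (hc : c ∈ continuousExpansions 𝕜 K X) :
    (fun k => A (c k)) ∈ continuousExpansions 𝕜 K Y := by
  induction hc using Submodule.span_induction with
  | mem c h =>
    obtain ⟨f, e, hf, rfl⟩ := h
    simpa using smul_mem_continuousExpansions hf (A e)
  | zero => simpa using const_mem_continuousExpansions (0 : Y)
  | add c d _ _ hc hd =>
    refine (congrArg (· ∈ continuousExpansions 𝕜 K _) (funext fun k => ?_)).mp (add_mem hc hd)
    simp
  | smul a c _ hc =>
    refine (congrArg (· ∈ continuousExpansions 𝕜 K _) (funext fun k => ?_)).mp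
      (Submodule.smul_mem _ a hc)
    simp

theorem map₂_mem_continuousExpansions (β : X →ₗ[𝕜] Y →ₗ[𝕜] Z) {c : K → X} {d : K → Y}
    (hc : c ∈ continuousExpansions 𝕜 K X) (hd : d ∈ continuousExpansions 𝕜 K Y) :
    (fun k => β (c k) (d k)) ∈ continuousExpansions 𝕜 K Z := by
  induction hc using Submodule.span_induction with
  | mem c h =>
    obtain ⟨f, e, hf, rfl⟩ := h
    induction hd using Submodule.span_induction with
    | mem d h =>
      obtain ⟨g, e', hg, rfl⟩ := h
      simpa [smul_smul] using smul_mem_continuousExpansions (hg.mul hf) (β e e')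
    | zero => simpa using const_mem_continuousExpansions (0 : Z)
    | add c d _ _ hc hd =>
      refine (congrArg (· ∈ continuousExpansions 𝕜 K _) (funext fun k => ?_)).mp (add_mem hc hd)
      simp
    | smul a c _ hc =>
      have := Submodule.smul_mem _ a hc
      refine (congrArg (· ∈ continuousExpansions 𝕜 K Z) ?_).mp this
      funext k
      simp
  | zero => simpa using const_mem_continuousExpansions (0 : Z)
  | add c d _ _ hc hd =>
    refine (congrArg (· ∈ continuousExpansions 𝕜 K _) (funext fun k => ?_)).mp (add_mem hc hd)
    simp
  | smul a c _ hc =>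
    refine (congrArg (· ∈ continuousExpansions 𝕜 K _) (funext fun k => ?_)).mp
      (Submodule.smul_mem _ a hc)
    simp

theorem continuousExpansions_of_basis {ι : Type*} [Finite ι] (b : Module.Basis ι 𝕜 X) {c : K → X}
    (h : ∀ i, Continuous fun k => b.repr (c k) i) : c ∈ continuousExpansions 𝕜 K X := by
  have := Fintype.ofFinite ι
  have e : c = ∑ i, fun k => b.repr (c k) i • b i := by
    funext k
    rw [Finset.sum_apply, b.sum_repr]
  rw [e]
  exact Submodule.sum_mem _ fun i _ => smul_mem_continuousExpansions (h i) (b i)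

/-- A finite expansion is integrated coefficient by coefficient, so a weak integral exists in any
vector space. This is needed for the infinite-dimensional space `𝒰(𝔤'_ℂ) ⊗ τ`. -/
theorem exists_integral_of_mem_continuousExpansions [CompactSpace K] [MeasurableSpace K]
    [BorelSpace K] (μ : Measure K) [IsFiniteMeasure μ] {c : K → X}
    (hc : c ∈ continuousExpansions 𝕜 K X) :
    ∃ x : X, ∀ l : X →ₗ[𝕜] 𝕜, Continuous (fun k => l (c k)) ∧ l x = ∫ k, l (c k) ∂μ := by
  have hint : ∀ {f : K → 𝕜}, Continuous f → Integrable f μ := fun hf =>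
    hf.integrable_of_hasCompactSupport (HasCompactSupport.of_compactSpace _)
  induction hc using Submodule.span_induction with
  | mem c h =>
    obtain ⟨f, e, hf, rfl⟩ := h
    refine ⟨(∫ k, f k ∂μ) • e, fun l => ?_⟩
    simp only [map_smul, smul_eq_mul, integral_mul_const, and_true]
    exact hf.mul continuous_const
  | zero => exact ⟨0, fun l => by simpa using continuous_const⟩
  | add c d _ _ hc hd =>
    obtain ⟨x, hx⟩ := hc
    obtain ⟨y, hy⟩ := hd
    refine ⟨x + y, fun l => ?_⟩
    simp only [map_add, Pi.add_apply]
    rw [integral_add (hint (hx l).1) (hint (hy l).1), (hx l).2, (hy l).2]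
    exact ⟨(hx l).1.add (hy l).1, rfl⟩
  | smul a c _ hc =>
    obtain ⟨x, hx⟩ := hc
    refine ⟨a • x, fun l => ?_⟩
    simp only [map_smul, Pi.smul_apply, smul_eq_mul, integral_const_mul, (hx l).2, and_true]
    exact continuous_const.mul (hx l).1

theorem continuous_of_mem_continuousExpansions {c : K → X}
    (hc : c ∈ continuousExpansions 𝕜 K X) (l : X →ₗ[𝕜] 𝕜) : Continuous fun k => l (c k) := by
  induction hc using Submodule.span_induction with
  | mem c h =>
    obtain ⟨f, e, hf, rfl⟩ := h
    simp only [map_smul, smul_eq_mul]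
    exact hf.mul continuous_const
  | zero => simpa using continuous_const
  | add c d _ _ hc hd =>
    simp only [Pi.add_apply, map_add]
    exact hc.add hd
  | smul a c _ hc =>
    simp only [Pi.smul_apply, map_smul]
    exact hc.const_smul a

theorem eq_of_forall_dual {x y : X} (h : ∀ l : X →ₗ[𝕜] 𝕜, l x = l y) : x = y := by
  rw [← sub_eq_zero]
  refine (Module.forall_dual_apply_eq_zero_iff 𝕜 (x - y)).mp fun l => ?_
  rw [map_sub, h, sub_self]

end Continuous

/-- The Haar probability measure of a compact group. -/
theorem exists_haar_probability (K : Type*) [Group K] [TopologicalSpace K] [IsTopologicalGroup K]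
    [CompactSpace K] [MeasurableSpace K] [BorelSpace K] :
    ∃ μ : Measure K, IsProbabilityMeasure μ ∧ μ.IsMulLeftInvariant ∧ μ.IsOpenPosMeasure := by
  let K₀ : TopologicalSpace.PositiveCompacts K := ⊤
  refine ⟨Measure.haarMeasure K₀, ⟨?_⟩, inferInstance, inferInstance⟩
  exact Measure.haarMeasure_self (K₀ := K₀)

/-- Averaging over a compact group. -/
theorem Representation.exists_average {K : Type*} [Group K] [TopologicalSpace K]
    [IsTopologicalGroup K] [CompactSpace K] (ρ : Representation 𝕜 K X) {x : X}
    (hx : (fun k => ρ k x) ∈ continuousExpansions 𝕜 K X) :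
    ∃ x' : X, (∀ k, ρ k x' = x') ∧
      ∀ (A : X →ₗ[𝕜] Y) (y : Y), (∀ k, A (ρ k x) = y) → A x' = y := by
  let _ : MeasurableSpace K := borel K
  have : BorelSpace K := ⟨rfl⟩
  obtain ⟨μ, hμ1, hμ2, -⟩ := exists_haar_probability K
  obtain ⟨x', hx'⟩ := exists_integral_of_mem_continuousExpansions μ hx
  refine ⟨x', fun h => eq_of_forall_dual (𝕜 := 𝕜) fun l => ?_,
    fun A y hA => eq_of_forall_dual (𝕜 := 𝕜) fun l => ?_⟩
  · have e := (hx' (l ∘ₗ ρ h)).2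
    simp only [LinearMap.comp_apply] at e
    rw [e, (hx' l).2]
    have e2 := integral_mul_left_eq_self (μ := μ) (fun k => l (ρ k x)) h
    simpa only [map_mul, Module.End.mul_apply] using e2
  · have e := (hx' (l ∘ₗ A)).2
    simp only [LinearMap.comp_apply, hA] at e
    rw [e]
    simp

section Deriv

theorem smul_mem_derivExpansions {f : ℝ → 𝕜} {f' : 𝕜} (hf : HasDerivAt f f' 0) (e : X) :
    (fun t => f t • e, f' • e) ∈ derivExpansions 𝕜 X :=
  Submodule.subset_span ⟨f, f', e, hf, rfl⟩

theorem const_mem_derivExpansions (e : X) :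
    ((fun _ => e, 0) : (ℝ → X) × X) ∈ derivExpansions 𝕜 X := by
  simpa using smul_mem_derivExpansions (𝕜 := 𝕜) (hasDerivAt_const (0 : ℝ) (1 : 𝕜)) e

theorem zero_mem_derivExpansions :
    ((fun _ => 0, 0) : (ℝ → X) × X) ∈ derivExpansions 𝕜 X := zero_mem _

theorem map_mem_derivExpansions (A : X →ₗ[𝕜] Y) {c : (ℝ → X) × X}
    (hc : c ∈ derivExpansions 𝕜 X) :
    (fun t => A (c.1 t), A c.2) ∈ derivExpansions 𝕜 Y := by
  induction hc using Submodule.span_induction with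
  | mem c h =>
    obtain ⟨f, f', e, hf, rfl⟩ := h
    simpa using smul_mem_derivExpansions hf (A e)
  | zero => simpa using zero_mem_derivExpansions (𝕜 := 𝕜) (X := Y)
  | add c d _ _ hc hd =>
    refine (congrArg (· ∈ derivExpansions 𝕜 Y) ?_).mp (add_mem hc hd)
    ext1
    · funext t; simp
    · simp
  | smul a c _ hc =>
    refine (congrArg (· ∈ derivExpansions 𝕜 Y) ?_).mp (Submodule.smul_mem _ a hc)
    ext1
    · funext t; simp
    · simp

theorem map₂_mem_derivExpansions (β : X →ₗ[𝕜] Y →ₗ[𝕜] Z) {c : (ℝ → X) × X} {d : (ℝ → Y) × Y}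
    (hc : c ∈ derivExpansions 𝕜 X) (hd : d ∈ derivExpansions 𝕜 Y) :
    (fun t => β (c.1 t) (d.1 t), β c.2 (d.1 0) + β (c.1 0) d.2) ∈ derivExpansions 𝕜 Z := by
  induction hc using Submodule.span_induction with
  | mem c h =>
    obtain ⟨f, f', e, hf, rfl⟩ := h
    induction hd using Submodule.span_induction with
    | mem d h =>
      obtain ⟨g, g', e', hg, rfl⟩ := h
      have := smul_mem_derivExpansions (hf.mul hg) (β e e')
      refine (congrArg (· ∈ derivExpansions 𝕜 Z) ?_).mp this
      ext1
      · funext t; simp [smul_smul, mul_comm]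
      · simp [smul_smul, add_smul, mul_comm]
    | zero => simpa using zero_mem_derivExpansions (𝕜 := 𝕜) (X := Z)
    | add c d _ _ hc hd =>
      refine (congrArg (· ∈ derivExpansions 𝕜 Z) ?_).mp (add_mem hc hd)
      ext1
      · funext t; simp
      · simp only [Prod.snd_add, Prod.fst_add, Pi.add_apply, map_add]; abel
    | smul a c _ hc =>
      refine (congrArg (· ∈ derivExpansions 𝕜 Z) ?_).mp (Submodule.smul_mem _ a hc)
      ext1
      · funext k; simp
      · simp
  | zero => simpa using zero_mem_derivExpansions (𝕜 := 𝕜) (X := Z)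
  | add c d _ _ hc hd =>
    refine (congrArg (· ∈ derivExpansions 𝕜 Z) ?_).mp (add_mem hc hd)
    ext1
    · funext t; simp
    · simp only [Prod.snd_add, Prod.fst_add, Pi.add_apply, map_add, LinearMap.add_apply]; abel
  | smul a c _ hc =>
    refine (congrArg (· ∈ derivExpansions 𝕜 Z) ?_).mp (Submodule.smul_mem _ a hc)
    ext1
    · funext k; simp
    · simp

theorem hasDerivAt_of_mem_derivExpansions {c : (ℝ → X) × X} (hc : c ∈ derivExpansions 𝕜 X)
    (l : X →ₗ[𝕜] 𝕜) : HasDerivAt (fun t => l (c.1 t)) (l c.2) 0 := by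
  induction hc using Submodule.span_induction with
  | mem c h =>
    obtain ⟨f, f', e, hf, rfl⟩ := h
    simpa using hf.mul_const (l e)
  | zero => simpa using hasDerivAt_const (0 : ℝ) (0 : 𝕜)
  | add c d _ _ hc hd =>
    simp only [Prod.fst_add, Prod.snd_add, Pi.add_apply, map_add]
    exact hc.add hd
  | smul a c _ hc =>
    simp only [Prod.smul_fst, Prod.smul_snd, Pi.smul_apply, map_smul]
    exact hc.const_smul a

/-- Each functional has a unique derivative along the curve, and functionals separate points. -/
theorem eq_of_mem_derivExpansions {c : ℝ → X} {x y : X} (hx : (c, x) ∈ derivExpansions 𝕜 X)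
    (hy : (c, y) ∈ derivExpansions 𝕜 X) : x = y :=
  eq_of_forall_dual fun l => (hasDerivAt_of_mem_derivExpansions hx l).unique
    (hasDerivAt_of_mem_derivExpansions hy l)

theorem derivExpansions_of_basis {ι : Type*} [Finite ι] (b : Module.Basis ι 𝕜 X) {c : ℝ → X}
    {x : X} (h : ∀ i, HasDerivAt (fun t => b.repr (c t) i) (b.repr x i) 0) :
    (c, x) ∈ derivExpansions 𝕜 X := by
  have := Fintype.ofFinite ι
  have e : (c, x) = ∑ i, ((fun t => b.repr (c t) i • b i, b.repr x i • b i) : (ℝ → X) × X) := by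
    ext1
    · funext t
      rw [Prod.fst_sum, Finset.sum_apply, b.sum_repr]
    · rw [Prod.snd_sum, b.sum_repr]
  rw [e]
  exact Submodule.sum_mem _ fun i _ => smul_mem_derivExpansions (h i) (b i)

end Deriv

end Expansions

/-! ### Finite-dimensional spaces of functions. -/

section FunctionSpaces

variable {α : Type*} {E : Submodule ℂ (α → ℂ)} [FiniteDimensional ℂ E]

/-- Linear functionals on a finite-dimensional space of functions are combinations of point
evaluations. -/
theorem dual_mem_span_eval (l : Module.Dual ℂ E) :
    l ∈ Submodule.span ℂ (Set.range fun a : α => (LinearMap.proj a ∘ₗ E.subtype : E →ₗ[ℂ] ℂ)) := by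
  set S := Submodule.span ℂ (Set.range fun a : α => (LinearMap.proj a ∘ₗ E.subtype : E →ₗ[ℂ] ℂ))
  have h : S.dualCoannihilator = ⊥ := by
    rw [eq_bot_iff]
    intro v hv
    rw [Submodule.mem_dualCoannihilator] at hv
    refine (Submodule.mem_bot ℂ).mpr (Subtype.ext (funext fun a => ?_))
    exact hv _ (Submodule.subset_span ⟨a, rfl⟩)
  have h2 : S = ⊤ := by
    rw [← Subspace.dualCoannihilator_dualAnnihilator_eq (W := S), h, Submodule.dualAnnihilator_bot]
  rw [h2]
  trivial

/-- Point evaluations span the dual, so pointwise information controls all coordinates. -/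
theorem continuous_dual_of_continuous_eval {K : Type*} [TopologicalSpace K] {c : K → E}
    (h : ∀ a, Continuous fun k => (c k : α → ℂ) a) (l : Module.Dual ℂ E) :
    Continuous fun k => l (c k) := by
  induction dual_mem_span_eval l using Submodule.span_induction with
  | mem l h' => obtain ⟨a, rfl⟩ := h'; exact h a
  | zero => exact continuous_const
  | add l m _ _ hl hm => exact hl.add hm
  | smul r l _ hl => exact hl.const_smul r

theorem hasDerivAt_dual_of_hasDerivAt_eval {c : ℝ → E} {c' : E} {t : ℝ}
    (h : ∀ a, HasDerivAt (fun k => (c k : α → ℂ) a) ((c' : α → ℂ) a) t) (l : Module.Dual ℂ E) :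
    HasDerivAt (fun k => l (c k)) (l c') t := by
  induction dual_mem_span_eval l using Submodule.span_induction with
  | mem l h' => obtain ⟨a, rfl⟩ := h'; exact h a
  | zero => exact hasDerivAt_const _ _
  | add l m _ _ hl hm => exact hl.add hm
  | smul r l _ hl => exact hl.const_smul r

/-- A finite-dimensional space of functions contains the derivatives of curves in it. -/
theorem mem_of_hasDerivAt_eval {c : ℝ → α → ℂ} (hc : ∀ t, c t ∈ E) {c' : α → ℂ} {t : ℝ}
    (h : ∀ a, HasDerivAt (fun s => c s a) (c' a) t) : c' ∈ E := by
  have hcl : IsClosed (E : Set (α → ℂ)) := Submodule.closed_of_finiteDimensional E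
  have hlim : Tendsto (slope c t) (𝓝[≠] t) (𝓝 c') := by
    rw [tendsto_pi_nhds]
    intro a
    refine (hasDerivAt_iff_tendsto_slope.mp (h a)).congr fun s => ?_
    simp [slope_def_module]
  refine hcl.mem_of_tendsto hlim (Eventually.of_forall fun s => ?_)
  rw [slope_def_module]
  have h2 : ((s - t)⁻¹ : ℝ) • (c s - c t) = (((s - t)⁻¹ : ℝ) : ℂ) • (c s - c t) := by
    funext a; simp
  rw [h2]
  exact E.smul_mem _ (E.sub_mem (hc s) (hc t))

end FunctionSpaces

/-! ### Invariant inner products and Casimir-type elements. -/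

section InvariantForms

variable {V : Type*} [AddCommGroup V] [Module ℝ V] [FiniteDimensional ℝ V]

/-- A representation of a compact group on a real vector space preserves an inner product. -/
theorem Representation.exists_invariant_form {K : Type*} [Group K] [TopologicalSpace K]
    [IsTopologicalGroup K] [CompactSpace K] (ρ : Representation ℝ K V)
    (hρ : ∀ (v : V) (l : V →ₗ[ℝ] ℝ), Continuous fun k => l (ρ k v)) :
    ∃ b : V →ₗ[ℝ] V →ₗ[ℝ] ℝ, (∀ u v, b u v = b v u) ∧ (∀ v, v ≠ 0 → 0 < b v v) ∧
      ∀ k u v, b (ρ k u) (ρ k v) = b u v := by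
  let _ : MeasurableSpace K := borel K
  have : BorelSpace K := ⟨rfl⟩
  obtain ⟨μ, hμ1, hμ2, hμ3⟩ := exists_haar_probability K
  let e := Module.finBasis ℝ V
  -- The coordinate inner product along the orbit of `k⁻¹`; with the inverse, left invariance of
  -- Haar measure becomes invariance under `ρ`.
  let q : V → V → K → ℝ := fun u v k => ∑ i, e.coord i (ρ k⁻¹ u) * e.coord i (ρ k⁻¹ v)
  have hq : ∀ u v, Continuous (q u v) := fun u v => by
    refine continuous_finsetSum _ fun i _ => ?_
    exact ((hρ u (e.coord i)).comp continuous_inv).mul ((hρ v (e.coord i)).comp continuous_inv)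
  have hint : ∀ u v, Integrable (q u v) μ := fun u v =>
    (hq u v).integrable_of_hasCompactSupport (HasCompactSupport.of_compactSpace _)
  have hsymm : ∀ u v, q u v = q v u := fun u v => by
    funext k; simp only [q, mul_comm]
  have hadd : ∀ u u' v, q (u + u') v = q u v + q u' v := fun u u' v => by
    funext k; simp only [q, map_add, add_mul, Finset.sum_add_distrib, Pi.add_apply]
  have hsmul : ∀ (c : ℝ) u v, q (c • u) v = c • q u v := fun c u v => by
    funext k
    simp only [q, map_smul, smul_eq_mul, Pi.smul_apply, Finset.mul_sum, mul_assoc]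
  have iadd : ∀ u u' v, ∫ k, q (u + u') v k ∂μ = ∫ k, q u v k ∂μ + ∫ k, q u' v k ∂μ := by
    intro u u' v
    rw [hadd, ← integral_add (hint u v) (hint u' v)]
    rfl
  have ismul : ∀ (c : ℝ) u v, ∫ k, q (c • u) v k ∂μ = c • ∫ k, q u v k ∂μ := by
    intro c u v
    rw [hsmul, ← integral_smul]
    rfl
  refine ⟨LinearMap.mk₂ ℝ (fun u v => ∫ k, q u v k ∂μ) iadd ismul ?_ ?_, ?_, ?_, ?_⟩
  · intro u v v'
    rw [hsymm, iadd, hsymm v, hsymm v']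
  · intro c u v
    rw [hsymm, ismul, hsymm v]
  · intro u v
    simp only [LinearMap.mk₂_apply]
    rw [hsymm]
  · intro v hv
    simp only [LinearMap.mk₂_apply]
    refine (hq v v).integral_pos_of_hasCompactSupport_nonneg_nonzero
      (HasCompactSupport.of_compactSpace _)
      (fun k => Finset.sum_nonneg fun i _ => mul_self_nonneg _) (x := 1) ?_
    simp only [q, inv_one, map_one, Module.End.one_apply]
    intro h0
    rw [Finset.sum_eq_zero_iff_of_nonneg fun i _ => mul_self_nonneg _] at h0
    refine hv (e.ext_elem fun i => ?_)
    simpa using h0 i (Finset.mem_univ i)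
  · intro h u v
    simp only [LinearMap.mk₂_apply]
    rw [← integral_mul_left_eq_self (μ := μ) (q u v) h⁻¹]
    congr 1
    funext k
    simp only [q, mul_inv_rev, inv_inv, map_mul, Module.End.mul_apply]

/-- An inner product has an orthonormal basis. -/
theorem exists_orthonormal_basis_of_form (b : V →ₗ[ℝ] V →ₗ[ℝ] ℝ) (hs : ∀ u v, b u v = b v u)
    (hp : ∀ v, v ≠ 0 → 0 < b v v) :
    ∃ (ι : Type) (_ : Fintype ι) (X : Module.Basis ι ℝ V), ∀ v, ∑ i, b v (X i) • X i = v := by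
  classical
  let core : InnerProductSpace.Core ℝ V :=
    { inner := fun u v => b u v
      conj_inner_symm := fun u v => hs v u
      re_inner_nonneg := fun v => by
        rcases eq_or_ne v 0 with rfl | h
        · simp
        · exact (hp v h).le
      add_left := fun u v w => by simp
      smul_left := fun u v r => by simp
      definite := fun v h => by
        by_contra h0
        exact (hp v h0).ne' h }
  let _ : NormedAddCommGroup V := core.toNormedAddCommGroup
  let _ : InnerProductSpace ℝ V := InnerProductSpace.ofCore core.toCore
  let B := stdOrthonormalBasis ℝ V
  refine ⟨_, inferInstance, B.toBasis, fun v => ?_⟩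
  conv_rhs => rw [← B.sum_repr v]
  refine Finset.sum_congr rfl fun i _ => ?_
  rw [B.coe_toBasis, B.repr_apply_apply, real_inner_comm]
  rfl

/-- The Casimir-type element of an orthonormal basis commutes with skew-symmetric derivations. -/
theorem commute_sum_sq_of_skew {R A ι : Type*} [CommRing R] [Ring A] [Algebra R A] [Fintype ι]
    {x : ι → A} {y : A} {a : ι → ι → R} (h : ∀ i, y * x i - x i * y = ∑ j, a i j • x j)
    (ha : ∀ i j, a i j = - a j i) : Commute y (∑ i, x i * x i) := by
  have h1 : ∀ i, y * (x i * x i) - (x i * x i) * y =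
      ∑ j, a i j • (x j * x i) + ∑ j, a i j • (x i * x j) := by
    intro i
    have e : y * (x i * x i) - (x i * x i) * y =
      (y * x i - x i * y) * x i + x i * (y * x i - x i * y) := by noncomm_ring
    rw [e, h, Finset.sum_mul, Finset.mul_sum]
    simp only [smul_mul_assoc, mul_smul_comm]
  have h2 : y * (∑ i, x i * x i) - (∑ i, x i * x i) * y = 0 := by
    rw [Finset.mul_sum, Finset.sum_mul, ← Finset.sum_sub_distrib]
    simp only [h1, Finset.sum_add_distrib]
    -- Exchanging `i` and `j` in one double sum makes the two cancel by skew-symmetry.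
    rw [Finset.sum_comm (f := fun i j => a i j • (x j * x i)), ← Finset.sum_add_distrib]
    refine Finset.sum_eq_zero fun i _ => ?_
    rw [← Finset.sum_add_distrib]
    refine Finset.sum_eq_zero fun j _ => ?_
    rw [ha j i, neg_smul, neg_add_cancel]
  exact sub_eq_zero.mp h2

end InvariantForms

/-! ### Enveloping algebras and complexification. -/

section Enveloping

/-- The enveloping algebra is generated by the Lie algebra. -/
theorem UniversalEnvelopingAlgebra.induction_on {R L : Type*} [CommRing R] [LieRing L]
    [LieAlgebra R L] {P : UniversalEnvelopingAlgebra R L → Prop}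
    (halg : ∀ r, P (algebraMap R _ r)) (hι : ∀ x, P (UniversalEnvelopingAlgebra.ι R x))
    (hadd : ∀ a b, P a → P b → P (a + b)) (hmul : ∀ a b, P a → P b → P (a * b))
    (a : UniversalEnvelopingAlgebra R L) : P a := by
  let S : Subalgebra R (UniversalEnvelopingAlgebra R L) :=
    Algebra.adjoin R (Set.range (UniversalEnvelopingAlgebra.ι R))
  let j : L →ₗ⁅R⁆ S :=
    { toFun := fun x => ⟨UniversalEnvelopingAlgebra.ι R x, Algebra.subset_adjoin ⟨x, rfl⟩⟩
      map_add' := fun x y => Subtype.ext (map_add _ x y)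
      map_smul' := fun r x => Subtype.ext (map_smul _ r x)
      map_lie' := fun {x y} => Subtype.ext (LieHom.map_lie _ x y) }
  -- The Lie algebra maps into the subalgebra `S` that it generates. The induced endomorphism of the
  -- enveloping algebra has image in `S` and is the identity by the universal property.
  have h : S.val.comp (UniversalEnvelopingAlgebra.lift R j) =
      AlgHom.id R (UniversalEnvelopingAlgebra R L) := by
    refine UniversalEnvelopingAlgebra.hom_ext R (LieHom.ext fun x => ?_)
    change ((UniversalEnvelopingAlgebra.lift R j) (UniversalEnvelopingAlgebra.ι R x) :
      UniversalEnvelopingAlgebra R L) = UniversalEnvelopingAlgebra.ι R x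
    rw [UniversalEnvelopingAlgebra.lift_ι_apply]
    rfl
  have ha : a ∈ S := by
    have := DFunLike.congr_fun h a
    rw [← AlgHom.id_apply (R := R) a, ← this]
    exact Subtype.property _
  induction ha using Algebra.adjoin_induction with
  | mem x hx => obtain ⟨y, rfl⟩ := hx; exact hι y
  | algebraMap r => exact halg r
  | add x y _ _ hx hy => exact hadd x y hx hy
  | mul x y _ _ hx hy => exact hmul x y hx hy

/-- The complex linear extension of a homomorphism from a real Lie algebra to a complex
associative algebra. -/
def complexifyLieHom {L A : Type*} [LieRing L] [LieAlgebra ℝ L] [Ring A] [Algebra ℂ A]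
    [Algebra ℝ A] [IsScalarTower ℝ ℂ A] (φ : L →ₗ⁅ℝ⁆ A) : (ℂ ⊗[ℝ] L) →ₗ⁅ℂ⁆ A where
  __ := LinearMap.liftBaseChange ℂ (φ : L →ₗ[ℝ] A)
  map_lie' := by
    intro X Y
    change LinearMap.liftBaseChange ℂ (φ : L →ₗ[ℝ] A) ⁅X, Y⁆ =
      ⁅LinearMap.liftBaseChange ℂ (φ : L →ₗ[ℝ] A) X, LinearMap.liftBaseChange ℂ (φ : L →ₗ[ℝ] A) Y⁆
    induction X with
    | zero => simp
    | add a b ha hb => simp only [add_lie, map_add, ha, hb]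
    | tmul a x =>
      induction Y with
      | zero =>
        have h0 : ⁅a ⊗ₜ[ℝ] x, (0 : ℂ ⊗[ℝ] L)⁆ = 0 := by
          have h2 := LieRing.lie_add (a ⊗ₜ[ℝ] x) (0 : ℂ ⊗[ℝ] L) 0
          rwa [add_zero, left_eq_add] at h2
        rw [map_zero, lie_zero]
        exact (congrArg _ h0).trans (map_zero _)
      | add c d hc hd => rw [map_add, LieRing.lie_add, LieRing.lie_add, map_add, hc, hd]
      | tmul b y =>
        rw [LieAlgebra.ExtendScalars.bracket_tmul]
        simp only [LinearMap.liftBaseChange_tmul, LieHom.coe_toLinearMap, LieHom.map_lie,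
          Ring.lie_def, smul_sub, smul_mul_assoc, mul_smul_comm, smul_smul, mul_comm]

theorem complexifyLieHom_tmul {L A : Type*} [LieRing L] [LieAlgebra ℝ L] [Ring A] [Algebra ℂ A]
    [Algebra ℝ A] [IsScalarTower ℝ ℂ A] (φ : L →ₗ⁅ℝ⁆ A) (z : ℂ) (x : L) :
    complexifyLieHom φ (z ⊗ₜ x) = z • φ x :=
  LinearMap.liftBaseChange_tmul _ _ _ _

end Enveloping

/-! ### The enveloping algebra acting on smooth functions, and its adjoint action. -/

section EnvelopingAction

variable {F : Type u} [Field F] [NumberField F] {n : ℕ} {G : LinearAlgebraicGroup F n}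
  {H : ClosedSubgroup G.ArchPts}

/-- Right translation by `G(𝔸_∞)` on smooth functions. -/
def smoothTranslation (G : LinearAlgebraicGroup F n) :
    Representation ℂ G.ArchPts (smoothFunctions G) where
  toFun x := ((rightTranslation G (x, 1)).restrict
    fun _ hf => smoothFunctions.rightTranslation_mem hf _)
  map_one' := by
    ext f g
    exact congrArg f.1 (mul_one g)
  map_mul' x y := by
    have e : ((x * y, 1) : G.Adelic) = (x, 1) * (y, 1) := by rw [Prod.mk_mul_mk, mul_one]
    ext f g
    exact (congrArg (fun z => rightTranslation G z f.1 g) e).trans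
      (congrFun (rightTranslation_mul_apply _ _ f.1) g)

theorem smoothTranslation_apply (x : G.ArchPts) (f : smoothFunctions G) :
    (smoothTranslation G x f : G.Adelic → ℂ) = rightTranslation G (x, 1) f := rfl

/-- The action of the enveloping algebra on smooth functions. -/
def envelopingAction (H : ClosedSubgroup G.ArchPts) :
    UniversalEnvelopingAlgebra ℂ (ℂ ⊗[ℝ] lieAlg H) →ₐ[ℂ] Module.End ℂ (smoothFunctions G) :=
  UniversalEnvelopingAlgebra.lift ℂ (complexifyLieHom (smoothLieHom H))

theorem envelopingAction_ι (z : ℂ) (X : lieAlg H) (f : smoothFunctions G) :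
    (envelopingAction H (UniversalEnvelopingAlgebra.ι ℂ (z ⊗ₜ X)) f : G.Adelic → ℂ) =
      z • lieDeriv X f := by
  rw [envelopingAction, UniversalEnvelopingAlgebra.lift_ι_apply, complexifyLieHom_tmul,
    LinearMap.smul_apply, Submodule.coe_smul, smoothLieHom_apply]

theorem Ad_one : Ad (1 : H) = LieHom.id := by
  ext X : 1
  refine Subtype.ext ?_
  change archMatrix (1 : G.ArchPts) * X.1 * archMatrix (1 : G.ArchPts)⁻¹ = X.1
  rw [inv_one, archMatrix_one, one_mul, mul_one]

theorem Ad_mul_apply (s t : H) (X : lieAlg H) : Ad (s * t) X = Ad s (Ad t X) := by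
  refine Subtype.ext ?_
  change archMatrix ((s : G.ArchPts) * (t : G.ArchPts)) * X.1 * archMatrix ((s : G.ArchPts) * (t : G.ArchPts))⁻¹ =
    archMatrix (s : G.ArchPts) * (archMatrix (t : G.ArchPts) * X.1 * archMatrix (t : G.ArchPts)⁻¹) *
      archMatrix (s : G.ArchPts)⁻¹
  rw [mul_inv_rev, archMatrix_mul, archMatrix_mul]
  simp only [mul_assoc]

theorem AdC_tmul (s : H) (z : ℂ) (X : lieAlg H) : AdC s (z ⊗ₜ X) = z ⊗ₜ Ad s X :=
  LinearMap.baseChange_tmul _ _ _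

/-- The adjoint action on the enveloping algebra. -/
def AdU (s : H) : UniversalEnvelopingAlgebra ℂ (ℂ ⊗[ℝ] lieAlg H) →ₐ[ℂ]
    UniversalEnvelopingAlgebra ℂ (ℂ ⊗[ℝ] lieAlg H) :=
  UniversalEnvelopingAlgebra.lift ℂ ((UniversalEnvelopingAlgebra.ι ℂ).comp (AdC s))

theorem AdU_ι (s : H) (X : ℂ ⊗[ℝ] lieAlg H) : AdU s (UniversalEnvelopingAlgebra.ι ℂ X) =
    UniversalEnvelopingAlgebra.ι ℂ (AdC s X) :=
  UniversalEnvelopingAlgebra.lift_ι_apply _ _ _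

theorem AdC_one_apply (X : ℂ ⊗[ℝ] lieAlg H) : AdC (1 : H) X = X := by
  induction X with
  | zero => exact map_zero _
  | add a b ha hb => rw [map_add, ha, hb]
  | tmul z X => rw [AdC_tmul, Ad_one]; rfl

theorem AdC_mul_apply (s t : H) (X : ℂ ⊗[ℝ] lieAlg H) : AdC (s * t) X = AdC s (AdC t X) := by
  induction X with
  | zero => simp only [map_zero]
  | add a b ha hb => simp only [map_add, ha, hb]
  | tmul z X => rw [AdC_tmul, AdC_tmul, AdC_tmul, Ad_mul_apply]

theorem AdU_one_apply (a : UniversalEnvelopingAlgebra ℂ (ℂ ⊗[ℝ] lieAlg H)) :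
    AdU (1 : H) a = a := by
  induction a using UniversalEnvelopingAlgebra.induction_on with
  | halg r => exact AlgHom.commutes _ r
  | hι x => rw [AdU_ι, AdC_one_apply]
  | hadd a b ha hb => rw [map_add, ha, hb]
  | hmul a b ha hb => rw [map_mul, ha, hb]

theorem AdU_mul_apply (s t : H) (a : UniversalEnvelopingAlgebra ℂ (ℂ ⊗[ℝ] lieAlg H)) :
    AdU (s * t) a = AdU s (AdU t a) := by
  induction a using UniversalEnvelopingAlgebra.induction_on with
  | halg r => simp only [AlgHom.commutes]
  | hι x => rw [AdU_ι, AdU_ι, AdU_ι, AdC_mul_apply]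
  | hadd a b ha hb => simp only [map_add, ha, hb]
  | hmul a b ha hb => simp only [map_mul, ha, hb]

theorem smoothTranslation_envelopingAction (s : H)
    (a : UniversalEnvelopingAlgebra ℂ (ℂ ⊗[ℝ] lieAlg H)) (f : smoothFunctions G) :
    smoothTranslation G s (envelopingAction H a f) =
      envelopingAction H (AdU s a) (smoothTranslation G s f) := by
  induction a using UniversalEnvelopingAlgebra.induction_on generalizing f with
  | halg r =>
    simp only [AlgHom.commutes, Module.algebraMap_end_apply, map_smul]
  | hι x =>
    rw [AdU_ι]
    induction x with
    | zero => simp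
    | add x y hx hy => simp only [map_add, LinearMap.add_apply, hx, hy]
    | tmul z X =>
      refine Subtype.ext ?_
      rw [AdC_tmul, smoothTranslation_apply, envelopingAction_ι, envelopingAction_ι, map_smul,
        smoothTranslation_apply, rightTranslation_lieDeriv (Y := Ad s X) (s : G.ArchPts) rfl]
  | hadd a b ha hb => simp only [map_add, LinearMap.add_apply, ha, hb]
  | hmul a b ha hb => simp only [map_mul, Module.End.mul_apply, ha, hb]

theorem continuous_dual_Ad (l : lieAlg H →ₗ[ℝ] ℝ) (X : lieAlg H) :
    Continuous fun s : H => l (Ad s X) := by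
  classical
  obtain ⟨l', hl'⟩ := LinearMap.exists_extend (p := (lieAlg H).toSubmodule) l
  have h1 : ∀ s : H, l (Ad s X) =
      l' (archMatrix (s : G.ArchPts) * X.1 * archMatrix (s : G.ArchPts)⁻¹) := fun s => by
    rw [← hl']; rfl
  simp only [h1]
  refine (LinearMap.continuous_of_finiteDimensional l').comp ?_
  exact ((continuous_archMatrix.comp continuous_subtype_val).mul continuous_const).mul
    (continuous_archMatrix.comp (continuous_inv.comp continuous_subtype_val))

open scoped Classical in
attribute [local instance] Matrix.linftyOpNormedRing Matrix.linftyOpNormedAlgebra in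
theorem hasDerivAt_dual_Ad (l : lieAlg H →ₗ[ℝ] ℝ) (Y X : lieAlg H) {γ : ℝ → H}
    (hγ : ∀ t, (γ t : G.ArchPts) = oneParam Y t) :
    HasDerivAt (fun t => l (Ad (γ t) X)) (l ⁅Y, X⁆) 0 := by
  classical
  obtain ⟨l', hl'⟩ := LinearMap.exists_extend (p := (lieAlg H).toSubmodule) l
  have h1 : ∀ t, l (Ad (γ t) X) =
      l' (archMatrix (oneParam Y t) * X.1 * archMatrix (oneParam Y (-t))) := fun t => by
    rw [← hl', oneParam_neg, ← hγ]; rfl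
  have h2 : l ⁅Y, X⁆ = l' (Y.1 * X.1 + X.1 * -Y.1) := by
    rw [← hl', mul_neg, ← sub_eq_add_neg]; rfl
  simp only [h1, h2]
  have h3 := hasDerivAt_archMatrix_oneParam Y 0
  have h4 : HasDerivAt (fun t => archMatrix (oneParam Y (-t))) (-Y.1) 0 := by
    have h5 := hasDerivAt_archMatrix_oneParam Y (-0)
    have h6 := h5.scomp (0 : ℝ) (hasDerivAt_neg (0 : ℝ))
    rw [neg_zero, oneParam_zero, archMatrix_one, one_mul, neg_one_smul] at h6
    exact h6
  have h7 := (h3.mul_const X.1).mul h4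
  simp only [neg_zero, oneParam_zero, archMatrix_one, one_mul, mul_one] at h7
  exact (LinearMap.toContinuousLinearMap l').hasFDerivAt.comp_hasDerivAt (0 : ℝ) h7

/-- Matrix coefficients of `Ad` are continuous, and finite expansions are stable under sums and
products; this is the local finiteness of the adjoint action in the form needed for averaging. -/
theorem continuousExpansions_AdU {K : Type*} [TopologicalSpace K] {θ : K → H}
    (hθ : Continuous θ) (a : UniversalEnvelopingAlgebra ℂ (ℂ ⊗[ℝ] lieAlg H)) :
    (fun k => AdU (θ k) a) ∈ continuousExpansions ℂ K _ := by
  induction a using UniversalEnvelopingAlgebra.induction_on with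
  | halg r =>
    simp only [AlgHom.commutes]
    exact const_mem_continuousExpansions _
  | hι x =>
    simp only [AdU_ι]
    refine map_mem_continuousExpansions
      (UniversalEnvelopingAlgebra.ι ℂ : _ →ₗ⁅ℂ⁆ _).toLinearMap (c := fun k => AdC (θ k) x) ?_
    induction x with
    | zero =>
      simp only [map_zero]
      exact const_mem_continuousExpansions _
    | add x y hx hy =>
      refine (congrArg (· ∈ continuousExpansions ℂ K _) (funext fun k => ?_)).mp (add_mem hx hy)
      simp
    | tmul z X =>
      let b := Module.finBasis ℝ (lieAlg H)
      refine continuousExpansions_of_basis (b.baseChange ℂ) fun i => ?_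
      simp only [AdC_tmul, Module.Basis.baseChange_repr_tmul]
      exact (continuous_dual_Ad (b.coord i) X).comp hθ |>.smul continuous_const
  | hadd a b ha hb =>
    refine (congrArg (· ∈ continuousExpansions ℂ K _) (funext fun k => ?_)).mp (add_mem ha hb)
    simp
  | hmul a b ha hb =>
    simp only [map_mul]
    exact map₂_mem_continuousExpansions (LinearMap.mul ℂ _) ha hb

theorem derivExpansions_AdC (Y : lieAlg H) {γ : ℝ → H}
    (hγ : ∀ t, (γ t : G.ArchPts) = oneParam Y t) (x : ℂ ⊗[ℝ] lieAlg H) :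
    ((fun t => AdC (γ t) x), ⁅(1 : ℂ) ⊗ₜ[ℝ] Y, x⁆) ∈ derivExpansions ℂ (ℂ ⊗[ℝ] lieAlg H) := by
  induction x with
  | zero =>
    have h0 : ⁅(1 : ℂ) ⊗ₜ[ℝ] Y, (0 : ℂ ⊗[ℝ] lieAlg H)⁆ = 0 := by
      have h2 := LieRing.lie_add ((1 : ℂ) ⊗ₜ[ℝ] Y) (0 : ℂ ⊗[ℝ] lieAlg H) 0
      rwa [add_zero, left_eq_add] at h2
    simp only [map_zero]
    exact (congrArg (fun v => ((fun _ => 0, v) : (ℝ → (ℂ ⊗[ℝ] lieAlg H)) × (ℂ ⊗[ℝ] lieAlg H)) ∈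
      derivExpansions ℂ (ℂ ⊗[ℝ] lieAlg H)) h0).mpr zero_mem_derivExpansions
  | add x y hx hy =>
    refine (congrArg (· ∈ derivExpansions ℂ _) ?_).mp (add_mem hx hy)
    ext1
    · funext t; simp
    · exact (LieRing.lie_add _ _ _).symm
  | tmul z X =>
    let b := Module.finBasis ℝ (lieAlg H)
    refine derivExpansions_of_basis (b.baseChange ℂ) fun i => ?_
    rw [LieAlgebra.ExtendScalars.bracket_tmul]
    simp only [AdC_tmul, Module.Basis.baseChange_repr_tmul, one_mul]
    exact (hasDerivAt_dual_Ad (b.coord i) Y X hγ).smul_const z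

theorem derivExpansions_AdU (Y : lieAlg H) {γ : ℝ → H}
    (hγ : ∀ t, (γ t : G.ArchPts) = oneParam Y t)
    (a : UniversalEnvelopingAlgebra ℂ (ℂ ⊗[ℝ] lieAlg H)) :
    ((fun t => AdU (γ t) a), UniversalEnvelopingAlgebra.ι ℂ (1 ⊗ₜ Y) * a -
      a * UniversalEnvelopingAlgebra.ι ℂ (1 ⊗ₜ Y)) ∈ derivExpansions ℂ _ := by
  have hγ0 : γ 0 = 1 := Subtype.ext ((hγ 0).trans (oneParam_zero Y))
  induction a using UniversalEnvelopingAlgebra.induction_on with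
  | halg r =>
    simp only [AlgHom.commutes]
    rw [← Algebra.commutes, sub_self]
    exact const_mem_derivExpansions _
  | hι x =>
    simp only [AdU_ι]
    rw [← Ring.lie_def, ← LieHom.map_lie]
    refine map_mem_derivExpansions
      (UniversalEnvelopingAlgebra.ι ℂ : _ →ₗ⁅ℂ⁆ _).toLinearMap
      (derivExpansions_AdC Y hγ x)
  | hadd a b ha hb =>
    refine (congrArg (· ∈ derivExpansions ℂ _) ?_).mp (add_mem ha hb)
    ext1
    · funext t; simp
    · simp only [Prod.mk_add_mk, mul_add, add_mul]; abel
  | hmul a b ha hb =>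
    simp only [map_mul]
    have h := map₂_mem_derivExpansions (LinearMap.mul ℂ _) ha hb
    refine (congrArg (· ∈ derivExpansions ℂ _) ?_).mp h
    ext1
    · rfl
    · simp only [hγ0, AdU_one_apply, LinearMap.mul_apply']
      noncomm_ring

end EnvelopingAction

/-- Solutions of a linear differential equation stay in invariant subspaces. -/
theorem mem_of_linear_ode {V : Type*} [AddCommGroup V] [Module ℂ V] [FiniteDimensional ℂ V]
    {A : V →ₗ[ℂ] V} {p : Submodule ℂ V} (hA : ∀ v ∈ p, A v ∈ p) {c : ℝ → V}
    (hc : ∀ (l : V →ₗ[ℂ] ℂ) (t : ℝ), HasDerivAt (fun t => l (c t)) (l (A (c t))) t)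
    (h0 : c 0 ∈ p) (t : ℝ) : c t ∈ p := by
  -- The image of the curve in `V ⧸ p` solves a linear equation with initial value zero, so it
  -- vanishes by uniqueness.
  let b := Module.finBasis ℂ (V ⧸ p)
  let e : (V ⧸ p) ≃ₗ[ℂ] (Fin (Module.finrank ℂ (V ⧸ p)) → ℂ) := b.equivFun
  let A' : (V ⧸ p) →ₗ[ℂ] (V ⧸ p) := p.mapQ p A hA
  let M : (Fin (Module.finrank ℂ (V ⧸ p)) → ℂ) →L[ℂ] (Fin (Module.finrank ℂ (V ⧸ p)) → ℂ) :=
    LinearMap.toContinuousLinearMap (e.toLinearMap ∘ₗ A' ∘ₗ e.symm.toLinearMap)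
  let x : ℝ → Fin (Module.finrank ℂ (V ⧸ p)) → ℂ := fun t => e (p.mkQ (c t))
  have hx : ∀ t, HasDerivAt x (M (x t)) t := by
    intro t
    have e1 : M (x t) = e (p.mkQ (A (c t))) := by
      simp [M, x, A']
    rw [e1, hasDerivAt_pi]
    intro i
    exact hc (LinearMap.proj i ∘ₗ e.toLinearMap ∘ₗ p.mkQ) t
  have hsol := ODE_solution_unique_univ (v := fun _ => M) (s := fun _ => Set.univ) (K := ‖M‖₊)
    (f := x) (g := fun _ => 0) (t₀ := 0) (fun t => M.lipschitz.lipschitzOnWith)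
    (fun t => ⟨hx t, trivial⟩) (fun t => ⟨by simpa using hasDerivAt_const t 0, trivial⟩)
    (by
      simp only [x]
      rw [Submodule.mkQ_apply, (Submodule.Quotient.mk_eq_zero p).mpr h0, map_zero])
  have h2 : x t = 0 := congrFun hsol t
  rw [← Submodule.Quotient.mk_eq_zero p, ← Submodule.mkQ_apply]
  exact (map_eq_zero_iff e e.injective).mp h2

/-- A finite-dimensional tensor product with `ℂ` consists of elements `1 ⊗ x + i ⊗ y`. -/
theorem exists_re_im_tensor {L : Type*} [AddCommGroup L] [Module ℝ L] (x : ℂ ⊗[ℝ] L) :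
    ∃ a b : L, x = 1 ⊗ₜ a + Complex.I ⊗ₜ b := by
  induction x with
  | zero => exact ⟨0, 0, by simp⟩
  | add x y hx hy =>
    obtain ⟨a, b, rfl⟩ := hx
    obtain ⟨a', b', rfl⟩ := hy
    exact ⟨a + a', b + b', by simp only [TensorProduct.tmul_add]; abel⟩
  | tmul z v =>
    refine ⟨z.re • v, z.im • v, ?_⟩
    rw [← TensorProduct.smul_tmul, ← TensorProduct.smul_tmul, ← TensorProduct.add_tmul]
    congr 1
    apply Complex.ext <;> simp

/-! ### The compact group `K'₀` and its adjoint action on `𝔭⁻`. -/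

namespace ArchimedeanData

variable {F : Type u} [Field F] [NumberField F] {n : ℕ} {G : LinearAlgebraicGroup F n}
  (D : ArchimedeanData G)

theorem K'₀_le_K' : D.K'₀ ≤ D.K'.toSubgroup := by
  rintro _ ⟨k, -, rfl⟩
  exact k.2

theorem K'_le_Kinf : D.K'.toSubgroup ≤ D.Kinf := by
  rw [D.Kinf_eq]; exact le_sup_right

theorem isCompact_K'₀ : IsCompact (D.K'₀ : Set G.ArchPts) := by
  have hK : CompactSpace D.K'.toSubgroup :=
    isCompact_iff_compactSpace.mp D.K'_maximal.prop.2
  have h : IsCompact (connectedComponent (1 : D.K'.toSubgroup)) :=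
    isClosed_connectedComponent.isCompact
  exact h.image continuous_subtype_val

instance : CompactSpace D.K'₀ := isCompact_iff_compactSpace.mp D.isCompact_K'₀

theorem conj_mem_K'₀ {s k : G.ArchPts} (hs : s ∈ D.K') (hk : k ∈ D.K'₀) :
    s * k * s⁻¹ ∈ D.K'₀ := by
  obtain ⟨k, hk, rfl⟩ := hk
  let σ : D.K'.toSubgroup := ⟨s, hs⟩
  have hc : Continuous fun x : D.K'.toSubgroup => σ * x * σ⁻¹ := by fun_prop
  have h := hc.mapsTo_connectedComponent 1 hk
  rw [mul_one, mul_inv_cancel] at h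
  exact ⟨_, h, rfl⟩

/-- Conjugation by `s ∈ K'` on `K'₀`. -/
def conjK'₀ {s : G.ArchPts} (hs : s ∈ D.K') : D.K'₀ →* D.K'₀ where
  toFun k := ⟨s * k * s⁻¹, D.conj_mem_K'₀ hs k.2⟩
  map_one' := Subtype.ext (by simp)
  map_mul' a b := Subtype.ext (by simp)

theorem continuous_conjK'₀ {s : G.ArchPts} (hs : s ∈ D.K') : Continuous (D.conjK'₀ hs) := by
  refine Continuous.subtype_mk ?_ _
  exact (continuous_const.mul continuous_subtype_val).mul continuous_const

theorem oneParam_mem_K'₀ {Y : D.g'} (hY : Y ∈ D.k) (t : ℝ) : oneParam Y t ∈ D.K'₀ := by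
  rw [oneParam_eq (X := Y) (Y := (⟨Y.1, hY⟩ : lieAlg D.K')) rfl t]
  exact oneParam_mem_identityComponent (H := D.K') _ t

/-- Elements of `K'₀` as elements of `G'`. -/
def toG' : D.K'₀ →* D.G' where
  toFun k := ⟨k, D.K'_le_G' (D.K'₀_le_K' k.2)⟩
  map_one' := rfl
  map_mul' _ _ := rfl

theorem continuous_toG' : Continuous D.toG' :=
  Continuous.subtype_mk continuous_subtype_val _

theorem Ad_mem_k {s : G.ArchPts} (hs : s ∈ D.K') {Y : D.g'} (hY : Y ∈ D.k) :
    Ad (⟨s, D.K'_le_G' hs⟩ : D.G') Y ∈ D.k :=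
  IsTangent.conj (H := D.K') hY hs

/-- `Ad(K'₀)` preserves `𝔭⁻`. -/
theorem AdC_mem_pMinus (k : D.K'₀) {X : D.g'C} (hX : X ∈ D.pMinus) :
    AdC (D.toG' k) X ∈ D.pMinus := by
  have hcl := identityComponent_le_closure D.K' k.2
  -- Stability of `𝔭⁻` is known only infinitesimally. Along `exp(tY)` with `Y ∈ 𝔨` it integrates
  -- through a linear differential equation, and exponentials generate `K'₀`. The inverse is carried
  -- along for the induction.
  have key : ∀ (g : G.ArchPts), g ∈ Subgroup.closure (Set.range fun X : lieAlg D.K' =>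
      oneParam X 1) → ∃ s : D.G', (s : G.ArchPts) = g ∧
        ∀ X ∈ D.pMinus, AdC s X ∈ D.pMinus ∧ AdC s⁻¹ X ∈ D.pMinus := by
    intro g hg
    induction hg using Subgroup.closure_induction with
    | mem x hx =>
      obtain ⟨Y, rfl⟩ := hx
      have hYt : ∀ t, ∃ h ∈ D.G', archMatrix h = NormedSpace.exp (t • Y.1) := fun t =>
        ⟨oneParam Y t, D.K'_le_G' (oneParam_mem Y t), archMatrix_oneParam Y t⟩
      let Y' : D.g' := ⟨Y.1, hYt⟩
      have hY' : Y' ∈ D.k := Y.2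
      let γ : ℝ → D.G' := fun t => ⟨oneParam Y' t, oneParam_mem Y' t⟩
      have hγ0 : γ 0 = 1 := Subtype.ext (oneParam_zero Y')
      have hγ : ∀ s t, γ (s + t) = γ s * γ t := fun s t => Subtype.ext (oneParam_add Y' s t)
      have hγn : (γ 1)⁻¹ = γ (-1) := by
        rw [inv_eq_iff_mul_eq_one, ← hγ, add_neg_cancel, hγ0]
      have hmem : ∀ X ∈ D.pMinus, ∀ t, AdC (γ t) X ∈ D.pMinus := by
        intro X hX t
        refine mem_of_linear_ode (V := D.g'C) (A := LieAlgebra.ad ℂ D.g'C (1 ⊗ₜ Y'))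
          (p := D.pMinus.toSubmodule) (c := fun t => AdC (γ t) X) (fun v hv => ?_) (fun l t => ?_)
          ?_ t
        · exact D.bracket_pMinus _ (Submodule.tmul_mem_baseChange_of_mem 1 hY') v hv
        -- Writing `γ s = γ (s - t) γ t` reduces the derivative at `t` to the one at zero.
        · have h := hasDerivAt_of_mem_derivExpansions
            (derivExpansions_AdC Y' (γ := γ) (fun _ => rfl) (AdC (γ t) X)) l
          have h2 := HasDerivAt.comp_sub_const t t (by rw [sub_self]; exact h)
          refine h2.congr_of_eventuallyEq (Eventually.of_forall fun s => ?_)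
          simp only [← AdC_mul_apply, ← hγ, sub_add_cancel]
        · simp only [hγ0, AdC_one_apply]
          exact hX
      refine ⟨γ 1, (oneParam_eq (X := Y) (Y := Y') rfl 1).symm, fun X hX => ⟨hmem X hX 1, ?_⟩⟩
      rw [hγn]
      exact hmem X hX (-1)
    | one => exact ⟨1, rfl, fun X hX => by rw [inv_one, AdC_one_apply]; exact ⟨hX, hX⟩⟩
    | mul x y _ _ hx hy =>
      obtain ⟨s, hs, hs'⟩ := hx
      obtain ⟨t, ht, ht'⟩ := hy
      refine ⟨s * t, by rw [← hs, ← ht]; rfl, fun X hX => ?_⟩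
      rw [mul_inv_rev, AdC_mul_apply, AdC_mul_apply]
      exact ⟨(hs' _ (ht' _ hX).1).1, (ht' _ (hs' _ hX).2).2⟩
    | inv x _ hx =>
      obtain ⟨s, hs, hs'⟩ := hx
      refine ⟨s⁻¹, by rw [← hs]; rfl, fun X hX => ?_⟩
      rw [inv_inv]
      exact (hs' X hX).symm
  obtain ⟨s, hs, h⟩ := key _ hcl
  have : s = D.toG' k := Subtype.ext hs
  rw [← this]
  exact (h X hX).1

/-! ### The type `τ` and its derivative. -/

section Tau

variable {D} {Φ : G.Adelic → ℂ}

theorem self_mem_tauSpace : Φ ∈ (D.tauSpace Φ).toSubmodule :=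
  Submodule.subset_span ⟨1, LinearMap.congr_fun (map_one D.restrictedTranslation) Φ⟩

theorem tauSpace_le_archSpan : (D.tauSpace Φ).toSubmodule ≤ archSpan D.Kinf Φ := by
  refine Submodule.span_le.mpr ?_
  rintro _ ⟨k, rfl⟩
  exact rightTranslation_mem_archSpan _ (D.K'_le_Kinf (D.K'₀_le_K' k.2))

theorem tauSpace_le_smoothFunctions (hΦ : Φ ∈ smoothFunctions G) :
    (D.tauSpace Φ).toSubmodule ≤ smoothFunctions G :=
  tauSpace_le_archSpan.trans (archSpan_le_smoothFunctions hΦ)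

variable [FiniteDimensional ℂ (D.tauSpace Φ).toSubmodule]

/-- A finite-dimensional space of functions is closed under pointwise limits, so it contains the
velocity of `t ↦ R(exp(tY))v`. -/
theorem lieDeriv_mem_tauSpace (hΦ : Φ ∈ smoothFunctions G) {Y : D.g'} (hY : Y ∈ D.k)
    {v : G.Adelic → ℂ} (hv : v ∈ (D.tauSpace Φ).toSubmodule) :
    lieDeriv Y v ∈ (D.tauSpace Φ).toSubmodule := by
  refine mem_of_hasDerivAt_eval (E := (D.tauSpace Φ).toSubmodule) (t := 0)
    (c := fun t => rightTranslation G (oneParam Y t, 1) v) (fun t => ?_) fun g =>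
      smoothFunctions.hasDerivAt_zero (tauSpace_le_smoothFunctions hΦ hv) Y g
  exact (D.tauSpace Φ).apply_mem_toSubmodule ⟨_, D.oneParam_mem_K'₀ hY t⟩ hv

theorem isDerived_tau (hΦ : Φ ∈ smoothFunctions G) {Y : D.g'} (hY : Y ∈ D.k)
    {v w : (D.tauSpace Φ).toSubmodule} (h : (w : G.Adelic → ℂ) = lieDeriv Y v) :
    D.IsDerived (D.tau Φ) Y v w := by
  refine ⟨fun t => ⟨_, D.oneParam_mem_K'₀ hY t⟩, fun t => rfl,
    hasDerivAt_dual_of_hasDerivAt_eval fun g => ?_⟩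
  rw [h]
  exact smoothFunctions.hasDerivAt_zero (tauSpace_le_smoothFunctions hΦ v.2) Y g

/-- Point evaluations are among the functionals that test `IsDerived`, so the abstract derivative is
the concrete one. -/
theorem coe_eq_lieDeriv_of_isDerived (hΦ : Φ ∈ smoothFunctions G) {Y : D.g'}
    {v w : (D.tauSpace Φ).toSubmodule} (h : D.IsDerived (D.tau Φ) Y v w) :
    (w : G.Adelic → ℂ) = lieDeriv Y v := by
  obtain ⟨γ, hγ, h⟩ := h
  funext g
  have h1 := h (LinearMap.proj g ∘ₗ (D.tauSpace Φ).toSubmodule.subtype)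
  have h2 := smoothFunctions.hasDerivAt_zero (tauSpace_le_smoothFunctions hΦ v.2) Y g
  refine h1.unique (h2.congr_of_eventuallyEq (Eventually.of_forall fun t => ?_))
  simp only [← hγ]
  rfl

/-- The derivative of `τ` in the direction of `Y ∈ 𝔨`. -/
def dTau (hΦ : Φ ∈ smoothFunctions G) {Y : D.g'} (hY : Y ∈ D.k) :
    (D.tauSpace Φ).toSubmodule →ₗ[ℂ] (D.tauSpace Φ).toSubmodule where
  toFun v := ⟨lieDeriv Y v, lieDeriv_mem_tauSpace hΦ hY v.2⟩
  map_add' v w := Subtype.ext (smoothFunctions.lieDeriv_add (tauSpace_le_smoothFunctions hΦ v.2)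
    (tauSpace_le_smoothFunctions hΦ w.2) Y)
  map_smul' c v := Subtype.ext (lieDeriv_smul c _ Y)

theorem isDerived_dTau (hΦ : Φ ∈ smoothFunctions G) {Y : D.g'} (hY : Y ∈ D.k)
    (v : (D.tauSpace Φ).toSubmodule) : D.IsDerived (D.tau Φ) Y v (dTau hΦ hY v) :=
  isDerived_tau hΦ hY rfl

theorem continuousExpansions_tau {K : Type*} [TopologicalSpace K] {θ : K → D.K'₀}
    (hc : Continuous Φ) (hθ : Continuous θ) (v : (D.tauSpace Φ).toSubmodule) :
    (fun k => D.tau Φ (θ k) v) ∈ continuousExpansions ℂ K _ := by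
  refine continuousExpansions_of_basis (Module.finBasis ℂ (D.tauSpace Φ).toSubmodule) fun i => ?_
  refine continuous_dual_of_continuous_eval (fun g => ?_)
    ((Module.finBasis ℂ (D.tauSpace Φ).toSubmodule).coord i)
  have hv : Continuous (v : G.Adelic → ℂ) := by
    obtain ⟨v, hv⟩ := v
    induction hv using Submodule.span_induction with
    | mem x hx =>
      obtain ⟨k, rfl⟩ := hx
      exact hc.comp (continuous_mul_const _)
    | zero => exact continuous_const
    | add x y _ _ hx hy => exact hx.add hy
    | smul c x _ hx => exact hx.const_smul c
  exact hv.comp (continuous_const.mul ((continuous_subtype_val.comp hθ).prodMk continuous_const))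

theorem derivExpansions_tau (hΦ : Φ ∈ smoothFunctions G) {Y : D.g'} (hY : Y ∈ D.k) {γ : ℝ → D.K'₀}
    (hγ : ∀ t, (γ t : G.ArchPts) = oneParam Y t) (v : (D.tauSpace Φ).toSubmodule) :
    ((fun t => D.tau Φ (γ t) v), dTau hΦ hY v) ∈ derivExpansions ℂ _ := by
  refine derivExpansions_of_basis (Module.finBasis ℂ (D.tauSpace Φ).toSubmodule) fun i => ?_
  refine hasDerivAt_dual_of_hasDerivAt_eval (fun g => ?_)
    ((Module.finBasis ℂ (D.tauSpace Φ).toSubmodule).coord i)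
  have h2 := smoothFunctions.hasDerivAt_zero (tauSpace_le_smoothFunctions hΦ v.2) Y g
  refine h2.congr_of_eventuallyEq (Eventually.of_forall fun t => ?_)
  simp only [← hγ]
  rfl

end Tau

/-! ### `R(𝒰(𝔤'_ℂ))τ` as a quotient of `L_τ`. -/

section InducedModule

variable {D} {Φ : G.Adelic → ℂ}

/-- The map `𝒰(𝔤'_ℂ) ⊗ τ → C^∞`, `u ⊗ v ↦ R(u)v`. -/
def inducedMap (D : ArchimedeanData G) (hΦ : Φ ∈ smoothFunctions G) :
    D.U ⊗[ℂ] (D.tauSpace Φ).toSubmodule →ₗ[ℂ] smoothFunctions G :=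
  TensorProduct.lift (((envelopingAction D.G').toLinearMap).compl₂
    (Submodule.inclusion (tauSpace_le_smoothFunctions hΦ)))

theorem inducedMap_tmul (hΦ : Φ ∈ smoothFunctions G) (a : D.U) (v : (D.tauSpace Φ).toSubmodule) :
    inducedMap D hΦ (a ⊗ₜ v) =
      envelopingAction D.G' a ⟨v, tauSpace_le_smoothFunctions hΦ v.2⟩ := rfl

theorem inducedMap_smul (hΦ : Φ ∈ smoothFunctions G) (a : D.U)
    (x : D.U ⊗[ℂ] (D.tauSpace Φ).toSubmodule) :
    inducedMap D hΦ (a • x) = envelopingAction D.G' a (inducedMap D hΦ x) := by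
  induction x with
  | zero => simp
  | add x y hx hy => simp only [smul_add, map_add, hx, hy]
  | tmul b v =>
    rw [TensorProduct.smul_tmul', smul_eq_mul, inducedMap_tmul, inducedMap_tmul, map_mul]
    rfl

/-- `X R(k)Φ = R(k)(Ad(k⁻¹)X)Φ`, and `Ad(k⁻¹)X` is again in `𝔭⁻`; the functions `R(k)Φ` span `τ`. -/
theorem pMinus_tauSpace (hΦ : Φ ∈ smoothFunctions G) (h : D.AnnihilatedByPMinus Φ)
    {X : D.g'C} (hX : X ∈ D.pMinus) {v : G.Adelic → ℂ} (hv : v ∈ (D.tauSpace Φ).toSubmodule) :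
    envelopingAction D.G' (UniversalEnvelopingAlgebra.ι ℂ X)
      ⟨v, tauSpace_le_smoothFunctions hΦ hv⟩ = 0 := by
  have h0 : ∀ X ∈ D.pMinus, envelopingAction D.G' (UniversalEnvelopingAlgebra.ι ℂ X)
      ⟨Φ, hΦ⟩ = 0 := by
    intro X hX
    obtain ⟨a, b, rfl⟩ := exists_re_im_tensor X
    refine Subtype.ext ?_
    rw [map_add, map_add, LinearMap.add_apply, Submodule.coe_add, envelopingAction_ι,
      envelopingAction_ι, one_smul]
    exact h a b hX
  induction hv using Submodule.span_induction with
  | mem x hx =>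
    obtain ⟨k, rfl⟩ := hx
    have e := smoothTranslation_envelopingAction (D.toG' k)
      (UniversalEnvelopingAlgebra.ι ℂ (AdC (D.toG' k⁻¹) X)) ⟨Φ, hΦ⟩
    rw [h0 _ (D.AdC_mem_pMinus k⁻¹ hX), map_zero, AdU_ι, ← AdC_mul_apply, ← map_mul,
      mul_inv_cancel, map_one, AdC_one_apply] at e
    exact e.symm
  | zero => exact map_zero _
  | add x y hx hy hx' hy' =>
    have e := congrArg₂ (· + ·) hx' hy'
    simp only [← map_add, add_zero] at e
    exact e
  | smul c x hx hx' =>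
    have e := congrArg (c • ·) hx'
    simp only [← map_smul, smul_zero] at e
    exact e

/-- This is the factorization of `inducedMap` through `L_τ`, by which hypotheses on `L_τ` become
statements about functions. -/
theorem inducedMap_eq_zero [FiniteDimensional ℂ (D.tauSpace Φ).toSubmodule]
    (hΦ : Φ ∈ smoothFunctions G) (h : D.AnnihilatedByPMinus Φ)
    {x : D.U ⊗[ℂ] (D.tauSpace Φ).toSubmodule} (hx : x ∈ D.inducedRelations (D.tau Φ)) :
    inducedMap D hΦ x = 0 := by
  induction hx using Submodule.span_induction with
  | mem x hx =>
    rcases hx with ⟨Y, hY, v, w, hvw, rfl⟩ | ⟨X, hX, v, rfl⟩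
    · rw [map_sub, inducedMap_tmul, inducedMap_tmul, map_one, sub_eq_zero]
      refine Subtype.ext ?_
      rw [envelopingAction_ι, one_smul]
      exact (coe_eq_lieDeriv_of_isDerived hΦ hvw).symm
    · rw [inducedMap_tmul]
      exact pMinus_tauSpace hΦ h hX v.2
  | zero => exact map_zero _
  | add x y _ _ hx hy => rw [map_add, hx, hy, add_zero]
  | smul a x _ hx => rw [inducedMap_smul, hx, map_zero]

end InducedModule

end ArchimedeanData

theorem LinearMap.comp_eq_sum_smulRight {R E X ι : Type*} [CommRing R] [AddCommGroup E] [Module R E]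
    [AddCommGroup X] [Module R X] [Fintype ι] (b : Module.Basis ι R E) (A : E →ₗ[R] X)
    (B : E →ₗ[R] E) :
    A ∘ₗ B = ∑ i, (b.coord i ∘ₗ B).smulRight (A (b i)) := by
  refine LinearMap.ext fun v => ?_
  rw [LinearMap.sum_apply, LinearMap.comp_apply]
  conv_lhs => rw [← b.sum_repr (B v), map_sum]
  refine Finset.sum_congr rfl fun i _ => ?_
  rw [map_smul]
  rfl

namespace ArchimedeanData

variable {F : Type u} [Field F] [NumberField F] {n : ℕ} {G : LinearAlgebraicGroup F n}
  {D : ArchimedeanData G} {Φ : G.Adelic → ℂ}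

/-! ### Lifting `K'₀`-homomorphisms into `𝒰(𝔤'_ℂ) ⊗ τ`. -/

section Lifting

/-- The adjoint representation on the enveloping algebra. -/
def adjointRepresentation (H : ClosedSubgroup G.ArchPts) :
    Representation ℂ H (UniversalEnvelopingAlgebra ℂ (ℂ ⊗[ℝ] lieAlg H)) where
  toFun s := (AdU s).toLinearMap
  map_one' := LinearMap.ext AdU_one_apply
  map_mul' s t := LinearMap.ext (AdU_mul_apply s t)

/-- The action of `K'₀` on `𝒰(𝔤'_ℂ) ⊗ τ`. -/
def inducedTranslation (D : ArchimedeanData G) (Φ : G.Adelic → ℂ) :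
    Representation ℂ D.K'₀ (D.U ⊗[ℂ] (D.tauSpace Φ).toSubmodule) :=
  Representation.tprod ((adjointRepresentation D.G').comp D.toG') (D.tau Φ)

theorem inducedTranslation_tmul (k : D.K'₀) (a : D.U) (v : (D.tauSpace Φ).toSubmodule) :
    inducedTranslation D Φ k (a ⊗ₜ v) = AdU (D.toG' k) a ⊗ₜ D.tau Φ k v := rfl

theorem inducedMap_inducedTranslation (hΦ : Φ ∈ smoothFunctions G) (k : D.K'₀)
    (x : D.U ⊗[ℂ] (D.tauSpace Φ).toSubmodule) :
    inducedMap D hΦ (inducedTranslation D Φ k x) = smoothTranslation G k (inducedMap D hΦ x) := by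
  induction x with
  | zero => simp only [map_zero]
  | add x y hx hy => simp only [map_add, hx, hy]
  | tmul a v =>
    rw [inducedTranslation_tmul, inducedMap_tmul, inducedMap_tmul]
    exact (smoothTranslation_envelopingAction (D.toG' k) a
      ⟨v, tauSpace_le_smoothFunctions hΦ v.2⟩).symm

variable [FiniteDimensional ℂ (D.tauSpace Φ).toSubmodule]

theorem continuousExpansions_inducedTranslation {K : Type*} [TopologicalSpace K] {θ : K → D.K'₀}
    (hc : Continuous Φ) (hθ : Continuous θ) (x : D.U ⊗[ℂ] (D.tauSpace Φ).toSubmodule) :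
    (fun k => inducedTranslation D Φ (θ k) x) ∈ continuousExpansions ℂ K _ := by
  induction x with
  | zero =>
    simp only [map_zero]
    exact const_mem_continuousExpansions _
  | add x y hx hy =>
    refine (congrArg (· ∈ continuousExpansions ℂ K _) (funext fun k => ?_)).mp (add_mem hx hy)
    simp
  | tmul a v =>
    exact map₂_mem_continuousExpansions (TensorProduct.mk ℂ D.U (D.tauSpace Φ).toSubmodule)
      (continuousExpansions_AdU (D.continuous_toG'.comp hθ) a) (continuousExpansions_tau hc hθ v)

/-- The derivative of the action of `K'₀` on `𝒰(𝔤'_ℂ) ⊗ τ`. -/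
def dInducedTranslation (hΦ : Φ ∈ smoothFunctions G) {Y : D.g'} (hY : Y ∈ D.k) :
    D.U ⊗[ℂ] (D.tauSpace Φ).toSubmodule →ₗ[ℂ] D.U ⊗[ℂ] (D.tauSpace Φ).toSubmodule :=
  TensorProduct.map (LinearMap.mulLeft ℂ (UniversalEnvelopingAlgebra.ι ℂ (1 ⊗ₜ Y : D.g'C)) -
    LinearMap.mulRight ℂ (UniversalEnvelopingAlgebra.ι ℂ (1 ⊗ₜ Y : D.g'C))) LinearMap.id +
  TensorProduct.map LinearMap.id (dTau hΦ hY)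

theorem derivExpansions_inducedTranslation (hΦ : Φ ∈ smoothFunctions G) {Y : D.g'} (hY : Y ∈ D.k)
    {γ : ℝ → D.K'₀} (hγ : ∀ t, (γ t : G.ArchPts) = oneParam Y t)
    (x : D.U ⊗[ℂ] (D.tauSpace Φ).toSubmodule) :
    ((fun t => inducedTranslation D Φ (γ t) x), dInducedTranslation hΦ hY x) ∈
      derivExpansions ℂ _ := by
  have hγ0 : γ 0 = 1 := Subtype.ext ((hγ 0).trans (oneParam_zero Y))
  induction x with
  | zero =>
    simp only [map_zero]
    exact zero_mem_derivExpansions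
  | add x y hx hy =>
    refine (congrArg (· ∈ derivExpansions ℂ _) ?_).mp (add_mem hx hy)
    ext1
    · funext t; simp
    · simp
  | tmul a v =>
    have h := map₂_mem_derivExpansions (TensorProduct.mk ℂ D.U (D.tauSpace Φ).toSubmodule)
      (derivExpansions_AdU Y (γ := fun t => D.toG' (γ t)) hγ a) (derivExpansions_tau hΦ hY hγ v)
    refine (congrArg (· ∈ derivExpansions ℂ _) ?_).mp h
    ext1
    · rfl
    · simp only [hγ0, map_one, AdU_one_apply, TensorProduct.mk_apply, Module.End.one_apply]
      rfl

/-- The derived action sends `a ⊗ v` to `(Ya - aY) ⊗ v + a ⊗ Yv`, and the relations identify `aY ⊗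
v` with `a ⊗ Yv`. On `L_τ` the derived action of `K'₀` is therefore left multiplication by `𝔨`. -/
theorem dInducedTranslation_sub_mem (hΦ : Φ ∈ smoothFunctions G) {Y : D.g'} (hY : Y ∈ D.k)
    (x : D.U ⊗[ℂ] (D.tauSpace Φ).toSubmodule) :
    dInducedTranslation hΦ hY x - UniversalEnvelopingAlgebra.ι ℂ (1 ⊗ₜ Y : D.g'C) • x ∈
      D.inducedRelations (D.tau Φ) := by
  induction x with
  | zero => simp
  | add x y hx hy =>
    have := add_mem hx hy
    refine (congrArg (· ∈ D.inducedRelations (D.tau Φ)) ?_).mp this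
    rw [map_add, smul_add]
    abel
  | tmul a v =>
    have h : UniversalEnvelopingAlgebra.ι ℂ (1 ⊗ₜ Y : D.g'C) ⊗ₜ[ℂ] v - 1 ⊗ₜ dTau hΦ hY v ∈
        D.inducedRelations (D.tau Φ) :=
      Submodule.subset_span (Or.inl ⟨Y, hY, v, _, isDerived_dTau hΦ hY v, rfl⟩)
    have h2 := Submodule.smul_mem _ (-a) h
    refine (congrArg (· ∈ D.inducedRelations (D.tau Φ)) ?_).mp h2
    rw [smul_sub, TensorProduct.smul_tmul', TensorProduct.smul_tmul', TensorProduct.smul_tmul']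
    simp only [dInducedTranslation, LinearMap.add_apply, TensorProduct.map_tmul,
      LinearMap.sub_apply, LinearMap.mulLeft_apply, LinearMap.mulRight_apply, LinearMap.id_apply,
      smul_eq_mul, mul_one, neg_mul, TensorProduct.sub_tmul, TensorProduct.neg_tmul]
    abel

/-- The representation of `K'₀` on `Hom(τ, 𝒰(𝔤'_ℂ) ⊗ τ)`, twisted by an element of `K'`. -/
def liftRepresentation (D : ArchimedeanData G) (Φ : G.Adelic → ℂ) {s : G.ArchPts} (hs : s ∈ D.K') :
    Representation ℂ D.K'₀
      ((D.tauSpace Φ).toSubmodule →ₗ[ℂ] D.U ⊗[ℂ] (D.tauSpace Φ).toSubmodule) :=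
  (D.tau Φ).linHom ((inducedTranslation D Φ).comp (D.conjK'₀ hs))

theorem liftRepresentation_apply {s : G.ArchPts} (hs : s ∈ D.K') (k : D.K'₀)
    (ψ : (D.tauSpace Φ).toSubmodule →ₗ[ℂ] D.U ⊗[ℂ] (D.tauSpace Φ).toSubmodule)
    (v : (D.tauSpace Φ).toSubmodule) : liftRepresentation D Φ hs k ψ v =
      inducedTranslation D Φ (D.conjK'₀ hs k) (ψ (D.tau Φ k⁻¹ v)) := rfl

theorem map_tau_of_liftRepresentation {s : G.ArchPts} (hs : s ∈ D.K')
    {ψ : (D.tauSpace Φ).toSubmodule →ₗ[ℂ] D.U ⊗[ℂ] (D.tauSpace Φ).toSubmodule}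
    (h : ∀ k, liftRepresentation D Φ hs k ψ = ψ) (k : D.K'₀) (v : (D.tauSpace Φ).toSubmodule) :
    ψ (D.tau Φ k v) = inducedTranslation D Φ (D.conjK'₀ hs k) (ψ v) := by
  have e := LinearMap.congr_fun (h k) (D.tau Φ k v)
  rw [liftRepresentation_apply, ← Module.End.mul_apply, ← map_mul (D.tau Φ),
    inv_mul_cancel, map_one (D.tau Φ), Module.End.one_apply] at e
  exact e.symm

theorem continuousExpansions_liftRepresentation (hc : Continuous Φ) {s : G.ArchPts}
    (hs : s ∈ D.K')
    (ψ : (D.tauSpace Φ).toSubmodule →ₗ[ℂ] D.U ⊗[ℂ] (D.tauSpace Φ).toSubmodule) :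
    (fun k => liftRepresentation D Φ hs k ψ) ∈ continuousExpansions ℂ D.K'₀ _ := by
  let b := Module.finBasis ℂ (D.tauSpace Φ).toSubmodule
  have e : (fun k => liftRepresentation D Φ hs k ψ) = ∑ i, fun k =>
      LinearMap.smulRightₗ (b.coord i ∘ₗ D.tau Φ k⁻¹)
        (inducedTranslation D Φ (D.conjK'₀ hs k) (ψ (b i))) := by
    funext k
    rw [Finset.sum_apply]
    exact LinearMap.comp_eq_sum_smulRight b
      (inducedTranslation D Φ (D.conjK'₀ hs k) ∘ₗ ψ) (D.tau Φ k⁻¹)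
  rw [e]
  refine Submodule.sum_mem _ fun i _ => ?_
  refine map₂_mem_continuousExpansions (𝕜 := ℂ) (X := Module.Dual ℂ (D.tauSpace Φ).toSubmodule)
    (Y := D.U ⊗[ℂ] (D.tauSpace Φ).toSubmodule)
    (Z := (D.tauSpace Φ).toSubmodule →ₗ[ℂ] D.U ⊗[ℂ] (D.tauSpace Φ).toSubmodule)
    LinearMap.smulRightₗ ?_
    (continuousExpansions_inducedTranslation hc (D.continuous_conjK'₀ hs) _)
  have hd := continuousExpansions_of_basis (𝕜 := ℂ) b.dualBasis
    (c := fun k : D.K'₀ => (b.coord i ∘ₗ D.tau Φ k⁻¹ : Module.Dual ℂ _)) fun j => by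
      simp only [Module.Basis.dualBasis_repr]
      exact continuous_of_mem_continuousExpansions (continuousExpansions_tau hc continuous_inv (b j))
        (b.coord i)
  exact hd

/-- The derivative of a `K'₀`-homomorphism from `τ` to `𝒰(𝔤'_ℂ) ⊗ τ`. -/
theorem map_dTau_of_equivariant (hΦ : Φ ∈ smoothFunctions G) {s : G.ArchPts} (hs : s ∈ D.K')
    (ψ : (D.tauSpace Φ).toSubmodule →ₗ[ℂ] D.U ⊗[ℂ] (D.tauSpace Φ).toSubmodule)
    (v : (D.tauSpace Φ).toSubmodule)
    (hcomm : ∀ k, ψ (D.tau Φ k v) = inducedTranslation D Φ (D.conjK'₀ hs k) (ψ v))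
    {Y : D.g'} (hY : Y ∈ D.k) :
    ψ (dTau hΦ hY v) = dInducedTranslation hΦ (D.Ad_mem_k hs hY) (ψ v) := by
  let γ : ℝ → D.K'₀ := fun t => ⟨_, D.oneParam_mem_K'₀ hY t⟩
  have hγ' : ∀ t, ((D.conjK'₀ hs (γ t) : D.K'₀) : G.ArchPts) =
      oneParam (Ad (⟨s, D.K'_le_G' hs⟩ : D.G') Y) t := fun t =>
    (oneParam_conj (X := Y) (Y := Ad (⟨s, D.K'_le_G' hs⟩ : D.G') Y) s rfl t).symm
  have h1 := map_mem_derivExpansions ψ (derivExpansions_tau hΦ hY (γ := γ) (fun t => rfl) v)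
  have h2 := derivExpansions_inducedTranslation hΦ (D.Ad_mem_k hs hY)
    (γ := fun t => D.conjK'₀ hs (γ t)) hγ' (ψ v)
  simp only [hcomm] at h1
  exact eq_of_mem_derivExpansions h1 h2

/-- Lifting of `K'₀`-homomorphisms from `τ` through `𝒰(𝔤'_ℂ) ⊗ τ → R(𝒰(𝔤'_ℂ))τ`. -/
theorem exists_lift (hΦ : Φ ∈ smoothFunctions G) (hc : Continuous Φ) {s : G.ArchPts}
    (hs : s ∈ D.K') (φ : (D.tauSpace Φ).toSubmodule →ₗ[ℂ] smoothFunctions G)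
    (hr : ∀ v, φ v ∈ LinearMap.range (inducedMap D hΦ))
    (hφ : ∀ (k : D.K'₀) v, φ (D.tau Φ k v) = smoothTranslation G (D.conjK'₀ hs k) (φ v)) :
    ∃ ψ : (D.tauSpace Φ).toSubmodule →ₗ[ℂ] D.U ⊗[ℂ] (D.tauSpace Φ).toSubmodule,
      (∀ v, inducedMap D hΦ (ψ v) = φ v) ∧ ∀ Y ∈ D.k, ∀ v w, D.IsDerived (D.tau Φ) Y v w →
        (D.inducedRelations (D.tau Φ)).mkQ (ψ w) =
          D.lAction (D.tau Φ) (AdC (⟨s, D.K'_le_G' hs⟩ : D.G') (1 ⊗ₜ Y))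
            ((D.inducedRelations (D.tau Φ)).mkQ (ψ v)) := by
  let b := Module.finBasis ℂ (D.tauSpace Φ).toSubmodule
  choose y hy using fun i => hr (b i)
  let ψ₀ := b.constr ℂ y
  have hψ₀ : ∀ v, inducedMap D hΦ (ψ₀ v) = φ v := by
    have : inducedMap D hΦ ∘ₗ ψ₀ = φ := b.ext fun i => by
      rw [LinearMap.comp_apply, Module.Basis.constr_basis, hy]
    exact LinearMap.congr_fun this
  -- An arbitrary linear lift is averaged over `K'₀`. Its image in the smooth functions stays equal
  -- to `φ`, because `φ` is already equivariant.
  obtain ⟨ψ, hinv, hψ⟩ := (liftRepresentation D Φ hs).exists_average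
    (Y := (D.tauSpace Φ).toSubmodule →ₗ[ℂ] smoothFunctions G)
    (continuousExpansions_liftRepresentation hc hs ψ₀)
  refine ⟨ψ, LinearMap.congr_fun (hψ (LinearMap.llcomp ℂ _ _ _ (inducedMap D hΦ)) φ fun k =>
    LinearMap.ext fun v => ?_), ?_⟩
  · rw [LinearMap.llcomp_apply, liftRepresentation_apply, inducedMap_inducedTranslation, hψ₀,
      ← hφ, ← Module.End.mul_apply, ← map_mul (D.tau Φ), mul_inv_cancel, map_one (D.tau Φ),
      Module.End.one_apply]
  · intro Y hY v w hvw
    have hw : w = dTau hΦ hY v := Subtype.ext (coe_eq_lieDeriv_of_isDerived hΦ hvw)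
    have h1 := map_dTau_of_equivariant hΦ hs ψ v
      (fun k => map_tau_of_liftRepresentation hs hinv k v) hY
    have h2 := (Submodule.Quotient.eq _).mpr
      (dInducedTranslation_sub_mem hΦ (D.Ad_mem_k hs hY) (ψ v))
    rw [← h1, ← hw] at h2
    rw [AdC_tmul]
    exact h2

end Lifting

end ArchimedeanData

/-! ### Irreducible representations and transport of structure. -/

section Irreducible

variable {K V W : Type*} [Monoid K] [AddCommGroup V] [Module ℂ V] [AddCommGroup W] [Module ℂ W]

theorem Representation.isIrreducible_iff_forall {ρ : Representation ℂ K V} : ρ.IsIrreducible ↔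
    Nontrivial V ∧ ∀ p : Submodule ℂ V, (∀ k, ∀ v ∈ p, ρ k v ∈ p) → p = ⊥ ∨ p = ⊤ := by
  constructor
  · intro h
    refine ⟨?_, fun p hp => ?_⟩
    · by_contra hV
      rw [not_nontrivial_iff_subsingleton] at hV
      obtain ⟨a, b, hab⟩ := h.exists_pair_ne
      exact hab (Subrepresentation.toSubmodule_injective (Subsingleton.elim _ _))
    · let p' : Subrepresentation ρ := ⟨p, fun k v hv => hp k v hv⟩
      rcases h.eq_bot_or_eq_top p' with h | h
      · exact Or.inl (congrArg Subrepresentation.toSubmodule h)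
      · exact Or.inr (congrArg Subrepresentation.toSubmodule h)
  · rintro ⟨hV, h⟩
    have hnt : Nontrivial (Subrepresentation ρ) := by
      refine ⟨⊥, ⊤, fun e => ?_⟩
      have e' : (⊥ : Submodule ℂ V) = ⊤ := congrArg Subrepresentation.toSubmodule e
      exact bot_ne_top e'
    refine { hnt with eq_bot_or_eq_top := fun p => ?_ }
    rcases h p.toSubmodule (fun k v hv => p.apply_mem_toSubmodule k hv) with h | h
    · exact Or.inl (Subrepresentation.toSubmodule_injective h)
    · exact Or.inr (Subrepresentation.toSubmodule_injective h)

/-- Transport of a representation along a linear equivalence. -/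
def Representation.transport (ρ : Representation ℂ K V) (e : V ≃ₗ[ℂ] W) :
    Representation ℂ K W where
  toFun k := e.toLinearMap ∘ₗ ρ k ∘ₗ e.symm.toLinearMap
  map_one' := by ext w; simp
  map_mul' k l := by ext w; simp

theorem Representation.transport_apply (ρ : Representation ℂ K V) (e : V ≃ₗ[ℂ] W) (k : K) (w : W) :
    ρ.transport e k w = e (ρ k (e.symm w)) := rfl

theorem Representation.IsIrreducible.transport {ρ : Representation ℂ K V} (h : ρ.IsIrreducible)
    (e : V ≃ₗ[ℂ] W) : (ρ.transport e).IsIrreducible := by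
  rw [isIrreducible_iff_forall] at h ⊢
  obtain ⟨hV, h⟩ := h
  refine ⟨e.symm.toEquiv.nontrivial, fun p hp => ?_⟩
  have hc : ∀ k, ∀ v ∈ p.comap e.toLinearMap, ρ k v ∈ p.comap e.toLinearMap := by
    intro k v hv
    have := hp k (e v) hv
    rw [transport_apply, e.symm_apply_apply] at this
    exact this
  have he : ∀ w ∈ p, e.symm w ∈ p.comap e.toLinearMap := fun w hw => by
    rw [Submodule.mem_comap, LinearEquiv.coe_coe, e.apply_symm_apply]
    exact hw
  rcases h _ hc with h | h
  · refine Or.inl (p.eq_bot_iff.mpr fun w hw => ?_)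
    have := (Submodule.eq_bot_iff _).mp h _ (he w hw)
    exact e.symm.map_eq_zero_iff.mp this
  · refine Or.inr (Submodule.eq_top_iff'.mpr fun w => ?_)
    have := Submodule.eq_top_iff'.mp h (e.symm w)
    rw [Submodule.mem_comap, LinearEquiv.coe_coe, e.apply_symm_apply] at this
    exact this

theorem Submodule.exists_smul_eq_of_finrank_eq_one {X : Type*} [AddCommGroup X] [Module ℂ X]
    {P : Submodule ℂ X} (h : Module.finrank ℂ P = 1) {x y : X} (hx : x ∈ P) (hx0 : x ≠ 0)
    (hy : y ∈ P) : ∃ c : ℂ, c • x = y := by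
  have h0 : (⟨x, hx⟩ : P) ≠ 0 := fun h => hx0 (congrArg Subtype.val h)
  obtain ⟨c, hc⟩ := (finrank_eq_one_iff_of_nonzero' _ h0).mp h ⟨y, hy⟩
  exact ⟨c, congrArg Subtype.val hc⟩

end Irreducible

/-! ### Consequences of the hypotheses on `K'₀`-types. -/

namespace ArchimedeanData

variable {F : Type u} [Field F] [NumberField F] {n : ℕ} {G : LinearAlgebraicGroup F n}
  {D : ArchimedeanData G} {Φ : G.Adelic → ℂ}

section Transport

variable {E E' M : Type*} [AddCommGroup E] [Module ℂ E] [AddCommGroup E'] [Module ℂ E']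
  [AddCommGroup M] [Module ℂ M]

theorem comp_mem_typeHom_transport {ρ : Representation ℂ D.K'₀ E} (e : E ≃ₗ[ℂ] E')
    {a : D.g'C →ₗ⁅ℂ⁆ Module.End ℂ M} {f : E →ₗ[ℂ] M} (hf : f ∈ D.typeHom ρ a) :
    f ∘ₗ e.symm.toLinearMap ∈ D.typeHom (ρ.transport e) a := by
  rintro Y hY v w ⟨γ, hγ, h⟩
  refine hf Y hY _ _ ⟨γ, hγ, fun l => ?_⟩
  have := h (l ∘ₗ e.symm.toLinearMap)
  simpa [Representation.transport_apply] using this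

theorem typeHom_transport_ne_bot {ρ : Representation ℂ D.K'₀ E} (e : E ≃ₗ[ℂ] E')
    {a : D.g'C →ₗ⁅ℂ⁆ Module.End ℂ M} {f : E →ₗ[ℂ] M} (hf : f ∈ D.typeHom ρ a) (h0 : f ≠ 0) :
    D.typeHom (ρ.transport e) a ≠ ⊥ := by
  intro hbot
  have h1 := comp_mem_typeHom_transport e hf
  rw [hbot, Submodule.mem_bot] at h1
  refine h0 (LinearMap.ext fun v => ?_)
  have := LinearMap.congr_fun h1 (e v)
  simpa using this

end Transport

theorem conjK'₀_one (k : D.K'₀) : D.conjK'₀ (one_mem D.K') k = k := Subtype.ext (by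
  change 1 * (k : G.ArchPts) * 1⁻¹ = k
  rw [one_mul, inv_one, mul_one])

/-- The map `v ↦ 1 ⊗ v` to the induced module. -/
def inducedUnit (D : ArchimedeanData G) (Φ : G.Adelic → ℂ) :
    (D.tauSpace Φ).toSubmodule →ₗ[ℂ] D.L (D.tau Φ) :=
  ((D.inducedRelations (D.tau Φ)).mkQ.restrictScalars ℂ) ∘ₗ
    TensorProduct.mk ℂ D.U (D.tauSpace Φ).toSubmodule 1

theorem mkQ_tmul_of_isDerived {Y : D.g'} (hY : Y ∈ D.k) {v w : (D.tauSpace Φ).toSubmodule}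
    (h : D.IsDerived (D.tau Φ) Y v w) (a : D.U) :
    (D.inducedRelations (D.tau Φ)).mkQ (a ⊗ₜ w) = (D.inducedRelations (D.tau Φ)).mkQ
      ((a * UniversalEnvelopingAlgebra.ι ℂ (1 ⊗ₜ Y : D.g'C)) ⊗ₜ v) := by
  have h1 : UniversalEnvelopingAlgebra.ι ℂ (1 ⊗ₜ Y : D.g'C) ⊗ₜ[ℂ] v - 1 ⊗ₜ w ∈
      D.inducedRelations (D.tau Φ) :=
    Submodule.subset_span (Or.inl ⟨Y, hY, v, w, h, rfl⟩)
  have h2 := Submodule.smul_mem _ a h1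
  rw [smul_sub, TensorProduct.smul_tmul', TensorProduct.smul_tmul', smul_eq_mul, smul_eq_mul,
    mul_one] at h2
  exact ((Submodule.Quotient.eq _).mpr h2).symm

theorem lAction_mkQ_tmul (X : D.g'C) (a : D.U) (v : (D.tauSpace Φ).toSubmodule) :
    D.lAction (D.tau Φ) X ((D.inducedRelations (D.tau Φ)).mkQ (a ⊗ₜ v)) =
      (D.inducedRelations (D.tau Φ)).mkQ ((UniversalEnvelopingAlgebra.ι ℂ X * a) ⊗ₜ v) := rfl

/-- For `a` commuting with all of `𝔨`, this makes `v ↦ a ⊗ v` an element of `Hom(τ, L_τ)`: `a = 1`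
gives the canonical generator, and a Casimir element must give a multiple of it. -/
theorem mkQ_tmul_of_commute {Y : D.g'} (hY : Y ∈ D.k) {v w : (D.tauSpace Φ).toSubmodule}
    (h : D.IsDerived (D.tau Φ) Y v w) {a : D.U}
    (ha : UniversalEnvelopingAlgebra.ι ℂ (1 ⊗ₜ Y : D.g'C) * a =
      a * UniversalEnvelopingAlgebra.ι ℂ (1 ⊗ₜ Y : D.g'C)) :
    (D.inducedRelations (D.tau Φ)).mkQ (a ⊗ₜ w) =
      D.lAction (D.tau Φ) (1 ⊗ₜ Y) ((D.inducedRelations (D.tau Φ)).mkQ (a ⊗ₜ v)) := by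
  have h1 := mkQ_tmul_of_isDerived hY h a
  rw [← ha] at h1
  exact h1.trans (lAction_mkQ_tmul (1 ⊗ₜ Y) a v).symm

theorem inducedUnit_mem_typeHom :
    inducedUnit D Φ ∈ D.typeHom (D.tau Φ) (D.lAction (D.tau Φ)) := fun Y hY v w h =>
  mkQ_tmul_of_commute (a := 1) hY h ((mul_one _).trans (one_mul _).symm)

section Consequences

variable [FiniteDimensional ℂ (D.tauSpace Φ).toSubmodule]

theorem inducedMap_eq_of_mkQ_eq (hΦ : Φ ∈ smoothFunctions G) (hp : D.AnnihilatedByPMinus Φ)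
    {x y : D.U ⊗[ℂ] (D.tauSpace Φ).toSubmodule}
    (h : (D.inducedRelations (D.tau Φ)).mkQ x = (D.inducedRelations (D.tau Φ)).mkQ y) :
    inducedMap D hΦ x = inducedMap D hΦ y := by
  have h1 := (Submodule.Quotient.eq _).mp h
  rw [← sub_eq_zero, ← map_sub]
  exact inducedMap_eq_zero hΦ hp h1

theorem inducedMap_one_tmul (hΦ : Φ ∈ smoothFunctions G) (v : (D.tauSpace Φ).toSubmodule) :
    inducedMap D hΦ (1 ⊗ₜ v) = ⟨v, tauSpace_le_smoothFunctions hΦ v.2⟩ := by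
  rw [inducedMap_tmul, map_one]
  rfl

/-- The relations could in principle kill `1 ⊗ τ`; they do not, since `inducedMap` recovers `v` from
`1 ⊗ v`. -/
theorem inducedUnit_ne_zero (hΦ : Φ ∈ smoothFunctions G) (hp : D.AnnihilatedByPMinus Φ)
    (hirr : (D.tau Φ).IsIrreducible) : inducedUnit D Φ ≠ 0 := by
  intro h0
  obtain ⟨hnt, -⟩ := Representation.isIrreducible_iff_forall.mp hirr
  obtain ⟨v, hv⟩ := exists_ne (0 : (D.tauSpace Φ).toSubmodule)
  have h1 : (D.inducedRelations (D.tau Φ)).mkQ (1 ⊗ₜ v) =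
      (D.inducedRelations (D.tau Φ)).mkQ 0 :=
    (LinearMap.congr_fun h0 v).trans (map_zero _).symm
  have h2 := inducedMap_eq_of_mkQ_eq hΦ hp h1
  rw [inducedMap_one_tmul, map_zero] at h2
  exact hv (Subtype.ext (congrArg (fun f : smoothFunctions G => (f : G.Adelic → ℂ)) h2))

/-- Elements of `Hom(τ, L_τ)` that lift to `𝒰(𝔤'_ℂ) ⊗ τ` are scalars. -/
theorem exists_inducedMap_eq_smul (hΦ : Φ ∈ smoothFunctions G) (hp : D.AnnihilatedByPMinus Φ)
    (hirr : (D.tau Φ).IsIrreducible) (honce : D.OccursOnce (D.tau Φ) (D.lAction (D.tau Φ)))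
    (ψ : (D.tauSpace Φ).toSubmodule →ₗ[ℂ] D.U ⊗[ℂ] (D.tauSpace Φ).toSubmodule)
    (hψ : ∀ Y ∈ D.k, ∀ v w, D.IsDerived (D.tau Φ) Y v w →
      (D.inducedRelations (D.tau Φ)).mkQ (ψ w) = D.lAction (D.tau Φ) (1 ⊗ₜ Y)
        ((D.inducedRelations (D.tau Φ)).mkQ (ψ v))) :
    ∃ c : ℂ, ∀ v, inducedMap D hΦ (ψ v) = c • ⟨v, tauSpace_le_smoothFunctions hΦ v.2⟩ := by
  let f : (D.tauSpace Φ).toSubmodule →ₗ[ℂ] D.L (D.tau Φ) :=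
    ((D.inducedRelations (D.tau Φ)).mkQ.restrictScalars ℂ) ∘ₗ ψ
  have hf : f ∈ D.typeHom (D.tau Φ) (D.lAction (D.tau Φ)) := hψ
  obtain ⟨c, hcf⟩ := Submodule.exists_smul_eq_of_finrank_eq_one honce inducedUnit_mem_typeHom
    (inducedUnit_ne_zero hΦ hp hirr) hf
  refine ⟨c, fun v => ?_⟩
  have h1 : c • inducedUnit D Φ v = f v := LinearMap.congr_fun hcf v
  have h2 : (D.inducedRelations (D.tau Φ)).mkQ (ψ v) =
      (D.inducedRelations (D.tau Φ)).mkQ (c • (1 ⊗ₜ v)) := by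
    refine h1.symm.trans ?_
    exact (LinearMap.map_smul ((D.inducedRelations (D.tau Φ)).mkQ.restrictScalars ℂ) c _).symm
  rw [inducedMap_eq_of_mkQ_eq hΦ hp h2, map_smul, inducedMap_one_tmul]

/-- `K'₀`-homomorphisms from `τ` to `R(𝒰(𝔤'_ℂ))τ` are scalars. -/
theorem hom_eq_smul (hΦ : Φ ∈ smoothFunctions G) (hc : Continuous Φ) (hp : D.AnnihilatedByPMinus Φ)
    (hirr : (D.tau Φ).IsIrreducible) (honce : D.OccursOnce (D.tau Φ) (D.lAction (D.tau Φ)))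
    (φ : (D.tauSpace Φ).toSubmodule →ₗ[ℂ] smoothFunctions G)
    (hr : ∀ v, φ v ∈ LinearMap.range (inducedMap D hΦ))
    (hφ : ∀ (k : D.K'₀) v, φ (D.tau Φ k v) = smoothTranslation G k (φ v)) :
    ∃ c : ℂ, ∀ v, φ v = c • ⟨v, tauSpace_le_smoothFunctions hΦ v.2⟩ := by
  obtain ⟨ψ, hψ, hψ'⟩ := exists_lift hΦ hc (one_mem D.K') φ hr
    (fun k v => (hφ k v).trans (by rw [conjK'₀_one]))
  obtain ⟨c, hcψ⟩ := exists_inducedMap_eq_smul hΦ hp hirr honce ψ (fun Y hY v w h =>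
    (hψ' Y hY v w h).trans (congrArg (fun X => D.lAction (D.tau Φ) X
      ((D.inducedRelations (D.tau Φ)).mkQ (ψ v))) (AdC_one_apply (H := D.G') (1 ⊗ₜ Y))))
  exact ⟨c, fun v => (hψ v).symm.trans (hcψ v)⟩

/-- There are no twisted `K'₀`-homomorphisms from `τ` to `R(𝒰(𝔤'_ℂ))τ`, if the corresponding
twist of `L_τ` has no `K'₀`-type in common with `L_τ`. -/
theorem twisted_hom_eq_zero (hΦ : Φ ∈ smoothFunctions G) (hc : Continuous Φ)
    (hp : D.AnnihilatedByPMinus Φ) (hirr : (D.tau Φ).IsIrreducible) {s : G.ArchPts} (hs : s ∈ D.K')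
    (htw : ¬ D.HaveCommonType (D.lAction (D.tau Φ))
      (D.twist (D.lAction (D.tau Φ)) ⟨s, D.K'_le_G' hs⟩))
    (φ : (D.tauSpace Φ).toSubmodule →ₗ[ℂ] smoothFunctions G)
    (hr : ∀ v, φ v ∈ LinearMap.range (inducedMap D hΦ))
    (hφ : ∀ (k : D.K'₀) v, φ (D.tau Φ k v) = smoothTranslation G (D.conjK'₀ hs k) (φ v)) :
    φ = 0 := by
  by_contra h0
  obtain ⟨ψ, hψ, hψ'⟩ := exists_lift hΦ hc hs φ hr hφ
  let f : (D.tauSpace Φ).toSubmodule →ₗ[ℂ] D.L (D.tau Φ) :=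
    ((D.inducedRelations (D.tau Φ)).mkQ.restrictScalars ℂ) ∘ₗ ψ
  have hf : f ∈ D.typeHom (D.tau Φ)
      (D.twist (D.lAction (D.tau Φ)) ⟨s, D.K'_le_G' hs⟩) := hψ'
  have hf0 : f ≠ 0 := by
    intro hf0
    refine h0 (LinearMap.ext fun v => ?_)
    have h1 : (D.inducedRelations (D.tau Φ)).mkQ (ψ v) =
        (D.inducedRelations (D.tau Φ)).mkQ 0 :=
      (LinearMap.congr_fun hf0 v).trans (map_zero _).symm
    rw [← hψ, inducedMap_eq_of_mkQ_eq hΦ hp h1, map_zero]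
    rfl
  let b := Module.finBasis ℂ (D.tauSpace Φ).toSubmodule
  -- `τ` itself is a common type: it occurs in `L_τ` through `inducedUnit` and in the twist through
  -- `f`. `HaveCommonType` asks for a coordinate space, hence the transport along a basis.
  refine htw ⟨_, (D.tau Φ).transport b.equivFun, fun v => ?_, hirr.transport _,
    typeHom_transport_ne_bot _ inducedUnit_mem_typeHom (inducedUnit_ne_zero hΦ hp hirr),
    typeHom_transport_ne_bot _ hf hf0⟩
  refine continuous_pi fun i => ?_
  exact continuous_of_mem_continuousExpansions
    (continuousExpansions_tau hc continuous_id (b.equivFun.symm v)) (b.coord i)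

/-- Elements of the enveloping algebra that commute with `𝔨` act on `τ` by scalars. -/
theorem exists_eq_smul_of_commute (hΦ : Φ ∈ smoothFunctions G) (hp : D.AnnihilatedByPMinus Φ)
    (hirr : (D.tau Φ).IsIrreducible) (honce : D.OccursOnce (D.tau Φ) (D.lAction (D.tau Φ)))
    (a : D.U) (ha : ∀ Y ∈ D.k, Commute (UniversalEnvelopingAlgebra.ι ℂ (1 ⊗ₜ Y : D.g'C)) a) :
    ∃ c : ℂ, ∀ v : (D.tauSpace Φ).toSubmodule,
      envelopingAction D.G' a ⟨v, tauSpace_le_smoothFunctions hΦ v.2⟩ =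
        c • ⟨v, tauSpace_le_smoothFunctions hΦ v.2⟩ := by
  exact exists_inducedMap_eq_smul hΦ hp hirr honce
    (TensorProduct.mk ℂ D.U (D.tauSpace Φ).toSubmodule a)
    fun Y hY v w h => mkQ_tmul_of_commute hY h (ha Y hY).eq

end Consequences

end ArchimedeanData

/-! ### Bootstrapping along iterated derivatives. -/

section Iterates

variable {S ι : Type*} [AddCommGroup S] [Module ℂ S] [Fintype ι]

/-- The span of `x_{i₁} ⋯ x_{i_l} T`, `l ≤ k`. -/
def iterateSpan (x : ι → Module.End ℂ S) (T : Submodule ℂ S) : ℕ → Submodule ℂ S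
  | 0 => T
  | k + 1 => iterateSpan x T k ⊔ ⨆ i, (iterateSpan x T k).map (x i)

variable {x : ι → Module.End ℂ S} {T : Submodule ℂ S}

theorem iterateSpan_le_succ (k : ℕ) : iterateSpan x T k ≤ iterateSpan x T (k + 1) := le_sup_left

theorem apply_mem_iterateSpan_succ {k : ℕ} {f : S} (hf : f ∈ iterateSpan x T k) (i : ι) :
    x i f ∈ iterateSpan x T (k + 1) :=
  Submodule.mem_sup_right (Submodule.mem_iSup_of_mem i (Submodule.mem_map_of_mem hf))

theorem exists_eq_sum_of_mem_iSup_map {N : Submodule ℂ S} {f : S} (hf : f ∈ ⨆ i, N.map (x i)) :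
    ∃ h : ι → S, (∀ i, h i ∈ N) ∧ f = ∑ i, x i (h i) := by
  classical
  induction hf using Submodule.iSup_induction' with
  | mem i f hf =>
    obtain ⟨g, hg, rfl⟩ := hf
    refine ⟨Pi.single i g, fun j => ?_, ?_⟩
    · rcases eq_or_ne j i with rfl | h
      · simpa using hg
      · simp [Pi.single_eq_of_ne h]
    · rw [Finset.sum_eq_single i (fun j _ h => by rw [Pi.single_eq_of_ne h, map_zero]) (by simp),
        Pi.single_eq_same]
  | zero => exact ⟨0, fun _ => zero_mem _, by simp⟩
  | add f g _ _ hf hg =>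
    obtain ⟨a, ha, rfl⟩ := hf
    obtain ⟨b, hb, rfl⟩ := hg
    exact ⟨a + b, fun i => add_mem (ha i) (hb i), by simp [Finset.sum_add_distrib]⟩

/-- A second-order operator raises the length by two in general. This one preserves `T`, and its
commutator with `x_j` is quadratic rather than cubic, so the length grows by one only. -/
theorem sum_sq_apply_mem_iterateSpan {a : ι → ι → ι → ℂ}
    (hx : ∀ i j, x i * x j - x j * x i = ∑ k, a i j k • x k)
    (hT : ∀ f ∈ T, (∑ i, x i * x i) f ∈ T) (k : ℕ) :
    ∀ f ∈ iterateSpan x T k, (∑ i, x i * x i) f ∈ iterateSpan x T (k + 1) := by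
  induction k with
  | zero => exact fun f hf => iterateSpan_le_succ 0 (hT f hf)
  | succ k ih =>
    suffices h : iterateSpan x T (k + 1) ≤ (iterateSpan x T (k + 2)).comap (∑ i, x i * x i) from h
    refine sup_le (fun f hf => iterateSpan_le_succ _ (ih f hf)) (iSup_le fun j => ?_)
    rintro _ ⟨f, hf, rfl⟩
    have e : (∑ i, x i * x i) * x j = x j * (∑ i, x i * x i) +
        ∑ i, ∑ k, a i j k • (x i * x k + x k * x i) := by
      rw [Finset.sum_mul, Finset.mul_sum, ← Finset.sum_add_distrib]
      refine Finset.sum_congr rfl fun i _ => ?_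
      have e1 : x i * x i * x j = x j * (x i * x i) + (x i * (x i * x j - x j * x i) +
        (x i * x j - x j * x i) * x i) := by noncomm_ring
      rw [e1, hx, Finset.mul_sum, Finset.sum_mul, ← Finset.sum_add_distrib]
      simp only [smul_add, mul_smul_comm, smul_mul_assoc]
    have e2 := LinearMap.congr_fun e f
    rw [Module.End.mul_apply] at e2
    rw [Submodule.mem_comap, e2, LinearMap.add_apply, Module.End.mul_apply]
    refine add_mem (apply_mem_iterateSpan_succ (ih f hf) j) ?_
    simp only [LinearMap.sum_apply, LinearMap.smul_apply, LinearMap.add_apply,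
      Module.End.mul_apply]
    exact Submodule.sum_mem _ fun i _ => Submodule.sum_mem _ fun k _ => Submodule.smul_mem _ _
      (add_mem (apply_mem_iterateSpan_succ (apply_mem_iterateSpan_succ hf k) i)
        (apply_mem_iterateSpan_succ (apply_mem_iterateSpan_succ hf i) k))

/-- An ellipticity argument: a space that contains `x_i f` whenever it contains `f`, `g`, `h_i`
with `∑ x_i² f = g + ∑ x_i h_i` contains all `x_{i₁} ⋯ x_{i_l} T`. -/
theorem iterateSpan_le {a : ι → ι → ι → ℂ}
    (hx : ∀ i j, x i * x j - x j * x i = ∑ k, a i j k • x k)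
    (hT : ∀ f ∈ T, (∑ i, x i * x i) f ∈ T) {P : Submodule ℂ S} (hTP : T ≤ P)
    (hP : ∀ (f g : S) (h : ι → S), f ∈ P → g ∈ P → (∀ i, h i ∈ P) →
      ∑ i, x i (x i f) = g + ∑ i, x i (h i) → ∀ i, x i f ∈ P) (k : ℕ) :
    iterateSpan x T k ≤ P := by
  induction k with
  | zero => exact hTP
  | succ k ih =>
    refine sup_le ih (iSup_le fun j => ?_)
    rintro _ ⟨f, hf, rfl⟩
    -- Membership in level `k + 1` is exactly a decomposition `g + ∑ xᵢhᵢ` with `g` and `hᵢ` in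
    -- level `k`, the right-hand side of the elliptic estimate.
    obtain ⟨g, hg, r, hr, e⟩ := Submodule.mem_sup.mp (sum_sq_apply_mem_iterateSpan hx hT k f hf)
    obtain ⟨h, hh, rfl⟩ := exists_eq_sum_of_mem_iSup_map hr
    refine hP f g h (ih hf) (ih hg) (fun i => ih (hh i)) ?_ j
    rw [e, LinearMap.sum_apply]
    rfl

end Iterates

/-! ### A Casimir element for `K'₀` and square-integrability by induction. -/

section Casimir

variable {F : Type u} [Field F] [NumberField F] {n : ℕ} {G : LinearAlgebraicGroup F n}
  {H : ClosedSubgroup G.ArchPts}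

theorem ι_tmul_sum_smul {ι : Type*} [Fintype ι] (r : ι → ℝ) (X : ι → lieAlg H) :
    UniversalEnvelopingAlgebra.ι ℂ (1 ⊗ₜ (∑ i, r i • X i) : ℂ ⊗[ℝ] lieAlg H) =
      ∑ i, (r i : ℂ) • UniversalEnvelopingAlgebra.ι ℂ (1 ⊗ₜ X i : ℂ ⊗[ℝ] lieAlg H) := by
  rw [TensorProduct.tmul_sum, map_sum]
  refine Finset.sum_congr rfl fun i _ => ?_
  rw [← map_smul, TensorProduct.smul_tmul', TensorProduct.tmul_smul, TensorProduct.smul_tmul']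
  simp

theorem ι_mul_sub_mul (X Y : lieAlg H) :
    UniversalEnvelopingAlgebra.ι ℂ (1 ⊗ₜ X : ℂ ⊗[ℝ] lieAlg H) *
      UniversalEnvelopingAlgebra.ι ℂ (1 ⊗ₜ Y) -
    UniversalEnvelopingAlgebra.ι ℂ (1 ⊗ₜ Y) * UniversalEnvelopingAlgebra.ι ℂ (1 ⊗ₜ X) =
      UniversalEnvelopingAlgebra.ι ℂ (1 ⊗ₜ ⁅X, Y⁆) := by
  have h := LieHom.map_lie (UniversalEnvelopingAlgebra.ι ℂ) (1 ⊗ₜ X : ℂ ⊗[ℝ] lieAlg H) (1 ⊗ₜ Y)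
  rw [LieAlgebra.ExtendScalars.bracket_tmul, mul_one, Ring.lie_def] at h
  exact h.symm

/-- An `Ad`-invariant bilinear form is infinitesimally invariant. -/
theorem form_lie_eq_neg {ι : Type*} [Fintype ι] {b : lieAlg H →ₗ[ℝ] lieAlg H →ₗ[ℝ] ℝ}
    {X : ι → lieAlg H} (hX : ∀ v, ∑ i, b v (X i) • X i = v)
    {Y : lieAlg H} {γ : ℝ → H} (hγ : ∀ t, (γ t : G.ArchPts) = oneParam Y t)
    (hb : ∀ t u v, b (Ad (γ t) u) (Ad (γ t) v) = b u v) (u v : lieAlg H) :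
    b ⁅Y, u⁆ v = - b u ⁅Y, v⁆ := by
  have hγ0 : γ 0 = 1 := Subtype.ext ((hγ 0).trans (oneParam_zero Y))
  -- In an orthonormal basis the form becomes a finite sum of products of linear functionals, to
  -- which the product rule applies.
  have hexp : ∀ u v, b u v = ∑ k, b u (X k) * b v (X k) := fun u v => by
    conv_lhs => rw [← hX v, map_sum]
    refine Finset.sum_congr rfl fun k _ => ?_
    rw [map_smul, smul_eq_mul, mul_comm]
  have hd : ∀ u k, HasDerivAt (fun t => b (Ad (γ t) u) (X k)) (b ⁅Y, u⁆ (X k)) 0 := fun u k =>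
    hasDerivAt_dual_Ad (b.flip (X k)) Y u hγ
  have h1 : HasDerivAt (fun t => ∑ k, b (Ad (γ t) u) (X k) * b (Ad (γ t) v) (X k))
      (∑ k, (b ⁅Y, u⁆ (X k) * b (Ad (γ 0) v) (X k) + b (Ad (γ 0) u) (X k) * b ⁅Y, v⁆ (X k))) 0 :=
    HasDerivAt.fun_sum fun k _ => (hd u k).mul (hd v k)
  have h2 : HasDerivAt (fun _ : ℝ => b u v) 0 0 := hasDerivAt_const _ _
  have e := h1.unique (h2.congr_of_eventuallyEq (Eventually.of_forall fun t =>
    (hexp _ _).symm.trans (hb t u v)))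
  rw [hγ0, Finset.sum_add_distrib, Ad_one] at e
  simp only [LieHom.id_apply] at e
  rw [← hexp, ← hexp] at e
  linarith

end Casimir

namespace ArchimedeanData

variable {F : Type u} [Field F] [NumberField F] {n : ℕ} {G : LinearAlgebraicGroup F n}
  {D : ArchimedeanData G} {Φ : G.Adelic → ℂ}

/-- The adjoint representation of `K'₀` on `𝔤'`. -/
def adjointK'₀ (D : ArchimedeanData G) : Representation ℝ D.K'₀ D.g' where
  toFun k := (Ad (D.toG' k)).toLinearMap
  map_one' := by
    rw [map_one, Ad_one]
    rfl
  map_mul' k l := LinearMap.ext fun X => by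
    rw [map_mul]
    exact Ad_mul_apply _ _ X

/-- A basis of `𝔤'` for which `∑ X_i²` commutes with `𝔨`. -/
theorem exists_casimir (D : ArchimedeanData G) :
    ∃ (ι : Type) (_ : Fintype ι) (X : Module.Basis ι ℝ D.g') (a : ι → ι → ι → ℂ),
      (∀ i j, UniversalEnvelopingAlgebra.ι ℂ (1 ⊗ₜ X i : D.g'C) *
        UniversalEnvelopingAlgebra.ι ℂ (1 ⊗ₜ X j : D.g'C) -
        UniversalEnvelopingAlgebra.ι ℂ (1 ⊗ₜ X j : D.g'C) *
        UniversalEnvelopingAlgebra.ι ℂ (1 ⊗ₜ X i : D.g'C) =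
        ∑ k, a i j k • UniversalEnvelopingAlgebra.ι ℂ (1 ⊗ₜ X k : D.g'C)) ∧
      ∀ Y ∈ D.k, Commute (UniversalEnvelopingAlgebra.ι ℂ (1 ⊗ₜ Y : D.g'C))
        (∑ i, UniversalEnvelopingAlgebra.ι ℂ (1 ⊗ₜ X i : D.g'C) *
          UniversalEnvelopingAlgebra.ι ℂ (1 ⊗ₜ X i : D.g'C)) := by
  obtain ⟨b, hs, hp, hb⟩ := Representation.exists_invariant_form D.adjointK'₀
    (fun v l => (continuous_dual_Ad l v).comp D.continuous_toG')
  obtain ⟨ι, _, X, hX⟩ := exists_orthonormal_basis_of_form b hs hp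
  have hbr : ∀ Y i, UniversalEnvelopingAlgebra.ι ℂ (1 ⊗ₜ Y : D.g'C) *
        UniversalEnvelopingAlgebra.ι ℂ (1 ⊗ₜ X i : D.g'C) -
        UniversalEnvelopingAlgebra.ι ℂ (1 ⊗ₜ X i : D.g'C) *
        UniversalEnvelopingAlgebra.ι ℂ (1 ⊗ₜ Y : D.g'C) =
        ∑ k, ((b ⁅Y, X i⁆ (X k) : ℝ) : ℂ) •
          UniversalEnvelopingAlgebra.ι ℂ (1 ⊗ₜ X k : D.g'C) := fun Y i => by
    rw [ι_mul_sub_mul, ← ι_tmul_sum_smul, hX]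
  refine ⟨ι, _, X, fun i j k => ((b ⁅X i, X j⁆ (X k) : ℝ) : ℂ), fun i j => hbr (X i) j,
    fun Y hY => commute_sum_sq_of_skew (hbr Y) fun i j => ?_⟩
  rw [form_lie_eq_neg hX (γ := fun t => D.toG' ⟨_, D.oneParam_mem_K'₀ hY t⟩) (fun t => rfl)
    (fun t u v => hb _ u v), hs, Complex.ofReal_neg]

/-- Multiplicity one makes the Casimir element act on `τ` by a scalar, which starts the elliptic
induction. The span of iterates is stable under a basis of `𝔤'`, hence under the enveloping algebra.
-/
theorem range_inducedMap_le [FiniteDimensional ℂ (D.tauSpace Φ).toSubmodule]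
    (hΦ : Φ ∈ smoothFunctions G) (hp : D.AnnihilatedByPMinus Φ)
    (hirr : (D.tau Φ).IsIrreducible) (honce : D.OccursOnce (D.tau Φ) (D.lAction (D.tau Φ)))
    {P : Submodule ℂ (smoothFunctions G)}
    (hTP : ∀ v (hv : v ∈ (D.tauSpace Φ).toSubmodule), ⟨v, tauSpace_le_smoothFunctions hΦ hv⟩ ∈ P)
    (hP : ∀ {ι : Type} [Fintype ι] (X : ι → D.g') (f g : smoothFunctions G)
      (h : ι → smoothFunctions G), f ∈ P → g ∈ P → (∀ i, h i ∈ P) →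
      ∑ i, smoothLieHom D.G' (X i) (smoothLieHom D.G' (X i) f) =
        g + ∑ i, smoothLieHom D.G' (X i) (h i) → ∀ i, smoothLieHom D.G' (X i) f ∈ P) :
    LinearMap.range (inducedMap D hΦ) ≤ P := by
  obtain ⟨ι, _, X, a, ha, hC⟩ := D.exists_casimir
  have hι : ∀ (z : ℂ) Y, envelopingAction D.G' (UniversalEnvelopingAlgebra.ι ℂ (z ⊗ₜ Y : D.g'C)) =
      z • smoothLieHom D.G' Y := fun z Y => by
    rw [envelopingAction, UniversalEnvelopingAlgebra.lift_ι_apply, complexifyLieHom_tmul]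
  have hι1 : ∀ Y, envelopingAction D.G' (UniversalEnvelopingAlgebra.ι ℂ (1 ⊗ₜ Y : D.g'C)) =
      smoothLieHom D.G' Y := fun Y => (hι 1 Y).trans (one_smul _ _)
  let x : ι → Module.End ℂ (smoothFunctions G) := fun i => smoothLieHom D.G' (X i)
  let T : Submodule ℂ (smoothFunctions G) := (D.tauSpace Φ).toSubmodule.comap
    (smoothFunctions G).subtype
  obtain ⟨c, hc⟩ := exists_eq_smul_of_commute hΦ hp hirr honce _ hC
  have hx : ∀ i j, x i * x j - x j * x i = ∑ k, a i j k • x k := fun i j => by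
    have h := congrArg (envelopingAction D.G') (ha i j)
    simpa only [map_sub, map_mul, map_sum, map_smul, hι1] using h
  have hT : ∀ f ∈ T, (∑ i, x i * x i) f ∈ T := fun f hf => by
    have h := hc ⟨f, hf⟩
    simp only [map_mul, map_sum, hι1] at h
    have h' : (∑ i, x i * x i) f = c • f := h
    rw [h']
    exact Submodule.smul_mem _ c hf
  have hle : ⨆ k, iterateSpan x T k ≤ P := iSup_le fun k =>
    iterateSpan_le hx hT (fun f hf => hTP f hf) (hP X) k
  have hst : ∀ i, ∀ f ∈ ⨆ k, iterateSpan x T k, x i f ∈ ⨆ k, iterateSpan x T k := by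
    intro i
    suffices h : ⨆ k, iterateSpan x T k ≤ (⨆ k, iterateSpan x T k).comap (x i) from h
    exact iSup_le fun k f hf => Submodule.mem_iSup_of_mem (k + 1)
      (apply_mem_iterateSpan_succ hf i)
  have hstY : ∀ Y : D.g', ∀ f ∈ ⨆ k, iterateSpan x T k,
      smoothLieHom D.G' Y f ∈ ⨆ k, iterateSpan x T k := by
    intro Y f hf
    rw [← X.sum_repr Y, map_sum, LinearMap.sum_apply]
    refine Submodule.sum_mem _ fun i _ => ?_
    rw [map_smul, LinearMap.smul_apply]
    exact Submodule.smul_of_tower_mem _ _ (hst i f hf)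
  have hstU : ∀ (u : D.U), ∀ f ∈ ⨆ k, iterateSpan x T k,
      envelopingAction D.G' u f ∈ ⨆ k, iterateSpan x T k := by
    intro u
    induction u using UniversalEnvelopingAlgebra.induction_on with
    | halg r =>
      intro f hf
      rw [AlgHom.commutes, Module.algebraMap_end_apply]
      exact Submodule.smul_mem _ r hf
    | hι Z =>
      intro f hf
      induction Z using TensorProduct.induction_on with
      | zero => rw [map_zero, map_zero]; exact zero_mem _
      | add a b ha hb => rw [map_add, map_add]; exact add_mem ha hb
      | tmul z Y => rw [hι]; exact Submodule.smul_mem _ z (hstY Y f hf)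
    | hadd a b ha hb => intro f hf; rw [map_add]; exact add_mem (ha f hf) (hb f hf)
    | hmul a b ha hb => intro f hf; rw [map_mul]; exact ha _ (hb f hf)
  rintro _ ⟨y, rfl⟩
  refine hle ?_
  induction y with
  | zero => rw [map_zero]; exact zero_mem _
  | add a b ha hb => rw [map_add]; exact add_mem ha hb
  | tmul a v =>
    rw [inducedMap_tmul]
    exact hstU a _ (Submodule.mem_iSup_of_mem 0 v.2)

end ArchimedeanData

/-! ### A dichotomy for stable subspaces of a unitary representation. -/

section Unitary

variable {K H : Type*} [Group K] [NormedAddCommGroup H] [InnerProductSpace ℂ H]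
  {ρ : Representation ℂ K H}

theorem Representation.starProjection_apply (hu : ∀ k x y, inner ℂ (ρ k x) (ρ k y) = inner ℂ x y)
    (E : Submodule ℂ H) [FiniteDimensional ℂ E] (hE : ∀ k, ∀ x ∈ E, ρ k x ∈ E) (k : K) (x : H) :
    E.starProjection (ρ k x) = ρ k (E.starProjection x) := by
  refine Submodule.eq_starProjection_of_mem_of_inner_eq_zero (hE k _ (E.starProjection_apply_mem x))
    fun w hw => ?_
  have e : w = ρ k (ρ k⁻¹ w) := by
    rw [← Module.End.mul_apply, ← map_mul, mul_inv_cancel, map_one, Module.End.one_apply]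
  rw [e, ← map_sub, hu]
  exact E.starProjection_inner_eq_zero x _ (hE _ _ hw)

/-- A stable subspace of `⨆ M_i`, where `Hom_K(T, M_i)` is contained in `Hom_K(T, T)` for an
irreducible finite-dimensional representation `T ≤ ⨆ M_i`, contains `T` or is orthogonal to it. -/
theorem Representation.le_or_inner_eq_zero
    (hu : ∀ k x y, inner ℂ (ρ k x) (ρ k y) = inner ℂ x y)
    (hfin : ∀ x, FiniteDimensional ℂ (Submodule.span ℂ (Set.range fun k => ρ k x)))
    {T : Submodule ℂ H} [FiniteDimensional ℂ T] (hT : ∀ k, ∀ x ∈ T, ρ k x ∈ T)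
    (hirr : ∀ p ≤ T, (∀ k, ∀ x ∈ p, ρ k x ∈ p) → p = ⊥ ∨ p = T)
    {ι : Type*} {M : ι → Submodule ℂ H} (hM : ∀ i k, ∀ x ∈ M i, ρ k x ∈ M i)
    (hhom : ∀ (i : ι) (φ : T →ₗ[ℂ] H), (∀ t, φ t ∈ M i) →
      (∀ k (t : T), φ ⟨ρ k t, hT k t t.2⟩ = ρ k (φ t)) → ∀ t, φ t ∈ T)
    (hTM : T ≤ ⨆ i, M i) {W : Submodule ℂ H} (hW : ∀ k, ∀ x ∈ W, ρ k x ∈ W)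
    (hWM : W ≤ ⨆ i, M i) : T ≤ W ∨ ∀ w ∈ W, ∀ t ∈ T, inner ℂ w t = 0 := by
  have hspan : ∀ x k, ∀ y ∈ Submodule.span ℂ (Set.range fun k => ρ k x),
      ρ k y ∈ Submodule.span ℂ (Set.range fun k => ρ k x) := by
    intro x k
    suffices h : Submodule.span ℂ (Set.range fun k => ρ k x) ≤
      (Submodule.span ℂ (Set.range fun k => ρ k x)).comap (ρ k) from h
    refine Submodule.span_le.mpr ?_
    rintro _ ⟨l, rfl⟩
    exact Submodule.subset_span ⟨k * l, by simp only [map_mul, Module.End.mul_apply]⟩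
  have hself : ∀ x, x ∈ Submodule.span ℂ (Set.range fun k => ρ k x) := fun x =>
    Submodule.subset_span ⟨1, by simp⟩
  have hspan_le : ∀ (N : Submodule ℂ H), (∀ k, ∀ y ∈ N, ρ k y ∈ N) → ∀ x ∈ N,
      Submodule.span ℂ (Set.range fun k => ρ k x) ≤ N := fun N hN x hx =>
    Submodule.span_le.mpr (by rintro _ ⟨k, rfl⟩; exact hN k x hx)
  have hproj : ∀ (E : Submodule ℂ H) [FiniteDimensional ℂ E], ∀ x ∈ E, ∀ y,
      inner ℂ x (E.starProjection y) = inner ℂ x y := fun E _ x hx y => by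
    rw [← E.inner_starProjection_left_eq_right, Submodule.starProjection_eq_self_iff.mpr hx]
  by_contra hcon
  push Not at hcon
  obtain ⟨hTW, w, hw, t₀, ht₀, h0⟩ := hcon
  -- `H` is not complete, so one projects only onto finite-dimensional orbit spans; these
  -- projections are equivariant by unitarity.
  let E := Submodule.span ℂ (Set.range fun k => ρ k w)
  have hE : FiniteDimensional ℂ E := hfin w
  let φ : T →ₗ[ℂ] H := E.starProjection.toLinearMap ∘ₗ T.subtype
  have hφW : ∀ t, φ t ∈ W := fun t => hspan_le W hW w hw (E.starProjection_apply_mem _)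
  have hφ : ∀ k (t : T), φ ⟨ρ k t, hT k t t.2⟩ = ρ k (φ t) := fun k t =>
    Representation.starProjection_apply hu E (hspan w) k t
  have hφ0 : φ ⟨t₀, ht₀⟩ ≠ 0 := fun h => h0 (by
    rw [← hproj E w (hself w)]
    exact (congrArg (inner ℂ w) h).trans (inner_zero_right _))
  -- Let `ψ` be the component of `φ` orthogonal to `T`. Projecting `ψ` to the orbit span of `m ∈ M
  -- i` gives a homomorphism into `M i`, so its values lie in `T` by `hhom` and are orthogonal to
  -- `ψ`; a projection orthogonal to its source is zero. Hence `ψ t` is orthogonal to every `M i`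
  -- and lies in their sum, so it vanishes.
  have key : ∀ t, φ t ∈ T := by
    intro t
    by_contra hφt
    let ψ : T →ₗ[ℂ] H := φ - T.starProjection.toLinearMap ∘ₗ φ
    have hψ : ∀ k (t : T), ψ ⟨ρ k t, hT k t t.2⟩ = ρ k (ψ t) := fun k t => by
      change φ _ - T.starProjection (φ _) = ρ k (φ t - T.starProjection (φ t))
      rw [hφ, Representation.starProjection_apply hu T hT, map_sub]
    have hψT : ∀ t, ∀ s ∈ T, inner ℂ (ψ t) s = 0 := fun t s hs =>
      T.starProjection_inner_eq_zero (φ t) s hs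
    have hψM : ψ t ∈ ⨆ i, M i :=
      sub_mem (hWM (hφW t)) (hTM (T.starProjection_apply_mem _))
    have hψ0 : ψ t ≠ 0 := fun h => hφt (by
      rw [sub_eq_zero.mp (show φ t - T.starProjection (φ t) = 0 from h)]
      exact T.starProjection_apply_mem _)
    have horth : ∀ i, M i ≤ (ℂ ∙ ψ t)ᗮ := by
      intro i m hm
      rw [Submodule.mem_orthogonal_singleton_iff_inner_left]
      let E' := Submodule.span ℂ (Set.range fun k => ρ k m)
      have hE' : FiniteDimensional ℂ E' := hfin m
      have h1 := hhom i (E'.starProjection.toLinearMap ∘ₗ ψ)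
        (fun s => hspan_le (M i) (hM i) m hm (E'.starProjection_apply_mem _))
        (fun k s => by
          change E'.starProjection (ψ _) = ρ k (E'.starProjection (ψ s))
          rw [hψ, Representation.starProjection_apply hu E' (hspan m)]) t
      have h2 : inner ℂ (ψ t) (E'.starProjection (ψ t)) = 0 := hψT t _ h1
      have h3 : E'.starProjection (ψ t) = 0 := by
        rw [← inner_self_eq_zero (𝕜 := ℂ), hproj E' _ (E'.starProjection_apply_mem _),
          ← inner_conj_symm, h2, map_zero]
      rw [← hproj E' m (hself m), h3, inner_zero_right]
    exact hψ0 (Submodule.disjoint_def.mp (ℂ ∙ ψ t).orthogonal_disjoint _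
      (Submodule.mem_span_singleton_self _) (iSup_le horth hψM))
  -- `φ t₀` is a nonzero vector of `T ⊓ W`, so irreducibility leaves only `T ≤ W`.
  rcases hirr (T ⊓ W) inf_le_left (fun k x hx => ⟨hT k x hx.1, hW k x hx.2⟩) with h | h
  · exact hφ0 (Submodule.eq_bot_iff _ |>.mp h _ ⟨key _, hφW _⟩)
  · exact hTW (inf_eq_left.mp h)

end Unitary

theorem Representation.le_or_core_inner_eq_zero {K H : Type*} [Group K] [AddCommGroup H]
    [Module ℂ H] {ρ : Representation ℂ K H} (core : InnerProductSpace.Core ℂ H)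
    (hu : ∀ k x y, core.inner (ρ k x) (ρ k y) = core.inner x y)
    (hfin : ∀ x, FiniteDimensional ℂ (Submodule.span ℂ (Set.range fun k => ρ k x)))
    {T : Submodule ℂ H} [FiniteDimensional ℂ T] (hT : ∀ k, ∀ x ∈ T, ρ k x ∈ T)
    (hirr : ∀ p ≤ T, (∀ k, ∀ x ∈ p, ρ k x ∈ p) → p = ⊥ ∨ p = T)
    {ι : Type*} {M : ι → Submodule ℂ H} (hM : ∀ i k, ∀ x ∈ M i, ρ k x ∈ M i)
    (hhom : ∀ (i : ι) (φ : T →ₗ[ℂ] H), (∀ t, φ t ∈ M i) →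
      (∀ k (t : T), φ ⟨ρ k t, hT k t t.2⟩ = ρ k (φ t)) → ∀ t, φ t ∈ T)
    (hTM : T ≤ ⨆ i, M i) {W : Submodule ℂ H} (hW : ∀ k, ∀ x ∈ W, ρ k x ∈ W)
    (hWM : W ≤ ⨆ i, M i) : T ≤ W ∨ ∀ w ∈ W, ∀ t ∈ T, core.inner w t = 0 := by
  let _ : NormedAddCommGroup H := core.toNormedAddCommGroup
  let _ : InnerProductSpace ℂ H := InnerProductSpace.ofCore core.toCore
  exact Representation.le_or_inner_eq_zero hu hfin hT hirr hM hhom hTM hW hWM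

/-! ### Averages over cosets of a subgroup of finite index. -/

section CosetSums

variable {C X : Type*} [Group C] [AddCommGroup X] [Module ℂ X]

/-- The sum of the operators `ρ k` over representatives `k` of the left cosets of `P`. -/
noncomputable def Representation.cosetSum (ρ : Representation ℂ C X) (P : Subgroup C)
    [P.FiniteIndex] : X →ₗ[ℂ] X :=
  letI : Fintype (C ⧸ P) := P.fintypeQuotientOfFiniteIndex
  ∑ q : C ⧸ P, ρ q.out

variable {ρ : Representation ℂ C X} {P : Subgroup C} [P.FiniteIndex] {x y : X}

theorem Representation.cosetSum_apply : ρ.cosetSum P x =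
    letI : Fintype (C ⧸ P) := P.fintypeQuotientOfFiniteIndex
    ∑ q : C ⧸ P, ρ q.out x := by
  rw [cosetSum, LinearMap.sum_apply]

theorem Representation.cosetSum_mem {W : Submodule ℂ X} (hW : ∀ k, ρ k x ∈ W) :
    ρ.cosetSum P x ∈ W := by
  rw [cosetSum_apply]
  exact W.sum_mem fun q _ => hW _

theorem Representation.map_cosetSum (L : X →ₗ[ℂ] ℂ) (hL : ∀ k, L (ρ k x) = L x) :
    L (ρ.cosetSum P x) = P.index * L x := by
  let _ : Fintype (C ⧸ P) := P.fintypeQuotientOfFiniteIndex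
  rw [cosetSum_apply, map_sum]
  simp only [hL, Finset.sum_const, nsmul_eq_mul, Finset.card_univ, Subgroup.index_eq_card,
    Nat.card_eq_fintype_card]

theorem Representation.cosetSum_of_fixed (hx : ∀ k, ρ k x = x) :
    ρ.cosetSum P x = (P.index : ℂ) • x := by
  let _ : Fintype (C ⧸ P) := P.fintypeQuotientOfFiniteIndex
  rw [cosetSum_apply]
  simp only [hx, Finset.sum_const, Finset.card_univ, Subgroup.index_eq_card,
    Nat.card_eq_fintype_card, Nat.cast_smul_eq_nsmul]

/-- Right multiplication by `k` permutes the cosets since `P` is normal, and a change of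
representative is absorbed by an element of `P`, which fixes `x`. -/
theorem Representation.cosetSum_apply_apply [P.Normal] (hx : ∀ p ∈ P, ρ p x = x) (k : C) :
    ρ.cosetSum P (ρ k x) = ρ.cosetSum P x := by
  let _ : Fintype (C ⧸ P) := P.fintypeQuotientOfFiniteIndex
  rw [cosetSum_apply, cosetSum_apply]
  refine Fintype.sum_equiv (Equiv.mulRight (k : C ⧸ P)) _ _ fun q => ?_
  have h : (((q * k : C ⧸ P).out : C) : C ⧸ P) = ((q.out * k : C) : C ⧸ P) := by
    rw [QuotientGroup.out_eq', QuotientGroup.mk_mul, QuotientGroup.out_eq']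
  rw [QuotientGroup.eq] at h
  have h2 := hx _ h
  rw [map_mul, map_mul, Module.End.mul_apply, Module.End.mul_apply] at h2
  have h3 := congrArg (ρ (q * k : C ⧸ P).out) h2
  rw [← Module.End.mul_apply, ← map_mul, mul_inv_cancel, map_one, Module.End.one_apply] at h3
  exact h3

/-- All `ρ b x` have the same coset sum, so `|B|` times the coset sum of `x` is the index of `P`
times `y`. Thus a Hecke eigenvalue equation computes an average over `K_v`. -/
theorem Representation.exists_cosetSum_eq_smul [P.Normal] (hx : ∀ p ∈ P, ρ p x = x)
    {B : Finset C} (hB : B.Nonempty) (hxy : ∑ b ∈ B, ρ b x = y) (hy : ∀ k, ρ k y = y) :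
    ∃ r : ℂ, ρ.cosetSum P x = r • y := by
  have h := congrArg (ρ.cosetSum P) hxy
  rw [map_sum, Finset.sum_congr rfl fun b _ => cosetSum_apply_apply hx b, Finset.sum_const,
    cosetSum_of_fixed hy, ← Nat.cast_smul_eq_nsmul ℂ] at h
  have h0 : (B.card : ℂ) ≠ 0 := Nat.cast_ne_zero.mpr hB.card_pos.ne'
  exact ⟨(B.card : ℂ)⁻¹ * P.index, by rw [mul_smul, ← h, inv_smul_smul₀ h0]⟩

end CosetSums

/-! ### Removing finite places one at a time. -/

section PlaceSpan

variable {A X ι : Type*} [Group A] [AddCommGroup X] [Module ℂ X] {Γ : ι → Type*}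
  [∀ v, Group (Γ v)]

/-- The span of `ρ(g₁ ⋯ g_r) V`, where `g_i` belongs to the `i`-th group of a list of groups. -/
def placeSpan (ρ : Representation ℂ A X) (emb : ∀ v, Γ v →* A) (V : Submodule ℂ X) :
    List ι → Submodule ℂ X
  | [] => V
  | v :: l => ⨆ g : Γ v, (placeSpan ρ emb V l).map (ρ (emb v g))

variable {ρ : Representation ℂ A X} {emb : ∀ v, Γ v →* A} {V : Submodule ℂ X}

theorem apply_mem_placeSpan (h : ∀ v, Γ v) {f : X} (hf : f ∈ V) (l : List ι) :
    ρ (l.map fun v => emb v (h v)).prod f ∈ placeSpan ρ emb V l := by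
  induction l with
  | nil =>
    rw [List.map_nil, List.prod_nil, map_one]
    exact hf
  | cons v l ih =>
    rw [List.map_cons, List.prod_cons, map_mul, Module.End.mul_apply]
    exact Submodule.mem_iSup_of_mem (h v) (Submodule.mem_map_of_mem ih)

/-- Operators at different places commute, so a relation at `v` that holds on `V` persists on
translates by the other places. -/
theorem placeSpan_le_ker {T : Module.End ℂ X} {l : List ι}
    (hT : ∀ v ∈ l, ∀ g : Γ v, Commute T (ρ (emb v g))) (hV : V ≤ LinearMap.ker T) :
    placeSpan ρ emb V l ≤ LinearMap.ker T := by
  induction l with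
  | nil => exact hV
  | cons v l ih =>
    refine iSup_le fun g => ?_
    rintro _ ⟨f, hf, rfl⟩
    have h1 : T f = 0 := ih (fun w hw => hT w (List.mem_cons_of_mem v hw)) hf
    have h2 := LinearMap.congr_fun (hT v List.mem_cons_self g).eq f
    rw [Module.End.mul_apply, Module.End.mul_apply, h1, map_zero] at h2
    exact h2

variable {K : ∀ v, Subgroup (Γ v)}

/-- Averaging over the groups `K v` one at a time. -/
theorem exists_mem_inf_of_placeSpan
    (hcomm : ∀ v w, v ≠ w → ∀ (g : Γ v) (h : Γ w), Commute (emb v g) (emb w h))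
    (hfix : ∀ v x, ∃ P : Subgroup (K v), P.FiniteIndex ∧ ∀ p ∈ P, ρ (emb v p) x = x)
    (hinv : ∀ v, ∀ k ∈ K v, ∀ f ∈ V, ρ (emb v k) f = f)
    (heig : ∀ v (g : Γ v), ∃ (B : Finset (K v)) (c : ℂ), B.Nonempty ∧ ∀ f ∈ V,
      ∑ b ∈ B, ρ (emb v b) (ρ (emb v g) f) = c • f)
    {W : Submodule ℂ X} (hW : ∀ a, ∀ w ∈ W, ρ a w ∈ W) {L : X →ₗ[ℂ] ℂ}
    (hL : ∀ v, ∀ k ∈ K v, ∀ x, L (ρ (emb v k) x) = L x) (l : List ι) (hl : l.Nodup) :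
    ∀ w ∈ W, w ∈ placeSpan ρ emb V l → ∃ w' ∈ W, w' ∈ V ∧ ∃ r : ℂ, r ≠ 0 ∧ L w' = r * L w := by
  induction l with
  | nil => exact fun w hw hwV => ⟨w, hw, hwV, 1, one_ne_zero, (one_mul _).symm⟩
  | cons v l ih =>
    obtain ⟨hvl, hl⟩ := List.nodup_cons.mp hl
    intro w hw hwV
    have hne : ∀ u ∈ l, ∀ (g : Γ v) (h : Γ u), Commute (ρ (emb v g)) (ρ (emb u h)) :=
      fun u hu g h => (hcomm v u (fun e => hvl (e ▸ hu)) g h).map ρ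
    let σ : Representation ℂ (K v) X := ρ.comp ((emb v).comp (K v).subtype)
    have hinv' : ∀ k : K v, ∀ f ∈ placeSpan ρ emb V l, σ k f = f := fun k f hf => by
      have h := placeSpan_le_ker (T := ρ (emb v k) - 1) (l := l)
        (fun u hu h => (hne u hu k h).sub_left (Commute.one_left _))
        (fun f hf => by
          rw [LinearMap.mem_ker, LinearMap.sub_apply, hinv v k k.2 f hf]
          exact sub_self f) hf
      exact sub_eq_zero.mp h
    have heig' : ∀ g : Γ v, ∃ (B : Finset (K v)) (c : ℂ), B.Nonempty ∧
        ∀ f ∈ placeSpan ρ emb V l, ∑ b ∈ B, σ b (ρ (emb v g) f) = c • f := fun g => by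
      obtain ⟨B, c, hB, h⟩ := heig v g
      refine ⟨B, c, hB, fun f hf => ?_⟩
      have h := placeSpan_le_ker (T := ∑ b ∈ B, ρ (emb v b) * ρ (emb v g) - c • 1) (l := l)
        (fun u hu h' => Commute.sub_left (Commute.sum_left _ _ _ fun b _ =>
          (hne u hu b h').mul_left (hne u hu g h')) ((Commute.one_left _).smul_left c))
        (fun f hf => by
          rw [LinearMap.mem_ker, LinearMap.sub_apply, LinearMap.sum_apply, sub_eq_zero]
          exact h f hf) hf
      rw [LinearMap.mem_ker, LinearMap.sub_apply, LinearMap.sum_apply, sub_eq_zero] at h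
      exact h
    -- The eigenvalue equation sends each translate `ρ(g)f`, `f` in the smaller span, to a multiple
    -- of `f`. A vector is a finite sum of such translates, so a single `P` of finite index fixes
    -- them all, and any smaller `P'` serves as well.
    have key : ∃ P : Subgroup (K v), P.FiniteIndex ∧ ∀ (P' : Subgroup (K v)) [P'.FiniteIndex]
        [P'.Normal], P' ≤ P → σ.cosetSum P' w ∈ placeSpan ρ emb V l := by
      clear hw
      induction hwV using Submodule.iSup_induction' with
      | mem g x hx =>
        obtain ⟨f, hf, rfl⟩ := hx
        obtain ⟨P, hP, hPf⟩ := hfix v (ρ (emb v g) f)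
        refine ⟨P, hP, fun P' _ _ hle => ?_⟩
        obtain ⟨B, c, hB, h⟩ := heig' g
        obtain ⟨r, hr⟩ := Representation.exists_cosetSum_eq_smul (ρ := σ) (P := P')
          (fun p hp => hPf p (hle hp)) hB (h f hf) (fun k => by rw [map_smul, hinv' k f hf])
        rw [hr]
        exact Submodule.smul_mem _ _ (Submodule.smul_mem _ _ hf)
      | zero => exact ⟨⊤, inferInstance, fun P' _ _ _ => by rw [map_zero]; exact zero_mem _⟩
      | add x y _ _ hx hy =>
        obtain ⟨P, hP, h⟩ := hx
        obtain ⟨Q, hQ, h'⟩ := hy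
        refine ⟨P ⊓ Q, inferInstance, fun P' _ _ hle => ?_⟩
        rw [map_add]
        exact add_mem (h P' (hle.trans inf_le_left)) (h' P' (hle.trans inf_le_right))
    obtain ⟨P, hP, h⟩ := key
    -- The normal core still has finite index. The sum stays in `W`, and `L`, being invariant under
    -- `K v`, is multiplied by the nonzero index.
    obtain ⟨w', hw', hwV', r, hr, e⟩ := ih hl (σ.cosetSum P.normalCore w)
      (Representation.cosetSum_mem fun k => hW _ w hw) (h _ P.normalCore_le)
    refine ⟨w', hw', hwV', r * P.normalCore.index, mul_ne_zero hr
      (Nat.cast_ne_zero.mpr Subgroup.FiniteIndex.index_ne_zero), ?_⟩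
    rw [e, Representation.map_cosetSum (ρ := σ) L fun k => hL v k k.2 w, mul_assoc]

end PlaceSpan

/-! ### Hecke operators as finite sums over `KgK/K`. -/

section DoubleCosets

variable {Γ : Type*} [Group Γ] [TopologicalSpace Γ] [IsTopologicalGroup Γ]

/-- `KgK/K` is the image of the compact `K` in the discrete space `Γ/K`, hence finite. -/
theorem exists_doubleCoset_representatives {K : Subgroup Γ} (ho : IsOpen (K : Set Γ))
    (hc : IsCompact (K : Set Γ)) (g : Γ) : ∃ B : Finset K, B.Nonempty ∧
      (B : Set K).PairwiseDisjoint (fun b => {h | ((b : Γ) * g)⁻¹ * h ∈ K}) ∧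
      ∀ k ∈ K, ∃ b ∈ B, ((b : Γ) * g)⁻¹ * (k * g) ∈ K := by
  classical
  have := QuotientGroup.discreteTopology ho
  have : CompactSpace K := isCompact_iff_compactSpace.mp hc
  let r : K → Γ ⧸ K := fun k => ((k : Γ) * g : Γ)
  have hr : Continuous r := QuotientGroup.continuous_mk.comp
    (continuous_subtype_val.mul continuous_const)
  have hfin : (Set.range r).Finite := (isCompact_range hr).finite_of_discrete
  have hs : ∀ q : Set.range r, ∃ k, r k = q := fun q => q.2
  choose s hs using hs
  have hfin' := hfin.to_subtype
  let _ : Fintype (Set.range r) := Fintype.ofFinite _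
  refine ⟨Finset.univ.image s, ⟨s ⟨r 1, 1, rfl⟩, Finset.mem_image_of_mem _ (Finset.mem_univ _)⟩,
    ?_, fun k hk => ?_⟩
  · intro b hb b' hb' hbb'
    simp only [Finset.coe_image, Finset.coe_univ, Set.image_univ, Set.mem_range] at hb hb'
    obtain ⟨q, rfl⟩ := hb
    obtain ⟨q', rfl⟩ := hb'
    rw [Function.onFun, Set.disjoint_left]
    intro h hh hh'
    have e1 : (((s q : Γ) * g : Γ) : Γ ⧸ K) = h := QuotientGroup.eq.mpr hh
    have e2 : (((s q' : Γ) * g : Γ) : Γ ⧸ K) = h := QuotientGroup.eq.mpr hh'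
    have e3 : q = q' := Subtype.ext ((hs q).symm.trans (e1.trans (e2.symm.trans (hs q'))))
    exact hbb' (congrArg s e3)
  · exact ⟨s ⟨r ⟨k, hk⟩, _, rfl⟩, Finset.mem_image_of_mem _ (Finset.mem_univ _),
      QuotientGroup.eq.mp (hs ⟨r ⟨k, hk⟩, _, rfl⟩)⟩

variable [MeasurableSpace Γ] [BorelSpace Γ] (ν : Measure Γ) [ν.IsHaarMeasure]

/-- An operator in the Hecke algebra in terms of representatives of `KgK/K`. -/
theorem exists_hecke_sum {K : Subgroup Γ} (ho : IsOpen (K : Set Γ)) (hc : IsCompact (K : Set Γ))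
    (g : Γ) : ∃ (B : Finset K) (φ : Γ → ℂ) (r : ℂ), B.Nonempty ∧ r ≠ 0 ∧ IsLocallyConstant φ ∧
      HasCompactSupport φ ∧ (∀ k ∈ K, ∀ h, φ (k * h) = φ h) ∧ (∀ k ∈ K, ∀ h, φ (h * k) = φ h) ∧
      ∀ f : Γ → ℂ, (∀ k ∈ K, ∀ h, f (h * k) = f h) →
        ∫ h, φ h * f h ∂ν = r * ∑ b ∈ B, f (b * g) := by
  classical
  obtain ⟨B, hB, hd, hB'⟩ := exists_doubleCoset_representatives ho hc g
  have hopen : ∀ x : Γ, IsOpen {h | x⁻¹ * h ∈ K} := fun x =>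
    ho.preimage (continuous_const_mul x⁻¹)
  have hclosed : ∀ x : Γ, IsClosed {h | x⁻¹ * h ∈ K} := fun x =>
    (K.isClosed_of_isOpen ho).preimage (continuous_const_mul x⁻¹)
  have hcompact : ∀ x : Γ, IsCompact {h | x⁻¹ * h ∈ K} := fun x =>
    (Homeomorph.mulLeft x⁻¹).isCompact_preimage.mpr hc
  have hvol : ∀ x : Γ, ν {h | x⁻¹ * h ∈ K} = ν K := fun x => measure_preimage_mul ν x⁻¹ K
  have hν0 : ν K ≠ 0 := (ho.measure_pos ν ⟨1, K.one_mem⟩).ne'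
  have hνt : ν K ≠ ⊤ := hc.measure_lt_top.ne
  let S : Set Γ := ⋃ b ∈ B, {h | ((b : Γ) * g)⁻¹ * h ∈ K}
  have hS : ∀ h, h ∈ S ↔ ∃ k ∈ K, (k * g)⁻¹ * h ∈ K := by
    intro h
    simp only [S, Set.mem_iUnion, exists_prop]
    constructor
    · rintro ⟨b, -, hb⟩
      exact ⟨b, b.2, hb⟩
    · rintro ⟨k, hk, hkh⟩
      obtain ⟨b, hb, hbk⟩ := hB' k hk
      refine ⟨b, hb, ?_⟩
      have := K.mul_mem hbk hkh
      rwa [mul_assoc, mul_inv_cancel_left] at this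
  have hSc : IsClopen S := ⟨B.finite_toSet.isClosed_biUnion fun b _ => hclosed _,
    isOpen_biUnion fun b _ => hopen _⟩
  have hScompact : IsCompact S := B.finite_toSet.isCompact_biUnion fun b _ => hcompact _
  have hSl : ∀ k ∈ K, ∀ h, k * h ∈ S ↔ h ∈ S := by
    have h1 : ∀ k ∈ K, ∀ h, h ∈ S → k * h ∈ S := fun k hk h hh => by
      obtain ⟨k', hk', e⟩ := (hS h).mp hh
      refine (hS _).mpr ⟨k * k', K.mul_mem hk hk', ?_⟩
      have e2 : (k * k' * g)⁻¹ * (k * h) = (k' * g)⁻¹ * h := by group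
      rwa [e2]
    refine fun k hk h => ⟨fun hh => ?_, h1 k hk h⟩
    have := h1 k⁻¹ (K.inv_mem hk) _ hh
    rwa [inv_mul_cancel_left] at this
  have hSr : ∀ k ∈ K, ∀ h, h * k ∈ S ↔ h ∈ S := by
    intro k hk h
    rw [hS, hS]
    refine exists_congr fun k' => and_congr_right fun _ => ?_
    rw [← mul_assoc, K.mul_mem_cancel_right hk]
  -- `S` is the double coset `KgK`; the test function is its indicator and `r` is the volume of `K`.
  refine ⟨B, S.indicator 1, (ν.real K : ℂ), hB,
    Complex.ofReal_ne_zero.mpr (ENNReal.toReal_ne_zero.mpr ⟨hν0, hνt⟩), ?_, ?_, ?_, ?_, ?_⟩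
  · rw [← LocallyConstant.coe_charFn ℂ hSc]
    exact LocallyConstant.isLocallyConstant _
  · exact HasCompactSupport.of_support_subset_isCompact hScompact Set.support_indicator_subset
  · intro k hk h
    simp only [Set.indicator_apply, hSl k hk]
    rfl
  · intro k hk h
    simp only [Set.indicator_apply, hSr k hk]
    rfl
  · intro f hf
    have e1 : ∀ h, S.indicator (1 : Γ → ℂ) h * f h = S.indicator f h := fun h => by
      by_cases hh : h ∈ S <;> simp [hh]
    have e2 : ∀ x : Γ, Set.EqOn f (fun _ => f x) {h | x⁻¹ * h ∈ K} := fun x h hh => by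
      have := hf _ hh x
      rwa [mul_inv_cancel_left] at this
    have hm : ∀ x : Γ, MeasurableSet {h | x⁻¹ * h ∈ K} := fun x => (hopen x).measurableSet
    simp only [e1]
    rw [integral_indicator hSc.isOpen.measurableSet, integral_biUnion_finset B (fun b _ => hm _) hd
      (fun b _ => ((integrableOn_const (hs := (by rw [hvol]; exact hνt))).congr_fun
        (e2 _).symm (hm _))), Finset.mul_sum]
    refine Finset.sum_congr rfl fun b _ => ?_
    rw [setIntegral_congr_fun (hm _) (e2 _), setIntegral_const, measureReal_def, hvol,
      Complex.real_smul]
    rfl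

end DoubleCosets

/-! ### Convergence in `G(𝔸_f)` and truncation to finitely many places. -/

section FiniteAdeles

variable {F : Type u} [Field F] [NumberField F] {n : ℕ} {α : Type*} {l : Filter α}

/-- Once all components are integral the family lives in `∏ 𝒪_v`, which carries the product
topology, so componentwise convergence is enough. -/
theorem tendsto_finAdele_zero {x : α → FinAdele F}
    (h : ∀ v, Tendsto (fun a => finAdeleEval v (x a)) l (𝓝 0))
    (hO : ∀ᶠ a in l, ∀ v, finAdeleEval v (x a) ∈ v.adicCompletionIntegers F) :
    Tendsto x l (𝓝 0) := by
  classical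
  let z : α → ∀ v : FinPlace F, v.adicCompletionIntegers F := fun a v =>
    if h : finAdeleEval v (x a) ∈ v.adicCompletionIntegers F then ⟨_, h⟩ else 0
  have hz : Tendsto z l (𝓝 0) := by
    rw [tendsto_pi_nhds]
    intro v
    rw [tendsto_subtype_rng]
    refine (h v).congr' ?_
    filter_upwards [hO] with a ha
    simp only [z, dif_pos (ha v)]
  let s : (∀ v : FinPlace F, v.adicCompletionIntegers F) → FinAdele F := fun y =>
    RestrictedProduct.structureMap (fun v : FinPlace F => v.adicCompletion F)
      (fun v => (v.adicCompletionIntegers F : Set (v.adicCompletion F))) cofinite y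
  have hs : Continuous s := RestrictedProduct.isEmbedding_structureMap.continuous
  have h1 : Tendsto (fun a => s (z a)) l (𝓝 0) := (hs.tendsto 0).comp hz
  refine h1.congr' ?_
  filter_upwards [hO] with a ha
  refine FiniteAdeleRing.ext F fun v => ?_
  change ((z a v : v.adicCompletionIntegers F) : v.adicCompletion F) = finAdeleEval v (x a)
  simp only [z, dif_pos (ha v)]

theorem tendsto_finAdele {x : α → FinAdele F} {x₀ : FinAdele F}
    (h : ∀ v, Tendsto (fun a => finAdeleEval v (x a)) l (𝓝 (finAdeleEval v x₀)))
    (hO : ∀ᶠ a in l, ∀ v,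
      finAdeleEval v (x a) - finAdeleEval v x₀ ∈ v.adicCompletionIntegers F) :
    Tendsto x l (𝓝 x₀) := by
  have h1 : Tendsto (fun a => x a - x₀) l (𝓝 0) := tendsto_finAdele_zero
    (fun v => by
      have := (h v).sub_const (finAdeleEval v x₀)
      rw [sub_self] at this
      simpa only [map_sub] using this)
    (by simpa only [map_sub] using hO)
  simpa using h1.add_const x₀

theorem tendsto_finAdele_matrix {x : α → Matrix (Fin n) (Fin n) (FinAdele F)}
    {x₀ : Matrix (Fin n) (Fin n) (FinAdele F)}
    (h : ∀ v, Tendsto (fun a => (x a).map (finAdeleEval v)) l (𝓝 (x₀.map (finAdeleEval v))))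
    (hO : ∀ i j, ∀ᶠ a in l, ∀ v, (x a).map (finAdeleEval v) i j - x₀.map (finAdeleEval v) i j ∈
      v.adicCompletionIntegers F) :
    Tendsto x l (𝓝 x₀) := by
  refine tendsto_pi_nhds.mpr fun i => tendsto_pi_nhds.mpr fun j => ?_
  exact tendsto_finAdele (fun v => tendsto_pi_nhds.mp (tendsto_pi_nhds.mp (h v) i) j) (hO i j)

namespace LinearAlgebraicGroup

variable {G : LinearAlgebraicGroup F n}

theorem tendsto_finPts {x : α → G.FinPts} {x₀ : G.FinPts}
    (h : ∀ v, Tendsto (fun a => G.map (finAdeleEval v) (x a)) l (𝓝 (G.map (finAdeleEval v) x₀)))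
    (hO : ∀ i j, ∀ᶠ a in l, ∀ v, (G.map (finAdeleEval v) (x a)).1.1 i j -
      (G.map (finAdeleEval v) x₀).1.1 i j ∈ v.adicCompletionIntegers F)
    (hO' : ∀ i j, ∀ᶠ a in l, ∀ v, (G.map (finAdeleEval v) (x a)).1⁻¹.1 i j -
      (G.map (finAdeleEval v) x₀).1⁻¹.1 i j ∈ v.adicCompletionIntegers F) :
    Tendsto x l (𝓝 x₀) := by
  refine tendsto_subtype_rng.mpr (Units.isInducing_embedProduct.tendsto_nhds_iff.mpr ?_)
  refine Tendsto.prodMk_nhds ?_ ((MulOpposite.continuous_op.tendsto _).comp ?_)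
  · refine tendsto_finAdele_matrix (fun v => ?_) hO
    exact ((Units.continuous_val.comp continuous_subtype_val).tendsto _).comp (h v)
  · refine tendsto_finAdele_matrix (fun v => ?_) hO'
    exact ((Units.continuous_val.comp (continuous_inv.comp continuous_subtype_val)).tendsto _).comp
      (h v)

theorem map_localEmb_same (v : FinPlace F) (g : G.LocPts v) :
    G.map (finAdeleEval v) (G.localEmb v g) = g :=
  Subtype.ext (Units.ext (localMatrix_map_same v g.1.1))

theorem map_localEmb_ne {v w : FinPlace F} (h : w ≠ v) (g : G.LocPts v) :
    G.map (finAdeleEval w) (G.localEmb v g) = 1 :=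
  Subtype.ext (Units.ext (localMatrix_map_ne h g.1.1))

theorem finPts_ext {x y : G.FinPts}
    (h : ∀ v, G.map (finAdeleEval v) x = G.map (finAdeleEval v) y) : x = y :=
  Subtype.ext (Units.ext (finAdele_matrix_ext fun v =>
    congrArg (fun g : G.LocPts v => g.1.1) (h v)))

theorem commute_localEmb {v w : FinPlace F} (h : v ≠ w) (x : G.LocPts v) (y : G.LocPts w) :
    Commute (G.localEmb v x) (G.localEmb w y) := by
  refine finPts_ext fun u => ?_
  rw [map_mul, map_mul]
  by_cases hu : u = v
  · rw [map_localEmb_ne (fun e => h (hu.symm.trans e)), mul_one, one_mul]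
  · rw [map_localEmb_ne hu, mul_one, one_mul]

/-- Components away from `v` are constant, and near `g` the entries at `v` change by integral
amounts because `𝒪_v` is open. -/
theorem continuous_localEmb (v : FinPlace F) : Continuous (G.localEmb v) := by
  rw [continuous_iff_continuousAt]
  intro g
  have hopen : IsOpen (v.adicCompletionIntegers F : Set (v.adicCompletion F)) :=
    Valued.isOpen_valuationSubring _
  have hz : ∀ c : v.adicCompletion F,
      c - c ∈ (v.adicCompletionIntegers F : Set (v.adicCompletion F)) := fun c => by
    rw [sub_self]; exact zero_mem _
  refine tendsto_finPts (fun w => ?_) (fun i j => ?_) fun i j => ?_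
  · by_cases hw : w = v
    · subst hw
      simp only [map_localEmb_same]
      exact tendsto_id
    · simp only [map_localEmb_ne hw]
      exact tendsto_const_nhds
  · have hc : Continuous fun x : G.LocPts v => x.1.1 i j - g.1.1 i j :=
      ((Units.continuous_val.comp continuous_subtype_val).matrix_elem i j).sub continuous_const
    filter_upwards [(hopen.preimage hc).mem_nhds (hz (g.1.1 i j))]
      with x hx w
    by_cases hw : w = v
    · subst hw
      rw [map_localEmb_same, map_localEmb_same]
      exact hx
    · rw [map_localEmb_ne hw, map_localEmb_ne hw, sub_self]
      exact zero_mem _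
  · have hc : Continuous fun x : G.LocPts v => x.1⁻¹.1 i j - g.1⁻¹.1 i j :=
      ((Units.continuous_val.comp
        (continuous_inv.comp continuous_subtype_val)).matrix_elem i j).sub continuous_const
    filter_upwards [(hopen.preimage hc).mem_nhds (hz (g.1⁻¹.1 i j))]
      with x hx w
    by_cases hw : w = v
    · subst hw
      rw [map_localEmb_same, map_localEmb_same]
      exact hx
    · rw [map_localEmb_ne hw, map_localEmb_ne hw, sub_self]
      exact zero_mem _

/-- The element of `G(𝔸_f)` with components `h_v` for `v` in the list, `1` elsewhere. -/
def truncate (h : G.FinPts) (L : List (FinPlace F)) : G.FinPts :=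
  (L.map fun v => G.localEmb v (G.map (finAdeleEval v) h)).prod

theorem map_truncate_of_notMem (h : G.FinPts) {L : List (FinPlace F)} {w : FinPlace F}
    (hw : w ∉ L) : G.map (finAdeleEval w) (truncate h L) = 1 := by
  induction L with
  | nil => exact map_one _
  | cons v L ih =>
    rw [List.mem_cons, not_or] at hw
    rw [truncate, List.map_cons, List.prod_cons, map_mul, map_localEmb_ne hw.1, one_mul]
    exact ih hw.2

theorem map_truncate_of_mem (h : G.FinPts) {L : List (FinPlace F)} (hL : L.Nodup) {w : FinPlace F}
    (hw : w ∈ L) : G.map (finAdeleEval w) (truncate h L) = G.map (finAdeleEval w) h := by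
  induction L with
  | nil => exact absurd hw List.not_mem_nil
  | cons v L ih =>
    obtain ⟨hv, hL⟩ := List.nodup_cons.mp hL
    rw [truncate, List.map_cons, List.prod_cons, map_mul]
    by_cases e : w = v
    · subst e
      rw [map_localEmb_same]
      exact (congrArg _ (map_truncate_of_notMem h hv)).trans (mul_one _)
    · rw [map_localEmb_ne e, one_mul]
      exact ih hL ((List.mem_cons.mp hw).resolve_left e)

/-- Almost all components of `h` and `h⁻¹` are integral; once `S` contains the exceptional places,
the tail differs from `1` by integral matrices supported off `S`. A vector fixed by an open subgroup
therefore cannot tell `h` from a large truncation. -/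
theorem tendsto_truncate (h : G.FinPts) :
    Tendsto (fun S : Finset (FinPlace F) => (truncate h S.toList)⁻¹ * h) atTop (𝓝 1) := by
  classical
  have hS : ∀ (S : Finset (FinPlace F)) v, G.map (finAdeleEval v) ((truncate h S.toList)⁻¹ * h) =
      if v ∈ S then 1 else G.map (finAdeleEval v) h := fun S v => by
    rw [map_mul, map_inv]
    split_ifs with hv
    · rw [map_truncate_of_mem h S.nodup_toList (Finset.mem_toList.mpr hv), inv_mul_cancel]
    · rw [map_truncate_of_notMem h (fun h' => hv (Finset.mem_toList.mp h')), inv_one, one_mul]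
  have hint : ∀ (A : Matrix (Fin n) (Fin n) (FinAdele F)) i j,
      ∀ᶠ S : Finset (FinPlace F) in atTop, ∀ v, v ∉ S →
        A.map (finAdeleEval v) i j - (1 : Matrix (Fin n) (Fin n) (v.adicCompletion F)) i j ∈
          v.adicCompletionIntegers F := fun A i j => by
    have hfin : {v | ¬ finAdeleEval v (A i j) ∈ v.adicCompletionIntegers F}.Finite := (A i j).2
    filter_upwards [eventually_ge_atTop hfin.toFinset] with S hS v hv
    have h1 : finAdeleEval v (A i j) ∈ v.adicCompletionIntegers F := by
      by_contra h'
      exact hv (hS (hfin.mem_toFinset.mpr h'))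
    refine sub_mem h1 ?_
    by_cases hij : i = j
    · subst hij; rw [Matrix.one_apply_eq]; exact one_mem _
    · rw [Matrix.one_apply_ne hij]; exact zero_mem _
  refine tendsto_finPts (fun v => ?_) (fun i j => ?_) fun i j => ?_
  · refine tendsto_const_nhds.congr' ?_
    filter_upwards [eventually_ge_atTop {v}] with S hv
    rw [hS, if_pos (hv (Finset.mem_singleton_self v)), map_one]
  · filter_upwards [hint h.1.1 i j] with S hv v
    rw [hS, map_one]
    split_ifs with hvS
    · rw [sub_self]; exact zero_mem _
    · exact hv v hvS
  · filter_upwards [hint h.1⁻¹.1 i j] with S hv v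
    rw [hS, map_one]
    split_ifs with hvS
    · rw [sub_self]; exact zero_mem _
    · have e : (1 : G.LocPts v).1⁻¹.1 = 1 := by rw [OneMemClass.coe_one, inv_one, Units.val_one]
      rw [e]
      exact hv v hvS

end LinearAlgebraicGroup

end FiniteAdeles

namespace ArchimedeanData

/-! ### The `𝔤'`-module generated by `τ`. -/

section LiePart

variable {F : Type u} [Field F] [NumberField F] {n : ℕ} {G : LinearAlgebraicGroup F n}
  {D : ArchimedeanData G} {Φ : G.Adelic → ℂ}

/-- The `𝔤'`-module generated by the `K'₀`-translates of `Φ`. -/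
def liePart (D : ArchimedeanData G) (hΦ : Φ ∈ smoothFunctions G) : Submodule ℂ (G.Adelic → ℂ) :=
  (LinearMap.range (inducedMap D hΦ)).map (smoothFunctions G).subtype

theorem inducedMap_mem_liePart (hΦ : Φ ∈ smoothFunctions G)
    (x : D.U ⊗[ℂ] (D.tauSpace Φ).toSubmodule) :
    (inducedMap D hΦ x : G.Adelic → ℂ) ∈ liePart D hΦ := ⟨_, ⟨x, rfl⟩, rfl⟩

theorem lieDeriv_mem_liePart (hΦ : Φ ∈ smoothFunctions G) (X : D.g') {f : G.Adelic → ℂ}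
    (hf : f ∈ liePart D hΦ) : lieDeriv X f ∈ liePart D hΦ := by
  obtain ⟨_, ⟨x, rfl⟩, rfl⟩ := hf
  have h := inducedMap_mem_liePart hΦ (UniversalEnvelopingAlgebra.ι ℂ (1 ⊗ₜ X : D.g'C) • x)
  rwa [inducedMap_smul, envelopingAction_ι, one_smul] at h

theorem rightTranslation_mem_liePart (hΦ : Φ ∈ smoothFunctions G) {k : G.ArchPts} (hk : k ∈ D.K'₀)
    {f : G.Adelic → ℂ} (hf : f ∈ liePart D hΦ) : rightTranslation G (k, 1) f ∈ liePart D hΦ := by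
  obtain ⟨_, ⟨x, rfl⟩, rfl⟩ := hf
  have h := inducedMap_mem_liePart hΦ (inducedTranslation D Φ ⟨k, hk⟩ x)
  rwa [inducedMap_inducedTranslation] at h

theorem tauSpace_le_liePart (hΦ : Φ ∈ smoothFunctions G) :
    (D.tauSpace Φ).toSubmodule ≤ liePart D hΦ := fun v hv => by
  have h := inducedMap_mem_liePart hΦ (1 ⊗ₜ (⟨v, hv⟩ : (D.tauSpace Φ).toSubmodule))
  rwa [inducedMap_tmul, map_one, Module.End.one_apply] at h

theorem lieDeriv_sum {H : ClosedSubgroup G.ArchPts} (X : lieAlg H) {β : Type*} (s : Finset β)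
    {f : β → G.Adelic → ℂ} (hf : ∀ b, f b ∈ smoothFunctions G) :
    lieDeriv X (∑ b ∈ s, f b) = ∑ b ∈ s, lieDeriv X (f b) := by
  have h := congrArg (fun f : smoothFunctions G => (f : G.Adelic → ℂ))
    (map_sum (smoothLieHom H X) (fun b => (⟨f b, hf b⟩ : smoothFunctions G)) s)
  simpa only [smoothLieHom_apply, Submodule.coe_sum] using h

variable [FiniteDimensional ℂ (D.tauSpace Φ).toSubmodule]

/-- An induction principle, used both for square-integrability and for carrying Hecke relations from
`Φ` to its derivatives. -/
theorem liePart_le (hΦ : Φ ∈ smoothFunctions G) (hp : D.AnnihilatedByPMinus Φ)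
    (hirr : (D.tau Φ).IsIrreducible) (honce : D.OccursOnce (D.tau Φ) (D.lAction (D.tau Φ)))
    {P : Submodule ℂ (G.Adelic → ℂ)} (hTP : (D.tauSpace Φ).toSubmodule ≤ P)
    (hP : ∀ {ι : Type} [Fintype ι] (X : ι → D.g') (f g : G.Adelic → ℂ) (h : ι → G.Adelic → ℂ),
      f ∈ P → g ∈ P → (∀ i, h i ∈ P) →
      ∑ i, lieDeriv (X i) (lieDeriv (X i) f) = g + ∑ i, lieDeriv (X i) (h i) →
      ∀ i, lieDeriv (X i) f ∈ P) : liePart D hΦ ≤ P := by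
  refine Submodule.map_le_iff_le_comap.mpr
    (range_inducedMap_le hΦ hp hirr honce (fun v hv => hTP hv) ?_)
  intro ι _ X f g h hf hg hh e i
  refine hP X f g (fun i => h i) hf hg hh ?_ i
  have e' := congrArg (fun f : smoothFunctions G => (f : G.Adelic → ℂ)) e
  simpa only [Submodule.coe_add, Submodule.coe_sum, smoothLieHom_apply] using e'

/-- Translations by `G(𝔸_f)` commute with `K'₀` and with Lie derivatives, so a linear relation among
translates of `Φ` holds on the whole module. -/
theorem sum_rightTranslation_eq_smul (hΦ : Φ ∈ smoothFunctions G) (hp : D.AnnihilatedByPMinus Φ)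
    (hirr : (D.tau Φ).IsIrreducible) (honce : D.OccursOnce (D.tau Φ) (D.lAction (D.tau Φ)))
    {β : Type*} {s : Finset β} {h : β → G.FinPts} {c : ℂ}
    (hc : ∑ b ∈ s, rightTranslation G (1, h b) Φ = c • Φ) {f : G.Adelic → ℂ}
    (hf : f ∈ liePart D hΦ) : ∑ b ∈ s, rightTranslation G (1, h b) f = c • f := by
  let A : Module.End ℂ (G.Adelic → ℂ) := ∑ b ∈ s, rightTranslation G (1, h b) - c • 1
  have hA : ∀ f, f ∈ LinearMap.ker A ↔ ∑ b ∈ s, rightTranslation G (1, h b) f = c • f := by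
    intro f
    rw [LinearMap.mem_ker, LinearMap.sub_apply, LinearMap.sum_apply, sub_eq_zero]
    rfl
  have hle : liePart D hΦ ≤ LinearMap.ker A ⊓ smoothFunctions G := by
    refine liePart_le hΦ hp hirr honce
      (le_inf (Submodule.span_le.mpr ?_) (tauSpace_le_smoothFunctions hΦ)) ?_
    · rintro _ ⟨k, rfl⟩
      refine (hA _).mpr ?_
      have e := congrArg (rightTranslation G ((k : G.ArchPts), 1)) hc
      rw [map_sum, map_smul] at e
      simp only [rightTranslation_arch_fin_comm] at e
      exact e
    · intro ι _ X f g h' hf _ _ _ i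
      refine ⟨(hA _).mpr ?_, smoothFunctions.lieDeriv_mem hf.2 _⟩
      simp only [← lieDeriv_rightTranslation_fin]
      rw [← lieDeriv_sum _ _ fun b => smoothFunctions.rightTranslation_mem hf.2 _,
        (hA _).mp hf.1, lieDeriv_smul]
  exact (hA f).mp (hle hf).1

end LiePart

end ArchimedeanData

/-! ### The unitary representation on square-integrable forms. -/

section L2Representation

variable {F : Type u} [Field F] [NumberField F] {n : ℕ} {G : LinearAlgebraicGroup F n}
  {Kinf : Subgroup G.ArchPts} {χ : G.adelicCenter →* Circle}
  {μ : Measure (AutomorphicQuotient G)}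
  {hne : ∃ Kf : Subgroup G.FinPts, IsOpen (Kf : Set G.FinPts) ∧ IsCompact (Kf : Set G.FinPts)}

theorem IsL2Form.rightTranslation {f : G.Adelic → ℂ} (hμ : IsQuotientHaar μ)
    (hf : IsL2Form μ Kinf χ f) {k : G.ArchPts} (hk : k ∈ Kinf) (h : G.FinPts) :
    IsL2Form μ Kinf χ (rightTranslation G (k, h) f) := by
  refine hf.rightTranslation_of_form hμ ?_
  have e : ((k, h) : G.Adelic) = (1, h) * (k, 1) :=
    Prod.ext (one_mul k).symm (mul_one h).symm
  rw [e, rightTranslation_mul_apply]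
  exact (hf.form.rightTranslation_arch hk).rightTranslation_fin h

/-- Right translation on square-integrable automorphic forms. -/
def l2Translation (hμ : IsQuotientHaar μ) :
    Representation ℂ (Kinf × G.FinPts) (l2Forms μ Kinf χ hne) where
  toFun x := (rightTranslation G ((x.1 : G.ArchPts), x.2)).restrict
    fun _ hf => IsL2Form.rightTranslation hμ hf x.1.2 x.2
  map_one' := by
    ext f g
    exact congrArg f.1 (mul_one g)
  map_mul' x y := by
    ext f g
    exact congrArg f.1 (mul_assoc g ((x.1 : G.ArchPts), x.2) ((y.1 : G.ArchPts), y.2)).symm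

theorem coe_l2Translation (hμ : IsQuotientHaar μ) (x : Kinf × G.FinPts)
    (f : l2Forms μ Kinf χ hne) : (l2Translation hμ x f : G.Adelic → ℂ) =
      rightTranslation G ((x.1 : G.ArchPts), x.2) f := rfl

/-- The Petersson inner product on square-integrable automorphic forms. -/
@[reducible]
def peterssonCore (hμ : IsQuotientHaar μ) : InnerProductSpace.Core ℂ (l2Forms μ Kinf χ hne) where
  inner f g := petersson μ f g
  conj_inner_symm f g := conj_petersson _ _
  re_inner_nonneg f := by
    rw [petersson_self]
    exact integral_nonneg fun q => by positivity
  add_left f g h := petersson_add_left f.2 g.2 h.2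
  smul_left f g c := petersson_smul_left c _ _
  definite f h := Subtype.ext (eq_zero_of_petersson_self hμ f.2 h)

theorem peterssonCore_l2Translation (hμ : IsQuotientHaar μ) (x : Kinf × G.FinPts)
    (f g : l2Forms μ Kinf χ hne) : (peterssonCore hμ).inner (l2Translation hμ x f)
      (l2Translation hμ x g) = (peterssonCore hμ).inner f g :=
  petersson_rightTranslation hμ f.2 g.2 _

/-- The linear form `f ↦ ⟨Φ, f⟩`. -/
def peterssonForm (Φ : l2Forms μ Kinf χ hne) : l2Forms μ Kinf χ hne →ₗ[ℂ] ℂ where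
  toFun f := petersson μ Φ f
  map_add' f g := by
    rw [← conj_petersson, ← conj_petersson _ (f : G.Adelic → ℂ),
      ← conj_petersson _ (g : G.Adelic → ℂ)]
    rw [Submodule.coe_add, petersson_add_left f.2 g.2 Φ.2, map_add]
  map_smul' c f := by
    rw [← conj_petersson, ← conj_petersson _ (f : G.Adelic → ℂ), Submodule.coe_smul,
      petersson_smul_left, map_mul, Complex.conj_conj]
    rfl

end L2Representation

/-! ### Copies of `τ` in the archimedean part. -/

namespace ArchimedeanData

variable {F : Type u} [Field F] [NumberField F] {n : ℕ} {G : LinearAlgebraicGroup F n}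
  {D : ArchimedeanData G} {Φ : G.Adelic → ℂ}
  {χ : G.adelicCenter →* Circle} {μ : Measure (AutomorphicQuotient G)}
  {hne : ∃ Kf : Subgroup G.FinPts, IsOpen (Kf : Set G.FinPts) ∧ IsCompact (Kf : Set G.FinPts)}

theorem mem_range_of_mem_liePart {hΦ : Φ ∈ smoothFunctions G} {f : smoothFunctions G}
    (hf : (f : G.Adelic → ℂ) ∈ liePart D hΦ) : f ∈ LinearMap.range (inducedMap D hΦ) := by
  obtain ⟨f', hf', e⟩ := hf
  rwa [← Subtype.ext e]

theorem tauSpace_le_l2Forms (hμ : IsQuotientHaar μ) (hΦ : IsL2Form μ D.Kinf χ Φ) :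
    (D.tauSpace Φ).toSubmodule ≤ l2Forms μ D.Kinf χ hne := by
  refine Submodule.span_le.mpr ?_
  rintro _ ⟨k, rfl⟩
  exact hΦ.rightTranslation hμ (D.K'_le_Kinf (D.K'₀_le_K' k.2)) 1

theorem finiteDimensional_tauSpace (hΦ : IsAutomorphicFormWith D.Kinf χ Φ) :
    FiniteDimensional ℂ (D.tauSpace Φ).toSubmodule := by
  have := hΦ.finite
  exact Submodule.finiteDimensional_of_le tauSpace_le_archSpan

/-- The elliptic estimate passes square-integrability from `τ` to all derivatives; this is what
makes the Petersson product available on the generated representation. -/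
theorem liePart_le_l2Forms (hμ : IsQuotientHaar μ) (hΦ : IsL2Form μ D.Kinf χ Φ)
    (hp : D.AnnihilatedByPMinus Φ) (hirr : (D.tau Φ).IsIrreducible)
    (honce : D.OccursOnce (D.tau Φ) (D.lAction (D.tau Φ))) :
    liePart D hΦ.form.smooth ≤ l2Forms μ D.Kinf χ hne := by
  have := finiteDimensional_tauSpace hΦ.form
  obtain ⟨Kf, ho, hc⟩ := hne
  have := weaklyLocallyCompactSpace_of_subgroup ho hc
  exact liePart_le hΦ.form.smooth hp hirr honce (tauSpace_le_l2Forms hμ hΦ)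
    fun X f g h hf hg hh e i => isL2Form_lieDeriv_of_sum_eq hμ X hf hg hh e i

variable (D μ χ hne) in
/-- The translate by `σ` of the `𝔤'`-module generated by the `K'₀`-translates of `Φ`. -/
def twistedPart (hΦ : Φ ∈ smoothFunctions G) (σ : G.ArchPts) :
    Submodule ℂ (l2Forms μ D.Kinf χ hne) :=
  (liePart D hΦ).comap (rightTranslation G (σ⁻¹, 1) ∘ₗ (l2Forms μ D.Kinf χ hne).subtype)

theorem mem_twistedPart {hΦ : Φ ∈ smoothFunctions G} {σ : G.ArchPts}
    {f : l2Forms μ D.Kinf χ hne} : f ∈ twistedPart D χ μ hne hΦ σ ↔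
      rightTranslation G (σ⁻¹, 1) (f : G.Adelic → ℂ) ∈ liePart D hΦ := Iff.rfl

variable (D μ χ hne) in
/-- The sum of the `K'`-translates of the `𝔤'`-module generated by the `K'₀`-translates of `Φ`. -/
def archPart (hΦ : Φ ∈ smoothFunctions G) : Submodule ℂ (l2Forms μ D.Kinf χ hne) :=
  ⨆ σ : D.K', twistedPart D χ μ hne hΦ σ

theorem rightTranslation_arch_mul (x y : G.ArchPts) (f : G.Adelic → ℂ) :
    rightTranslation G (x, 1) (rightTranslation G (y, 1) f) = rightTranslation G (x * y, 1) f := by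
  rw [← rightTranslation_mul_apply, Prod.mk_mul_mk, one_mul]

theorem rightTranslation_one (f : G.Adelic → ℂ) :
    rightTranslation G ((1, 1) : G.Adelic) f = f := by
  have : ((1, 1) : G.Adelic) = 1 := rfl
  rw [this, map_one]
  rfl

/-- `K'₀` as a subgroup of `K_∞ × G(𝔸_f)`. -/
def toKinf (D : ArchimedeanData G) : D.K'₀ →* D.Kinf × G.FinPts where
  toFun k := (⟨k, D.K'_le_Kinf (D.K'₀_le_K' k.2)⟩, 1)
  map_one' := rfl
  map_mul' _ _ := Prod.ext rfl (one_mul 1).symm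

theorem l2Translation_mem_twistedPart (hμ : IsQuotientHaar μ) {hΦ : Φ ∈ smoothFunctions G}
    (σ : D.K') (k : D.K'₀) {f : l2Forms μ D.Kinf χ hne}
    (hf : f ∈ twistedPart D χ μ hne hΦ σ) :
    l2Translation hμ (D.toKinf k) f ∈ twistedPart D χ μ hne hΦ σ := by
  rw [mem_twistedPart] at hf ⊢
  have h := rightTranslation_mem_liePart hΦ (D.conjK'₀ (inv_mem σ.2) k).2 hf
  have e : (D.conjK'₀ (inv_mem σ.2) k : G.ArchPts) = (σ : G.ArchPts)⁻¹ * k * (σ : G.ArchPts)⁻¹⁻¹ :=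
    rfl
  rw [e, rightTranslation_arch_mul, inv_mul_cancel_right, ← rightTranslation_arch_mul] at h
  exact h

theorem sum_l2Translation_eq_smul (hμ : IsQuotientHaar μ) (hΦ : IsL2Form μ D.Kinf χ Φ)
    (hp : D.AnnihilatedByPMinus Φ) (hirr : (D.tau Φ).IsIrreducible)
    (honce : D.OccursOnce (D.tau Φ) (D.lAction (D.tau Φ)))
    {β : Type*} {s : Finset β} {h : β → G.FinPts} {c : ℂ}
    (hc : ∑ b ∈ s, rightTranslation G (1, h b) Φ = c • Φ) {f : l2Forms μ D.Kinf χ hne}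
    (hf : f ∈ archPart D χ μ hne hΦ.form.smooth) :
    ∑ b ∈ s, l2Translation hμ (1, h b) f = c • f := by
  have := finiteDimensional_tauSpace hΦ.form
  let A : Module.End ℂ (l2Forms μ D.Kinf χ hne) :=
    ∑ b ∈ s, l2Translation hμ (1, h b) - c • 1
  have hA : ∀ f, f ∈ LinearMap.ker A ↔ ∑ b ∈ s, l2Translation hμ (1, h b) f = c • f := by
    intro f
    rw [LinearMap.mem_ker, LinearMap.sub_apply, LinearMap.sum_apply, sub_eq_zero]
    rfl
  suffices hle : archPart D χ μ hne hΦ.form.smooth ≤ LinearMap.ker A from (hA f).mp (hle hf)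
  refine iSup_le fun σ f hf => (hA f).mpr (Subtype.ext ?_)
  have e := congrArg (rightTranslation G ((σ : G.ArchPts), 1))
    (sum_rightTranslation_eq_smul hΦ.form.smooth hp hirr honce hc (mem_twistedPart.mp hf))
  simp only [map_sum, map_smul, rightTranslation_arch_fin_comm, rightTranslation_arch_mul,
    mul_inv_cancel, rightTranslation_one] at e
  rw [Submodule.coe_sum]
  exact e

section Homomorphisms

variable (hμ : IsQuotientHaar μ) (hΦ : IsL2Form μ D.Kinf χ Φ)

variable (D μ χ hne) in
/-- The space of `τ` in the space of square-integrable automorphic forms. -/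
def l2TauSpace (Φ : G.Adelic → ℂ) : Submodule ℂ (l2Forms μ D.Kinf χ hne) :=
  (D.tauSpace Φ).toSubmodule.comap (l2Forms μ D.Kinf χ hne).subtype

/-- The identification of `τ` with a space of square-integrable automorphic forms. -/
def toL2TauSpace : (D.tauSpace Φ).toSubmodule →ₗ[ℂ] l2TauSpace D χ μ hne Φ where
  toFun v := ⟨⟨v, tauSpace_le_l2Forms hμ hΦ v.2⟩, v.2⟩
  map_add' _ _ := rfl
  map_smul' _ _ := rfl

theorem l2Translation_mem_l2TauSpace (k : D.K'₀) {f : l2Forms μ D.Kinf χ hne}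
    (hf : f ∈ l2TauSpace D χ μ hne Φ) : l2Translation hμ (D.toKinf k) f ∈
      l2TauSpace D χ μ hne Φ := (D.tauSpace Φ).apply_mem_toSubmodule k hf

theorem l2TauSpace_eq_bot_or_eq (hirr : (D.tau Φ).IsIrreducible)
    {p : Submodule ℂ (l2Forms μ D.Kinf χ hne)} (hpT : p ≤ l2TauSpace D χ μ hne Φ)
    (hp : ∀ k, ∀ f ∈ p, l2Translation hμ (D.toKinf k) f ∈ p) :
    p = ⊥ ∨ p = l2TauSpace D χ μ hne Φ := by
  let q : Submodule ℂ (D.tauSpace Φ).toSubmodule :=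
    (p.map (l2Forms μ D.Kinf χ hne).subtype).comap (D.tauSpace Φ).toSubmodule.subtype
  have hq : ∀ k, ∀ v ∈ q, D.tau Φ k v ∈ q := by
    rintro k v ⟨f, hf, e⟩
    exact ⟨_, hp k f hf, congrArg (rightTranslation G ((k : G.ArchPts), 1)) e⟩
  rcases (Representation.isIrreducible_iff_forall.mp hirr).2 q hq with h | h
  · refine Or.inl (p.eq_bot_iff.mpr fun f hf => Subtype.ext ?_)
    have hfq : (⟨f, hpT hf⟩ : (D.tauSpace Φ).toSubmodule) ∈ q := ⟨f, hf, rfl⟩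
    rw [h, Submodule.mem_bot] at hfq
    exact congrArg (fun v : (D.tauSpace Φ).toSubmodule => (v : G.Adelic → ℂ)) hfq
  · refine Or.inr (le_antisymm hpT fun f hf => ?_)
    have hfq : (⟨f, hf⟩ : (D.tauSpace Φ).toSubmodule) ∈ q := h ▸ Submodule.mem_top
    obtain ⟨f', hf', e⟩ := hfq
    rwa [← Subtype.ext e]

/-- For `σ ∈ K'₀` the translate is `liePart` itself and multiplicity one makes the map a scalar. For
other `σ`, composing with `R(σ⁻¹)` gives a homomorphism to `liePart` twisted by `σ⁻¹`, which
vanishes because the twist of `L_τ` shares no type with `L_τ`. -/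
theorem hom_twistedPart_mem (hp : D.AnnihilatedByPMinus Φ) (hirr : (D.tau Φ).IsIrreducible)
    (honce : D.OccursOnce (D.tau Φ) (D.lAction (D.tau Φ)))
    (htw : ∀ (σ : G.ArchPts) (hσ : σ ∈ D.K'), σ ∉ D.K'₀ →
      ¬ D.HaveCommonType (D.lAction (D.tau Φ))
        (D.twist (D.lAction (D.tau Φ)) ⟨σ, D.K'_le_G' hσ⟩)) (σ : D.K')
    (φ : l2TauSpace D χ μ hne Φ →ₗ[ℂ] l2Forms μ D.Kinf χ hne)
    (hr : ∀ t, φ t ∈ twistedPart D χ μ hne hΦ.form.smooth σ)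
    (hφ : ∀ k (t : l2TauSpace D χ μ hne Φ),
      φ ⟨l2Translation hμ (D.toKinf k) t, l2Translation_mem_l2TauSpace hμ k t.2⟩ =
        l2Translation hμ (D.toKinf k) (φ t)) (t : l2TauSpace D χ μ hne Φ) :
    φ t ∈ l2TauSpace D χ μ hne Φ := by
  have := finiteDimensional_tauSpace hΦ.form
  have hle : l2Forms μ D.Kinf χ hne ≤ smoothFunctions G := fun f hf => hf.form.smooth
  let φ₁ : (D.tauSpace Φ).toSubmodule →ₗ[ℂ] smoothFunctions G :=
    Submodule.inclusion hle ∘ₗ φ ∘ₗ toL2TauSpace hμ hΦ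
  have hφ₁ : ∀ (k : D.K'₀) v, φ₁ (D.tau Φ k v) = smoothTranslation G k (φ₁ v) := fun k v =>
    congrArg (Submodule.inclusion hle) (hφ k (toL2TauSpace hμ hΦ v))
  have ht : toL2TauSpace hμ hΦ ⟨t, t.2⟩ = t := rfl
  have hφt : ((φ₁ ⟨t, t.2⟩ : smoothFunctions G) : G.Adelic → ℂ) = φ t := by
    rw [← ht]; rfl
  by_cases hσ : (σ : G.ArchPts) ∈ D.K'₀
  · obtain ⟨c, hc⟩ := hom_eq_smul hΦ.form.smooth hΦ.form.continuous hp hirr honce φ₁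
      (fun v => mem_range_of_mem_liePart (by
        have h := rightTranslation_mem_liePart hΦ.form.smooth hσ
          (mem_twistedPart.mp (hr (toL2TauSpace hμ hΦ v)))
        rw [rightTranslation_arch_mul, mul_inv_cancel, rightTranslation_one] at h
        exact h)) hφ₁
    have h := congrArg (fun f : smoothFunctions G => (f : G.Adelic → ℂ)) (hc ⟨t, t.2⟩)
    change (φ t : G.Adelic → ℂ) ∈ (D.tauSpace Φ).toSubmodule
    rw [← hφt]
    exact h ▸ Submodule.smul_mem _ c t.2
  · have h0 := twisted_hom_eq_zero hΦ.form.smooth hΦ.form.continuous hp hirr (inv_mem σ.2)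
      (htw _ (inv_mem σ.2) fun h => hσ (by simpa using inv_mem h))
      (smoothTranslation G (σ : G.ArchPts)⁻¹ ∘ₗ φ₁)
      (fun v => mem_range_of_mem_liePart (hr (toL2TauSpace hμ hΦ v)))
      (fun k v => Subtype.ext (by
        have e : (D.conjK'₀ (inv_mem σ.2) k : G.ArchPts) =
          (σ : G.ArchPts)⁻¹ * k * (σ : G.ArchPts)⁻¹⁻¹ := rfl
        have e1 := congrArg (fun f : smoothFunctions G =>
          rightTranslation G ((σ : G.ArchPts)⁻¹, 1) (f : G.Adelic → ℂ)) (hφ₁ k v)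
        refine e1.trans ?_
        change _ = rightTranslation G ((D.conjK'₀ (inv_mem σ.2) k : G.ArchPts), 1)
          (rightTranslation G ((σ : G.ArchPts)⁻¹, 1) (φ₁ v))
        rw [e]
        simp only [smoothTranslation_apply, rightTranslation_arch_mul, inv_mul_cancel_right]))
    have h := congrArg (fun f : smoothFunctions G => (f : G.Adelic → ℂ))
      (LinearMap.congr_fun h0 ⟨t, t.2⟩)
    have h' : rightTranslation G ((σ : G.ArchPts)⁻¹, 1) (φ t : G.Adelic → ℂ) = 0 := h
    have h2 := congrArg (rightTranslation G ((σ : G.ArchPts), 1)) h'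
    rw [rightTranslation_arch_mul, mul_inv_cancel, rightTranslation_one, map_zero] at h2
    have h3 : φ t = 0 := Subtype.ext h2
    rw [h3]
    exact zero_mem _

/-- A `K'₀`-stable space of sums of vectors in `R(K')R(𝒰(𝔤'))τ` contains `Φ` or is orthogonal
to `Φ`. -/
theorem mem_or_petersson_eq_zero (hp : D.AnnihilatedByPMinus Φ) (hirr : (D.tau Φ).IsIrreducible)
    (honce : D.OccursOnce (D.tau Φ) (D.lAction (D.tau Φ)))
    (htw : ∀ (σ : G.ArchPts) (hσ : σ ∈ D.K'), σ ∉ D.K'₀ →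
      ¬ D.HaveCommonType (D.lAction (D.tau Φ))
        (D.twist (D.lAction (D.tau Φ)) ⟨σ, D.K'_le_G' hσ⟩))
    {W : Submodule ℂ (l2Forms μ D.Kinf χ hne)} (hW : W ≤ archPart D χ μ hne hΦ.form.smooth)
    (hWk : ∀ k, ∀ f ∈ W, l2Translation hμ (D.toKinf k) f ∈ W) :
    ⟨Φ, hΦ⟩ ∈ W ∨ ∀ w ∈ W, petersson μ (w : G.Adelic → ℂ) Φ = 0 := by
  have := finiteDimensional_tauSpace hΦ.form
  have hfd : FiniteDimensional ℂ (l2TauSpace D χ μ hne Φ) :=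
    Module.Finite.of_injective
      ((l2Forms μ D.Kinf χ hne).subtype.restrict (p := l2TauSpace D χ μ hne Φ)
        (q := (D.tauSpace Φ).toSubmodule) fun _ h => h)
      fun a b h => Subtype.ext (Subtype.ext (congrArg
        (fun v : (D.tauSpace Φ).toSubmodule => (v : G.Adelic → ℂ)) h))
  have hΦT : (⟨Φ, hΦ⟩ : l2Forms μ D.Kinf χ hne) ∈ l2TauSpace D χ μ hne Φ := D.self_mem_tauSpace
  have h := Representation.le_or_core_inner_eq_zero (ρ := (l2Translation hμ).comp D.toKinf)
    (peterssonCore hμ) (fun k x y => peterssonCore_l2Translation hμ (D.toKinf k) x y)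
    (fun x => ?_) (T := l2TauSpace D χ μ hne Φ)
    (fun k x hx => l2Translation_mem_l2TauSpace hμ k hx)
    (fun p hpT hp => l2TauSpace_eq_bot_or_eq hμ hirr hpT hp)
    (M := fun σ : D.K' => twistedPart D χ μ hne hΦ.form.smooth σ)
    (fun σ k x hx => l2Translation_mem_twistedPart hμ σ k hx)
    (fun σ φ hr hφ => hom_twistedPart_mem hμ hΦ hp hirr honce htw σ φ hr hφ)
    (fun t ht => ?_) hWk hW
  · rcases h with h | h
    · exact Or.inl (h hΦT)
    · exact Or.inr fun w hw => h w hw _ hΦT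
  · have hx := x.2.form.finite
    let S := Submodule.span ℂ (Set.range fun k => ((l2Translation hμ).comp D.toKinf) k x)
    have hS : ∀ y ∈ S, (l2Forms μ D.Kinf χ hne).subtype y ∈ archSpan D.Kinf x := by
      intro y hy
      suffices h : S ≤ (archSpan D.Kinf x).comap (l2Forms μ D.Kinf χ hne).subtype from h hy
      refine Submodule.span_le.mpr ?_
      rintro _ ⟨k, rfl⟩
      exact rightTranslation_mem_archSpan _ (D.K'_le_Kinf (D.K'₀_le_K' k.2))
    exact Module.Finite.of_injective ((l2Forms μ D.Kinf χ hne).subtype.restrict hS)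
      fun a b h => Subtype.ext (Subtype.ext (congrArg
        (fun v : archSpan D.Kinf (x : G.Adelic → ℂ) => (v : G.Adelic → ℂ)) h))
  · refine Submodule.mem_iSup_of_mem 1 (mem_twistedPart.mpr ?_)
    have e : (((1 : D.K') : G.ArchPts))⁻¹ = 1 := inv_one
    rw [e, rightTranslation_one]
    exact tauSpace_le_liePart hΦ.form.smooth ht

end Homomorphisms

end ArchimedeanData

theorem Subgroup.finiteIndex_comap_of_isOpen {Γ A : Type*} [Group Γ] [TopologicalSpace Γ]
    [IsTopologicalGroup Γ] [Group A] [TopologicalSpace A] {K : Subgroup Γ}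
    (hK : IsCompact (K : Set Γ)) {θ : Γ →* A} (hθ : Continuous θ) {P : Subgroup A}
    (hP : IsOpen (P : Set A)) : (P.comap (θ.comp K.subtype)).FiniteIndex := by
  have : CompactSpace K := isCompact_iff_compactSpace.mp hK
  have := Subgroup.quotient_finite_of_isOpen (P.comap (θ.comp K.subtype))
    (hP.preimage (hθ.comp continuous_subtype_val))
  exact Subgroup.finiteIndex_of_finite_quotient

/-! ### From Hecke algebras to sums of translates. -/

section Hecke

variable {F : Type u} [Field F] [NumberField F] {n : ℕ} {G : LinearAlgebraicGroup F n}
  {Φ : G.Adelic → ℂ}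

/-- An eigenvector of the Hecke algebra is an eigenvector of the sums over `KgK/K`. -/
theorem IsHeckeEigenvector.exists_sum_eq_smul {v : FinPlace F} {ν : Measure (G.LocPts v)}
    [ν.IsHaarMeasure] {K : Subgroup (G.LocPts v)} (h : IsHeckeEigenvector ν K Φ)
    (ho : IsOpen (K : Set (G.LocPts v))) (hc : IsCompact (K : Set (G.LocPts v)))
    (g : G.LocPts v) : ∃ (B : Finset K) (c : ℂ), B.Nonempty ∧
      ∑ b ∈ B, rightTranslation G (1, G.localEmb v ((b : G.LocPts v) * g)) Φ = c • Φ := by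
  obtain ⟨B, φ, r, hB, hr, h1, h2, h3, h4, hφ⟩ := exists_hecke_sum ν ho hc g
  obtain ⟨c, hcφ⟩ := h.eigen φ ⟨h1, h2, h3, h4⟩
  refine ⟨B, r⁻¹ * c, hB, funext fun x => ?_⟩
  have e := hφ (fun y => rightTranslation G (1, G.localEmb v y) Φ x) fun k hk y => by
    have e1 : ((1, G.localEmb v (y * k)) : G.Adelic) =
        (1, G.localEmb v y) * (1, G.localEmb v k) := by
      rw [map_mul, Prod.mk_mul_mk, one_mul]
    rw [e1, rightTranslation_mul_apply, h.right_invariant k hk]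
  have e2 : c • Φ x = r * ∑ b ∈ B, rightTranslation G (1, G.localEmb v ((b : G.LocPts v) * g)) Φ x :=
    (congrFun hcφ x).symm.trans e
  rw [Finset.sum_apply, Pi.smul_apply, mul_smul, e2, smul_eq_mul, inv_mul_cancel_left₀ hr]

end Hecke

/-! ### The sum of all translates is an invariant space. -/

namespace ArchimedeanData

variable {F : Type u} [Field F] [NumberField F] {n : ℕ} {G : LinearAlgebraicGroup F n}
  {D : ArchimedeanData G} {Φ : G.Adelic → ℂ}
  {χ : G.adelicCenter →* Circle} {μ : Measure (AutomorphicQuotient G)}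
  {hne : ∃ Kf : Subgroup G.FinPts, IsOpen (Kf : Set G.FinPts) ∧ IsCompact (Kf : Set G.FinPts)}

variable (D χ hne) in
/-- The action of `G(𝔸_f)` on square-integrable automorphic forms. -/
def finTranslation (hμ : IsQuotientHaar μ) : Representation ℂ G.FinPts (l2Forms μ D.Kinf χ hne) :=
  (l2Translation hμ).comp (MonoidHom.inr D.Kinf G.FinPts)

variable (D χ hne) in
/-- The sum of the `G(𝔸_f)`-translates of `archPart`. -/
def adelicPart (hμ : IsQuotientHaar μ) (hΦ : Φ ∈ smoothFunctions G) :
    Submodule ℂ (l2Forms μ D.Kinf χ hne) :=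
  ⨆ h : G.FinPts, (archPart D χ μ hne hΦ).map (finTranslation D χ hne hμ h)

/-- In a generator `R(h)f` the form `f` is fixed by an open subgroup, so `h` may be replaced by a
truncation: every vector involves only finitely many places. -/
theorem eventually_mem_placeSpan (hμ : IsQuotientHaar μ) (hΦ : Φ ∈ smoothFunctions G)
    {f : l2Forms μ D.Kinf χ hne} (hf : f ∈ adelicPart D χ hne hμ hΦ) :
    ∀ᶠ S : Finset (FinPlace F) in atTop, f ∈ placeSpan (finTranslation D χ hne hμ) G.localEmb
      (archPart D χ μ hne hΦ) S.toList := by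
  induction hf using Submodule.iSup_induction' with
  | mem h f hf =>
    obtain ⟨f, hf, rfl⟩ := hf
    obtain ⟨K₁, o, -, hK⟩ := f.2.form.right_invariant
    filter_upwards [(LinearAlgebraicGroup.tendsto_truncate h).eventually
      (o.mem_nhds K₁.one_mem)] with S hS
    have e1 : finTranslation D χ hne hμ ((LinearAlgebraicGroup.truncate h S.toList)⁻¹ * h) f = f :=
      Subtype.ext (hK _ hS)
    have e2 := apply_mem_placeSpan (ρ := finTranslation D χ hne hμ) (emb := G.localEmb)
      (fun v => G.map (finAdeleEval v) h) hf S.toList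
    rw [← e1, ← Module.End.mul_apply, ← map_mul] at e2
    have e3 : (S.toList.map fun v => G.localEmb v (G.map (finAdeleEval v) h)).prod *
        ((LinearAlgebraicGroup.truncate h S.toList)⁻¹ * h) = h := mul_inv_cancel_left _ h
    rwa [e3] at e2
  | zero => exact Eventually.of_forall fun _ => zero_mem _
  | add f g _ _ hf hg =>
    filter_upwards [hf, hg] with S h1 h2
    exact add_mem h1 h2

theorem l2Translation_mem_archPart (hμ : IsQuotientHaar μ) (hΦ : Φ ∈ smoothFunctions G)
    {k : G.ArchPts} (hk : k ∈ D.K') {f : l2Forms μ D.Kinf χ hne}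
    (hf : f ∈ archPart D χ μ hne hΦ) :
    l2Translation hμ (⟨k, D.K'_le_Kinf hk⟩, 1) f ∈ archPart D χ μ hne hΦ := by
  suffices h : archPart D χ μ hne hΦ ≤ (archPart D χ μ hne hΦ).comap
    (l2Translation hμ (⟨k, D.K'_le_Kinf hk⟩, 1)) from h hf
  refine iSup_le fun σ f hf => Submodule.mem_iSup_of_mem (⟨k, hk⟩ * σ) (mem_twistedPart.mpr ?_)
  have e : (((⟨k, hk⟩ * σ : D.K') : G.ArchPts))⁻¹ * k = (σ : G.ArchPts)⁻¹ := by
    change (k * (σ : G.ArchPts))⁻¹ * k = _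
    rw [mul_inv_rev, inv_mul_cancel_right]
  rw [coe_l2Translation, rightTranslation_arch_mul, e]
  exact hf

/-- `R(σ⁻¹)Xf` is the derivative of `R(σ⁻¹)f` in the direction `Ad(σ⁻¹)X`, so each translate is
stable under `𝔤'`. Square-integrability of `Xf` comes from that of `liePart`, translated back by
`σ`. -/
theorem lieDeriv_mem_archPart (hμ : IsQuotientHaar μ) (hΦ : IsL2Form μ D.Kinf χ Φ)
    (hp : D.AnnihilatedByPMinus Φ) (hirr : (D.tau Φ).IsIrreducible)
    (honce : D.OccursOnce (D.tau Φ) (D.lAction (D.tau Φ))) (X : D.g')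
    {f : l2Forms μ D.Kinf χ hne} (hf : f ∈ archPart D χ μ hne hΦ.form.smooth) :
    ∃ f' ∈ archPart D χ μ hne hΦ.form.smooth, (f' : G.Adelic → ℂ) = lieDeriv X f := by
  have hle : l2Forms μ D.Kinf χ hne ≤ smoothFunctions G := fun f hf => hf.form.smooth
  suffices h : archPart D χ μ hne hΦ.form.smooth ≤ ((archPart D χ μ hne hΦ.form.smooth).map
    (l2Forms μ D.Kinf χ hne).subtype).comap ((smoothFunctions G).subtype ∘ₗ
      smoothLieHom D.G' X ∘ₗ Submodule.inclusion hle) from h hf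
  refine iSup_le fun σ f hf => ?_
  let s : D.G' := ⟨_, D.K'_le_G' (inv_mem σ.2)⟩
  have h1 : rightTranslation G ((σ : G.ArchPts)⁻¹, 1) (lieDeriv X (f : G.Adelic → ℂ)) ∈
      liePart D hΦ.form.smooth := by
    rw [rightTranslation_lieDeriv (Y := Ad s X) (σ : G.ArchPts)⁻¹ rfl]
    exact lieDeriv_mem_liePart _ _ (mem_twistedPart.mp hf)
  have h2 : IsL2Form μ D.Kinf χ (lieDeriv X (f : G.Adelic → ℂ)) := by
    have h3 := (mem_l2Forms.mp (liePart_le_l2Forms (hne := hne) hμ hΦ hp hirr honce h1)).rightTranslation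
      hμ (D.K'_le_Kinf σ.2) 1
    rwa [rightTranslation_arch_mul, mul_inv_cancel, rightTranslation_one] at h3
  exact ⟨⟨_, h2⟩, Submodule.mem_iSup_of_mem σ (mem_twistedPart.mpr h1), rfl⟩

theorem rightTranslation_eq_smul_of_mem_Z' {f : G.Adelic → ℂ}
    (hf : IsAutomorphicFormWith D.Kinf χ f) {z : G.ArchPts} (hz : z ∈ D.Z') :
    ∃ c : ℂ, rightTranslation G (z, 1) f = c • f := by
  let z' : G.adelicCenter := ⟨(z, 1), D.Z'_central hz, one_mem _⟩
  refine ⟨χ z', funext fun g => ?_⟩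
  have h := hf.central z' g
  have e : g * (z, 1) = (z' : G.Adelic) * g := by
    refine Prod.ext ?_ ?_
    · exact (mul_comm_of_mem_center (D.Z'_central hz) g.1).symm
    · exact (mul_one g.2).trans (one_mul g.2).symm
  rw [rightTranslation_apply, e, h]
  rfl

/-- The decompositions `G(𝔸_∞) = Z'G'` and `K_∞ = (Z' ∩ K_∞)K'` reduce stability under `𝔤` and `K_∞`
to `𝔤'` and `K'`, as the central parts act by scalars. -/
theorem isInvariantSpace_adelicPart (hμ : IsQuotientHaar μ) (hΦ : IsL2Form μ D.Kinf χ Φ)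
    (hp : D.AnnihilatedByPMinus Φ) (hirr : (D.tau Φ).IsIrreducible)
    (honce : D.OccursOnce (D.tau Φ) (D.lAction (D.tau Φ))) :
    IsInvariantSpace D.Kinf ((adelicPart D χ hne hμ hΦ.form.smooth).map
      (l2Forms μ D.Kinf χ hne).subtype) := by
  set V := (adelicPart D χ hne hμ hΦ.form.smooth).map (l2Forms μ D.Kinf χ hne).subtype with hV
  have hVform : ∀ f ∈ V, IsL2Form μ D.Kinf χ f := by
    rintro _ ⟨f, -, rfl⟩
    exact f.2
  have hle : l2Forms μ D.Kinf χ hne ≤ smoothFunctions G := fun f hf => hf.form.smooth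
  have hK' : ∀ k ∈ D.K', ∀ f ∈ V, rightTranslation G (k, 1) f ∈ V := by
    rintro k hk _ ⟨f, hf, rfl⟩
    suffices h : adelicPart D χ hne hμ hΦ.form.smooth ≤
      (adelicPart D χ hne hμ hΦ.form.smooth).comap (l2Translation hμ (⟨k, D.K'_le_Kinf hk⟩, 1)) from
      ⟨_, h hf, rfl⟩
    refine iSup_le fun h => ?_
    rintro _ ⟨f, hf, rfl⟩
    refine Submodule.mem_iSup_of_mem h ⟨_, l2Translation_mem_archPart hμ hΦ.form.smooth hk hf, ?_⟩
    exact Subtype.ext (rightTranslation_arch_fin_comm k h f).symm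
  have hZ' : ∀ z ∈ D.Z', ∀ f ∈ V, rightTranslation G (z, 1) f ∈ V := by
    intro z hz f hf
    obtain ⟨c, hc⟩ := rightTranslation_eq_smul_of_mem_Z' (hVform f hf).form hz
    rw [hc]
    exact V.smul_mem c hf
  refine ⟨?_, ?_, ?_⟩
  · rintro h _ ⟨f, hf, rfl⟩
    suffices h : adelicPart D χ hne hμ hΦ.form.smooth ≤
      (adelicPart D χ hne hμ hΦ.form.smooth).comap (finTranslation D χ hne hμ h) from
      ⟨_, h hf, rfl⟩
    refine iSup_le fun h' => ?_
    rintro _ ⟨f, hf, rfl⟩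
    refine Submodule.mem_iSup_of_mem (h * h') ⟨f, hf, ?_⟩
    rw [map_mul]
    rfl
  -- `K_∞` is a join of two subgroups, so stability is phrased as membership in a subgroup, which
  -- requires including inverses.
  · let S : Subgroup G.ArchPts :=
      { carrier := {k | (∀ f ∈ V, rightTranslation G (k, 1) f ∈ V) ∧
          ∀ f ∈ V, rightTranslation G (k⁻¹, 1) f ∈ V}
        one_mem' := by
          rw [Set.mem_ofPred_eq, inv_one]
          simp only [rightTranslation_one, imp_self, implies_true, and_self]
        mul_mem' := fun {x y} hx hy => by
          rw [Set.mem_ofPred_eq, mul_inv_rev]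
          simp only [← rightTranslation_arch_mul]
          exact ⟨fun f hf => hx.1 _ (hy.1 f hf), fun f hf => hy.2 _ (hx.2 f hf)⟩
        inv_mem' := fun {x} hx => by
          rw [Set.mem_ofPred_eq, inv_inv]
          exact ⟨hx.2, hx.1⟩ }
    have hS : D.Kinf ≤ S := by
      rw [D.Kinf_eq]
      exact sup_le (fun z hz => ⟨hZ' z hz.1, hZ' _ (inv_mem hz.1)⟩)
        fun k hk => ⟨hK' k hk, hK' _ (inv_mem hk)⟩
    exact fun k hk => (hS hk).1
  · intro X f hf
    have hc := fun z (hz : z ∈ D.Z') => mul_comm_of_mem_center (D.Z'_central hz)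
    obtain ⟨a, b, e⟩ := exists_lieAlg_add D.Z' hc (closedClosure D.Z')
      D.Z'.le_topologicalClosure (mul_comm_of_mem_closedClosure hc) D.G' D.Z'_sup_G' X
    have hX : X = toFullArch a + toFullArch b := Subtype.ext e
    rw [hX, smoothFunctions.add_lieDeriv (hVform f hf).form.smooth, lieDeriv_toFullArch,
      lieDeriv_toFullArch]
    obtain ⟨c, hca⟩ := (hVform f hf).form.lieDeriv_central D.Z'_central a
    rw [hca]
    refine V.add_mem (V.smul_mem c hf) ?_
    obtain ⟨f, hf, rfl⟩ := hf
    suffices h : adelicPart D χ hne hμ hΦ.form.smooth ≤ V.comap ((smoothFunctions G).subtype ∘ₗ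
      smoothLieHom D.G' b ∘ₗ Submodule.inclusion hle) from h hf
    refine iSup_le fun h => ?_
    rintro _ ⟨f, hf, rfl⟩
    obtain ⟨f', hf', e'⟩ := lieDeriv_mem_archPart hμ hΦ hp hirr honce b hf
    refine ⟨_, Submodule.mem_iSup_of_mem h ⟨f', hf', rfl⟩, ?_⟩
    change rightTranslation G (1, h) (f' : G.Adelic → ℂ) =
      lieDeriv b (rightTranslation G (1, h) (f : G.Adelic → ℂ))
    rw [e', lieDeriv_rightTranslation_fin]

theorem mem_adelicPart (hμ : IsQuotientHaar μ) (hΦ : IsL2Form μ D.Kinf χ Φ) :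
    (⟨Φ, hΦ⟩ : l2Forms μ D.Kinf χ hne) ∈ adelicPart D χ hne hμ hΦ.form.smooth := by
  refine Submodule.mem_iSup_of_mem 1 ⟨⟨Φ, hΦ⟩, Submodule.mem_iSup_of_mem 1 (mem_twistedPart.mpr ?_), ?_⟩
  · have e : (((1 : D.K') : G.ArchPts))⁻¹ = 1 := inv_one
    rw [e, rightTranslation_one]
    exact tauSpace_le_liePart hΦ.form.smooth D.self_mem_tauSpace
  · rw [map_one]
    rfl

end ArchimedeanData

/-! ### Orthogonal complements of invariant subspaces. -/

section Orthogonal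

variable {F : Type u} [Field F] [NumberField F] {n : ℕ} {G : LinearAlgebraicGroup F n}
  {Kinf : Subgroup G.ArchPts} {χ : G.adelicCenter →* Circle}
  {μ : Measure (AutomorphicQuotient G)}
  {hne : ∃ Kf : Subgroup G.FinPts, IsOpen (Kf : Set G.FinPts) ∧ IsCompact (Kf : Set G.FinPts)}

theorem peterssonForm_apply (Φ f : l2Forms μ Kinf χ hne) :
    peterssonForm Φ f = petersson μ (Φ : G.Adelic → ℂ) f := rfl

/-- The functions in `V` orthogonal to `W`. -/
def orthogonalIn {V W : Submodule ℂ (G.Adelic → ℂ)} (hV : V ≤ l2Forms μ Kinf χ hne)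
    (hWV : W ≤ V) : Submodule ℂ (G.Adelic → ℂ) :=
  ((⨅ w : W, LinearMap.ker (peterssonForm (⟨w, hV (hWV w.2)⟩ : l2Forms μ Kinf χ hne))).map
    (l2Forms μ Kinf χ hne).subtype) ⊓ V

theorem mem_orthogonalIn {V W : Submodule ℂ (G.Adelic → ℂ)} {hV : V ≤ l2Forms μ Kinf χ hne}
    {hWV : W ≤ V} {f : G.Adelic → ℂ} :
    f ∈ orthogonalIn hV hWV ↔ f ∈ V ∧ ∀ w ∈ W, petersson μ w f = 0 := by
  constructor
  · rintro ⟨⟨f, hf, rfl⟩, hfV⟩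
    exact ⟨hfV, fun w hw => (Submodule.mem_iInf _).mp hf ⟨w, hw⟩⟩
  · rintro ⟨hfV, h⟩
    exact ⟨⟨⟨f, hV hfV⟩, (Submodule.mem_iInf _).mpr fun w => h w w.2, rfl⟩, hfV⟩

theorem petersson_rightTranslation_inv (hμ : IsQuotientHaar μ) {f g : G.Adelic → ℂ}
    (hf : IsL2Form μ Kinf χ f) {x : G.Adelic}
    (hg : IsL2Form μ Kinf χ (rightTranslation G x⁻¹ g)) :
    petersson μ g (rightTranslation G x f) = petersson μ (rightTranslation G x⁻¹ g) f := by
  have h := petersson_rightTranslation hμ hg hf x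
  rw [← h, ← rightTranslation_mul_apply, mul_inv_cancel, map_one]
  rfl

/-- Translations are unitary and Lie derivatives skew-adjoint; the latter needs the derivatives to
be square-integrable, which holds because `V` is invariant and consists of square-integrable forms.
-/
theorem isInvariantSpace_orthogonalIn (hμ : IsQuotientHaar μ)
    {V W : Submodule ℂ (G.Adelic → ℂ)} (hV : V ≤ l2Forms μ Kinf χ hne) (hWV : W ≤ V)
    (hVi : IsInvariantSpace Kinf V) (hWi : IsInvariantSpace Kinf W) :
    IsInvariantSpace Kinf (orthogonalIn hV hWV) := by
  have hL : ∀ f ∈ V, IsL2Form μ Kinf χ f := fun f hf => hV hf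
  refine ⟨fun h f hf => ?_, fun k hk f hf => ?_, fun X f hf => ?_⟩
  all_goals
    rw [mem_orthogonalIn] at hf ⊢
  · refine ⟨hVi.fin h f hf.1, fun w hw => ?_⟩
    have hm : rightTranslation G ((1, h) : G.Adelic)⁻¹ w ∈ W := by
      have e : ((1, h) : G.Adelic)⁻¹ = (1, h⁻¹) := Prod.ext inv_one rfl
      rw [e]
      exact hWi.fin _ _ hw
    rw [petersson_rightTranslation_inv hμ (hL f hf.1) (hL _ (hWV hm)), hf.2 _ hm]
  · refine ⟨hVi.cpt k hk f hf.1, fun w hw => ?_⟩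
    have hm : rightTranslation G ((k, 1) : G.Adelic)⁻¹ w ∈ W := by
      have e : ((k, 1) : G.Adelic)⁻¹ = (k⁻¹, 1) := Prod.ext rfl inv_one
      rw [e]
      exact hWi.cpt _ (inv_mem hk) _ hw
    rw [petersson_rightTranslation_inv hμ (hL f hf.1) (hL _ (hWV hm)), hf.2 _ hm]
  · refine ⟨hVi.lie X f hf.1, fun w hw => ?_⟩
    obtain ⟨Kf, ho, hc⟩ := hne
    have := weaklyLocallyCompactSpace_of_subgroup ho hc
    have h := petersson_lieDeriv hμ (hL w (hWV hw)) (hL f hf.1) X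
      (hL _ (hWV (hWi.lie X w hw))) (hL _ (hVi.lie X f hf.1))
    rw [hf.2 _ (hWi.lie X w hw)] at h
    exact neg_eq_zero.mp h.symm

/-- An invariant space orthogonal to a generator is zero. -/
theorem eq_bot_of_petersson_generator_eq_zero (hμ : IsQuotientHaar μ) {Φ : G.Adelic → ℂ}
    (hV : generatedRep Kinf Φ ≤ l2Forms μ Kinf χ hne) {W : Submodule ℂ (G.Adelic → ℂ)}
    (hWV : W ≤ generatedRep Kinf Φ) (hWi : IsInvariantSpace Kinf W)
    (h : ∀ w ∈ W, petersson μ w Φ = 0) : W = ⊥ := by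
  have hle : generatedRep Kinf Φ ≤ orthogonalIn hV hWV :=
    generatedRep_le (mem_orthogonalIn.mpr ⟨mem_generatedRep_self _ _, h⟩)
      (isInvariantSpace_orthogonalIn hμ hV hWV (isInvariantSpace_generatedRep _ _) hWi)
  exact W.eq_bot_iff.mpr fun w hw => eq_zero_of_petersson_self hμ (hV (hWV hw))
    ((mem_orthogonalIn.mp (hle (hWV hw))).2 w hw)

end Orthogonal

/-! ### The dichotomy and the conclusion. -/

namespace ArchimedeanData

variable {F : Type u} [Field F] [NumberField F] {n : ℕ} {G : LinearAlgebraicGroup F n}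
  {D : ArchimedeanData G} {Φ : G.Adelic → ℂ}
  {χ : G.adelicCenter →* Circle} {μ : Measure (AutomorphicQuotient G)}
  {hne : ∃ Kf : Subgroup G.FinPts, IsOpen (Kf : Set G.FinPts) ∧ IsCompact (Kf : Set G.FinPts)}

/-- Averaging over `K_v` at the places that `w` involves produces a vector of `W` in `archPart`
whose product with `Φ` is a nonzero multiple of that of `w`. There a `K'₀`-stable space either
contains `Φ`, which is excluded, or is orthogonal to it. -/
theorem petersson_eq_zero_of_not_mem (hμ : IsQuotientHaar μ)
    {ν : ∀ v : FinPlace F, Measure (G.LocPts v)} (hν : ∀ v, (ν v).IsHaarMeasure)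
    {K : ∀ v : FinPlace F, Subgroup (G.LocPts v)}
    (hK_open : ∀ v, IsOpen (K v : Set (G.LocPts v)))
    (hK_compact : ∀ v, IsCompact (K v : Set (G.LocPts v)))
    (hΦ : IsL2Form μ D.Kinf χ Φ)
    (hp : D.AnnihilatedByPMinus Φ) (hirr : (D.tau Φ).IsIrreducible)
    (honce : D.OccursOnce (D.tau Φ) (D.lAction (D.tau Φ)))
    (htw : ∀ (σ : G.ArchPts) (hσ : σ ∈ D.K'), σ ∉ D.K'₀ →
      ¬ D.HaveCommonType (D.lAction (D.tau Φ))
        (D.twist (D.lAction (D.tau Φ)) ⟨σ, D.K'_le_G' hσ⟩))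
    (hhecke : ∀ v, IsHeckeEigenvector (ν v) (K v) Φ) {W : Submodule ℂ (G.Adelic → ℂ)}
    (hWV : W ≤ (adelicPart D χ hne hμ hΦ.form.smooth).map (l2Forms μ D.Kinf χ hne).subtype)
    (hW : IsInvariantSpace D.Kinf W) (hΦW : Φ ∉ W) : ∀ w ∈ W, petersson μ w Φ = 0 := by
  intro w hw
  obtain ⟨w, hwA, rfl⟩ := hWV hw
  let WH : Submodule ℂ (l2Forms μ D.Kinf χ hne) := W.comap (l2Forms μ D.Kinf χ hne).subtype
  let Φ' : l2Forms μ D.Kinf χ hne := ⟨Φ, hΦ⟩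
  obtain ⟨S, hS⟩ := (eventually_mem_placeSpan hμ hΦ.form.smooth hwA).exists
  have hinv : ∀ v, ∀ k ∈ K v, ∀ f ∈ archPart D χ μ hne hΦ.form.smooth,
      finTranslation D χ hne hμ (G.localEmb v k) f = f := by
    intro v k hk f hf
    -- Invariance under `k` is the one-term case of a linear relation among translates.
    have h := sum_l2Translation_eq_smul hμ hΦ hp hirr honce (s := {()})
      (h := fun _ => G.localEmb v k) (c := 1)
      (by rw [Finset.sum_singleton, one_smul]; exact (hhecke v).right_invariant k hk) hf
    rw [Finset.sum_singleton, one_smul] at h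
    exact h
  have heig : ∀ v (g : G.LocPts v), ∃ (B : Finset (K v)) (c : ℂ), B.Nonempty ∧
      ∀ f ∈ archPart D χ μ hne hΦ.form.smooth,
      ∑ b ∈ B, finTranslation D χ hne hμ (G.localEmb v b)
        (finTranslation D χ hne hμ (G.localEmb v g) f) = c • f := by
    intro v g
    have := hν v
    obtain ⟨B, c, hB, hc⟩ := (hhecke v).exists_sum_eq_smul (hK_open v) (hK_compact v) g
    refine ⟨B, c, hB, fun f hf => ?_⟩
    have h := sum_l2Translation_eq_smul hμ hΦ hp hirr honce hc hf
    refine (Finset.sum_congr rfl fun b _ => ?_).trans h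
    rw [← Module.End.mul_apply, ← map_mul, ← map_mul]
    rfl
  have hfix : ∀ v (x : l2Forms μ D.Kinf χ hne), ∃ P : Subgroup (K v), P.FiniteIndex ∧
      ∀ p ∈ P, finTranslation D χ hne hμ (G.localEmb v p) x = x := by
    intro v x
    obtain ⟨K₁, o, -, hK⟩ := x.2.form.right_invariant
    exact ⟨_, Subgroup.finiteIndex_comap_of_isOpen (hK_compact v)
      (LinearAlgebraicGroup.continuous_localEmb v) o, fun p hp => Subtype.ext (hK _ hp)⟩
  have hL : ∀ v, ∀ k ∈ K v, ∀ x : l2Forms μ D.Kinf χ hne,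
      peterssonForm Φ' (finTranslation D χ hne hμ (G.localEmb v k) x) = peterssonForm Φ' x := by
    intro v k hk x
    have h := petersson_rightTranslation hμ hΦ x.2 (1, G.localEmb v k)
    rw [(hhecke v).right_invariant k hk] at h
    exact h
  obtain ⟨w', hw'W, hw'V, r, hr, e⟩ := exists_mem_inf_of_placeSpan
    (fun _ _ h => LinearAlgebraicGroup.commute_localEmb h) hfix hinv heig
    (W := WH) (fun a f hf => hW.fin a _ hf) hL S.toList S.nodup_toList w hw hS
  have h := mem_or_petersson_eq_zero hμ hΦ hp hirr honce htw
    (W := WH ⊓ archPart D χ μ hne hΦ.form.smooth) inf_le_right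
    fun k f hf => ⟨hW.cpt _ (D.K'_le_Kinf (D.K'₀_le_K' k.2)) _ hf.1,
      l2Translation_mem_archPart hμ hΦ.form.smooth (D.K'₀_le_K' k.2) hf.2⟩
  rcases h with h | h
  · exact absurd h.1 hΦW
  · have h0 : peterssonForm Φ' w' = 0 := by
      rw [peterssonForm_apply, ← conj_petersson, h w' ⟨hw'W, hw'V⟩, map_zero]
    have h1 : peterssonForm Φ' w = 0 :=
      (mul_eq_zero.mp (e.symm.trans h0)).resolve_left hr
    have h2 : petersson μ Φ (w : G.Adelic → ℂ) = 0 := h1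
    refine (conj_petersson (w : G.Adelic → ℂ) Φ).symm.trans ?_
    rw [h2, map_zero]

theorem generatedRep_ne_bot (hirr : (D.tau Φ).IsIrreducible) : generatedRep D.Kinf Φ ≠ ⊥ := by
  intro h
  have h0 : Φ = 0 := by
    have := mem_generatedRep_self D.Kinf Φ
    rwa [h, Submodule.mem_bot] at this
  have := (Representation.isIrreducible_iff_forall.mp hirr).1
  obtain ⟨v, hv⟩ := exists_ne (0 : (D.tauSpace Φ).toSubmodule)
  refine hv (Subtype.ext ?_)
  have hle : (D.tauSpace Φ).toSubmodule ≤ ⊥ := by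
    refine Submodule.span_le.mpr ?_
    rintro _ ⟨k, rfl⟩
    rw [h0]
    exact map_zero _
  exact (Submodule.mem_bot ℂ).mp (hle v.2)

/-- An invariant subspace that contains `Φ` is everything; any other is orthogonal to `Φ`, hence to
all that `Φ` generates, itself included. -/
theorem isIrreducible_generatedRep (hμ : IsQuotientHaar μ)
    {ν : ∀ v : FinPlace F, Measure (G.LocPts v)} (hν : ∀ v, (ν v).IsHaarMeasure)
    {K : ∀ v : FinPlace F, Subgroup (G.LocPts v)}
    (hK_open : ∀ v, IsOpen (K v : Set (G.LocPts v)))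
    (hK_compact : ∀ v, IsCompact (K v : Set (G.LocPts v)))
    (hΦ : IsAutomorphicForm D.Kinf Φ) (hΦ2 : IsSquareIntegrable μ Φ)
    (hp : D.AnnihilatedByPMinus Φ) (hirr : (D.tau Φ).IsIrreducible)
    (honce : D.OccursOnce (D.tau Φ) (D.lAction (D.tau Φ)))
    (htw : ∀ (σ : G.ArchPts) (hσ : σ ∈ D.K'), σ ∉ D.K'₀ →
      ¬ D.HaveCommonType (D.lAction (D.tau Φ))
        (D.twist (D.lAction (D.tau Φ)) ⟨σ, D.K'_le_G' hσ⟩))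
    (hhecke : ∀ v, IsHeckeEigenvector (ν v) (K v) Φ) :
    IsIrreducibleAutomorphicRep D.Kinf (generatedRep D.Kinf Φ) := by
  obtain ⟨χ, -, hform⟩ := hΦ.exists_with
  obtain ⟨Kf, ho, hc, -⟩ := hform.right_invariant
  have hne : ∃ Kf : Subgroup G.FinPts, IsOpen (Kf : Set G.FinPts) ∧ IsCompact (Kf : Set G.FinPts) :=
    ⟨Kf, ho, hc⟩
  have hL2 : IsL2Form μ D.Kinf χ Φ := hform.isL2Form hΦ2
  have hle : generatedRep D.Kinf Φ ≤
      (adelicPart D χ hne hμ hL2.form.smooth).map (l2Forms μ D.Kinf χ hne).subtype :=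
    generatedRep_le ⟨_, mem_adelicPart hμ hL2, rfl⟩
      (isInvariantSpace_adelicPart hμ hL2 hp hirr honce)
  refine ⟨isAutomorphicRep_generatedRep hΦ, generatedRep_ne_bot hirr, fun W hWV hW => ?_⟩
  by_cases hΦW : Φ ∈ W
  · exact Or.inr (le_antisymm hWV (generatedRep_le hΦW hW))
  · exact Or.inl (eq_bot_of_petersson_generator_eq_zero hμ
      (hle.trans (Submodule.map_subtype_le _ _)) hWV hW
      (petersson_eq_zero_of_not_mem hμ hν hK_open hK_compact hL2 hp hirr honce htw hhecke
        (hWV.trans hle) hW hΦW))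

end ArchimedeanData

end

theorem mainTheorem2 {F : Type u} [Field F] [NumberField F] {n : ℕ}
    (G : LinearAlgebraicGroup F n) (D : ArchimedeanData G)
    (μ : Measure (AutomorphicQuotient G)) (hμ : IsQuotientHaar μ)
    (ν : ∀ v : FinPlace F, Measure (G.LocPts v)) (hν : ∀ v, (ν v).IsHaarMeasure)
    (K : ∀ v : FinPlace F, Subgroup (G.LocPts v))
    (hK_open : ∀ v, IsOpen (K v : Set (G.LocPts v)))
    (hK_compact : ∀ v, IsCompact (K v : Set (G.LocPts v)))
    (hK_maximal : ∀ᶠ v in cofinite,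
      Maximal (fun C : Subgroup (G.LocPts v) => IsCompact (C : Set (G.LocPts v))) (K v))
    (Φ : G.Adelic → ℂ) (hΦ : IsAutomorphicForm D.Kinf Φ) (hΦ2 : IsSquareIntegrable μ Φ)
    (h_irreducible : (D.tau Φ).IsIrreducible)
    (h_once : D.OccursOnce (D.tau Φ) (D.lAction (D.tau Φ)))
    (h_twist : ∀ (σ : G.ArchPts) (hσ : σ ∈ D.K'), σ ∉ D.K'₀ →
      ¬ D.HaveCommonType (D.lAction (D.tau Φ))
        (D.twist (D.lAction (D.tau Φ)) ⟨σ, D.K'_le_G' hσ⟩))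
    (h_pMinus : D.AnnihilatedByPMinus Φ)
    (h_hecke : ∀ v, IsHeckeEigenvector (ν v) (K v) Φ) :
    IsIrreducibleAutomorphicRep D.Kinf (generatedRep D.Kinf Φ) :=
  ArchimedeanData.isIrreducible_generatedRep hμ hν hK_open hK_compact hΦ hΦ2 h_pMinus
    h_irreducible h_once h_twist h_hecke
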